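/- Setting. Let $X$ be a compact manifold with boundary of dimension $n\ge 2$ with a scattering metric $g=dx^2/x^4+h'/x^2$ near $\partial X$, and let $Y=\partial X$, a closed manifold of dimension $m=n-1\ge 1$, with the metric $h=h'|_Y$. (Only the closed Riemannian manifold $(Y,h)$ enters below, and it may be arbitrary.) With the boundary defining function $x$, the scattering cotangent bundle ${}^{sc}T^*_{Y}X$ is $\mathbb R_\tau\times T^*Y$, the point $(\tau,y,\mu)$ standing for $\tau\,dx/x^2+\mu\cdot dy/x$; its contact form is $d\tau+\mu\cdot dy$, and $d(f/x)=(-f,df)$. The front face bf of $X^2_b=[X^2;(\partial X)^2]$ is $[0,\pi/2]_\theta\times Y\times Y$, where $\tan\theta=x'/x''$; $\theta=0$ and $\theta=\pi/2$ are its corners with lb and rb. The fibred-scattering cotangent bundle of $X^2_b$ over bf consists of the points $(\theta,y',y'',\tau',\tau'',\mu',\mu'')$, standing for $\tau'\frac{dx'}{x'^2}+\tau''\frac{dx''}{x''^2}+\mu'\cdot\frac{dy'}{x'}+\mu''\cdot\frac{dy''}{x''}$. With $x^{-2}=x'^{-2}+x''^{-2}$, $\tau=\tau'\cos\theta+\tau''\sin\theta$,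 $\eta=\tau'\sin\theta-\tau''\cos\theta$, its contact form is $d\tau+\eta\,d\theta+\cos\theta\,\mu'\cdot dy'+\sin\theta\,\mu''\cdot dy''$; over the interior of bf the bundle is the scattering cotangent bundle with respect to $x$. Over the corner with lb it is mapped to ${}^{sc}T^*_YX$ by $\tilde\phi_{lb}:(y',y'',\tau',\tau'',\mu',\mu'')\mapsto(y',\tau',\mu')$, with fibres ${}^{sc}T^*_YX\ni(y'',\tau'',\mu'')$, and over the corner with rb in the same way with the two factors exchanged. Definitions. A Legendre submanifold of ${}^{sc}T^*_{Z}$ (over a boundary, or an open part of a boundary, $Z$) is an embedded submanifold of dimension $\dim Z$ on which the contact form vanishes. An intersecting pair with conic points $(G,G^\sharp)$ consists of Legendre submanifolds such that, for some boundary defining function $\tilde x$, $G^\sharp$ is a finite union of graphs of $c_j\,d(1/\tilde x)$, $c_j\in\mathbb R$, $\operatorname{cl}G\setminus G\subset G^\sharp$, and $\operatorname{cl}G$ is the image under the blow-down map of a closed embedded submanifold with boundary of $[{}^{sc}T^*_Z;\operatorname{span}d(1/\tilde x)]$ which meets the front face transversally. A Legendre submanifold $G$ of the fibred-scattering cotangent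 bundle is an embedded submanifold of the bundle over bf, of dimension $\dim\mathrm{bf}=2m+1$, on which the contact form vanishes, which is transversal to the bundle over the corners $\mathrm{lb}\cap\mathrm{bf}$ and $\mathrm{rb}\cap\mathrm{bf}$, and whose part over each corner is made by $\tilde\phi_{lb}$, resp. $\tilde\phi_{rb}$, a smooth locally trivial fibration over a Legendre submanifold $G_1$ of ${}^{sc}T^*_YX$, with fibres Legendre submanifolds of ${}^{sc}T^*_YX$. A pair $(G,G^\sharp)$ of such submanifolds is an intersecting pair of Legendre submanifolds with conic points if it is an intersecting pair with conic points over the interior of bf and if over each corner the fibrations of $G$ and $G^\sharp$ have the same base $G_1$ and their fibres over each point of $G_1$ form an intersecting pair with conic points in ${}^{sc}T^*_YX$. Let $\lambda>0$, let $\exp(sH_{\frac12h})$ be the geodesic flow on $T^*Y$ (the Hamilton flow of $\frac12|\mu|_h^2$), and write $c\cdot(y,\mu)=(y,c\mu)$. Let $L(\lambda)$ be the set of all $(\theta,y',y'',\tau',\tau'',\mu',\mu'')$ for which there are $(y,\hat\mu)\in S^*Y$ and $s,s'\in[0,\pi]$ with $\sin^2s+\sin^2s'>0$, $\theta\in[0,\pi/2]$,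 $\tan\theta=\sin s'/\sin s$ (so $\theta=\pi/2$ if $\sin s=0$), $\tau'=\lambda\cos s'$, $\tau''=-\lambda\cos s$, $(y',\mu')=\lambda\sin s'\cdot\exp(s'H_{\frac12h})(y,\hat\mu)$, $(y'',\mu'')=-\lambda\sin s\cdot\exp(sH_{\frac12h})(y,\hat\mu)$, together with all $(\theta,y,y,\lambda,-\lambda,0,0)$ and $(\theta,y,y,-\lambda,\lambda,0,0)$, $\theta\in[0,\pi/2]$, $y\in Y$. Let $L^\sharp(\pm\lambda)=\{(\theta,y',y'',\mp\lambda,\mp\lambda,0,0):\theta\in[0,\pi/2],\ y',y''\in Y\}$. Proposition. The pair $(L(\lambda),\,L^\sharp(\lambda)\cup L^\sharp(-\lambda))$ is an intersecting pair of Legendre submanifolds with conic points in the fibred-scattering cotangent bundle over $X^2_b$. -/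

import Mathlib

open Bundle Manifold Set
open scoped Manifold ContDiff Topology

noncomputable section

namespace ScatGeom

/-! ### Submanifolds of a manifold (with boundary `{ρ = 0}`) -/

section Submanifold

variable {EK : Type*} [NormedAddCommGroup EK] [NormedSpace ℝ EK]
  {HK : Type*} [TopologicalSpace HK] (IK : ModelWithCorners ℝ EK HK)
  {K : Type*} [TopologicalSpace K] [ChartedSpace HK K]

/-- Near `p`, the set `S` is cut out of the manifold with boundary `{ρ ≥ 0}` by the `c` equations
`F = 0`, whose differentials are independent at `p`, and, if `p` lies on the boundary, independent
on the tangent space `ker dρ` of the boundary. -/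
structure CutsOut (ρ : K → ℝ) (S : Set K) (p : K) {c : ℕ} (F : K → Fin c → ℝ) : Prop where
  exists_nhds : ∃ U : Set K, IsOpen U ∧ p ∈ U ∧ ContMDiffOn IK 𝓘(ℝ, Fin c → ℝ) ∞ F U ∧
    ∀ q ∈ U, q ∈ S ↔ 0 ≤ ρ q ∧ F q = 0
  independent : Function.Surjective (mfderiv IK 𝓘(ℝ, Fin c → ℝ) F p)
  transversal : ρ p = 0 → ∀ w : Fin c → ℝ, ∃ v : TangentSpace IK p,
    mfderiv IK 𝓘(ℝ, ℝ) ρ p v = (0 : ℝ) ∧ mfderiv IK 𝓘(ℝ, Fin c → ℝ) F p v = w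

/-- `S` is an embedded smooth submanifold of codimension `c` of the manifold with boundary
`{ρ ≥ 0}`, transversal to the boundary `{ρ = 0}`; so `S` is a manifold with boundary
`S ∩ {ρ = 0}`. -/
def IsNeatSubmanifold (ρ : K → ℝ) (c : ℕ) (S : Set K) : Prop :=
  ∀ p ∈ S, ∃ F : K → Fin c → ℝ, CutsOut IK ρ S p F

/-- `S` is a submanifold as in `IsNeatSubmanifold`, and the one-form `χ` vanishes on each of its
tangent spaces `T_p S = ker dF_p`. -/
def IsNeatIntegralSubmanifold (χ : ∀ p : K, TangentSpace IK p → ℝ) (ρ : K → ℝ) (c : ℕ)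
    (S : Set K) : Prop :=
  ∀ p ∈ S, ∃ F : K → Fin c → ℝ, CutsOut IK ρ S p F ∧
    ∀ v : TangentSpace IK p, mfderiv IK 𝓘(ℝ, Fin c → ℝ) F p v = (0 : Fin c → ℝ) → χ p v = 0

/-- Let `{u = 0}` be a submanifold, `u` having values in `ℝᵏ` and independent differentials. Its
blow-up is `{(q, r, ω) : r ≥ 0, |ω| = 1, u q = r ω}`, with blow-down map `(q, r, ω) ↦ q` and front
face `{r = 0}`. This is the lift of `G \ {u = 0}` to the blow-up. -/
def polarLift {k : ℕ} (u : K → EuclideanSpace ℝ (Fin k)) (G : Set K) :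
    Set (K × ℝ × EuclideanSpace ℝ (Fin k)) :=
  {w | w.1 ∈ G ∧ u w.1 ≠ 0 ∧ w.2.1 = ‖u w.1‖ ∧ w.2.2 = ‖u w.1‖⁻¹ • u w.1}

/-- `S` is a submanifold of codimension `k`, and `cl G` has at most a conic singularity along `S`:
near each point of `S` in `cl G`, the set `cl G` is the image under the blow-down map of a closed
subset of the blow-up of `S` that is a submanifold with boundary (of codimension `c` in
`K × [0, ∞) × ℝᵏ`) transversal to the front face. By transversality such a submanifold is the
closure of its part off the front face, that is, of the lift of `G`. -/
def IsConicAlong (k c : ℕ) (S G : Set K) : Prop :=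
  ∀ p ∈ S ∩ closure G, ∃ (U : Set K) (u : K → EuclideanSpace ℝ (Fin k)),
    IsOpen U ∧ p ∈ U ∧ ContMDiffOn IK 𝓘(ℝ, EuclideanSpace ℝ (Fin k)) ∞ u U ∧
    (∀ q ∈ U, Function.Surjective (mfderiv IK 𝓘(ℝ, EuclideanSpace ℝ (Fin k)) u q)) ∧
    (∀ q ∈ U, q ∈ S ↔ u q = 0) ∧
    IsNeatSubmanifold (IK.prod (𝓘(ℝ, ℝ).prod 𝓘(ℝ, EuclideanSpace ℝ (Fin k))))
      (fun w : K × ℝ × EuclideanSpace ℝ (Fin k) => w.2.1) c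
      (closure (polarLift u (G ∩ U)) ∩ Prod.fst ⁻¹' U) ∧
    closure G ∩ U ⊆ Prod.fst '' closure (polarLift u (G ∩ U))

end Submanifold

/-! ### The scattering cotangent bundle over the boundary

Let `Z` be the boundary of a manifold and `x` a boundary defining function. The scattering cotangent
bundle over `Z` is spanned by the covectors `d(f/x)`, `f` smooth; in the coordinates of
`τ dx/x² + μ · dy/x` this covector at `z ∈ Z` is `τ = -f(z)`, `μ = d(f|_Z)(z)`. So the choice of `x`
identifies the bundle with `ℝ × T*Z`. -/

section Scattering

variable {E : Type*} [NormedAddCommGroup E] [NormedSpace ℝ E]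
  {H : Type*} [TopologicalSpace H] (I : ModelWithCorners ℝ E H)
  (Z : Type*) [TopologicalSpace Z] [ChartedSpace H Z] [IsManifold I ∞ Z]

/-- The cotangent bundle `T*Z`. -/
abbrev Cot : Type _ :=
  TotalSpace (E →L[ℝ] ℝ) (fun z : Z => TangentSpace I z →L[ℝ] Bundle.Trivial Z ℝ z)

/-- The model with corners of `T*Z`. -/
abbrev cotModel : ModelWithCorners ℝ (E × (E →L[ℝ] ℝ)) (ModelProd H (E →L[ℝ] ℝ)) :=
  I.prod 𝓘(ℝ, E →L[ℝ] ℝ)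

/-- The scattering cotangent bundle over the boundary `Z`: points `(τ, (y, μ))`. -/
abbrev ScCot : Type _ := ℝ × Cot I Z

/-- The model with corners of `ScCot I Z`. -/
abbrev scModel : ModelWithCorners ℝ (ℝ × E × (E →L[ℝ] ℝ)) (ModelProd ℝ (ModelProd H (E →L[ℝ] ℝ))) :=
  𝓘(ℝ, ℝ).prod (cotModel I)

variable {I Z}

/-- A covector as a linear form on the tangent space. -/
def Cot.form (p : Cot I Z) : TangentSpace I p.proj →L[ℝ] ℝ := p.snd

/-- The point of `T*Z` given by a linear form on a tangent space. -/
def Cot.of (z : Z) (ξ : TangentSpace I z →L[ℝ] ℝ) : Cot I Z := ⟨z, ξ⟩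

/-- Multiplication by `c` in the fibres of `T*Z`. -/
def Cot.scale (c : ℝ) (p : Cot I Z) : Cot I Z := Cot.of p.proj (c • p.form)

/-- The zero covector at `z`. -/
def Cot.zero (z : Z) : Cot I Z := Cot.of z 0

/-- The canonical one-form `μ · dy` of `T*Z`. -/
def canonicalForm (p : Cot I Z) (v : TangentSpace (cotModel I) p) : ℝ :=
  p.form (mfderiv (cotModel I) I (fun q : Cot I Z => q.proj) p v)

/-- The contact form `dτ + μ · dy`. -/
def contactForm (q : ScCot I Z) (v : TangentSpace (scModel I) q) : ℝ :=
  (show ℝ from mfderiv (scModel I) 𝓘(ℝ, ℝ) (fun w : ScCot I Z => w.1) q v) +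
    canonicalForm q.2 (mfderiv (scModel I) (cotModel I) (fun w : ScCot I Z => w.2) q v)

variable (I) in
/-- The value at `z` of the section `d(f/x)` of the scattering cotangent bundle. -/
def scDiff (f : Z → ℝ) (z : Z) : ScCot I Z := (-f z, Cot.of z (mfderiv I 𝓘(ℝ, ℝ) f z))

/-- Legendre submanifolds: smooth submanifolds of dimension `dim Z` (so of codimension `dim Z + 1`)
on which the contact form vanishes. -/
def IsLegendre (G : Set (ScCot I Z)) : Prop :=
  IsNeatIntegralSubmanifold (scModel I) contactForm (fun _ => 1) (Module.finrank ℝ E + 1) G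

/-- Over the open subset `Ω` of `Z`, `(G, G♯)` is an intersecting pair of Legendre submanifolds with
conic points: for some boundary defining function `x/a`, `a > 0`, `G♯` is the union of the graphs of
the differentials `c d(a/x)` for finitely many real numbers `c`, `G` is a Legendre submanifold
with `cl G \ G ⊆ G♯`, and `cl G` is the image of a submanifold with boundary of the blow-up of the
span of `d(a/x)` that is transversal to the front face. -/
def IsConicPair (Ω : Set Z) (G Gs : Set (ScCot I Z)) : Prop :=
  (∀ q ∈ G, q.2.proj ∈ Ω) ∧ IsLegendre G ∧ IsLegendre Gs ∧
  ∃ (a : Z → ℝ) (Λ : Finset ℝ), ContMDiffOn I 𝓘(ℝ, ℝ) ∞ a Ω ∧ (∀ z ∈ Ω, 0 < a z) ∧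
    Gs = {q | ∃ c ∈ Λ, ∃ z ∈ Ω, q = scDiff I (fun w => c * a w) z} ∧
    {q ∈ closure G | q.2.proj ∈ Ω} \ G ⊆ Gs ∧
    IsConicAlong (scModel I) (Module.finrank ℝ E) (2 * Module.finrank ℝ E + 2)
      {q | ∃ c : ℝ, ∃ z ∈ Ω, q = scDiff I (fun w => c * a w) z} G

/-- The restriction of the first projection to `C` is a fibration onto `B` (a locally trivial smooth
fibre bundle). Locally over `B`, the maps `k = Φ(j, f)` and `f = Ψ(j, k)` are the fibre components
of a trivialization and of its inverse. -/
def IsFibration (C : Set (ScCot I Z × ScCot I Z)) (B : Set (ScCot I Z)) : Prop :=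
  Prod.fst '' C = B ∧ ∀ b ∈ B, ∃ (V : Set (ScCot I Z)) (Φ Ψ : ScCot I Z × ScCot I Z → ScCot I Z),
    IsOpen V ∧ b ∈ V ∧
    ContMDiffOn ((scModel I).prod (scModel I)) (scModel I) ∞ Φ (C ∩ Prod.fst ⁻¹' V) ∧
    ContMDiffOn ((scModel I).prod (scModel I)) (scModel I) ∞ Ψ ((B ∩ V) ×ˢ {f | (b, f) ∈ C}) ∧
    (∀ j ∈ V, ∀ f, (j, f) ∈ C → (b, Φ (j, f)) ∈ C ∧ Ψ (j, Φ (j, f)) = f) ∧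
    (∀ j ∈ B ∩ V, ∀ k, (b, k) ∈ C → (j, Ψ (j, k)) ∈ C ∧ Φ (j, Ψ (j, k)) = k)

/-! ### The fibred-scattering cotangent bundle over the face bf of the b-double space

Let `Z = ∂X`. The front face bf of the blow-up of `(∂X)²` in `X²` is `[0, π/2] × Z × Z`, with points
`(θ, y', y'')`, `tan θ = x'/x''`; its boundary consists of the corners with lb (`θ = 0`) and
rb (`θ = π/2`). The fibred-scattering cotangent bundle is the sum of the pull-backs of the
scattering cotangent bundles of the two factors: its points over bf are
`τ' dx'/x'² + μ' · dy'/x' + τ'' dx''/x''² + μ'' · dy''/x''`. -/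

variable (I Z) in
/-- The bundle, with points `(θ, (τ', (y', μ')), (τ'', (y'', μ'')))`; those with `0 ≤ θ ≤ π/2` lie
over bf. -/
abbrev FibCot : Type _ := ℝ × ScCot I Z × ScCot I Z

variable (I) in
/-- The model with corners of `FibCot I Z`. -/
abbrev fibModel := 𝓘(ℝ, ℝ).prod ((scModel I).prod (scModel I))

/-- A function that is positive in the interior of `[0, π/2]`, negative outside this interval, and
has simple zeros at the end points. -/
def bfDef (q : FibCot I Z) : ℝ := q.1 * (Real.pi / 2 - q.1)

/-- With `x⁻² = x'⁻² + x''⁻²`, that is, `x' = x / cos θ` and `x'' = x / sin θ`, a covector is also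
`τ dx/x² + η dθ/x + (cos θ μ' · dy' + sin θ μ'' · dy'')/x`. This is `τ`. -/
def totalTau (q : FibCot I Z) : ℝ := q.2.1.1 * Real.cos q.1 + q.2.2.1 * Real.sin q.1

/-- The coordinate `η`; see `totalTau`. -/
def totalEta (q : FibCot I Z) : ℝ := q.2.1.1 * Real.sin q.1 - q.2.2.1 * Real.cos q.1

/-- The contact form `dτ + η dθ + cos θ μ' · dy' + sin θ μ'' · dy''`. -/
def fibContactForm (q : FibCot I Z) (v : TangentSpace (fibModel I) q) : ℝ :=
  (show ℝ from mfderiv (fibModel I) 𝓘(ℝ, ℝ) (totalTau : FibCot I Z → ℝ) q v) +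
    totalEta q * (show ℝ from mfderiv (fibModel I) 𝓘(ℝ, ℝ) (fun w : FibCot I Z => w.1) q v) +
    Real.cos q.1 *
      canonicalForm q.2.1.2 (mfderiv (fibModel I) (cotModel I) (fun w : FibCot I Z => w.2.1.2) q v) +
    Real.sin q.1 *
      canonicalForm q.2.2.2 (mfderiv (fibModel I) (cotModel I) (fun w : FibCot I Z => w.2.2.2) q v)

/-- Over the interior of bf the structure is a scattering structure: the covector as a point
`(τ, (θ, y', y''), η dθ + cos θ μ' + sin θ μ'')` of the scattering cotangent bundle with respect to
the boundary defining function `x`. -/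
def toInterior (q : FibCot I Z) : ScCot (𝓘(ℝ, ℝ).prod (I.prod I)) (ℝ × Z × Z) :=
  let z : ℝ × Z × Z := (q.1, q.2.1.2.proj, q.2.2.2.proj)
  let dθ : TangentSpace (𝓘(ℝ, ℝ).prod (I.prod I)) z →L[ℝ] ℝ :=
    mfderiv (𝓘(ℝ, ℝ).prod (I.prod I)) 𝓘(ℝ, ℝ) (fun w : ℝ × Z × Z => w.1) z
  let μ' : TangentSpace (𝓘(ℝ, ℝ).prod (I.prod I)) z →L[ℝ] ℝ :=
    q.2.1.2.form.comp (mfderiv (𝓘(ℝ, ℝ).prod (I.prod I)) I (fun w : ℝ × Z × Z => w.2.1) z)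
  let μ'' : TangentSpace (𝓘(ℝ, ℝ).prod (I.prod I)) z →L[ℝ] ℝ :=
    q.2.2.2.form.comp (mfderiv (𝓘(ℝ, ℝ).prod (I.prod I)) I (fun w : ℝ × Z × Z => w.2.2) z)
  (totalTau q, Cot.of z (totalEta q • dθ + Real.cos q.1 • μ' + Real.sin q.1 • μ''))

/-- The interior of bf. -/
def bfInterior : Set (ℝ × Z × Z) := {z | z.1 ∈ Ioo 0 (Real.pi / 2)}

/-- The part of `G` over the interior of bf, in the scattering cotangent bundle there. -/
def interiorPart (G : Set (FibCot I Z)) :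
    Set (ScCot (𝓘(ℝ, ℝ).prod (I.prod I)) (ℝ × Z × Z)) :=
  toInterior '' {q ∈ G | q.1 ∈ Ioo 0 (Real.pi / 2)}

/-- The two boundary hypersurfaces other than bf. -/
inductive SideFace
  | lb
  | rb

/-- The part of `G` over the corner of bf with a side face. The side face fibres over `∂X`, with the
other factor `X` as fibre `F`, and the induced map of the bundle keeps the component of a covector
in the scattering cotangent bundle of the factor that contains the base. That component is put
first; the second one lies in the scattering cotangent bundle of `F` over `∂F`. -/
def corner : SideFace → Set (FibCot I Z) → Set (ScCot I Z × ScCot I Z)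
  | .lb, G => {w | (0, w.1, w.2) ∈ G}
  | .rb, G => {w | (Real.pi / 2, w.2, w.1) ∈ G}

/-- The fibre over `b` of the part of `G` over a corner. -/
def cornerFibre (S : SideFace) (G : Set (FibCot I Z)) (b : ScCot I Z) : Set (ScCot I Z) :=
  {f | (b, f) ∈ corner S G}

/-- Legendre submanifolds of the fibred-scattering cotangent bundle: submanifolds of the bundle over
bf of dimension `dim bf = 2 dim Z + 1` (so of codimension `2 dim Z + 2`) on which the contact form
vanishes, transversal to the bundle over each corner, and such that over each corner the bundle map
induces a fibration over a Legendre submanifold, with Legendre submanifolds as fibres. -/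
def IsFibLegendre (G : Set (FibCot I Z)) : Prop :=
  IsNeatIntegralSubmanifold (fibModel I) fibContactForm bfDef (2 * Module.finrank ℝ E + 2) G ∧
  ∀ S : SideFace, ∃ G₁ : Set (ScCot I Z), IsLegendre G₁ ∧ IsFibration (corner S G) G₁ ∧
    ∀ b ∈ G₁, IsLegendre (cornerFibre S G b)

/-- Legendre pairs with conic points in the fibred-scattering cotangent bundle: pairs of Legendre
submanifolds that form an intersecting pair with conic points over the interior of bf, such that
over each corner the two fibrations have the same base, and their fibres are intersecting pairs
with conic points. -/
def IsFibConicPair (G Gs : Set (FibCot I Z)) : Prop :=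
  IsFibLegendre G ∧ IsFibLegendre Gs ∧
  IsConicPair bfInterior (interiorPart G) (interiorPart Gs) ∧
  ∀ S : SideFace, ∃ G₁ : Set (ScCot I Z), IsLegendre G₁ ∧
    IsFibration (corner S G) G₁ ∧ IsFibration (corner S Gs) G₁ ∧
    ∀ b ∈ G₁, IsConicPair univ (cornerFibre S G b) (cornerFibre S Gs b)

/-! ### The geodesic flow and the Legendre submanifolds -/

/-- `V` is the Hamilton vector field of `f : T*Z → ℝ`. In the chart of `T*Z` at `p` that is induced
by the chart of `Z`, tangent vectors at `p` are pairs `(δy, δμ)`, and the condition says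
`V = (∂f/∂μ, -∂f/∂y)`. -/
def IsHamiltonField (f : Cot I Z → ℝ) (V : ∀ p : Cot I Z, TangentSpace (cotModel I) p) : Prop :=
  ∀ (p : Cot I Z) (δy : E) (δμ : E →L[ℝ] ℝ),
    mfderiv (cotModel I) 𝓘(ℝ, ℝ) f p (show E × (E →L[ℝ] ℝ) from (δy, δμ)) =
      δμ (show E × (E →L[ℝ] ℝ) from V p).1 - (show E × (E →L[ℝ] ℝ) from V p).2 δy

/-- The square `|μ|²` of the norm of a covector with respect to the dual metric, that is, `μ(v)`
where `μ = h(v, ·)`. -/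
def normSq (h : ContMDiffRiemannianMetric I ∞ E (fun z : Z => TangentSpace I z)) (p : Cot I Z) : ℝ :=
  p.form ((h.inner p.proj).inverse p.form)

/-- `s ↦ γ s` is an orbit `s ↦ exp(s H_{h/2})(γ 0)` of the geodesic flow, the flow of the Hamilton
vector field of `½ |μ|²`. -/
def IsGeodesicOrbit (h : ContMDiffRiemannianMetric I ∞ E (fun z : Z => TangentSpace I z))
    (γ : ℝ → Cot I Z) : Prop :=
  ∃ V : ∀ p : Cot I Z, TangentSpace (cotModel I) p,
    IsHamiltonField (fun p => normSq h p / 2) V ∧ IsMIntegralCurve γ V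

/-- The set `L(λ)`. The points with `tan θ = sin s' / sin s` come from the unit covector `γ 0`; here
`tan θ = ∞`, `θ = π/2`, if `sin s = 0`. -/
def legL (h : ContMDiffRiemannianMetric I ∞ E (fun z : Z => TangentSpace I z)) (lam : ℝ) :
    Set (FibCot I Z) :=
  {q | ∃ γ : ℝ → Cot I Z, IsGeodesicOrbit h γ ∧ normSq h (γ 0) = 1 ∧
    ∃ s ∈ Icc 0 Real.pi, ∃ s' ∈ Icc 0 Real.pi, ∃ θ ∈ Icc 0 (Real.pi / 2),
      0 < Real.sin s ^ 2 + Real.sin s' ^ 2 ∧ Real.sin θ * Real.sin s = Real.cos θ * Real.sin s' ∧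
      q = (θ, (lam * Real.cos s', (γ s').scale (lam * Real.sin s')),
        (-lam * Real.cos s, (γ s).scale (-lam * Real.sin s)))} ∪
  {q | ∃ θ ∈ Icc 0 (Real.pi / 2), ∃ y : Z, q = (θ, (lam, Cot.zero y), (-lam, Cot.zero y))} ∪
  {q | ∃ θ ∈ Icc 0 (Real.pi / 2), ∃ y : Z, q = (θ, (-lam, Cot.zero y), (lam, Cot.zero y))}

variable (I Z) in
/-- The set `L♯(λ)`. -/
def legSharp (lam : ℝ) : Set (FibCot I Z) :=
  {q | ∃ θ ∈ Icc 0 (Real.pi / 2), ∃ y' y'' : Z,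
    q = (θ, (-lam, Cot.zero y'), (-lam, Cot.zero y''))}

end Scattering

end ScatGeom

end

noncomputable section

set_option linter.unusedSectionVars false
set_option synthInstance.maxHeartbeats 400000

namespace ScatGeom

/-! ### Smooth dependence of solutions of ordinary differential equations -/

section ODE

open Filter

universe u

variable {K : Type*} [TopologicalSpace K] [CompactSpace K]
  {E F : Type u} [NormedAddCommGroup E] [NormedSpace ℝ E] [NormedAddCommGroup F] [NormedSpace ℝ F]

/-! The geodesic parameters can be eliminated from the description of L. Over θ < π/2 put t = tan θ,
a = τ', b = τ'', n = |μ''|². The defining relations give n = λ² sin² s and t²n = λ² sin² s', hence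
b² + n = λ² and a² + t²n = λ², and (y', μ') is -t times the image of (y'', μ'') under the geodesic
flow for the time T = (s - s')/(λ sin s).

Everything rests on T being a smooth function of (t, a, b, n), also where n = 0. The half-angle
formulas show that D = λ² - ab + tn is 2λ² cos²((s - s')/2) and that tan((s - s')/2) = √n w with w =
(a + tb)/D. So T = 2 arctan(√n w)/√n = 2 w A(n w²), where A(z) = arctan √z / √z is smooth on z ≥ 0
(`transit_eq`). The two relations imply 2D = (a - b)² + (1 + t)² n, so on their common zero set D
vanishes exactly where a = b and n = 0. Thus over θ < π/2 the set L is the graph of a smooth map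
over the parameters (θ, a, b, (y'', μ'')) with D > 0 that satisfy the two relations
(`mem_legL_of_lt`). The points added to L by hand are those with n = 0, a = -b, D = 2λ², while those
with n = 0, a = b, D = 0 belong to L♯. The end θ = π/2 follows by exchanging the two factors, which
reverses the geodesics.

For the contact form, let α be the canonical one-form of T*Y. The Lie derivative of α along the
generator of the flow is the differential of the energy n/2, and α takes the value n on the
generator. Hence the flow with variable time T pulls α back to α + T d(n/2) + n dT
(`pullForm_geoFlow`). For the T above the correction is the rational expression (w dn + 2n dw)/(1 +
n w²) (`pullForm_geoFlow_flowTime`), and the vanishing of the contact form becomes the algebraic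
identity `transit_contact`.

Over a corner, say θ = 0, one has μ' = 0 and τ' = e with e = ±λ. Stereographic projection of τ² +
|μ|² = e² from τ = e followed by the geodesic flow identifies this part of L with T*Y; the
projection to the base G₁ becomes T*Y → Y, and the contact form of the fibres becomes a multiple of
α (`contactForm_stereoInv`). So the fibres correspond to cotangent spaces, on which α vanishes.

At the conic points D → 0 and w is unbounded. Put μ'' = ρ d. The time belonging to d is ρT, and
arctan x + arctan(1/x) = ±π/2 rewrites it as ±π/|d| minus a flow time with bounded argument, which
is smooth up to ρ = 0 for d ≠ 0 (`exists_conicTime`, `conicTransit_eq`). Hence the closure of the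
lift of L to the blow-up is parametrized smoothly by (θ, ρ, d), respectively by (ρ, d) over a
corner, and shifting ρ gives transversality to the front face; `isNeatSubmanifold_polarLift` is the
common criterion. The boundary defining function is given by 1/x' + 1/x'' over the interior of bf
and by that of the factor itself over the corners. The assumption dim Y ≥ 1 enters only over the
corners, where L itself meets the span of d(1/x).

Nearly all submanifolds here are recognized by `exists_cutsOut_of_retraction`: a parametrization
with a smooth left inverse. The analytic inputs are the smooth dependence of solutions of ordinary
differential equations on initial data and the completeness of the geodesic flow over the compact
manifold Y. -/

variable (K E F) in
set_option synthInstance.maxHeartbeats 200000 in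
/-- Pointwise application of a continuous family of operators to a continuous family of vectors. -/
def pointwiseApply : C(K, E →L[ℝ] F) →L[ℝ] C(K, E) →L[ℝ] C(K, F) :=
  LinearMap.mkContinuous₂
    (LinearMap.mk₂ ℝ (fun (A : C(K, E →L[ℝ] F)) (h : C(K, E)) =>
      (⟨fun t => A t (h t), A.continuous.clm_apply h.continuous⟩ : C(K, F)))
      (fun A B h => by ext t; simp) (fun c A h => by ext t; simp)
      (fun A h k => by ext t; simp) (fun c A h => by ext t; simp)) 1
    (fun A h => by
      rw [one_mul]
      refine (ContinuousMap.norm_le _ (by positivity)).2 fun t => ?_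
      refine ((A t).le_opNorm _).trans ?_
      gcongr
      exacts [A.norm_coe_le_norm t, h.norm_coe_le_norm t])

@[simp] lemma pointwiseApply_apply (A : C(K, E →L[ℝ] F)) (h : C(K, E)) (t : K) :
    pointwiseApply K E F A h t = A t (h t) := rfl

/-- At each point the remainder is controlled by the oscillation of `fderiv ℝ f` near the range of
`α`. That range is compact, so uniform continuity there makes the bound independent of the point, as
the sup norm requires. -/
lemma hasFDerivAt_postcomp {f : E → F} (hf : ContDiff ℝ 1 f) (α : C(K, E)) :
    HasFDerivAt (fun β : C(K, E) => (⟨f, hf.continuous⟩ : C(E, F)).comp β)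
      (pointwiseApply K E F
        ((⟨fderiv ℝ f, hf.continuous_fderiv one_ne_zero⟩ : C(E, E →L[ℝ] F)).comp α)) α := by
  rw [hasFDerivAt_iff_isLittleO_nhds_zero, Asymptotics.isLittleO_iff]
  intro c hc
  have hK : IsCompact (range α) := isCompact_range α.continuous
  have hu := hK.uniformContinuousAt_of_continuousAt (fderiv ℝ f)
    (fun a _ => (hf.continuous_fderiv one_ne_zero).continuousAt) (Metric.dist_mem_uniformity hc)
  obtain ⟨δ, hδ, hδu⟩ := Metric.mem_uniformity_dist.1 hu
  filter_upwards [Metric.ball_mem_nhds (0 : C(K, E)) hδ] with h hh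
  refine (ContinuousMap.norm_le _ (by positivity)).2 fun t => ?_
  have hht : ‖h t‖ < δ := (h.norm_coe_le_norm t).trans_lt (by simpa using hh)
  have key := (convex_ball (α t) δ).norm_image_sub_le_of_norm_fderiv_le' (𝕜 := ℝ) (f := f)
    (φ := fderiv ℝ f (α t)) (C := c) (x := α t) (y := α t + h t)
    (fun x _ => (hf.differentiable one_ne_zero).differentiableAt)
    (fun x hx => by
      have : dist (fderiv ℝ f (α t)) (fderiv ℝ f x) < c :=
        hδu (a := α t) (b := x) (by rw [dist_comm]; exact hx) (mem_range_self t)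
      rw [dist_comm] at this
      simpa [dist_eq_norm] using this.le)
    (Metric.mem_ball_self hδ) (by simpa using hht)
  have h2 : ‖f (α t + h t) - f (α t) - fderiv ℝ f (α t) (h t)‖ ≤ c * ‖h t‖ := by
    simpa using key
  refine le_trans (le_of_eq ?_) (h2.trans (by gcongr; exact h.norm_coe_le_norm t))
  simp

-- Induction on the order: the derivative of post-composition with `f` is post-composition with
-- `fderiv ℝ f`, one order less regular, followed by the bounded linear map `pointwiseApply`. The
-- target space is quantified inside the induction because each step replaces it by a space of
-- operators.
set_option synthInstance.maxHeartbeats 200000 in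
lemma contDiff_postcomp (n : ℕ) : ∀ {F : Type u} [NormedAddCommGroup F] [NormedSpace ℝ F]
    {f : E → F} (hf : ContDiff ℝ n f),
    ContDiff ℝ n (fun β : C(K, E) => (⟨f, hf.continuous⟩ : C(E, F)).comp β) := by
  induction n with
  | zero =>
    intro F _ _ f hf
    exact contDiff_zero.2 (ContinuousMap.continuous_postcomp _)
  | succ n ih =>
    intro F _ _ f hf
    have hf1 : ContDiff ℝ 1 f := hf.of_le (by exact_mod_cast Nat.le_add_left 1 n)
    have hf' : ContDiff ℝ n (fderiv ℝ f) :=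
      hf.fderiv_right (by norm_cast)
    refine contDiff_succ_iff_hasFDerivAt.2 ⟨_, ?_, fun α => hasFDerivAt_postcomp hf1 α⟩
    exact (pointwiseApply K E F).contDiff.comp (ih hf')

variable (E) in
/-- Integration from `0`, as an operator on continuous functions on `[0, 1]`. -/
def primitive : C(unitInterval, E) →L[ℝ] C(unitInterval, E) :=
  LinearMap.mkContinuous
    { toFun := fun α => ⟨fun t => ∫ s in (0 : ℝ)..t, IccExtend zero_le_one α s,
        (intervalIntegral.continuous_primitive
          (fun a b => (α.continuous.Icc_extend' ).intervalIntegrable a b) 0).comp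
          continuous_subtype_val⟩
      map_add' := fun α β => by
        ext t
        simp only [ContinuousMap.coe_mk, ContinuousMap.add_apply]
        rw [← intervalIntegral.integral_add
          ((α.continuous.Icc_extend').intervalIntegrable _ _)
          ((β.continuous.Icc_extend').intervalIntegrable _ _)]
        rfl
      map_smul' := fun c α => by
        ext t
        simp only [ContinuousMap.coe_mk, ContinuousMap.smul_apply, RingHom.id_apply]
        rw [← intervalIntegral.integral_smul]
        rfl } 1
    (fun α => by
      rw [one_mul]
      refine (ContinuousMap.norm_le _ (by positivity)).2 fun t => ?_
      refine (intervalIntegral.norm_integral_le_of_norm_le_const (C := ‖α‖)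
        (fun s _ => α.norm_coe_le_norm _)).trans ?_
      rw [sub_zero, abs_of_nonneg t.2.1]
      exact mul_le_of_le_one_right (norm_nonneg _) t.2.2)

lemma primitive_apply (α : C(unitInterval, E)) (t : unitInterval) :
    primitive E α t = ∫ s in (0 : ℝ)..t, IccExtend zero_le_one α s := rfl

variable [CompleteSpace E]

/-- A local flow of a `C^n` vector field that is continuous at a point is `C^n` there. -/
theorem contDiffAt_flow_of_contDiff {n : ℕ} (hn : n ≠ 0) {f : E → E} (hf : ContDiff ℝ n f) {x₀ : E}
    {β : ℝ × E → E} (hβc : ContinuousAt β (0, x₀)) (hβ0 : ∀ᶠ x in 𝓝 x₀, β (0, x) = x)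
    (hβ : ∀ᶠ z in 𝓝 ((0 : ℝ), x₀), HasDerivAt (fun t => β (t, z.2)) (f (β z)) z.1) :
    ContDiffAt ℝ n β (0, x₀) := by
  set cst : E →L[ℝ] C(unitInterval, E) := ContinuousLinearMap.const ℝ unitInterval with hcst
  -- Time is rescaled to the unit interval: the orbit segment of duration `t` from `x` becomes a
  -- zero of `α ↦ α - x - t ∫ f(α)`. At `t = 0` the derivative in `α` is the identity whatever `f`
  -- is, so the implicit function theorem yields a `C^n` family of curves, and the flow is its value
  -- at 1.
  let G : (ℝ × E) × C(unitInterval, E) → C(unitInterval, E) := fun w =>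
    w.2 - cst w.1.2 - w.1.1 • primitive E ((⟨f, hf.continuous⟩ : C(E, E)).comp w.2)
  have hG : ContDiff ℝ n G := by
    have h1 : ContDiff ℝ n (fun w : (ℝ × E) × C(unitInterval, E) =>
        (⟨f, hf.continuous⟩ : C(E, E)).comp w.2) := (contDiff_postcomp n hf).comp contDiff_snd
    have h2 := (primitive E).contDiff (n := n).comp h1
    have h3 : ContDiff ℝ n (fun w : (ℝ × E) × C(unitInterval, E) => cst w.1.2) :=
      cst.contDiff.comp (contDiff_snd.comp contDiff_fst)
    exact (contDiff_snd.sub h3).sub ((contDiff_fst.comp contDiff_fst).smul h2)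
  set u : (ℝ × E) × C(unitInterval, E) := ((0, x₀), cst x₀) with hu
  have hn' : (n : WithTop ℕ∞) ≠ 0 := by exact_mod_cast hn
  have hinv : (fderiv ℝ G u ∘L .inr ℝ (ℝ × E) C(unitInterval, E)).IsInvertible := by
    have h1 : HasFDerivAt (fun α : C(unitInterval, E) => G ((0, x₀), α))
        (fderiv ℝ G u ∘L .inr ℝ (ℝ × E) C(unitInterval, E)) (cst x₀) := by
      have := (hG.differentiable hn' u).hasFDerivAt
      exact this.comp (cst x₀) (hasFDerivAt_prodMk_right _ _)
    have h2 : HasFDerivAt (fun α : C(unitInterval, E) => G ((0, x₀), α))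
        (ContinuousLinearMap.id ℝ _) (cst x₀) := by
      have : (fun α : C(unitInterval, E) => G ((0, x₀), α)) = fun α => α - cst x₀ := by
        ext α; simp [G]
      rw [this]
      exact (hasFDerivAt_id _).sub_const _
    rw [h1.unique h2]
    exact ⟨.refl ℝ _, rfl⟩
  have hGu : G u = 0 := by simp [G, hu]
  have hiff := hG.contDiffAt.eventually_apply_eq_iff_implicitFunction (u := u) hn' hinv
  have hψ := hG.contDiffAt.contDiffAt_implicitFunction (u := u) hn' hinv
  set ψ := hG.contDiffAt.implicitFunction (u := u) hn' hinv with hψdef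
  have hev : ContDiffAt ℝ n (fun z => ContinuousMap.evalCLM ℝ (1 : unitInterval) (ψ z)) (0, x₀) :=
    ContDiffAt.comp (g := ContinuousMap.evalCLM ℝ (1 : unitInterval)) (0, x₀)
      (ContinuousLinearMap.contDiff _).contDiffAt hψ
  refine hev.congr_of_eventuallyEq ?_
  rw [nhds_prod_eq] at hiff
  obtain ⟨A, hA, B, hB, hAB⟩ := Filter.mem_prod_iff.1 hiff
  obtain ⟨δ, hδ, hδB⟩ := Metric.mem_nhds_iff.1 hB
  have hx₀ : β (0, x₀) = x₀ := hβ0.self_of_nhds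
  have hball : ∀ᶠ z in 𝓝 ((0 : ℝ), x₀), β z ∈ Metric.ball x₀ (δ / 2) :=
    hβc.preimage_mem_nhds (by rw [hx₀]; exact Metric.ball_mem_nhds _ (half_pos hδ))
  obtain ⟨r, hr, hrβ⟩ := Metric.mem_nhds_iff.1 ((hβ.and hball).and
    (continuous_snd.continuousAt.eventually hβ0))
  filter_upwards [hA, Metric.ball_mem_nhds _ hr] with z hzA hzr
  rw [Metric.mem_ball, Prod.dist_eq, max_lt_iff] at hzr
  have hseg : ∀ s ∈ Icc (0 : ℝ) 1, ((z.1 * s, z.2) : ℝ × E) ∈ Metric.ball ((0 : ℝ), x₀) r := by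
    intro s hs
    rw [Metric.mem_ball, Prod.dist_eq, max_lt_iff]
    refine ⟨lt_of_le_of_lt ?_ hzr.1, hzr.2⟩
    simp only [dist_zero_right, norm_mul, Real.norm_eq_abs]
    exact mul_le_of_le_one_right (abs_nonneg _) (by rw [abs_of_nonneg hs.1]; exact hs.2)
  have hder : ∀ s ∈ Icc (0 : ℝ) 1, HasDerivAt (fun s => β (z.1 * s, z.2))
      (z.1 • f (β (z.1 * s, z.2))) s := by
    intro s hs
    have h1 := (hrβ (hseg s hs)).1.1
    have h2 : HasDerivAt (fun s : ℝ => z.1 * s) z.1 s := by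
      simpa using (hasDerivAt_id s).const_mul z.1
    exact HasDerivAt.scomp (g₁ := fun t => β (t, z.2)) s h1 h2
  have hcont : ContinuousOn (fun s => β (z.1 * s, z.2)) (Icc 0 1) := fun s hs =>
    (hder s hs).continuousAt.continuousWithinAt
  -- The rescaled orbit of `β` solves the integral equation. Continuity of `β` keeps it uniformly
  -- close to the constant curve, hence inside the region where the implicit function is the only
  -- solution.
  let α : C(unitInterval, E) := ⟨fun s => β (z.1 * s, z.2), hcont.domRestrict⟩
  have hαext : ∀ s ∈ Icc (0 : ℝ) 1,
      IccExtend zero_le_one ((⟨f, hf.continuous⟩ : C(E, E)).comp α) s = f (β (z.1 * s, z.2)) := by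
    intro s hs
    rw [IccExtend_of_mem _ _ hs]; rfl
  have hGα : G (z, α) = 0 := by
    ext t
    simp only [G, ContinuousMap.sub_apply, ContinuousMap.smul_apply, primitive_apply,
      ContinuousMap.zero_apply]
    have h1 : z.1 • ∫ s in (0 : ℝ)..t, IccExtend zero_le_one
        ((⟨f, hf.continuous⟩ : C(E, E)).comp α) s = β (z.1 * t, z.2) - z.2 := by
      rw [← intervalIntegral.integral_smul]
      have hsub : uIcc (0 : ℝ) t ⊆ Icc 0 1 := by
        rw [uIcc_of_le t.2.1]; exact Icc_subset_Icc_right t.2.2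
      rw [intervalIntegral.integral_eq_sub_of_hasDerivAt (f := fun s => β (z.1 * s, z.2))]
      · have : β (0, z.2) = z.2 := (hrβ (Metric.mem_ball.2 (by
          rw [Prod.dist_eq, max_lt_iff]; exact hzr))).2
        simp [this]
      · intro s hs
        rw [hαext s (hsub hs)]
        exact hder s (hsub hs)
      · exact (((((⟨f, hf.continuous⟩ : C(E, E)).comp α).continuous.Icc_extend').const_smul
          z.1)).intervalIntegrable _ _
    rw [h1]
    have : α t = β (z.1 * t, z.2) := rfl
    simp [this, cst]
  have hαB : α ∈ B := by
    refine hδB ?_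
    rw [Metric.mem_ball]
    refine lt_of_le_of_lt ?_ (half_lt_self hδ)
    refine (ContinuousMap.dist_le (half_pos hδ).le).2 fun s => ?_
    exact (Metric.mem_ball.1 (hrβ (hseg s s.2)).1.2).le
  have hmem : ((z, α) : (ℝ × E) × C(unitInterval, E)) ∈ A ×ˢ B := ⟨hzA, hαB⟩
  have hfin := (hAB hmem).1 (by rw [hGα, hGu])
  simp only [ContinuousMap.evalCLM_apply]
  rw [hfin]
  change β z = β (z.1 * (1 : unitInterval), z.2)
  simp

/-- A `C^n` vector field has a local flow that is `C^n`. -/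
theorem exists_contDiffAt_localFlow [FiniteDimensional ℝ E] {n : ℕ} (hn : n ≠ 0) {f : E → E}
    {x₀ : E} (hf : ContDiffAt ℝ n f x₀) :
    ∃ β : ℝ × E → E, ContDiffAt ℝ n β (0, x₀) ∧ ∃ ε > 0, ∃ N ∈ 𝓝 x₀,
      ContinuousOn β (Ioo (-ε) ε ×ˢ N) ∧
      ∀ x ∈ N, β (0, x) = x ∧ ∀ t ∈ Ioo (-ε) ε, HasDerivAt (fun t => β (t, x)) (f (β (t, x))) t := by
  have hn' : (n : WithTop ℕ∞) ≠ 0 := by exact_mod_cast hn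
  have h1n : (1 : WithTop ℕ∞) ≤ n := by exact_mod_cast Nat.one_le_iff_ne_zero.2 hn
  obtain ⟨ε, hε, a, r, L, k, hr, hpl⟩ := IsPicardLindelof.of_contDiffAt_one (hf.of_le h1n)
  obtain ⟨α, hα, hαc⟩ := (hpl 0).exists_forall_mem_closedBall_eq_hasDerivWithinAt_continuousOn
  set β : ℝ × E → E := fun z => α (z.2, z.1) with hβ
  have hr' : (0 : ℝ) < r := hr
  have hβc : ContinuousOn β (Ioo (-ε) ε ×ˢ Metric.closedBall x₀ r) := by
    refine hαc.comp continuous_swap.continuousOn ?_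
    rintro ⟨t, x⟩ ⟨ht, hx⟩
    exact ⟨hx, by simpa using Ioo_subset_Icc_self ht⟩
  have hβd : ∀ x ∈ Metric.closedBall x₀ r, β (0, x) = x ∧
      ∀ t ∈ Ioo (-ε) ε, HasDerivAt (fun t => β (t, x)) (f (β (t, x))) t := by
    intro x hx
    refine ⟨(hα x hx).1, fun t ht => ?_⟩
    refine ((hα x hx).2 t (by simpa using Ioo_subset_Icc_self ht)).hasDerivAt ?_
    exact Icc_mem_nhds (by simpa using ht.1) (by simpa using ht.2)
  have hN : Metric.closedBall x₀ (r : ℝ) ∈ 𝓝 x₀ := Metric.closedBall_mem_nhds _ hr'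
  have hI : Ioo (-ε) ε ∈ 𝓝 (0 : ℝ) := Ioo_mem_nhds (by linarith) hε
  refine ⟨β, ?_, ε, hε, _, hN, hβc, hβd⟩
  -- cut the vector field off
  obtain ⟨U, hU, hfU⟩ := hf.contDiffOn (le_refl _) (by simp)
  obtain ⟨R, hR, hRU⟩ := Metric.mem_nhds_iff.1 hU
  let χ : ContDiffBump x₀ := ⟨R / 4, R / 2, by positivity, by linarith⟩
  have hg : ContDiff ℝ n (fun x => χ x • f x) := by
    rw [contDiff_iff_contDiffAt]
    intro x
    by_cases hx : x ∈ Metric.ball x₀ R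
    · refine χ.contDiffAt.smul ?_
      exact (hfU.mono (hRU)).contDiffAt (Metric.isOpen_ball.mem_nhds hx)
    · have : (fun x => χ x • f x) =ᶠ[𝓝 x] fun _ => 0 := by
        have hx' : x ∈ (Metric.closedBall x₀ (R / 2))ᶜ := by
          simp only [mem_compl_iff, Metric.mem_closedBall, not_le]
          simp only [Metric.mem_ball, not_lt] at hx
          linarith
        filter_upwards [Metric.isClosed_closedBall.isOpen_compl.mem_nhds hx'] with y hy
        rw [χ.zero_of_le_dist, zero_smul]
        simp only [mem_compl_iff, Metric.mem_closedBall, not_le] at hy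
        exact hy.le
      exact contDiffAt_const.congr_of_eventuallyEq this
  have hβc0 : ContinuousAt β (0, x₀) :=
    hβc.continuousAt (prod_mem_nhds hI hN)
  have hx₀ : β (0, x₀) = x₀ := (hβd x₀ (Metric.mem_closedBall_self hr'.le)).1
  refine contDiffAt_flow_of_contDiff hn hg hβc0 ?_ ?_
  · filter_upwards [hN] with x hx using (hβd x hx).1
  · have h1 : ∀ᶠ z in 𝓝 ((0 : ℝ), x₀), β z ∈ Metric.closedBall x₀ (R / 4) :=
      hβc0.preimage_mem_nhds (by rw [hx₀]; exact Metric.closedBall_mem_nhds _ (by positivity))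
    filter_upwards [h1, prod_mem_nhds hI hN] with z hz1 hz2
    rw [χ.one_of_mem_closedBall hz1, one_smul]
    exact (hβd z.2 hz2.2).2 z.1 hz2.1

end ODE
end ScatGeom

namespace ScatGeom

/-! ### Flows of vector fields on manifolds -/

section Flow

universe u

variable {E : Type u} [NormedAddCommGroup E] [NormedSpace ℝ E] [FiniteDimensional ℝ E]
  {H : Type*} [TopologicalSpace H] {I : ModelWithCorners ℝ E H} [I.Boundaryless]
  {M : Type*} [TopologicalSpace M] [ChartedSpace H M] [IsManifold I ∞ M]
  {V : ∀ p : M, TangentSpace I p}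

/-- The Euclidean local flow is carried over by the chart at `p₀`. Times and initial points are
restricted so that the Euclidean orbits stay in the target of that chart; this gives one time
interval for a whole neighbourhood. -/
lemma exists_local_flow {n : ℕ} (hn : n ≠ 0)
    (hV : ContMDiff I I.tangent ∞ (fun x => (⟨x, V x⟩ : TangentBundle I M))) (p₀ : M) :
    ∃ φ : ℝ × M → M, ContMDiffAt (𝓘(ℝ, ℝ).prod I) I n φ (0, p₀) ∧ ∃ ε > 0, ∃ N ∈ 𝓝 p₀,
      ∀ p ∈ N, φ (0, p) = p ∧ IsMIntegralCurveOn (fun t => φ (t, p)) V (Ioo (-ε) ε) := by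
  have : CompleteSpace E := FiniteDimensional.complete ℝ E
  have hv := (hV.of_le (m := n) (by exact_mod_cast le_top)).contMDiffAt (x := p₀)
  rw [contMDiffAt_iff] at hv
  obtain ⟨_, hv⟩ := hv
  have hx : I.IsInteriorPoint p₀ := BoundarylessManifold.isInteriorPoint
  obtain ⟨β, hβ, ε, hε, N, hN, -, hβN⟩ := exists_contDiffAt_localFlow hn
    (hv.contDiffAt (range_mem_nhds_isInteriorPoint hx)).snd
  set κ := extChartAt I p₀ with hκ
  have htgt : κ.target ∈ 𝓝 (κ p₀) := extChartAt_target_mem_nhds p₀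
  have hβ0 : β (0, κ p₀) = κ p₀ := (hβN _ (mem_of_mem_nhds hN)).1
  have hmem : ∀ᶠ z in 𝓝 ((0 : ℝ), κ p₀), β z ∈ κ.target :=
    hβ.continuousAt.preimage_mem_nhds (by rw [hβ0]; exact htgt)
  rw [nhds_prod_eq] at hmem
  obtain ⟨A, hA, B, hB, hAB⟩ := Filter.mem_prod_iff.1 hmem
  obtain ⟨ε', hε', hA'⟩ := Metric.mem_nhds_iff.1 hA
  rw [Real.ball_eq_Ioo, zero_sub, zero_add] at hA'
  have hκc : ContinuousAt κ p₀ := continuousAt_extChartAt p₀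
  refine ⟨fun z => κ.symm (β (z.1, κ z.2)), ?_, min ε ε', lt_min hε hε',
    κ.source ∩ κ ⁻¹' (N ∩ B), Filter.inter_mem (extChartAt_source_mem_nhds p₀)
      (hκc.preimage_mem_nhds (Filter.inter_mem hN hB)), ?_⟩
  · have h1 : ContMDiffAt 𝓘(ℝ, E) I n κ.symm (β (0, κ p₀)) := by
      rw [hβ0]
      exact ((contMDiffOn_extChartAt_symm p₀).contMDiffAt htgt)
    have h2 : ContMDiffAt (𝓘(ℝ, ℝ).prod I) 𝓘(ℝ, E) n (fun z : ℝ × M => β (z.1, κ z.2)) (0, p₀) := by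
      have h3 : ContMDiffAt 𝓘(ℝ, ℝ × E) 𝓘(ℝ, E) n β (0, κ p₀) := hβ.contMDiffAt
      have h4 : ContMDiffAt (𝓘(ℝ, ℝ).prod I) 𝓘(ℝ, ℝ × E) n (fun z : ℝ × M => (z.1, κ z.2))
          (0, p₀) :=
        contMDiffAt_fst.prodMk_space
          ((contMDiffAt_extChartAt (x := p₀)).comp ((0 : ℝ), p₀) contMDiffAt_snd)
      exact h3.comp (0, p₀) h4
    exact ContMDiffAt.comp (0, p₀) h1 h2
  · rintro p ⟨hps, hpN, hpB⟩
    refine ⟨by simp only [(hβN _ hpN).1]; exact κ.left_inv hps, fun t ht => ?_⟩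
    have ht1 : t ∈ Ioo (-ε) ε := ⟨by have := min_le_left ε ε'; linarith [ht.1],
      ht.2.trans_le (min_le_left _ _)⟩
    have ht2 : t ∈ Ioo (-ε') ε' := ⟨by have := min_le_right ε ε'; linarith [ht.1],
      ht.2.trans_le (min_le_right _ _)⟩
    have hf3' : β (t, κ p) ∈ κ.target :=
      hAB (show ((t, κ p) : ℝ × E) ∈ A ×ˢ B from ⟨hA' ht2, hpB⟩)
    let xₜ : M := κ.symm (β (t, κ p))
    have h : HasDerivAt (fun t => β (t, κ p)) (fderivWithin ℝ (κ ∘ (extChartAt I xₜ).symm)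
      (range I) (extChartAt I xₜ xₜ) (V xₜ)) t := (hβN _ hpN).2 t ht1
    rw [hκ, ← tangentCoordChange_def] at h
    have hft1 : xₜ ∈ κ.source := κ.map_target hf3'
    have hft2 := mem_extChartAt_source (I := I) xₜ
    have hgoal : HasDerivAt ((extChartAt I xₜ ∘ κ.symm) ∘ (fun t => β (t, κ p)))
        (show E from V xₜ) t := by
      rw [← tangentCoordChange_self (I := I) (x := xₜ) (z := xₜ) (v := show E from V xₜ) hft2,
        ← tangentCoordChange_comp (x := p₀) ⟨⟨hft2, hft1⟩, hft2⟩]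
      apply HasFDerivAt.comp_hasDerivAt _ _ h
      have hkey := hasFDerivWithinAt_tangentCoordChange (I := I) (x := p₀) (y := xₜ) (z := xₜ)
        ⟨hft1, hft2⟩
      rw [I.range_eq_univ, hasFDerivWithinAt_univ] at hkey
      have : extChartAt I p₀ xₜ = β (t, κ p) := κ.right_inv hf3'
      rw [this] at hkey
      exact hkey
    have haux : ∀ (f : ℝ → E) (e : E), HasDerivAt f e t →
        HasFDerivAt f ((1 : ℝ →L[ℝ] ℝ).smulRight e) t := fun f e hf => by
      refine hf.hasFDerivAt.congr_fderiv ?_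
      ext
      simp
    exact HasMFDerivAt.hasMFDerivWithinAt ⟨ContinuousAt.comp (f := fun t => β (t, κ p))
      (continuousAt_extChartAt_symm'' hf3') h.continuousAt, (haux _ _ hgoal).hasFDerivWithinAt⟩

lemma contMDiff_one_of_infty
    (hV : ContMDiff I I.tangent ∞ (fun x => (⟨x, V x⟩ : TangentBundle I M))) :
    ContMDiff I I.tangent 1 (fun x => (⟨x, V x⟩ : TangentBundle I M)) :=
  hV.of_le (by exact_mod_cast le_top)

variable [T2Space M]

/-- The group property of a global flow. -/
lemma flow_add (hV : ContMDiff I I.tangent ∞ (fun x => (⟨x, V x⟩ : TangentBundle I M)))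
    {Φ : ℝ → M → M} (h0 : ∀ p, Φ 0 p = p) (hΦ : ∀ p, IsMIntegralCurve (fun t => Φ t p) V)
    (s t : ℝ) (p : M) : Φ (s + t) p = Φ s (Φ t p) := by
  have h1 := (hΦ p).comp_add t
  have := isMIntegralCurve_Ioo_eq_of_contMDiff_boundaryless (t₀ := 0) (contMDiff_one_of_infty hV)
    h1 (hΦ (Φ t p)) (by simp [h0])
  exact congrFun this s

/-- A global flow of a smooth vector field is smooth. -/
theorem contMDiff_flow (hV : ContMDiff I I.tangent ∞ (fun x => (⟨x, V x⟩ : TangentBundle I M)))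
    {Φ : ℝ → M → M} (h0 : ∀ p, Φ 0 p = p) (hΦ : ∀ p, IsMIntegralCurve (fun t => Φ t p) V) :
    ContMDiff (𝓘(ℝ, ℝ).prod I) I ∞ (fun z : ℝ × M => Φ z.1 z.2) := by
  -- Each finite order is treated separately, because the local flows are only `C^n` on
  -- neighbourhoods that may depend on `n`.
  have key : ∀ n : ℕ, n ≠ 0 → ∀ z : ℝ × M,
      ContMDiffAt (𝓘(ℝ, ℝ).prod I) I n (fun z : ℝ × M => Φ z.1 z.2) z := by
    intro n hn
    have hloc : ∀ p₀ : M, ∀ᶠ z in 𝓝 ((0 : ℝ), p₀),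
        ContMDiffAt (𝓘(ℝ, ℝ).prod I) I n (fun z : ℝ × M => Φ z.1 z.2) z := by
      intro p₀
      obtain ⟨φ, hφ, ε, hε, N, hN, hφN⟩ := exists_local_flow hn hV p₀
      have heq : (fun z : ℝ × M => Φ z.1 z.2) =ᶠ[𝓝 ((0 : ℝ), p₀)] φ := by
        filter_upwards [prod_mem_nhds (Ioo_mem_nhds (neg_lt_zero.2 hε) hε) hN] with z hz
        exact isMIntegralCurveOn_Ioo_eqOn_of_contMDiff_boundaryless (t₀ := 0)
          ⟨neg_lt_zero.2 hε, hε⟩ (contMDiff_one_of_infty hV) ((hΦ z.2).isMIntegralCurveOn _)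
          (hφN z.2 hz.2).2 (by simp [h0, (hφN z.2 hz.2).1]) hz.1
      exact (contMDiffAt_iff_contMDiffAt_nhds (by simp)).1 (hφ.congr_of_eventuallyEq heq)
    rintro ⟨t, p⟩
    -- A continuity argument in time. The set `A` of good times is open by definition of
    -- differentiability of finite order. It is closed because near a limit time `t` the flow is the
    -- short-time flow near `Φ t p`, smooth by the local theory, after the flow for some earlier or
    -- later time in `A`.
    let A : Set ℝ :=
      {t | ContMDiffAt (𝓘(ℝ, ℝ).prod I) I n (fun z : ℝ × M => Φ z.1 z.2) (t, p)}
    have hAo : IsOpen A := by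
      rw [isOpen_iff_mem_nhds]
      intro t ht
      have h1 := (contMDiffAt_iff_contMDiffAt_nhds (by simp)).1 ht
      exact (Continuous.prodMk_left p).continuousAt.eventually h1
    have hAc : IsClosed A := by
      refine isClosed_of_closure_subset fun t ht => ?_
      have h1 := hloc (Φ t p)
      have h2 : Filter.Tendsto (fun t₁ => (t - t₁, Φ t₁ p)) (𝓝 t) (𝓝 (0, Φ t p)) := by
        have : ContinuousAt (fun t₁ => (t - t₁, Φ t₁ p)) t :=
          (continuousAt_const.sub continuousAt_id).prodMk (hΦ p).continuous.continuousAt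
        simpa [ContinuousAt] using this
      obtain ⟨t₁, ht₁A, ht₁⟩ := ((mem_closure_iff_frequently.1 ht).and_eventually
        (h2.eventually h1)).exists
      have heq : (fun z : ℝ × M => Φ z.1 z.2) = fun z => Φ (z.1 - t₁) (Φ t₁ z.2) := by
        ext z
        rw [← flow_add hV h0 hΦ, sub_add_cancel]
      change ContMDiffAt _ _ _ _ _
      rw [heq]
      have h3 : ContMDiffAt (𝓘(ℝ, ℝ).prod I) (𝓘(ℝ, ℝ).prod I) n
          (fun z : ℝ × M => (z.1 - t₁, Φ t₁ z.2)) (t, p) := by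
        refine ContMDiffAt.prodMk ?_ ?_
        · exact contMDiffAt_fst.sub contMDiffAt_const
        · exact ContMDiffAt.comp (g := fun z : ℝ × M => Φ z.1 z.2)
            (f := fun z : ℝ × M => (t₁, z.2)) (t, p) ht₁A
            (contMDiffAt_const.prodMk contMDiffAt_snd)
      exact ContMDiffAt.comp (g := fun z : ℝ × M => Φ z.1 z.2)
        (f := fun z : ℝ × M => (z.1 - t₁, Φ t₁ z.2)) (t, p) ht₁ h3
    have h0A : (0 : ℝ) ∈ A := (hloc p).self_of_nhds
    have := IsClopen.eq_univ ⟨hAc, hAo⟩ ⟨0, h0A⟩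
    exact (this.symm ▸ mem_univ t : t ∈ A)
  intro z
  rw [contMDiffAt_infty]
  intro n
  exact (key (n + 1) n.succ_ne_zero z).of_le (by exact_mod_cast n.le_succ)

end Flow
end ScatGeom

namespace ScatGeom

/-! ### The cotangent bundle in coordinates -/

section Cotangent

universe u

variable {E : Type u} [NormedAddCommGroup E] [NormedSpace ℝ E]
  {H : Type*} [TopologicalSpace H] {I : ModelWithCorners ℝ E H}
  {Z : Type*} [TopologicalSpace Z] [ChartedSpace H Z] [IsManifold I ∞ Z]

/-! Shortcuts for the instance search. -/

scoped instance instTopologicalSpaceCot : TopologicalSpace (Cot I Z) := inferInstance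

scoped instance instChartedSpaceCot : ChartedSpace (ModelProd H (E →L[ℝ] ℝ)) (Cot I Z) :=
  inferInstance

scoped instance instIsManifoldCot : IsManifold (cotModel I) ∞ (Cot I Z) := inferInstance

/-- The fibre coordinates of a covector with respect to the chart at `y`. -/
def fibCoord (y : Z) (p : Cot I Z) : E →L[ℝ] ℝ :=
  p.form.comp ((trivializationAt E (TangentSpace I) y).symmL ℝ p.proj)

lemma inCoordinates_cot (y : Z) (p : Cot I Z) :
    ContinuousLinearMap.inCoordinates E (TangentSpace I) ℝ (Bundle.Trivial Z ℝ) y p.proj y p.proj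
      p.2 = fibCoord y p := by
  ext v
  simp [ContinuousLinearMap.inCoordinates, fibCoord, Cot.form]

lemma extChartAt_cot (p₀ p : Cot I Z) :
    extChartAt (cotModel I) p₀ p = (extChartAt I p₀.proj p.proj, fibCoord p₀.proj p) := by
  rw [← inCoordinates_cot]
  have := hom_chart p₀ p (𝕜 := ℝ) (F₁ := E) (F₂ := ℝ) (E₁ := (TangentSpace I : Z → Type _))
    (E₂ := Bundle.Trivial Z ℝ) (HB := H)
  simp only [extChartAt, OpenPartialHomeomorph.extend, PartialEquiv.coe_trans,
    Function.comp_apply, OpenPartialHomeomorph.toFun_eq_coe]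
  rw [this]
  rfl

lemma extChartAt_cot_source (p₀ : Cot I Z) :
    (extChartAt (cotModel I) p₀).source =
      (fun p : Cot I Z => p.proj) ⁻¹' (chartAt H p₀.proj).source := by
  rw [FiberBundle.extChartAt]
  ext p
  simp only [PartialEquiv.trans_source, PartialEquiv.prod_source, PartialEquiv.refl_source,
    Trivialization.source_eq, hom_trivializationAt_baseSet, extChartAt_source]
  simp [hom_trivializationAt_apply]

lemma extChartAt_cot_target (p₀ : Cot I Z) :
    (extChartAt (cotModel I) p₀).target = (extChartAt I p₀.proj).target ×ˢ univ := by
  rw [FiberBundle.extChartAt_target]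
  congr 1
  rw [hom_trivializationAt_baseSet]
  refine inter_eq_left.2 fun x hx => ⟨?_, by simp⟩
  have := (extChartAt I p₀.proj).map_target hx
  simpa using this

lemma contMDiffAt_cot_iff {EK : Type*} [NormedAddCommGroup EK] [NormedSpace ℝ EK]
    {HK : Type*} [TopologicalSpace HK] {IK : ModelWithCorners ℝ EK HK}
    {K : Type*} [TopologicalSpace K] [ChartedSpace HK K] {n : WithTop ℕ∞} {f : K → Cot I Z} {k₀ : K} :
    ContMDiffAt IK (cotModel I) n f k₀ ↔ ContMDiffAt IK I n (fun k => (f k).proj) k₀ ∧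
      ContMDiffAt IK 𝓘(ℝ, E →L[ℝ] ℝ) n (fun k => fibCoord (f k₀).proj (f k)) k₀ := by
  rw [contMDiffAt_hom_bundle]
  simp only [inCoordinates_cot]

lemma contMDiff_proj : ContMDiff (cotModel I) I ∞ (fun p : Cot I Z => p.proj) :=
  Bundle.contMDiff_proj _

lemma contMDiffAt_fibCoord {y : Z} {p : Cot I Z} (hp : p.proj ∈ (chartAt H y).source) :
    ContMDiffAt (cotModel I) 𝓘(ℝ, E →L[ℝ] ℝ) ∞ (fibCoord (I := I) y) p := by
  have h1 : ContMDiffAt (cotModel I) 𝓘(ℝ, E × (E →L[ℝ] ℝ)) ∞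
      (extChartAt (cotModel I) (Cot.zero (I := I) y)) p :=
    contMDiffAt_extChartAt' (by rw [← extChartAt_source (cotModel I), extChartAt_cot_source]; exact hp)
  have h2 : fibCoord (I := I) y = fun p => (extChartAt (cotModel I) (Cot.zero (I := I) y) p).2 := by
    ext1 p; rw [extChartAt_cot]; rfl
  rw [h2]
  exact contDiff_snd.contMDiff.contMDiffAt.comp p h1

lemma symmL_mfderiv_extChartAt {y z : Z} (hz : z ∈ (chartAt H y).source) (v : TangentSpace I z) :
    (trivializationAt E (TangentSpace I) y).symmL ℝ z (mfderiv I 𝓘(ℝ, E) (extChartAt I y) z v) = v := by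
  rw [← TangentBundle.continuousLinearMapAt_trivializationAt hz]
  exact (trivializationAt E (TangentSpace I) y).symmL_continuousLinearMapAt
    (by simpa using hz) v

/-- The canonical one-form in coordinates. -/
lemma canonicalForm_eq {p₀ p : Cot I Z} (hp : p.proj ∈ (chartAt H p₀.proj).source)
    (w : TangentSpace (cotModel I) p) :
    canonicalForm p w = (extChartAt (cotModel I) p₀ p).2
      (mfderiv (cotModel I) 𝓘(ℝ, E × (E →L[ℝ] ℝ)) (extChartAt (cotModel I) p₀) p w).1 := by
  have hs : p ∈ (chartAt (ModelProd H (E →L[ℝ] ℝ)) p₀).source := by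
    rw [← extChartAt_source (cotModel I), extChartAt_cot_source]; exact hp
  have h1 : MDifferentiableAt (cotModel I) 𝓘(ℝ, E × (E →L[ℝ] ℝ)) (extChartAt (cotModel I) p₀) p :=
    mdifferentiableAt_extChartAt hs
  have h2 : (mfderiv (cotModel I) 𝓘(ℝ, E × (E →L[ℝ] ℝ)) (extChartAt (cotModel I) p₀) p w).1 =
      mfderiv I 𝓘(ℝ, E) (extChartAt I p₀.proj) p.proj
        (mfderiv (cotModel I) I (fun q : Cot I Z => q.proj) p w) := by
    have ha : mfderiv (cotModel I) 𝓘(ℝ, E)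
        (fun q => (extChartAt (cotModel I) p₀ q).1) p w =
        (mfderiv (cotModel I) 𝓘(ℝ, E × (E →L[ℝ] ℝ)) (extChartAt (cotModel I) p₀) p w).1 := by
      have := mfderiv_comp (I := cotModel I) (I' := 𝓘(ℝ, E × (E →L[ℝ] ℝ))) (I'' := 𝓘(ℝ, E)) p
        (g := (Prod.fst : E × (E →L[ℝ] ℝ) → E)) (f := extChartAt (cotModel I) p₀)
        (differentiableAt_fst.mdifferentiableAt) h1
      change mfderiv (cotModel I) 𝓘(ℝ, E) (Prod.fst ∘ (extChartAt (cotModel I) p₀)) p w = _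
      rw [this, mfderiv_eq_fderiv, fderiv_fst]
      rfl
    rw [← ha]
    have hb : (fun q => (extChartAt (cotModel I) p₀ q).1) =
        (extChartAt I p₀.proj) ∘ (fun q : Cot I Z => q.proj) := by
      ext1 q; rw [extChartAt_cot]; rfl
    rw [hb, mfderiv_comp p (mdifferentiableAt_extChartAt hp)
      (contMDiff_proj.mdifferentiable (by simp) p)]
    rfl
  rw [h2, extChartAt_cot]
  exact (congrArg p.form (symmL_mfderiv_extChartAt hp
    (mfderiv (cotModel I) I (fun q : Cot I Z => q.proj) p w))).symm

lemma mfderiv_eq_fderiv_chart {EK : Type*} [NormedAddCommGroup EK] [NormedSpace ℝ EK]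
    {HK : Type*} [TopologicalSpace HK] {IK : ModelWithCorners ℝ EK HK} [IK.Boundaryless]
    {K : Type*} [TopologicalSpace K] [ChartedSpace HK K]
    {F : Type*} [NormedAddCommGroup F] [NormedSpace ℝ F] {f : K → F} {p : K}
    (hf : MDifferentiableAt IK 𝓘(ℝ, F) f p) :
    mfderiv IK 𝓘(ℝ, F) f p = fderiv ℝ (f ∘ (extChartAt IK p).symm) (extChartAt IK p p) := by
  rw [hf.mfderiv, IK.range_eq_univ, fderivWithin_univ]
  rfl

/-- A map that preserves the canonical one-form is symplectic. -/
lemma symplectic_of_preserves {Ψ : E × (E →L[ℝ] ℝ) → E × (E →L[ℝ] ℝ)} {x : E × (E →L[ℝ] ℝ)}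
    (hΨ : ContDiffAt ℝ 2 Ψ x)
    (h : ∀ᶠ x' in 𝓝 x, ∀ w, (Ψ x').2 (fderiv ℝ Ψ x' w).1 = x'.2 w.1) (w₁ w₂ : E × (E →L[ℝ] ℝ)) :
    (fderiv ℝ Ψ x w₁).2 (fderiv ℝ Ψ x w₂).1 - (fderiv ℝ Ψ x w₂).2 (fderiv ℝ Ψ x w₁).1 =
      w₁.2 w₂.1 - w₂.2 w₁.1 := by
  have hd : DifferentiableAt ℝ Ψ x := hΨ.differentiableAt (by simp)
  have hd2 : DifferentiableAt ℝ (fderiv ℝ Ψ) x :=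
    (hΨ.fderiv_right (m := 1) (by norm_num)).differentiableAt (by simp)
  -- Differentiating the preserved one-form in the direction `a` produces the symplectic term and a
  -- second derivative of `Ψ`. The latter is symmetric in `a` and `b`, so it drops out of the
  -- antisymmetric combination.
  have key : ∀ a b : E × (E →L[ℝ] ℝ), (fderiv ℝ Ψ x a).2 (fderiv ℝ Ψ x b).1 +
      (Ψ x).2 (fderiv ℝ (fderiv ℝ Ψ) x a b).1 = a.2 b.1 := by
    intro a b
    have h1 := (hd2.hasFDerivAt.clm_apply (hasFDerivAt_const b x)).fst
    have h2 : HasFDerivAt (fun x' => (Ψ x').2)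
        ((ContinuousLinearMap.snd ℝ E (E →L[ℝ] ℝ)).comp (fderiv ℝ Ψ x)) x :=
      (ContinuousLinearMap.snd ℝ E (E →L[ℝ] ℝ)).hasFDerivAt.comp x hd.hasFDerivAt
    have h3 := h2.clm_apply h1
    have h4 : HasFDerivAt (fun x' : E × (E →L[ℝ] ℝ) => x'.2 b.1)
        ((ContinuousLinearMap.apply ℝ ℝ b.1).comp (ContinuousLinearMap.snd ℝ E (E →L[ℝ] ℝ))) x :=
      ((ContinuousLinearMap.apply ℝ ℝ b.1).comp
        (ContinuousLinearMap.snd ℝ E (E →L[ℝ] ℝ))).hasFDerivAt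
    have h5 := h3.congr_of_eventuallyEq (f₁ := fun x' : E × (E →L[ℝ] ℝ) => x'.2 b.1)
      (by filter_upwards [h] with x' hx' using (hx' b).symm)
    have h6 := congrArg (fun L => L a) (h4.unique h5)
    simp only [ContinuousLinearMap.comp_apply, ContinuousLinearMap.apply_apply,
      ContinuousLinearMap.coe_snd', add_apply,
      ContinuousLinearMap.flip_apply, ContinuousLinearMap.coe_fst',
      ContinuousLinearMap.comp_zero, zero_add] at h6
    rw [h6]; ring
  have hsymm := (hΨ.isSymmSndFDerivAt (by simp)) w₁ w₂
  have k1 := key w₁ w₂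
  have k2 := key w₂ w₁
  rw [hsymm] at k1
  linarith

variable [FiniteDimensional ℝ E]

variable (E) in
/-- The identification of the double dual with the space. -/
def ofDoubleDual : ((E →L[ℝ] ℝ) →L[ℝ] ℝ) →L[ℝ] E :=
  LinearMap.toContinuousLinearMap
    (LinearEquiv.ofBijective ((NormedSpace.inclusionInDoubleDual ℝ E).toLinearMap)
      (by
        have hinj : Function.Injective (NormedSpace.inclusionInDoubleDual ℝ E).toLinearMap :=
          (NormedSpace.inclusionInDoubleDualLi (𝕜 := ℝ) (E := E)).injective
        refine ⟨hinj, ?_⟩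
        refine (LinearMap.injective_iff_surjective_of_finrank_eq_finrank ?_).1 hinj
        rw [← (LinearMap.toContinuousLinearMap (𝕜 := ℝ) (E := E →L[ℝ] ℝ) (F' := ℝ)).finrank_eq,
          Module.finrank_linearMap, Module.finrank_self, mul_one,
          ← (LinearMap.toContinuousLinearMap (𝕜 := ℝ) (E := E) (F' := ℝ)).finrank_eq,
          Module.finrank_linearMap, Module.finrank_self, mul_one])).symm.toLinearMap

lemma apply_ofDoubleDual (L : (E →L[ℝ] ℝ) →L[ℝ] ℝ) (ξ : E →L[ℝ] ℝ) :
    ξ (ofDoubleDual E L) = L ξ := by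
  have : NormedSpace.inclusionInDoubleDual ℝ E (ofDoubleDual E L) = L :=
    LinearEquiv.apply_symm_apply (LinearEquiv.ofBijective
      ((NormedSpace.inclusionInDoubleDual ℝ E).toLinearMap) _) L
  conv_rhs => rw [← this]
  rfl

variable (E) in
/-- The vector `(∂f/∂μ, -∂f/∂y)` of a differential. -/
def hamVec : (E × (E →L[ℝ] ℝ) →L[ℝ] ℝ) →L[ℝ] E × (E →L[ℝ] ℝ) :=
  ((ofDoubleDual E).comp
    ((ContinuousLinearMap.inr ℝ E (E →L[ℝ] ℝ)).precomp ℝ)).prod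
    ((-ContinuousLinearMap.inl ℝ E (E →L[ℝ] ℝ)).precomp ℝ)

lemma hamVec_spec (L : E × (E →L[ℝ] ℝ) →L[ℝ] ℝ) (w : E × (E →L[ℝ] ℝ)) :
    L w = w.2 (hamVec E L).1 - (hamVec E L).2 w.1 := by
  have h1 : w.2 (hamVec E L).1 = L (0, w.2) := apply_ofDoubleDual _ _
  have h2 : (hamVec E L).2 w.1 = -L (w.1, 0) := map_neg L (w.1, 0)
  rw [h1, h2, sub_neg_eq_add, ← map_add]
  simp

/-- Test with vectors of the fibre and with vectors of the base. Vector fields on the cotangent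
bundle are compared below through their symplectic pairings. -/
lemma symplectic_nondegenerate {a b : E × (E →L[ℝ] ℝ)}
    (h : ∀ w : E × (E →L[ℝ] ℝ), w.2 a.1 - a.2 w.1 = w.2 b.1 - b.2 w.1) : a = b := by
  refine Prod.ext ?_ ?_
  · have h1 : ∀ ξ : E →L[ℝ] ℝ, ξ a.1 = ξ b.1 := fun ξ => by simpa using h (0, ξ)
    by_contra hne
    obtain ⟨f, hf⟩ := SeparatingDual.exists_separating_of_ne (R := ℝ) hne
    exact hf (h1 f)
  · ext v
    simpa using h (v, 0)

variable [I.Boundaryless]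

/-- The Hamilton vector field in any of the coordinate systems of `T*Z`. -/
lemma mfderiv_extChartAt_hamiltonField {f : Cot I Z → ℝ}
    {V : ∀ p : Cot I Z, TangentSpace (cotModel I) p} (hV : IsHamiltonField f V)
    (hf : ContMDiff (cotModel I) 𝓘(ℝ, ℝ) ∞ f) {p₀ p : Cot I Z}
    (hp : p.proj ∈ (chartAt H p₀.proj).source) :
    mfderiv (cotModel I) 𝓘(ℝ, E × (E →L[ℝ] ℝ)) (extChartAt (cotModel I) p₀) p (V p) =
      hamVec E (fderiv ℝ (f ∘ (extChartAt (cotModel I) p₀).symm)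
        (extChartAt (cotModel I) p₀ p)) := by
  set κ := extChartAt (cotModel I) p₀ with hκ
  set κp := extChartAt (cotModel I) p with hκp
  have hs : p ∈ κ.source := by rw [hκ, extChartAt_cot_source]; exact hp
  have hs' : p ∈ (chartAt (ModelProd H (E →L[ℝ] ℝ)) p₀).source := by
    rw [← extChartAt_source (cotModel I)]; exact hs
  have hκd : MDifferentiableAt (cotModel I) 𝓘(ℝ, E × (E →L[ℝ] ℝ)) κ p :=
    mdifferentiableAt_extChartAt hs'
  -- `IsHamiltonField` speaks of the chart at the point `p` itself, whereas smoothness needs one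
  -- fixed chart. The transition map `Ψ` preserves the canonical one-form, hence is symplectic,
  -- hence carries the Hamilton vector in one chart to the one in the other.
  set Ψ : E × (E →L[ℝ] ℝ) → E × (E →L[ℝ] ℝ) := κ ∘ κp.symm with hΨ
  have hD : mfderiv (cotModel I) 𝓘(ℝ, E × (E →L[ℝ] ℝ)) κ p = fderiv ℝ Ψ (κp p) :=
    mfderiv_eq_fderiv_chart hκd
  have htp : κp.target ∈ 𝓝 (κp p) := extChartAt_target_mem_nhds p
  have hsymm : ContMDiffOn 𝓘(ℝ, E × (E →L[ℝ] ℝ)) (cotModel I) ∞ κp.symm κp.target :=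
    contMDiffOn_extChartAt_symm p
  have hsrc : κp.target ∩ κp.symm ⁻¹' κ.source ∈ 𝓝 (κp p) := by
    refine Filter.inter_mem htp ?_
    refine (continuousAt_extChartAt_symm p).preimage_mem_nhds ?_
    rw [extChartAt_to_inv]
    exact (isOpen_extChartAt_source p₀).mem_nhds hs
  have hopen : IsOpen κp.target := isOpen_extChartAt_target p
  have hΨd : ContDiffAt ℝ 2 Ψ (κp p) := by
    have h1 : ContMDiffAt 𝓘(ℝ, E × (E →L[ℝ] ℝ)) 𝓘(ℝ, E × (E →L[ℝ] ℝ)) ∞ Ψ (κp p) := by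
      refine ContMDiffAt.comp (I' := cotModel I) (κp p) ?_ (hsymm.contMDiffAt htp)
      rw [extChartAt_to_inv]
      exact contMDiffAt_extChartAt' hs'
    exact h1.contDiffAt.of_le ENat.LEInfty.out
  have hpres : ∀ᶠ x' in 𝓝 (κp p), ∀ w, (Ψ x').2 (fderiv ℝ Ψ x' w).1 = x'.2 w.1 := by
    filter_upwards [hsrc] with x' hx' w
    set q := κp.symm x' with hq
    have hqp : q ∈ κp.source := κp.map_target hx'.1
    have hqs : q ∈ κ.source := hx'.2
    have hqκ : MDifferentiableAt (cotModel I) 𝓘(ℝ, E × (E →L[ℝ] ℝ)) κ q :=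
      mdifferentiableAt_extChartAt (by rw [← extChartAt_source (cotModel I)]; exact hqs)
    have hqκp : MDifferentiableAt (cotModel I) 𝓘(ℝ, E × (E →L[ℝ] ℝ)) κp q :=
      mdifferentiableAt_extChartAt (by rw [← extChartAt_source (cotModel I)]; exact hqp)
    have hsd : MDifferentiableAt 𝓘(ℝ, E × (E →L[ℝ] ℝ)) (cotModel I) κp.symm x' :=
      (hsymm.contMDiffAt (hopen.mem_nhds hx'.1)).mdifferentiableAt (by simp)
    set w' := mfderiv 𝓘(ℝ, E × (E →L[ℝ] ℝ)) (cotModel I) κp.symm x' w with hw'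
    have e1 : mfderiv (cotModel I) 𝓘(ℝ, E × (E →L[ℝ] ℝ)) κ q w' = fderiv ℝ Ψ x' w := by
      have := mfderiv_comp x' (I' := cotModel I) hqκ hsd
      rw [← mfderiv_eq_fderiv, hΨ, this]
      rfl
    have e2 : mfderiv (cotModel I) 𝓘(ℝ, E × (E →L[ℝ] ℝ)) κp q w' = w := by
      have := mfderiv_comp x' (I' := cotModel I) hqκp hsd
      have h3 : mfderiv 𝓘(ℝ, E × (E →L[ℝ] ℝ)) 𝓘(ℝ, E × (E →L[ℝ] ℝ)) (κp ∘ κp.symm) x' =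
          ContinuousLinearMap.id ℝ _ := by
        rw [← mfderiv_id]
        refine Filter.EventuallyEq.mfderiv_eq ?_
        filter_upwards [hopen.mem_nhds hx'.1] with z hz using κp.right_inv hz
      rw [this] at h3
      exact congrArg (fun L => L w) h3
    have c1 := canonicalForm_eq (p₀ := p₀) (p := q)
      (by rw [hκ, extChartAt_cot_source] at hqs; exact hqs) w'
    have c2 := canonicalForm_eq (p₀ := p) (p := q)
      (by rw [hκp, extChartAt_cot_source] at hqp; exact hqp) w'
    rw [c1] at c2
    have c3 : (κ q).2 (fderiv ℝ Ψ x' w).1 = (κp q).2 w.1 := by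
      rw [← e1]; refine c2.trans ?_; rw [← hκp, e2]
    rw [hq, κp.right_inv hx'.1] at c3
    exact c3
  have hsymp := symplectic_of_preserves hΨd hpres
  have hsurj : Function.Surjective (fderiv ℝ Ψ (κp p)) := by
    rw [← hD]
    obtain ⟨e, he⟩ := isInvertible_mfderiv_extChartAt (I := cotModel I) hs
    rw [← he]
    exact e.surjective
  have hmf : mfderiv (cotModel I) 𝓘(ℝ, ℝ) f p =
      (fderiv ℝ (f ∘ κ.symm) (κ p)).comp (fderiv ℝ Ψ (κp p)) := by
    have hfd : MDifferentiableAt 𝓘(ℝ, E × (E →L[ℝ] ℝ)) 𝓘(ℝ, ℝ) (f ∘ κ.symm) (κ p) := by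
      refine MDifferentiableAt.comp (I' := cotModel I) (κ p)
        (hf.mdifferentiable (by simp) _) ?_
      exact ((contMDiffOn_extChartAt_symm (n := ∞) p₀).contMDiffAt
        ((isOpen_extChartAt_target p₀).mem_nhds (κ.map_source hs))).mdifferentiableAt (by simp)
    have h1 := mfderiv_comp p hfd hκd
    have h2 : (f ∘ κ.symm) ∘ κ =ᶠ[𝓝 p] f := by
      filter_upwards [(isOpen_extChartAt_source p₀).mem_nhds hs] with q hq
      simp only [Function.comp_apply]
      rw [κ.left_inv hq]
    rw [h2.mfderiv_eq, mfderiv_eq_fderiv, hD] at h1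
    exact h1
  rw [hD]
  refine symplectic_nondegenerate fun w => ?_
  obtain ⟨w', rfl⟩ := hsurj w
  rw [← hamVec_spec]
  have h1 := hV p w'.1 w'.2
  rw [hmf] at h1
  have h2 := hsymp w' (V p)
  exact h2.trans h1.symm

end Cotangent
end ScatGeom

namespace ScatGeom

section Cotangent

universe u

variable {E : Type u} [NormedAddCommGroup E] [NormedSpace ℝ E]
  {H : Type*} [TopologicalSpace H] {I : ModelWithCorners ℝ E H}
  {Z : Type*} [TopologicalSpace Z] [ChartedSpace H Z] [IsManifold I ∞ Z]
  {EK : Type*} [NormedAddCommGroup EK] [NormedSpace ℝ EK]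
  {HK : Type*} [TopologicalSpace HK] {IK : ModelWithCorners ℝ EK HK}
  {K : Type*} [TopologicalSpace K] [ChartedSpace HK K]

/-! ### Multiplication in the fibres -/

@[simp] lemma proj_scale (c : ℝ) (p : Cot I Z) : (p.scale c).proj = p.proj := rfl

@[simp] lemma form_scale (c : ℝ) (p : Cot I Z) : (p.scale c).form = c • p.form := rfl

@[simp] lemma proj_zero (z : Z) : (Cot.zero (I := I) z).proj = z := rfl

@[simp] lemma form_zero (z : Z) : (Cot.zero (I := I) z).form = 0 := rfl

lemma scale_scale (a b : ℝ) (p : Cot I Z) : (p.scale b).scale a = p.scale (a * b) :=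
  congrArg (Cot.of p.proj) (smul_smul a b p.form)

@[simp] lemma scale_one (p : Cot I Z) : p.scale 1 = p :=
  congrArg (Cot.of p.proj) (one_smul ℝ p.form)

lemma scale_zero (p : Cot I Z) : p.scale 0 = Cot.zero p.proj :=
  congrArg (Cot.of p.proj) (zero_smul ℝ p.form)

@[simp] lemma scale_zero_section (c : ℝ) (z : Z) :
    (Cot.zero (I := I) z).scale c = Cot.zero z :=
  congrArg (Cot.of z) (smul_zero c)

@[simp] lemma fibCoord_scale (y : Z) (c : ℝ) (p : Cot I Z) :
    fibCoord y (p.scale c) = c • fibCoord y p := rfl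

@[simp] lemma fibCoord_zero (y z : Z) : fibCoord y (Cot.zero (I := I) z) = 0 := rfl

lemma fibCoord_apply_mfderiv {y : Z} {p : Cot I Z} (hp : p.proj ∈ (chartAt H y).source)
    (v : TangentSpace I p.proj) :
    fibCoord y p (show E from mfderiv I 𝓘(ℝ, E) (extChartAt I y) p.proj v) = p.form v :=
  congrArg p.form (symmL_mfderiv_extChartAt hp v)

lemma eq_of_fibCoord {y : Z} {p q : Cot I Z} (hp : p.proj ∈ (chartAt H y).source)
    (hpq : p.proj = q.proj) (h : fibCoord y p = fibCoord y q) : p = q := by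
  have e1 : extChartAt (cotModel I) (Cot.zero (I := I) y) p =
      extChartAt (cotModel I) (Cot.zero (I := I) y) q := by
    rw [extChartAt_cot, extChartAt_cot]
    simp only [proj_zero]
    rw [hpq, h]
  refine (extChartAt (cotModel I) (Cot.zero (I := I) y)).injOn ?_ ?_ e1
  · rw [extChartAt_cot_source]; exact hp
  · rw [extChartAt_cot_source]; exact (hpq ▸ hp : q.proj ∈ _)

lemma eq_zero_of_fibCoord {y : Z} {p : Cot I Z} (hp : p.proj ∈ (chartAt H y).source)
    (h : fibCoord y p = 0) : p = Cot.zero p.proj :=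
  eq_of_fibCoord hp rfl h

lemma ContMDiffAt.cotScale {n : WithTop ℕ∞} {c : K → ℝ} {f : K → Cot I Z} {k : K}
    (hc : ContMDiffAt IK 𝓘(ℝ, ℝ) n c k) (hf : ContMDiffAt IK (cotModel I) n f k) :
    ContMDiffAt IK (cotModel I) n (fun k => (f k).scale (c k)) k := by
  rw [contMDiffAt_cot_iff] at hf ⊢
  exact ⟨hf.1, hc.smul hf.2⟩

lemma contMDiff_zeroSection : ContMDiff I (cotModel I) ∞ (fun z : Z => Cot.zero (I := I) z) := by
  intro z
  rw [contMDiffAt_cot_iff]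
  exact ⟨contMDiffAt_id, contMDiffAt_const (c := (0 : E →L[ℝ] ℝ))⟩

/-- Uniqueness of integral curves needs this. Covectors over different base points are separated in
`Z`, those over the same base point by their fibre coordinates. -/
instance [T2Space Z] : T2Space (Cot I Z) := by
  refine ⟨fun p q hpq => ?_⟩
  by_cases h : p.proj = q.proj
  · have hp : p.proj ∈ (chartAt H p.proj).source := mem_chart_source H p.proj
    have hne : fibCoord p.proj p ≠ fibCoord p.proj q := fun hc => hpq (eq_of_fibCoord hp h hc)
    obtain ⟨A, B, hA, hB, hpA, hqB, hAB⟩ := t2_separation hne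
    have hopen : IsOpen ((fun p : Cot I Z => p.proj) ⁻¹' (chartAt H p.proj).source) :=
      (chartAt H p.proj).open_source.preimage contMDiff_proj.continuous
    have hcont : ContinuousOn (fibCoord (I := I) p.proj)
        ((fun p : Cot I Z => p.proj) ⁻¹' (chartAt H p.proj).source) := fun p' hp' =>
      (contMDiffAt_fibCoord hp').continuousAt.continuousWithinAt
    refine ⟨_, _, hcont.isOpen_inter_preimage hopen hA, hcont.isOpen_inter_preimage hopen hB,
      ⟨hp, hpA⟩, ⟨(h ▸ hp : q.proj ∈ (chartAt H p.proj).source), hqB⟩, ?_⟩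
    exact (hAB.preimage _).mono inter_subset_right inter_subset_right
  · obtain ⟨A, B, hA, hB, hpA, hqB, hAB⟩ := t2_separation h
    exact ⟨_, _, hA.preimage contMDiff_proj.continuous, hB.preimage contMDiff_proj.continuous,
      hpA, hqB, hAB.preimage _⟩

/-! ### Curves in coordinates -/

variable [FiniteDimensional ℝ E] [I.Boundaryless]

/-! ### The Hamilton vector field -/

/-- The Hamilton vector field of a function. -/
def hamField (f : Cot I Z → ℝ) (p : Cot I Z) : TangentSpace (cotModel I) p :=
  hamVec E (mfderiv (cotModel I) 𝓘(ℝ, ℝ) f p)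

lemma isHamiltonField_hamField (f : Cot I Z → ℝ) : IsHamiltonField f (hamField f) :=
  fun p δy δμ => hamVec_spec (mfderiv (cotModel I) 𝓘(ℝ, ℝ) f p) (δy, δμ)

lemma IsHamiltonField.eq_hamField {f : Cot I Z → ℝ}
    {V : ∀ p : Cot I Z, TangentSpace (cotModel I) p} (hV : IsHamiltonField f V) :
    V = hamField f := by
  funext p
  refine symplectic_nondegenerate fun w => ?_
  exact (hV p w.1 w.2).symm.trans (isHamiltonField_hamField f p w.1 w.2)

lemma contDiffAt_comp_extChartAt_symm {f : Cot I Z → ℝ}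
    (hf : ContMDiff (cotModel I) 𝓘(ℝ, ℝ) ∞ f) {p₀ : Cot I Z} {x : E × (E →L[ℝ] ℝ)}
    (hx : x ∈ (extChartAt (cotModel I) p₀).target) :
    ContDiffAt ℝ ∞ (f ∘ (extChartAt (cotModel I) p₀).symm) x := by
  have h1 : ContMDiffAt 𝓘(ℝ, E × (E →L[ℝ] ℝ)) (cotModel I) ∞ (extChartAt (cotModel I) p₀).symm x :=
    (contMDiffOn_extChartAt_symm p₀).contMDiffAt ((isOpen_extChartAt_target p₀).mem_nhds hx)
  exact (hf.contMDiffAt.comp x h1).contDiffAt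

/-- In the fixed chart at `p₀` the field is the symplectic gradient of the function written in that
chart, by `mfderiv_extChartAt_hamiltonField`, and this depends smoothly on the point. -/
lemma contMDiff_hamField {f : Cot I Z → ℝ} (hf : ContMDiff (cotModel I) 𝓘(ℝ, ℝ) ∞ f) :
    ContMDiff (cotModel I) (cotModel I).tangent ∞
      (fun p => (⟨p, hamField f p⟩ : TangentBundle (cotModel I) (Cot I Z))) := by
  intro p₀
  refine contMDiffAt_totalSpace.2 ⟨contMDiffAt_id, ?_⟩
  set κ := extChartAt (cotModel I) p₀ with hκ
  have hs : p₀ ∈ κ.source := mem_extChartAt_source p₀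
  have h1 : ContDiffAt ℝ ∞ (fun x => hamVec E (fderiv ℝ (f ∘ κ.symm) x)) (κ p₀) :=
    ContDiffAt.comp (g := hamVec E) (f := fderiv ℝ (f ∘ κ.symm)) (κ p₀)
      (ContinuousLinearMap.contDiff _).contDiffAt
      ((contDiffAt_comp_extChartAt_symm hf (κ.map_source hs)).fderiv_right (m := ∞) (by simp))
  have h2 : ContMDiffAt (cotModel I) 𝓘(ℝ, E × (E →L[ℝ] ℝ)) ∞
      (fun p => hamVec E (fderiv ℝ (f ∘ κ.symm) (κ p))) p₀ :=
    h1.contMDiffAt.comp p₀ contMDiffAt_extChartAt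
  refine h2.congr_of_eventuallyEq ?_
  filter_upwards [(isOpen_extChartAt_source p₀).mem_nhds hs] with p hp
  have hp' : p ∈ (chartAt (ModelProd H (E →L[ℝ] ℝ)) p₀).source := by
    rw [← extChartAt_source (cotModel I)]; exact hp
  have h3 := mfderiv_extChartAt_hamiltonField (isHamiltonField_hamField f) hf (p₀ := p₀) (p := p)
    (by rw [extChartAt_cot_source] at hp; exact hp)
  have h4 := congrArg (fun A => A (hamField f p))
    (TangentBundle.continuousLinearMapAt_trivializationAt (I := cotModel I) hp')
  have h5 : p ∈ (trivializationAt (E × (E →L[ℝ] ℝ)) (TangentSpace (cotModel I)) p₀).baseSet := by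
    simpa using hp'
  have h6 := congrFun (Trivialization.coe_linearMapAt_of_mem (R := ℝ)
    (trivializationAt (E × (E →L[ℝ] ℝ)) (TangentSpace (cotModel I)) p₀) h5) (hamField f p)
  exact h6.symm.trans (h4.trans h3)

/-- Antisymmetry of the symplectic form. This is conservation of energy. -/
lemma mfderiv_hamField_self (f : Cot I Z → ℝ) (p : Cot I Z) :
    mfderiv (cotModel I) 𝓘(ℝ, ℝ) f p (hamField f p) = (0 : ℝ) := by
  have := hamVec_spec (mfderiv (cotModel I) 𝓘(ℝ, ℝ) f p) (hamField f p)
  exact this.trans (sub_self _)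

end Cotangent
end ScatGeom

namespace ScatGeom

section NormSq

universe u

variable {E : Type u} [NormedAddCommGroup E] [NormedSpace ℝ E] [FiniteDimensional ℝ E]
  {H : Type*} [TopologicalSpace H] {I : ModelWithCorners ℝ E H}
  {Z : Type*} [TopologicalSpace Z] [ChartedSpace H Z] [IsManifold I ∞ Z]

/-! ### The dual metric -/

/-- A positive definite bilinear form on a finite-dimensional space is invertible. -/
lemma isInvertible_of_pos {g : E →L[ℝ] E →L[ℝ] ℝ} (hg : ∀ v, v ≠ 0 → 0 < g v v) :
    g.IsInvertible := by
  have hinj : Function.Injective g := by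
    refine (injective_iff_map_eq_zero g).2 fun v hv => ?_
    by_contra hne
    have := hg v hne
    rw [hv] at this
    simp at this
  have hfr : Module.finrank ℝ E = Module.finrank ℝ (E →L[ℝ] ℝ) := by
    rw [← LinearEquiv.finrank_eq (LinearMap.toContinuousLinearMap (𝕜 := ℝ) (E := E) (F' := ℝ))]
    exact (Subspace.dual_finrank_eq (K := ℝ) (V := E)).symm
  refine ⟨(LinearEquiv.ofInjectiveOfFinrankEq (g : E →ₗ[ℝ] E →L[ℝ] ℝ) hinj
    hfr).toContinuousLinearEquiv, ?_⟩
  ext v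
  rfl

lemma apply_inverse_of_pos {g : E →L[ℝ] E →L[ℝ] ℝ} (hg : ∀ v, v ≠ 0 → 0 < g v v)
    (ξ : E →L[ℝ] ℝ) : g (g.inverse ξ) = ξ := by
  obtain ⟨e, he⟩ := isInvertible_of_pos hg
  rw [← he, ContinuousLinearMap.inverse_equiv]
  exact e.apply_symm_apply ξ

lemma inverse_apply_of_pos {g : E →L[ℝ] E →L[ℝ] ℝ} (hg : ∀ v, v ≠ 0 → 0 < g v v)
    (v : E) : g.inverse (g v) = v := by
  obtain ⟨e, he⟩ := isInvertible_of_pos hg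
  rw [← he, ContinuousLinearMap.inverse_equiv]
  exact e.symm_apply_apply v

/-- The Cauchy–Schwarz inequality. -/
lemma sq_apply_le_of_pos {g : E →L[ℝ] E →L[ℝ] ℝ} (hsymm : ∀ v w, g v w = g w v)
    (hg : ∀ v, v ≠ 0 → 0 < g v v) (v w : E) : (g v w) ^ 2 ≤ g v v * g w w := by
  have hnn : ∀ v, 0 ≤ g v v := fun v => by
    by_cases h : v = 0
    · simp [h]
    · exact (hg v h).le
  by_cases hw : w = 0
  · simp [hw]
  have hw' := hg w hw
  have := hnn (g w w • v - g v w • w)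
  simp only [map_sub, map_smul, sub_apply, smul_apply,
    smul_eq_mul, hsymm w v] at this
  have h2 : 0 ≤ g w w * (g v v * g w w - (g v w) ^ 2) := by nlinarith
  nlinarith [nonneg_of_mul_nonneg_right h2 hw']

variable (h : ContMDiffRiemannianMetric I ∞ E (fun z : Z => TangentSpace I z))

/-- The metric in the chart at `y`. -/
def metricCoord (y z : Z) : E →L[ℝ] E →L[ℝ] ℝ :=
  ContinuousLinearMap.inCoordinates E (TangentSpace I) (E →L[ℝ] ℝ)
    (fun z : Z => TangentSpace I z →L[ℝ] Bundle.Trivial Z ℝ z) y z y z (h.inner z)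

lemma contMDiffAt_metricCoord (y : Z) :
    ContMDiffAt I 𝓘(ℝ, E →L[ℝ] E →L[ℝ] ℝ) ∞ (metricCoord h y) y :=
  ((contMDiffAt_hom_bundle _).1 (h.contMDiff y)).2

lemma metricCoord_apply {y z : Z} (hz : z ∈ (chartAt H y).source) (v w : E) :
    metricCoord h y z v w = h.inner z ((trivializationAt E (TangentSpace I) y).symmL ℝ z v)
      ((trivializationAt E (TangentSpace I) y).symmL ℝ z w) := by
  have hz' : z ∈ (trivializationAt E (TangentSpace I) y).baseSet := by simpa using hz
  rw [metricCoord]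
  have := inCoordinates_apply_eq₂ (𝕜 := ℝ) (x₀ := y) (x := z)
    (F₁ := E) (F₂ := E) (F₃ := ℝ) (E₁ := (TangentSpace I : Z → Type _))
    (E₂ := (TangentSpace I : Z → Type _)) (E₃ := Bundle.Trivial Z ℝ)
    (ϕ := h.inner z) (v := v) (w := w) hz' hz' (Set.mem_univ _)
  rw [this]
  simp only [Bundle.Trivial.eq_trivialization, Bundle.Trivial.linearMapAt_trivialization,
    LinearMap.id_coe, id_eq]
  have e1 := fun u => (trivializationAt E (TangentSpace I) y).symmL_apply (R := ℝ) hz' u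
  exact congrArg₂ (fun a b => h.inner z a b) (e1 v).symm (e1 w).symm

lemma symmL_mfderiv_surjective {y z : Z} (hz : z ∈ (chartAt H y).source) (v : TangentSpace I z) :
    ∃ u : E, (trivializationAt E (TangentSpace I) y).symmL ℝ z u = v :=
  ⟨_, symmL_mfderiv_extChartAt hz v⟩

lemma metricCoord_pos {y z : Z} (hz : z ∈ (chartAt H y).source) (v : E) (hv : v ≠ 0) :
    0 < metricCoord h y z v v := by
  rw [metricCoord_apply h hz]
  refine h.pos z _ fun h0 => hv ?_
  have hz' : z ∈ (trivializationAt E (TangentSpace I) y).baseSet := by simpa using hz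
  have h1 := (trivializationAt E (TangentSpace I) y).continuousLinearMapAt_symmL (R := ℝ) hz' v
  rw [← h1, h0, map_zero]

lemma inner_inverse_form (p : Cot I Z) :
    h.inner p.proj ((h.inner p.proj).inverse p.form) = p.form :=
  apply_inverse_of_pos (E := E) (g := h.inner p.proj) (h.pos p.proj) p.form

lemma normSq_eq_of_inner {p : Cot I Z} {v : TangentSpace I p.proj}
    (hv : h.inner p.proj v = p.form) : normSq h p = h.inner p.proj v v := by
  have h1 : (h.inner p.proj).inverse p.form = v := by
    rw [← hv]
    exact inverse_apply_of_pos (E := E) (g := h.inner p.proj) (h.pos p.proj) v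
  rw [normSq, h1, hv]

lemma exists_inner_eq_form (p : Cot I Z) : ∃ v : TangentSpace I p.proj,
    h.inner p.proj v = p.form := ⟨_, inner_inverse_form h p⟩

lemma normSq_eq_fibCoord {y : Z} {p : Cot I Z} (hp : p.proj ∈ (chartAt H y).source) :
    normSq h p = fibCoord y p ((metricCoord h y p.proj).inverse (fibCoord y p)) := by
  obtain ⟨v, hv⟩ := exists_inner_eq_form h p
  obtain ⟨u, hu⟩ := symmL_mfderiv_surjective hp v
  have h1 : metricCoord h y p.proj u = fibCoord y p := by
    ext w
    rw [metricCoord_apply h hp, hu, hv]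
    rfl
  rw [normSq_eq_of_inner h hv, ← h1, inverse_apply_of_pos (metricCoord_pos h hp),
    metricCoord_apply h hp, hu]

lemma normSq_scale (c : ℝ) (p : Cot I Z) : normSq h (p.scale c) = c ^ 2 * normSq h p := by
  obtain ⟨v, hv⟩ := exists_inner_eq_form h p
  have h1 : h.inner (p.scale c).proj (c • v) = (p.scale c).form := by
    rw [form_scale, ← hv]; exact map_smul _ _ _
  rw [normSq_eq_of_inner h hv, normSq_eq_of_inner h h1]
  have h2 : h.inner p.proj (c • v) (c • v) = c ^ 2 * h.inner p.proj v v := by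
    rw [map_smul, map_smul, smul_apply, smul_eq_mul, smul_eq_mul]; ring
  exact h2

@[simp] lemma normSq_zero (z : Z) : normSq h (Cot.zero z) = 0 := by
  rw [normSq, form_zero]; rfl

lemma normSq_nonneg (p : Cot I Z) : 0 ≤ normSq h p := by
  obtain ⟨v, hv⟩ := exists_inner_eq_form h p
  rw [normSq_eq_of_inner h hv]
  by_cases h0 : v = 0
  · rw [h0, map_zero]
  · exact (h.pos _ v h0).le

lemma normSq_eq_zero {p : Cot I Z} : normSq h p = 0 ↔ p = Cot.zero p.proj := by
  refine ⟨fun h0 => ?_, fun h0 => by rw [h0, normSq_zero]⟩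
  obtain ⟨v, hv⟩ := exists_inner_eq_form h p
  rw [normSq_eq_of_inner h hv] at h0
  have hv0 : v = 0 := by
    by_contra hne
    exact (h.pos _ v hne).ne' h0
  have : p.form = 0 := by rw [← hv, hv0, map_zero]
  exact congrArg (Cot.of p.proj) this

lemma sq_fibCoord_apply_le {y : Z} {p : Cot I Z} (hp : p.proj ∈ (chartAt H y).source) (u : E) :
    (fibCoord y p u) ^ 2 ≤ normSq h p * metricCoord h y p.proj u u := by
  obtain ⟨v, hv⟩ := exists_inner_eq_form h p
  have h1 : fibCoord y p u = h.inner p.proj v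
      ((trivializationAt E (TangentSpace I) y).symmL ℝ p.proj u) := by rw [hv]; rfl
  rw [h1, normSq_eq_of_inner h hv, metricCoord_apply h hp]
  exact sq_apply_le_of_pos (E := E) (g := h.inner p.proj) (h.symm p.proj) (h.pos p.proj) _ _

/-- Cauchy–Schwarz for the metric. It turns a bound on the length of a covector into a bound on its
coordinates, with a constant that is locally uniform in the base point. -/
lemma norm_fibCoord_sq_le {y : Z} {p : Cot I Z} (hp : p.proj ∈ (chartAt H y).source) :
    ‖fibCoord y p‖ ^ 2 ≤ normSq h p * ‖metricCoord h y p.proj‖ := by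
  have hN := normSq_nonneg h p
  have h1 : ‖fibCoord y p‖ ≤ √(normSq h p * ‖metricCoord h y p.proj‖) := by
    refine ContinuousLinearMap.opNorm_le_bound _ (Real.sqrt_nonneg _) fun u => ?_
    rw [← Real.sqrt_sq (norm_nonneg u), ← Real.sqrt_mul (by positivity)]
    refine Real.le_sqrt_of_sq_le ?_
    rw [Real.norm_eq_abs, sq_abs]
    refine (sq_fibCoord_apply_le h hp u).trans ?_
    have := (Real.le_norm_self _).trans ((metricCoord h y p.proj).le_opNorm₂ u u)
    calc _ ≤ normSq h p * (‖metricCoord h y p.proj‖ * ‖u‖ * ‖u‖) :=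
          mul_le_mul_of_nonneg_left this hN
      _ = _ := by ring
  calc _ ≤ (√(normSq h p * ‖metricCoord h y p.proj‖)) ^ 2 := by gcongr
    _ = _ := Real.sq_sqrt (by positivity)

lemma contMDiff_normSq : ContMDiff (cotModel I) 𝓘(ℝ, ℝ) ∞ (normSq h) := by
  intro p₀
  have hs := mem_chart_source H p₀.proj
  have h1 : ContMDiffAt (cotModel I) 𝓘(ℝ, E →L[ℝ] E →L[ℝ] ℝ) ∞
      (fun p : Cot I Z => metricCoord h p₀.proj p.proj) p₀ :=
    ContMDiffAt.comp (g := metricCoord h p₀.proj) p₀ (contMDiffAt_metricCoord h p₀.proj)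
      contMDiff_proj.contMDiffAt
  have h2 : ContMDiffAt (cotModel I) 𝓘(ℝ, (E →L[ℝ] ℝ) →L[ℝ] E) ∞
      (fun p : Cot I Z => (metricCoord h p₀.proj p.proj).inverse) p₀ :=
    ContMDiffAt.comp (g := ContinuousLinearMap.inverse) p₀
      (ContDiffAt.contMDiffAt (𝕜 := ℝ)
        (isInvertible_of_pos (metricCoord_pos h hs)).contDiffAt_map_inverse) h1
  have h3 := contMDiffAt_fibCoord (I := I) hs
  refine (h3.clm_apply (h2.clm_apply h3)).congr_of_eventuallyEq ?_
  filter_upwards [((chartAt H p₀.proj).open_source.preimage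
    contMDiff_proj.continuous).mem_nhds hs] with p hp
  exact normSq_eq_fibCoord h hp

end NormSq
end ScatGeom

namespace ScatGeom

section GeodesicFlow

universe u

variable {E : Type u} [NormedAddCommGroup E] [NormedSpace ℝ E] [FiniteDimensional ℝ E]
  {H : Type*} [TopologicalSpace H] {I : ModelWithCorners ℝ E H} [I.Boundaryless]
  {Z : Type*} [TopologicalSpace Z] [ChartedSpace H Z] [IsManifold I ∞ Z]

/-! ### Homogeneity -/

variable (E) in
/-- Multiplication by `c` in the fibres, in coordinates. -/
def scaleL (c : ℝ) : E × (E →L[ℝ] ℝ) →L[ℝ] E × (E →L[ℝ] ℝ) :=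
  (ContinuousLinearMap.fst ℝ E (E →L[ℝ] ℝ)).prod (c • ContinuousLinearMap.snd ℝ E (E →L[ℝ] ℝ))

@[simp] lemma scaleL_apply (c : ℝ) (x : E × (E →L[ℝ] ℝ)) : scaleL E c x = (x.1, c • x.2) := rfl

lemma hasMFDerivAt_scale (c : ℝ) (p : Cot I Z) :
    HasMFDerivAt (cotModel I) (cotModel I) (Cot.scale c) p (scaleL E c) := by
  have hc : ContMDiffAt (cotModel I) (cotModel I) ∞ (Cot.scale c) p :=
    ContMDiffAt.cotScale (c := fun _ : Cot I Z => c) (f := fun p : Cot I Z => p)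
      contMDiffAt_const contMDiffAt_id
  refine ⟨hc.continuousAt, ?_⟩
  have h1 : HasFDerivAt (fun x => scaleL E c x) (scaleL E c) (extChartAt (cotModel I) p p) :=
    (scaleL E c).hasFDerivAt
  refine HasFDerivAt.hasFDerivWithinAt (h1.congr_of_eventuallyEq ?_)
  filter_upwards [(isOpen_extChartAt_target p).mem_nhds (mem_extChartAt_target p)] with x hx
  have h2 := (extChartAt (cotModel I) p).right_inv hx
  rw [extChartAt_cot] at h2
  rw [writtenInExtChartAt, Function.comp_apply, Function.comp_apply, extChartAt_cot]
  simp only [proj_scale, fibCoord_scale, scaleL_apply]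
  rw [Prod.ext_iff] at h2
  exact Prod.ext h2.1 (congrArg (c • ·) h2.2)

variable (h : ContMDiffRiemannianMetric I ∞ E (fun z : Z => TangentSpace I z))

/-- The generator of the geodesic flow. -/
def geoField : ∀ p : Cot I Z, TangentSpace (cotModel I) p := hamField (fun p => normSq h p / 2)

lemma contMDiff_energy :
    ContMDiff (cotModel I) 𝓘(ℝ, ℝ) ∞ (fun p : Cot I Z => normSq h p / 2) :=
  (contMDiff_normSq h).div_const 2

lemma mdifferentiableAt_energy (p : Cot I Z) :
    MDifferentiableAt (cotModel I) 𝓘(ℝ, ℝ) (fun p : Cot I Z => normSq h p / 2) p :=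
  (contMDiff_energy h).mdifferentiableAt (by simp)

lemma mdifferentiableAt_normSq (p : Cot I Z) :
    MDifferentiableAt (cotModel I) 𝓘(ℝ, ℝ) (normSq h) p :=
  (contMDiff_normSq h).mdifferentiableAt (by simp)

lemma contMDiff_geoField : ContMDiff (cotModel I) (cotModel I).tangent ∞
    (fun p => (⟨p, geoField h p⟩ : TangentBundle (cotModel I) (Cot I Z))) :=
  contMDiff_hamField (contMDiff_energy h)

/-- The energy is quadratic in the fibres, so scaling by `c` multiplies its differential by `c ^ 2`,
while the symplectic form picks up only one factor `c`. The remaining factor `c` says that a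
covector multiplied by `c` travels `c` times as fast. -/
lemma geoField_scale {c : ℝ} (hc : c ≠ 0) (p : Cot I Z) :
    (show E × (E →L[ℝ] ℝ) from geoField h (p.scale c)) =
      c • scaleL E c (show E × (E →L[ℝ] ℝ) from geoField h p) := by
  refine symplectic_nondegenerate fun w => ?_
  have h1 := isHamiltonField_hamField (fun p => normSq h p / 2) (p.scale c) w.1 w.2
  have h2 := isHamiltonField_hamField (fun p => normSq h p / 2) p w.1 (c⁻¹ • w.2)
  have h3 : HasMFDerivAt (cotModel I) 𝓘(ℝ, ℝ) (fun p => normSq h (p.scale c) / 2) p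
      ((mfderiv (cotModel I) 𝓘(ℝ, ℝ) (fun p => normSq h p / 2) (p.scale c)).comp (scaleL E c)) :=
    HasMFDerivAt.comp (g := fun p => normSq h p / 2) (f := Cot.scale c) p
      (mdifferentiableAt_energy h (p.scale c)).hasMFDerivAt (hasMFDerivAt_scale c p)
  have h4 : HasMFDerivAt (cotModel I) 𝓘(ℝ, ℝ) (fun p => normSq h (p.scale c) / 2) p
      ((c ^ 2) • (mfderiv (cotModel I) 𝓘(ℝ, ℝ) (fun p => normSq h p / 2) p)) := by
    have := (mdifferentiableAt_energy h p).hasMFDerivAt.const_smul (c ^ 2)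
    refine this.congr_of_eventuallyEq (Filter.Eventually.of_forall fun q => ?_)
    simp only [normSq_scale, Pi.smul_apply, smul_eq_mul]
    ring
  have h5 := congrArg (fun A => A (show E × (E →L[ℝ] ℝ) from (w.1, c⁻¹ • w.2)))
    (hasMFDerivAt_unique h3 h4)
  have h6 : scaleL E c (w.1, c⁻¹ • w.2) = w := by
    ext <;> simp [smul_smul, hc]
  have h7 : (mfderiv (cotModel I) 𝓘(ℝ, ℝ) (fun p => normSq h p / 2) (p.scale c))
      (show E × (E →L[ℝ] ℝ) from w) =
      (c ^ 2) * (show ℝ from (mfderiv (cotModel I) 𝓘(ℝ, ℝ) (fun p => normSq h p / 2) p)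
        (show E × (E →L[ℝ] ℝ) from (w.1, c⁻¹ • w.2))) := by
    refine Eq.trans ?_ h5
    exact congrArg (mfderiv (cotModel I) 𝓘(ℝ, ℝ) (fun p => normSq h p / 2) (p.scale c)) h6.symm
  refine h1.symm.trans (h7.trans ?_)
  refine (congrArg (fun a => c ^ 2 * a) h2).trans ?_
  change c ^ 2 * ((c⁻¹ • w.2) (show E × (E →L[ℝ] ℝ) from geoField h p).1 -
    (show E × (E →L[ℝ] ℝ) from geoField h p).2 w.1) = w.2 (c • (show E × (E →L[ℝ] ℝ) from
      geoField h p).1) - (c • c • (show E × (E →L[ℝ] ℝ) from geoField h p).2) w.1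
  simp only [smul_apply, smul_eq_mul, map_smul]
  field_simp

/-- Homogeneity with the factor 2 at a fixed point of the scaling: the base component equals twice
itself and the fibre component four times itself. -/
lemma geoField_zero (z : Z) : geoField h (Cot.zero z) = 0 := by
  have h1 := geoField_scale h (two_ne_zero) (Cot.zero (I := I) z)
  rw [scale_zero_section] at h1
  set v : E × (E →L[ℝ] ℝ) := geoField h (Cot.zero z)
  have h2 : v = (2 : ℝ) • scaleL E 2 v := h1
  rw [Prod.ext_iff] at h2
  obtain ⟨h3, h4⟩ := h2
  simp only [scaleL_apply, Prod.smul_fst, Prod.smul_snd, smul_smul] at h3 h4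
  have e1 : v.1 = 0 := by
    have : (1 : ℝ) • v.1 = 0 := by
      calc (1 : ℝ) • v.1 = (2 : ℝ) • v.1 - v.1 := by module
        _ = 0 := by rw [← h3, sub_self]
    simpa using this
  have e2 : v.2 = 0 := by
    have : (3 : ℝ) • v.2 = 0 := by
      calc (3 : ℝ) • v.2 = (2 * 2 : ℝ) • v.2 - v.2 := by module
        _ = 0 := by rw [← h4, sub_self]
    simpa using this
  exact Prod.ext e1 e2

lemma isMIntegralCurveOn_scale {γ : ℝ → Cot I Z} {s : Set ℝ}
    (hγ : IsMIntegralCurveOn γ (geoField h) s) {c : ℝ} (hc : c ≠ 0) :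
    IsMIntegralCurveOn (fun t => (γ (t * c)).scale c) (geoField h) {t | t * c ∈ s} := by
  intro t ht
  have h1 := hγ.comp_mul c t ht
  have h2 := (hasMFDerivAt_scale c (γ (t * c))).comp_hasMFDerivWithinAt t h1
  have h3 : (ContinuousLinearMap.smulRight (1 : ℝ →L[ℝ] ℝ)
      (show E × (E →L[ℝ] ℝ) from geoField h ((γ (t * c)).scale c))) =
      (scaleL E c).comp ((1 : ℝ →L[ℝ] ℝ).smulRight
        (c • (show E × (E →L[ℝ] ℝ) from geoField h (γ (t * c))))) := by
    have h4 : ∀ v : E × (E →L[ℝ] ℝ), (1 : ℝ →L[ℝ] ℝ).smulRight (c • scaleL E c v) =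
        (scaleL E c).comp ((1 : ℝ →L[ℝ] ℝ).smulRight (c • v)) := by
      intro v
      ext <;> simp
    rw [geoField_scale h hc]
    exact h4 _
  exact h3 ▸ h2

lemma eq_of_isMIntegralCurveOn {EK : Type*} [NormedAddCommGroup EK] [NormedSpace ℝ EK]
    {HK : Type*} [TopologicalSpace HK] {IK : ModelWithCorners ℝ EK HK}
    {K : Type*} [TopologicalSpace K] [ChartedSpace HK K] {V : ∀ k : K, TangentSpace IK k}
    {f : K → ℝ} (hf : ∀ k, MDifferentiableAt IK 𝓘(ℝ, ℝ) f k)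
    (hV : ∀ k, mfderiv IK 𝓘(ℝ, ℝ) f k (V k) = (0 : ℝ)) {γ : ℝ → K} {a b : ℝ}
    (hγ : IsMIntegralCurveOn γ V (Ioo a b)) {s t : ℝ} (hs : s ∈ Ioo a b) (ht : t ∈ Ioo a b) :
    f (γ s) = f (γ t) := by
  have hd : ∀ t ∈ Ioo a b, HasDerivAt (f ∘ γ) 0 t := by
    intro t ht
    have h1 := (hγ t ht).hasMFDerivAt (isOpen_Ioo.mem_nhds ht)
    have h2 := ((hf (γ t)).hasMFDerivAt.comp t h1).hasFDerivAt
    have e : ∀ x : ℝ, mfderiv IK 𝓘(ℝ, ℝ) f (γ t) (x • V (γ t)) = (0 : ℝ) := fun x =>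
      (map_smul _ x _).trans ((congrArg (fun a : ℝ => x • a) (hV _)).trans (smul_zero x))
    have h3 : HasFDerivAt (f ∘ γ) (0 : ℝ →L[ℝ] ℝ) t :=
      h2.congr_fderiv (ContinuousLinearMap.ext fun x => e x)
    simpa using h3.hasDerivAt
  exact isOpen_Ioo.is_const_of_deriv_eq_zero isPreconnected_Ioo
    (fun t ht => (hd t ht).differentiableAt.differentiableWithinAt)
    (fun t ht => (hd t ht).deriv) hs ht

lemma mfderiv_normSq_geoField (p : Cot I Z) :
    mfderiv (cotModel I) 𝓘(ℝ, ℝ) (normSq h) p (geoField h p) = (0 : ℝ) := by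
  have h1 := mfderiv_hamField_self (fun p : Cot I Z => normSq h p / 2) p
  have h2 : mfderiv (cotModel I) 𝓘(ℝ, ℝ) (normSq h) p =
      (2 : ℝ) • mfderiv (cotModel I) 𝓘(ℝ, ℝ) (fun p : Cot I Z => normSq h p / 2) p := by
    have := (mdifferentiableAt_energy h p).hasMFDerivAt.const_smul 2
    refine (this.congr_of_eventuallyEq (Filter.Eventually.of_forall fun q => ?_)).mfderiv
    simp only [Pi.smul_apply, smul_eq_mul]
    ring
  rw [h2]
  exact (congrArg (fun a => (2 : ℝ) * a) h1).trans (mul_zero 2)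

/-! ### Global existence -/

/-- In the chart at `y` the metric is bounded near `y`, so covectors of small length over a small
neighbourhood have small coordinates. -/
lemma exists_nhds_zeroSection {y : Z} {N : Set (Cot I Z)} (hN : N ∈ 𝓝 (Cot.zero (I := I) y)) :
    ∃ U ∈ 𝓝 y, ∃ δ > 0, ∀ p : Cot I Z, p.proj ∈ U → normSq h p < δ → p ∈ N := by
  set p₀ := Cot.zero (I := I) y
  set κ := extChartAt (cotModel I) p₀
  have h1 : κ.symm ⁻¹' N ∈ 𝓝 (κ p₀) := by
    refine (continuousAt_extChartAt_symm p₀).preimage_mem_nhds ?_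
    rwa [extChartAt_to_inv]
  have e : κ p₀ = (extChartAt I y y, (0 : E →L[ℝ] ℝ)) := extChartAt_cot p₀ p₀
  rw [e] at h1
  obtain ⟨A, hA, B, hB, hAB⟩ := mem_nhds_prod_iff.1 h1
  obtain ⟨r, hr, hrB⟩ := Metric.mem_nhds_iff.1 hB
  have hcont : ContinuousAt (metricCoord h y) y := (contMDiffAt_metricCoord h y).continuousAt
  have h2 : ∀ᶠ z in 𝓝 y, ‖metricCoord h y z‖ < ‖metricCoord h y y‖ + 1 := by
    have := Filter.Tendsto.norm (E := E →L[ℝ] E →L[ℝ] ℝ) hcont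
    exact this.eventually_lt tendsto_const_nhds (lt_add_one _)
  set C := ‖metricCoord h y y‖ + 1
  have hC : 0 < C := by positivity
  have h3 : ∀ᶠ z in 𝓝 y, z ∈ (chartAt H y).source :=
    (chartAt H y).open_source.mem_nhds (mem_chart_source H y)
  have h4 : ∀ᶠ z in 𝓝 y, extChartAt I y z ∈ A := (continuousAt_extChartAt y).eventually_mem hA
  refine ⟨_, (h2.and (h3.and h4)), r ^ 2 / C, by positivity, ?_⟩
  rintro p ⟨hp2, hp3, hp4⟩ hp
  have h5 : ‖fibCoord y p‖ ^ 2 < r ^ 2 := by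
    calc _ ≤ normSq h p * ‖metricCoord h y p.proj‖ := norm_fibCoord_sq_le h hp3
      _ ≤ normSq h p * C := mul_le_mul_of_nonneg_left hp2.le (normSq_nonneg h p)
      _ < r ^ 2 / C * C := mul_lt_mul_of_pos_right hp hC
      _ = r ^ 2 := by field_simp
  have h6 : fibCoord y p ∈ Metric.ball 0 r := by
    rw [mem_ball_zero_iff]
    exact lt_of_pow_lt_pow_left₀ 2 hr.le h5
  have h7 : κ p ∈ κ.symm ⁻¹' N := by
    have : κ p = (extChartAt I y p.proj, fibCoord y p) := extChartAt_cot p₀ p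
    rw [this]
    exact hAB ⟨hp4, hrB h6⟩
  have h8 : p ∈ κ.source := by rw [extChartAt_cot_source]; exact hp3
  rw [mem_preimage, κ.left_inv h8] at h7
  exact h7

/-- Local flows at the points of the zero section exist for a positive time on neighbourhoods that
contain all short covectors nearby; compactness of `Z` leaves finitely many of them. -/
lemma exists_uniform_time [CompactSpace Z] : ∃ δ > 0, ∃ ε > 0, ∀ p : Cot I Z, normSq h p < δ →
    ∃ γ : ℝ → Cot I Z, γ 0 = p ∧ IsMIntegralCurveOn γ (geoField h) (Ioo (-ε) ε) := by
  have key : ∃ δ > 0, ∃ ε > 0, ∀ p : Cot I Z, p.proj ∈ (univ : Set Z) → normSq h p < δ →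
      ∃ γ : ℝ → Cot I Z, γ 0 = p ∧ IsMIntegralCurveOn γ (geoField h) (Ioo (-ε) ε) := by
    refine isCompact_univ.induction_on (p := fun s => ∃ δ > 0, ∃ ε > 0, ∀ p : Cot I Z,
      p.proj ∈ s → normSq h p < δ →
      ∃ γ : ℝ → Cot I Z, γ 0 = p ∧ IsMIntegralCurveOn γ (geoField h) (Ioo (-ε) ε)) ?_ ?_ ?_ ?_
    · exact ⟨1, one_pos, 1, one_pos, fun p hp => absurd hp (notMem_empty _)⟩
    · rintro s t hst ⟨δ, hδ, ε, hε, H⟩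
      exact ⟨δ, hδ, ε, hε, fun p hp => H p (hst hp)⟩
    · rintro s t ⟨δ₁, hδ₁, ε₁, hε₁, H₁⟩ ⟨δ₂, hδ₂, ε₂, hε₂, H₂⟩
      refine ⟨min δ₁ δ₂, lt_min hδ₁ hδ₂, min ε₁ ε₂, lt_min hε₁ hε₂, fun p hp hp' => ?_⟩
      rcases hp with hp | hp
      · obtain ⟨γ, h0, hγ⟩ := H₁ p hp (hp'.trans_le (min_le_left _ _))
        exact ⟨γ, h0, hγ.mono (Ioo_subset_Ioo (neg_le_neg (min_le_left _ _)) (min_le_left _ _))⟩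
      · obtain ⟨γ, h0, hγ⟩ := H₂ p hp (hp'.trans_le (min_le_right _ _))
        exact ⟨γ, h0, hγ.mono (Ioo_subset_Ioo (neg_le_neg (min_le_right _ _)) (min_le_right _ _))⟩
    · intro y _
      obtain ⟨φ, -, ε, hε, N, hN, hφ⟩ := exists_local_flow one_ne_zero (contMDiff_geoField h)
        (Cot.zero (I := I) y)
      obtain ⟨U, hU, δ, hδ, H⟩ := exists_nhds_zeroSection h hN
      exact ⟨U, mem_nhdsWithin_of_mem_nhds hU, δ, hδ, ε, hε, fun p hp hp' =>
        ⟨fun t => φ (t, p), (hφ p (H p hp hp')).1, (hφ p (H p hp hp')).2⟩⟩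
  simpa using key

lemma IsMIntegralCurveOn.smul_of_const {V : ∀ p : Cot I Z, TangentSpace (cotModel I) p}
    {γ : ℝ → Cot I Z} {s : Set ℝ} {a : Cot I Z → ℝ} {c : ℝ} (hγ : IsMIntegralCurveOn γ V s)
    (hc : ∀ t ∈ s, a (γ t) = c) :
    IsMIntegralCurveOn (γ ∘ (· * c)) (fun p => a p • V p) {t | t * c ∈ s} := by
  intro t ht
  have h1 := hγ.comp_mul c t ht
  have e : a (γ (t * c)) = c := hc _ ht
  change HasMFDerivWithinAt 𝓘(ℝ, ℝ) (cotModel I) (γ ∘ (· * c)) {t | t * c ∈ s} t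
    ((1 : ℝ →L[ℝ] ℝ).smulRight (a (γ (t * c)) • V (γ (t * c))))
  rw [e]
  exact h1

/-- Long covectors move fast, so the generator itself has no uniform time of existence. The
generator divided by `√(1 + |p|²)` has one: by homogeneity every orbit is a rescaled orbit of a
short covector. So the divided field is complete, and because the length is conserved, its orbits
differ from those of the generator only by a constant change of speed. -/
theorem exists_isMIntegralCurve_geoField [CompactSpace Z] [T2Space Z] (p : Cot I Z) :
    ∃ γ : ℝ → Cot I Z, γ 0 = p ∧ IsMIntegralCurve γ (geoField h) := by
  obtain ⟨δ, hδ, ε, hε, hunif⟩ := exists_uniform_time h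
  set a : Cot I Z → ℝ := fun p => (√(1 + normSq h p))⁻¹ with ha
  have hpos : ∀ p : Cot I Z, 0 < 1 + normSq h p := fun p => by
    have := normSq_nonneg h p; linarith
  have hspos : ∀ p : Cot I Z, 0 < √(1 + normSq h p) := fun p => Real.sqrt_pos.2 (hpos p)
  have hasm : ContMDiff (cotModel I) 𝓘(ℝ, ℝ) ∞ a := by
    intro p
    have h1 : ContDiffAt ℝ ∞ (fun x : ℝ => (√(1 + x))⁻¹) (normSq h p) := by
      refine ContDiffAt.inv ?_ (hspos p).ne'
      exact ((contDiffAt_const.add contDiffAt_id).sqrt (hpos p).ne')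
    exact ContMDiffAt.comp (g := fun x : ℝ => (√(1 + x))⁻¹) p h1.contMDiffAt (contMDiff_normSq h p)
  have hWsm : ContMDiff (cotModel I) (cotModel I).tangent ∞
      (fun p => (⟨p, a p • geoField h p⟩ : TangentBundle (cotModel I) (Cot I Z))) :=
    ContMDiff.smul_section hasm (contMDiff_geoField h)
  have hWN : ∀ p : Cot I Z,
      mfderiv (cotModel I) 𝓘(ℝ, ℝ) (normSq h) p (a p • geoField h p) = (0 : ℝ) := by
    intro p
    have := (mfderiv (cotModel I) 𝓘(ℝ, ℝ) (normSq h) p).map_smul (a p) (geoField h p)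
    exact this.trans ((congrArg (fun b : ℝ => a p • b) (mfderiv_normSq_geoField h p)).trans
      (smul_zero (a p)))
  have hloc : ∀ p : Cot I Z, ∃ γ : ℝ → Cot I Z, γ 0 = p ∧
      IsMIntegralCurveOn γ (fun p => a p • geoField h p) (Ioo (-(√δ * ε)) (√δ * ε)) := by
    intro p
    -- This factor makes `p` shorter than the threshold `δ`. The orbit of the scaled covector lives
    -- for time `ε`; undoing the scaling gives time `c * ε` for the generator, and slowing down by
    -- `a p` gives `√δ * ε`, independently of `p`.
    set c := √δ * a p with hcdef
    have hc : 0 < c := mul_pos (Real.sqrt_pos.2 hδ) (inv_pos.2 (hspos p))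
    have hcN : normSq h (p.scale c) < δ := by
      rw [normSq_scale, hcdef, mul_pow, Real.sq_sqrt hδ.le, ha, inv_pow, Real.sq_sqrt (hpos p).le,
        mul_assoc]
      have : (1 + normSq h p)⁻¹ * normSq h p < 1 := by
        rw [inv_mul_lt_iff₀ (hpos p)]; linarith
      nlinarith
    obtain ⟨η, hη0, hη⟩ := hunif _ hcN
    have h1 := isMIntegralCurveOn_scale h hη (inv_ne_zero hc.ne')
    have h2 : {t | t * c⁻¹ ∈ Ioo (-ε) ε} = Ioo (-(c * ε)) (c * ε) := by
      ext t
      simp only [mem_ofPred_eq, mem_Ioo, ← div_eq_mul_inv]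
      rw [lt_div_iff₀ hc, div_lt_iff₀ hc]
      constructor <;> rintro ⟨_, _⟩ <;> constructor <;> linarith
    rw [h2] at h1
    set γ : ℝ → Cot I Z := fun t => (η (t * c⁻¹)).scale c⁻¹
    have hγ0 : γ 0 = p := by
      change (η (0 * c⁻¹)).scale c⁻¹ = p
      rw [zero_mul, hη0, scale_scale, inv_mul_cancel₀ hc.ne', scale_one]
    have hcε : 0 < c * ε := mul_pos hc hε
    have h3 : ∀ t ∈ Ioo (-(c * ε)) (c * ε), a (γ t) = a p := by
      intro t ht
      have := eq_of_isMIntegralCurveOn (mdifferentiableAt_normSq h) (mfderiv_normSq_geoField h) h1 ht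
        (t := 0) ⟨by linarith, hcε⟩
      rw [ha]
      simp only
      rw [this, hγ0]
    have h4 := IsMIntegralCurveOn.smul_of_const h1 h3
    refine ⟨_, ?_, h4.mono ?_⟩
    · simp [hγ0]
    · intro t ht
      have hap : 0 < a p := inv_pos.2 (hspos p)
      have : c * ε = √δ * ε * a p := by rw [hcdef]; ring
      rw [mem_ofPred_eq, this, mem_Ioo, ← neg_mul]
      exact ⟨mul_lt_mul_of_pos_right ht.1 hap, mul_lt_mul_of_pos_right ht.2 hap⟩
  obtain ⟨γ, hγ0, hγ⟩ := exists_isMIntegralCurve_of_isMIntegralCurveOn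
    (contMDiff_one_of_infty hWsm) (mul_pos (Real.sqrt_pos.2 hδ) hε) hloc p
  have hconst : ∀ t ∈ (univ : Set ℝ), (√(1 + normSq h (γ t))) = √(1 + normSq h p) := by
    intro t _
    have := eq_of_isMIntegralCurveOn (mdifferentiableAt_normSq h) hWN
      (hγ.isMIntegralCurveOn (Ioo (-|t| - 1) (|t| + 1))) (s := t) (t := 0)
      ⟨by linarith [neg_abs_le t], by linarith [le_abs_self t]⟩
      ⟨by linarith [abs_nonneg t], by linarith [abs_nonneg t]⟩
    rw [this, hγ0]
  have h5 := IsMIntegralCurveOn.smul_of_const (a := fun p => √(1 + normSq h p))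
    (hγ.isMIntegralCurveOn univ) hconst
  refine ⟨γ ∘ (· * √(1 + normSq h p)), by simpa using hγ0, isMIntegralCurve_iff_isMIntegralCurveOn.2 ?_⟩
  · have h6 : (fun p : Cot I Z => √(1 + normSq h p) • (a p • geoField h p)) = geoField h := by
      funext p
      rw [ha, smul_smul, mul_inv_cancel₀ (hspos p).ne', one_smul]
    rw [h6] at h5
    simpa using h5

/-! ### The geodesic flow -/

variable [CompactSpace Z] [T2Space Z]

/-- The geodesic flow. -/
def geoFlow (t : ℝ) (p : Cot I Z) : Cot I Z :=
  (exists_isMIntegralCurve_geoField h p).choose t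

@[simp] lemma geoFlow_zero_time (p : Cot I Z) : geoFlow h 0 p = p :=
  (exists_isMIntegralCurve_geoField h p).choose_spec.1

lemma isMIntegralCurve_geoFlow (p : Cot I Z) :
    IsMIntegralCurve (fun t => geoFlow h t p) (geoField h) :=
  (exists_isMIntegralCurve_geoField h p).choose_spec.2

lemma eq_geoFlow {γ : ℝ → Cot I Z} (hγ : IsMIntegralCurve γ (geoField h)) (t : ℝ) :
    γ t = geoFlow h t (γ 0) :=
  congrFun (isMIntegralCurve_Ioo_eq_of_contMDiff_boundaryless (t₀ := 0)
    (contMDiff_one_of_infty (contMDiff_geoField h)) hγ (isMIntegralCurve_geoFlow h (γ 0))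
    (by simp)) t

lemma geoFlow_add (s t : ℝ) (p : Cot I Z) :
    geoFlow h (s + t) p = geoFlow h s (geoFlow h t p) :=
  flow_add (contMDiff_geoField h) (geoFlow_zero_time h) (isMIntegralCurve_geoFlow h) s t p

lemma geoFlow_neg_geoFlow (t : ℝ) (p : Cot I Z) : geoFlow h (-t) (geoFlow h t p) = p := by
  rw [← geoFlow_add, neg_add_cancel, geoFlow_zero_time]

lemma contMDiff_geoFlow : ContMDiff (𝓘(ℝ, ℝ).prod (cotModel I)) (cotModel I) ∞
    (fun z : ℝ × Cot I Z => geoFlow h z.1 z.2) :=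
  contMDiff_flow (contMDiff_geoField h) (geoFlow_zero_time h) (isMIntegralCurve_geoFlow h)

@[simp] lemma normSq_geoFlow (t : ℝ) (p : Cot I Z) : normSq h (geoFlow h t p) = normSq h p := by
  have := eq_of_isMIntegralCurveOn (mdifferentiableAt_normSq h) (mfderiv_normSq_geoField h)
      ((isMIntegralCurve_geoFlow h p).isMIntegralCurveOn (Ioo (-|t| - 1) (|t| + 1)))
      (s := t) (t := 0)
      ⟨by linarith [neg_abs_le t], by linarith [le_abs_self t]⟩
      ⟨by linarith [abs_nonneg t], by linarith [abs_nonneg t]⟩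
  rwa [geoFlow_zero_time] at this

@[simp] lemma geoFlow_zero (t : ℝ) (z : Z) : geoFlow h t (Cot.zero z) = Cot.zero z :=
  (eq_geoFlow h (isMIntegralCurve_const (geoField_zero h z)) t).symm

/-- Both sides are orbits with the same initial point. The factor 0 is separate because
`isMIntegralCurveOn_scale` needs an invertible scaling; there the orbit rests on the zero section.
-/
lemma geoFlow_scale (t c : ℝ) (p : Cot I Z) :
    geoFlow h t (p.scale c) = (geoFlow h (t * c) p).scale c := by
  by_cases hc : c = 0
  · rw [hc, scale_zero, scale_zero, geoFlow_zero, mul_zero, geoFlow_zero_time]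
  · have h1 := isMIntegralCurveOn_scale h
      ((isMIntegralCurve_geoFlow h p).isMIntegralCurveOn univ) hc
    have h2 : IsMIntegralCurve (fun t => (geoFlow h (t * c) p).scale c) (geoField h) :=
      isMIntegralCurve_iff_isMIntegralCurveOn.2 (by simpa using h1)
    have := eq_geoFlow h h2 t
    simp only [zero_mul, geoFlow_zero_time] at this
    exact this.symm

lemma isGeodesicOrbit_geoFlow (p : Cot I Z) : IsGeodesicOrbit h (fun t => geoFlow h t p) :=
  ⟨geoField h, isHamiltonField_hamField _, isMIntegralCurve_geoFlow h p⟩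

lemma IsGeodesicOrbit.eq_geoFlow {γ : ℝ → Cot I Z} (hγ : IsGeodesicOrbit h γ) (t : ℝ) :
    γ t = geoFlow h t (γ 0) := by
  obtain ⟨V, hV, hγ⟩ := hγ
  rw [hV.eq_hamField] at hγ
  exact ScatGeom.eq_geoFlow h hγ t

end GeodesicFlow
end ScatGeom

namespace ScatGeom

section Pullback

universe u

variable {E : Type u} [NormedAddCommGroup E] [NormedSpace ℝ E] [FiniteDimensional ℝ E]
  {H : Type*} [TopologicalSpace H] {I : ModelWithCorners ℝ E H} [I.Boundaryless]
  {Z : Type*} [TopologicalSpace Z] [ChartedSpace H Z] [IsManifold I ∞ Z]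
  (h : ContMDiffRiemannianMetric I ∞ E (fun z : Z => TangentSpace I z))

/-! ### The canonical one-form and the geodesic flow -/

lemma extChartAt_symm_scale {p₀ : Cot I Z} {x : E × (E →L[ℝ] ℝ)}
    (hx : x ∈ (extChartAt (cotModel I) p₀).target) (c : ℝ) :
    (extChartAt (cotModel I) p₀).symm (x.1, c • x.2) =
      ((extChartAt (cotModel I) p₀).symm x).scale c := by
  set κ := extChartAt (cotModel I) p₀ with hκ
  have hs : κ.symm x ∈ κ.source := κ.map_target hx
  have hs' : (κ.symm x).scale c ∈ κ.source := by
    rw [hκ, extChartAt_cot_source] at hs ⊢; exact hs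
  have h1 : κ ((κ.symm x).scale c) = (x.1, c • x.2) := by
    have h2 := κ.right_inv hx
    rw [hκ, extChartAt_cot, Prod.ext_iff] at h2
    rw [hκ, extChartAt_cot]
    exact Prod.ext h2.1 (congrArg (c • ·) h2.2)
  rw [← h1, κ.left_inv hs']

/-- Euler's identity. -/
lemma fderiv_energy_radial {p₀ : Cot I Z} {x : E × (E →L[ℝ] ℝ)}
    (hx : x ∈ (extChartAt (cotModel I) p₀).target) :
    fderiv ℝ ((fun p => normSq h p / 2) ∘ (extChartAt (cotModel I) p₀).symm) x (0, x.2) =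
      normSq h ((extChartAt (cotModel I) p₀).symm x) := by
  set f := (fun p => normSq h p / 2) ∘ (extChartAt (cotModel I) p₀).symm
  have h1 : HasFDerivAt f (fderiv ℝ f x) ((x.1, (1 : ℝ) • x.2)) := by
    rw [one_smul]
    exact ((contDiffAt_comp_extChartAt_symm (contMDiff_energy h) hx).differentiableAt
      (by simp)).hasFDerivAt
  have h2 : HasDerivAt (fun c : ℝ => (x.1, c • x.2)) ((0 : E), x.2) 1 := by
    have := (hasDerivAt_const (1 : ℝ) x.1).prodMk ((hasDerivAt_id (1 : ℝ)).smul_const x.2)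
    simpa using this
  have h3 := HasFDerivAt.comp_hasDerivAt_of_eq (1 : ℝ) h1 h2 rfl
  have h4 : HasDerivAt (fun c : ℝ => c ^ 2 * (normSq h ((extChartAt (cotModel I) p₀).symm x) / 2))
      (normSq h ((extChartAt (cotModel I) p₀).symm x)) 1 := by
    have := (hasDerivAt_pow 2 (1 : ℝ)).mul_const
      (normSq h ((extChartAt (cotModel I) p₀).symm x) / 2)
    exact this.congr_deriv (by push_cast; ring)
  refine h3.unique (h4.congr_of_eventuallyEq (Filter.Eventually.of_forall fun c => ?_))
  simp only [f, Function.comp_apply, extChartAt_symm_scale hx, normSq_scale]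
  ring

/-- The base component of the generator is the fibre derivative of the energy, so this is Euler's
identity for a function homogeneous of degree two. -/
lemma canonicalForm_geoField (p : Cot I Z) : canonicalForm p (geoField h p) = normSq h p := by
  have hs : p.proj ∈ (chartAt H p.proj).source := mem_chart_source H p.proj
  have ht := mem_extChartAt_target (I := cotModel I) p
  have h1 := canonicalForm_eq hs (geoField h p)
  have h2 := mfderiv_extChartAt_hamiltonField
    (isHamiltonField_hamField (fun p : Cot I Z => normSq h p / 2)) (contMDiff_energy h) hs
  have h3 := fderiv_energy_radial h ht
  rw [hamVec_spec, extChartAt_to_inv] at h3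
  simp only [map_zero, sub_zero] at h3
  refine h1.trans (Eq.trans ?_ h3)
  exact congrArg (fun v : E × (E →L[ℝ] ℝ) => (extChartAt (cotModel I) p p).2 v.1) h2

/-- Mixed second derivatives. -/
lemma hasDerivAt_fderiv_apply {W W' : Type*} [NormedAddCommGroup W] [NormedSpace ℝ W]
    [NormedAddCommGroup W'] [NormedSpace ℝ W'] {G : ℝ × W → W'} {x₀ : W}
    (hG : ContDiffAt ℝ ∞ G (0, x₀)) (u : W) :
    HasDerivAt (fun t => fderiv ℝ G (t, x₀) (0, u))
      (fderiv ℝ (fun x => fderiv ℝ G (0, x) (1, 0)) x₀ u) 0 := by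
  have hG1 : HasFDerivAt (fderiv ℝ G) (fderiv ℝ (fderiv ℝ G) (0, x₀)) (0, x₀) :=
    ((hG.fderiv_right (m := ∞) (by simp)).differentiableAt (by simp)).hasFDerivAt
  have hap : ∀ w : ℝ × W, HasFDerivAt (fun z => fderiv ℝ G z w)
      ((fderiv ℝ (fderiv ℝ G) (0, x₀)).flip w) (0, x₀) := fun w => by
    simpa using hG1.clm_apply (hasFDerivAt_const w (0, x₀))
  have hline : HasDerivAt (fun t : ℝ => (t, x₀)) ((1 : ℝ), (0 : W)) 0 :=
    (hasDerivAt_id (0 : ℝ)).prodMk (hasDerivAt_const _ _)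
  have hinr : HasFDerivAt (fun x : W => ((0 : ℝ), x)) (ContinuousLinearMap.inr ℝ ℝ W) x₀ :=
    hasFDerivAt_prodMk_right 0 x₀
  have h1 := HasFDerivAt.comp_hasDerivAt_of_eq (0 : ℝ) (hap (0, u)) hline rfl
  have h2 := HasFDerivAt.comp x₀ (hap (1, 0)) hinr
  refine h1.congr_deriv ?_
  have h3 : fderiv ℝ (fun x => fderiv ℝ G (0, x) (1, 0)) x₀ = _ := h2.fderiv
  rw [h3]
  exact (hG.isSymmSndFDerivAt (by simpa using ENat.LEInfty.out)) _ _

/-- If `G t` is a flow in coordinates whose generator is the Hamilton vector field of a function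
`f` that is homogeneous of degree two, the derivative of the pull-back of the canonical form is
`df`. -/
lemma hasDerivAt_pullback_of_euler {G : ℝ × (E × (E →L[ℝ] ℝ)) → E × (E →L[ℝ] ℝ)}
    {f : E × (E →L[ℝ] ℝ) → ℝ} {x₀ : E × (E →L[ℝ] ℝ)} (hG : ContDiffAt ℝ ∞ G (0, x₀))
    (hG0 : ∀ᶠ x in 𝓝 x₀, G (0, x) = x)
    (hGV : ∀ᶠ x in 𝓝 x₀, fderiv ℝ G (0, x) (1, 0) = hamVec E (fderiv ℝ f x))
    (hf : ContDiffAt ℝ ∞ f x₀) (heuler : ∀ᶠ x in 𝓝 x₀, fderiv ℝ f x (0, x.2) = 2 * f x)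
    (u : E × (E →L[ℝ] ℝ)) :
    HasDerivAt (fun t => (G (t, x₀)).2 (fderiv ℝ G (t, x₀) (0, u)).1) (fderiv ℝ f x₀ u) 0 := by
  set V : E × (E →L[ℝ] ℝ) → E × (E →L[ℝ] ℝ) := fun x => hamVec E (fderiv ℝ f x) with hV
  have hVs : ContDiffAt ℝ ∞ V x₀ :=
    ContDiffAt.comp (g := hamVec E) (f := fderiv ℝ f) x₀ (ContinuousLinearMap.contDiff _).contDiffAt
      (hf.fderiv_right (m := ∞) (by simp))
  have hVd : HasFDerivAt V (fderiv ℝ V x₀) x₀ := (hVs.differentiableAt (by simp)).hasFDerivAt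
  have hline : HasDerivAt (fun t : ℝ => (t, x₀)) ((1 : ℝ), (0 : E × (E →L[ℝ] ℝ))) 0 :=
    (hasDerivAt_id (0 : ℝ)).prodMk (hasDerivAt_const _ _)
  have hinr : HasFDerivAt (fun x : E × (E →L[ℝ] ℝ) => ((0 : ℝ), x))
      (ContinuousLinearMap.inr ℝ ℝ (E × (E →L[ℝ] ℝ))) x₀ := hasFDerivAt_prodMk_right 0 x₀
  have hGd : HasFDerivAt G (fderiv ℝ G (0, x₀)) (0, x₀) :=
    (hG.differentiableAt (by simp)).hasFDerivAt
  have hd1 : HasDerivAt (fun t => (G (t, x₀)).2) (V x₀).2 0 := by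
    have := HasFDerivAt.comp_hasDerivAt_of_eq (0 : ℝ) hGd hline rfl
    rw [hGV.self_of_nhds] at this
    exact this.snd
  have hd2 : HasDerivAt (fun t => (fderiv ℝ G (t, x₀) (0, u)).1) (fderiv ℝ V x₀ u).1 0 := by
    have h1 := hasDerivAt_fderiv_apply hG u
    rw [Filter.EventuallyEq.fderiv_eq hGV] at h1
    exact h1.fst
  have hd := hd1.clm_apply hd2
  have hw1 : (fderiv ℝ G (0, x₀) (0, u)) = u := by
    have h6 := HasFDerivAt.comp x₀ hGd hinr
    exact congrArg (fun A => A u) (h6.unique ((hasFDerivAt_id x₀).congr_of_eventuallyEq hG0))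
  rw [hw1, hG0.self_of_nhds] at hd
  have heuler' : (fun x : E × (E →L[ℝ] ℝ) => x.2 (V x).1) =ᶠ[𝓝 x₀] fun x => 2 * f x := by
    filter_upwards [heuler] with x hx
    rw [hamVec_spec] at hx
    simpa using hx
  have he1 := (hasFDerivAt_snd (𝕜 := ℝ) (p := x₀)).clm_apply hVd.fst
  have he2 := (hf.differentiableAt (by simp)).hasFDerivAt.const_mul 2
  -- Differentiating Euler's identity `μ(V₁) = 2f` relates `μ(dV₁(u))` to `df(u)`. Combined with
  -- `df(u) = u₂(V₁) - V₂(u₁)` it shows that the derivative found in `hd`, namely `V₂(u₁) +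
  -- μ(dV₁(u))`, is `df(u)`.
  have he3 : x₀.2 (fderiv ℝ V x₀ u).1 + u.2 (V x₀).1 = 2 * fderiv ℝ f x₀ u :=
    congrArg (fun A => A u) (he1.unique (he2.congr_of_eventuallyEq heuler'))
  have he4 : fderiv ℝ f x₀ u = u.2 (V x₀).1 - (V x₀).2 u.1 := hamVec_spec (fderiv ℝ f x₀) u
  exact hd.congr_deriv (by linarith)

variable {EK : Type*} [NormedAddCommGroup EK] [NormedSpace ℝ EK]
  {HK : Type*} [TopologicalSpace HK] {IK : ModelWithCorners ℝ EK HK}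
  {K : Type*} [TopologicalSpace K] [ChartedSpace HK K]

variable (IK) in
/-- The pull-back of the canonical one-form by a map to the cotangent bundle. -/
def pullForm (f : K → Cot I Z) (k : K) (v : TangentSpace IK k) : ℝ :=
  canonicalForm (f k) (mfderiv IK (cotModel I) f k v)

lemma pullForm_eq {f : K → Cot I Z} {k : K} (hf : MDifferentiableAt IK (cotModel I) f k)
    (v : TangentSpace IK k) :
    pullForm IK f k v = (f k).form (mfderiv IK I (fun k => (f k).proj) k v) := by
  have h1 := mfderiv_comp (g := fun p : Cot I Z => p.proj) (I'' := I) k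
    (contMDiff_proj.mdifferentiableAt (by simp)) hf
  exact (congrArg (fun A => (f k).form (A v)) h1).symm

/-- The canonical one-form sees a tangent vector only through its projection to the base, which the
scaling leaves alone even when the factor varies. -/
lemma pullForm_scale {f : K → Cot I Z} {c : K → ℝ} {k : K}
    (hf : MDifferentiableAt IK (cotModel I) f k)
    (hfc : MDifferentiableAt IK (cotModel I) (fun k => (f k).scale (c k)) k)
    (v : TangentSpace IK k) :
    pullForm IK (fun k => (f k).scale (c k)) k v = c k * pullForm IK f k v := by
  rw [pullForm_eq hf, pullForm_eq hfc]
  rfl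

variable [CompactSpace Z] [T2Space Z]

lemma contMDiff_geoFlow_time (t : ℝ) : ContMDiff (cotModel I) (cotModel I) ∞ (geoFlow h t) :=
  (contMDiff_geoFlow h).comp (contMDiff_const.prodMk contMDiff_id : ContMDiff (cotModel I)
    (𝓘(ℝ, ℝ).prod (cotModel I)) ∞ (fun p : Cot I Z => (t, p)))

lemma mdifferentiableAt_geoFlow (t : ℝ) (p : Cot I Z) :
    MDifferentiableAt (cotModel I) (cotModel I) (geoFlow h t) p :=
  (contMDiff_geoFlow_time h t).mdifferentiableAt (by simp)

/-- This is Cartan's formula for the Lie derivative of the canonical form: the value on the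
generator is twice the energy, and contraction of the exterior derivative contributes minus the
differential of the energy. It is carried out in the chart at `p`, where
`hasDerivAt_pullback_of_euler` applies. -/
lemma hasDerivAt_canonicalForm_geoFlow_zero (p : Cot I Z) (w : TangentSpace (cotModel I) p) :
    HasDerivAt (fun t => canonicalForm (geoFlow h t p)
      (mfderiv (cotModel I) (cotModel I) (geoFlow h t) p w))
      (show ℝ from mfderiv (cotModel I) 𝓘(ℝ, ℝ) (fun p => normSq h p / 2) p w) 0 := by
  set κ := extChartAt (cotModel I) p with hκ
  set x₀ := κ p with hx₀
  set f : E × (E →L[ℝ] ℝ) → ℝ := (fun p => normSq h p / 2) ∘ κ.symm with hf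
  set V : E × (E →L[ℝ] ℝ) → E × (E →L[ℝ] ℝ) := fun x => hamVec E (fderiv ℝ f x) with hV
  set u : E × (E →L[ℝ] ℝ) := w with hu
  have hT : κ.target ∈ 𝓝 x₀ := extChartAt_target_mem_nhds p
  have hx₀T : x₀ ∈ κ.target := mem_extChartAt_target p
  have hsymm : κ.symm x₀ = p := extChartAt_to_inv p
  set G : ℝ × (E × (E →L[ℝ] ℝ)) → E × (E →L[ℝ] ℝ) := fun z => κ (geoFlow h z.1 (κ.symm z.2)) with hG
  have hGs : ∀ z : ℝ × (E × (E →L[ℝ] ℝ)), z.2 ∈ κ.target → geoFlow h z.1 (κ.symm z.2) ∈ κ.source →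
      ContDiffAt ℝ ∞ G z := by
    intro z hz hz'
    have h1 : ContMDiffAt 𝓘(ℝ, E × (E →L[ℝ] ℝ)) (cotModel I) ∞ κ.symm z.2 :=
      (contMDiffOn_extChartAt_symm p).contMDiffAt ((isOpen_extChartAt_target p).mem_nhds hz)
    have h2 : ContMDiffAt 𝓘(ℝ, ℝ × (E × (E →L[ℝ] ℝ))) (cotModel I) ∞
        (fun z : ℝ × (E × (E →L[ℝ] ℝ)) => κ.symm z.2) z :=
      ContMDiffAt.comp (g := κ.symm) z h1 contDiff_snd.contMDiff.contMDiffAt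
    have h3 : ContMDiffAt 𝓘(ℝ, ℝ × (E × (E →L[ℝ] ℝ))) (cotModel I) ∞
        (fun z : ℝ × (E × (E →L[ℝ] ℝ)) => geoFlow h z.1 (κ.symm z.2)) z :=
      ContMDiffAt.comp (g := fun z : ℝ × Cot I Z => geoFlow h z.1 z.2) z
        (contMDiff_geoFlow h _) (contDiff_fst.contMDiff.contMDiffAt.prodMk h2)
    have h4 : ContMDiffAt (cotModel I) 𝓘(ℝ, E × (E →L[ℝ] ℝ)) ∞ κ
        (geoFlow h z.1 (κ.symm z.2)) :=
      contMDiffAt_extChartAt' (by rw [← extChartAt_source (cotModel I)]; exact hz')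
    exact (ContMDiffAt.comp (g := κ) z h4 h3).contDiffAt
  have hG0 : ContDiffAt ℝ ∞ G (0, x₀) :=
    hGs _ hx₀T (by rw [geoFlow_zero_time]; exact κ.map_target hx₀T)
  have hfs : ∀ x ∈ κ.target, ContDiffAt ℝ ∞ f x := fun x hx =>
    contDiffAt_comp_extChartAt_symm (contMDiff_energy h) hx
  -- the velocity of the flow in coordinates
  have hGV : ∀ x ∈ κ.target, fderiv ℝ G (0, x) (1, 0) = V x := by
    intro x hx
    have hxs : κ.symm x ∈ κ.source := κ.map_target hx
    have h1 : HasFDerivAt G (fderiv ℝ G (0, x)) (0, x) :=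
      ((hGs (0, x) hx (by rw [geoFlow_zero_time]; exact hxs)).differentiableAt
        (by simp)).hasFDerivAt
    have h2 : HasFDerivAt (fun t : ℝ => (t, x))
        (ContinuousLinearMap.inl ℝ ℝ (E × (E →L[ℝ] ℝ))) 0 := hasFDerivAt_prodMk_left 0 x
    have h3 := HasFDerivAt.comp (0 : ℝ) h1 h2
    have hp : (κ.symm x).proj ∈ (chartAt H p.proj).source := by
      rw [hκ, extChartAt_cot_source] at hxs; exact hxs
    have h4 := (isMIntegralCurve_geoFlow h (κ.symm x)) 0
    have hsrc : geoFlow h 0 (κ.symm x) ∈ (chartAt (ModelProd H (E →L[ℝ] ℝ)) p).source := by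
      rw [geoFlow_zero_time, ← extChartAt_source (cotModel I)]; exact hxs
    obtain ⟨D, h5, hD⟩ : ∃ D : ℝ →L[ℝ] E × (E →L[ℝ] ℝ),
        HasFDerivAt (fun t => κ (geoFlow h t (κ.symm x))) D (0 : ℝ) ∧
        D 1 = mfderiv (cotModel I) 𝓘(ℝ, E × (E →L[ℝ] ℝ)) κ (geoFlow h 0 (κ.symm x))
          ((1 : ℝ) • geoField h (geoFlow h 0 (κ.symm x))) :=
      ⟨_, ((mdifferentiableAt_extChartAt hsrc).hasMFDerivAt.comp (0 : ℝ) h4).hasFDerivAt, rfl⟩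
    have h6 := congrArg (fun A : ℝ →L[ℝ] E × (E →L[ℝ] ℝ) => A 1) (h5.unique h3)
    refine h6.symm.trans (hD.trans ?_)
    have h7 : ∀ q : Cot I Z, q = κ.symm x →
        mfderiv (cotModel I) 𝓘(ℝ, E × (E →L[ℝ] ℝ)) κ q ((1 : ℝ) • geoField h q) = V x := by
      rintro q rfl
      have h8 := mfderiv_extChartAt_hamiltonField
        (isHamiltonField_hamField (fun p : Cot I Z => normSq h p / 2)) (contMDiff_energy h) hp
      rw [one_smul]
      refine h8.trans ?_
      rw [κ.right_inv hx]
    exact h7 _ (geoFlow_zero_time h _)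
  -- the pull-back of the canonical form in coordinates
  have hev : (fun t => canonicalForm (geoFlow h t p)
      (mfderiv (cotModel I) (cotModel I) (geoFlow h t) p w)) =ᶠ[𝓝 0]
      fun t => (G (t, x₀)).2 (fderiv ℝ G (t, x₀) (0, u)).1 := by
    have hc : ContinuousAt (fun t => geoFlow h t p) 0 :=
      (isMIntegralCurve_geoFlow h p 0).continuousAt
    have h0 : geoFlow h 0 p ∈ κ.source := by
      rw [geoFlow_zero_time]; exact mem_extChartAt_source p
    filter_upwards [hc.preimage_mem_nhds ((isOpen_extChartAt_source p).mem_nhds h0)] with t ht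
    have ht : geoFlow h t p ∈ κ.source := ht
    have ht' : (geoFlow h t p).proj ∈ (chartAt H p.proj).source := by
      rw [hκ, extChartAt_cot_source] at ht; exact ht
    have ht'' : geoFlow h t p ∈ (chartAt (ModelProd H (E →L[ℝ] ℝ)) p).source := by
      rw [← extChartAt_source (cotModel I)]; exact ht
    have hκd := mdifferentiableAt_extChartAt (I := cotModel I) ht''
    have h1 := canonicalForm_eq ht' (mfderiv (cotModel I) (cotModel I) (geoFlow h t) p w)
    have h2 : MDifferentiableAt (cotModel I) 𝓘(ℝ, E × (E →L[ℝ] ℝ)) (κ ∘ geoFlow h t) p :=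
      hκd.comp p (mdifferentiableAt_geoFlow h t p)
    have h3 := mfderiv_eq_fderiv_chart h2
    have h4 := mfderiv_comp p hκd (mdifferentiableAt_geoFlow h t p)
    have h5 : HasFDerivAt G (fderiv ℝ G (t, x₀)) (t, x₀) :=
      ((hGs (t, x₀) hx₀T (by rw [hsymm]; exact ht)).differentiableAt (by simp)).hasFDerivAt
    have h6 : HasFDerivAt (fun x : E × (E →L[ℝ] ℝ) => (t, x))
        (ContinuousLinearMap.inr ℝ ℝ (E × (E →L[ℝ] ℝ))) x₀ := hasFDerivAt_prodMk_right t x₀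
    have h7 : fderiv ℝ ((κ ∘ geoFlow h t) ∘ κ.symm) x₀ =
        (fderiv ℝ G (t, x₀)).comp (ContinuousLinearMap.inr ℝ ℝ (E × (E →L[ℝ] ℝ))) :=
      (HasFDerivAt.comp x₀ h5 h6).fderiv
    have h8 : mfderiv (cotModel I) 𝓘(ℝ, E × (E →L[ℝ] ℝ)) κ (geoFlow h t p)
        (mfderiv (cotModel I) (cotModel I) (geoFlow h t) p w) = fderiv ℝ G (t, x₀) (0, u) := by
      refine (congrArg (fun A => A w) h4).symm.trans ((congrArg (fun A => A w) h3).trans ?_)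
      exact congrArg (fun A => A u) h7
    refine h1.trans ?_
    have h9 : G (t, x₀) = κ (geoFlow h t p) := by rw [hG]; simp only [hsymm]
    rw [h9]
    exact congrArg (fun v : E × (E →L[ℝ] ℝ) => (κ (geoFlow h t p)).2 v.1) h8
  refine HasDerivAt.congr_of_eventuallyEq ?_ hev
  have hmf : (show ℝ from mfderiv (cotModel I) 𝓘(ℝ, ℝ) (fun p => normSq h p / 2) p w) =
      fderiv ℝ f x₀ u :=
    congrArg (fun A => A u) (mfderiv_eq_fderiv_chart (mdifferentiableAt_energy h p))
  rw [hmf]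
  refine hasDerivAt_pullback_of_euler hG0 ?_ ?_ (hfs x₀ hx₀T) ?_ u
  · filter_upwards [hT] with x hx
    rw [hG]
    simp only [geoFlow_zero_time]
    exact κ.right_inv hx
  · filter_upwards [hT] with x hx using hGV x hx
  · filter_upwards [hT] with x hx
    rw [fderiv_energy_radial h hx]
    simp only [hf, Function.comp_apply]
    ring

/-- The group property reduces time `t` to time zero at the point `geoFlow h t p`, and invariance of
the energy shows that the derivative does not depend on `t`. So the pull-back is affine in time. -/
lemma hasDerivAt_canonicalForm_geoFlow (p : Cot I Z) (w : TangentSpace (cotModel I) p) (t : ℝ) :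
    HasDerivAt (fun t => canonicalForm (geoFlow h t p)
      (mfderiv (cotModel I) (cotModel I) (geoFlow h t) p w))
      (show ℝ from mfderiv (cotModel I) 𝓘(ℝ, ℝ) (fun p => normSq h p / 2) p w) t := by
  set w' := mfderiv (cotModel I) (cotModel I) (geoFlow h t) p w with hw'
  have h1 := hasDerivAt_canonicalForm_geoFlow_zero h (geoFlow h t p) w'
  have h2 : (show ℝ from mfderiv (cotModel I) 𝓘(ℝ, ℝ) (fun p => normSq h p / 2) (geoFlow h t p) w') =
      (show ℝ from mfderiv (cotModel I) 𝓘(ℝ, ℝ) (fun p => normSq h p / 2) p w) := by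
    have h3 := mfderiv_comp p (mdifferentiableAt_energy h (geoFlow h t p))
      (mdifferentiableAt_geoFlow h t p)
    have h4 : (fun p => normSq h p / 2) ∘ geoFlow h t = fun p => normSq h p / 2 := by
      funext p; simp
    rw [h4] at h3
    exact (congrArg (fun A => A w) h3).symm
  rw [h2] at h1
  have h5 : HasDerivAt (fun s : ℝ => s - t) 1 t := (hasDerivAt_id t).sub_const t
  have h6 := HasDerivAt.comp_of_eq t h1 h5 (sub_self t).symm
  rw [mul_one] at h6
  refine h6.congr_of_eventuallyEq (Filter.Eventually.of_forall fun s => ?_)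
  have h7 : geoFlow h s = geoFlow h (s - t) ∘ geoFlow h t := by
    funext q; rw [Function.comp_apply, ← geoFlow_add, sub_add_cancel]
  have h8 := mfderiv_comp p (mdifferentiableAt_geoFlow h (s - t) (geoFlow h t p))
    (mdifferentiableAt_geoFlow h t p)
  have h9 : ∀ f : Cot I Z → Cot I Z, f = geoFlow h (s - t) ∘ geoFlow h t →
      canonicalForm (f p) (mfderiv (cotModel I) (cotModel I) f p w) =
      canonicalForm (geoFlow h (s - t) (geoFlow h t p))
        (mfderiv (cotModel I) (cotModel I) (geoFlow h (s - t)) (geoFlow h t p) w') := by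
    rintro f rfl
    rw [h8]
    rfl
  exact h9 _ h7

/-- The pull-back of the canonical one-form by the geodesic flow. -/
theorem canonicalForm_mfderiv_geoFlow (t : ℝ) (p : Cot I Z) (w : TangentSpace (cotModel I) p) :
    canonicalForm (geoFlow h t p) (mfderiv (cotModel I) (cotModel I) (geoFlow h t) p w) =
      canonicalForm p w +
        t * (show ℝ from mfderiv (cotModel I) 𝓘(ℝ, ℝ) (fun p => normSq h p / 2) p w) := by
  set A : ℝ → ℝ := fun t => canonicalForm (geoFlow h t p)
      (mfderiv (cotModel I) (cotModel I) (geoFlow h t) p w) with hA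
  set a : ℝ := mfderiv (cotModel I) 𝓘(ℝ, ℝ) (fun p => normSq h p / 2) p w with ha
  have hd : ∀ s, HasDerivAt (fun s => A s - s * a) 0 s := fun s => by
    have := (hasDerivAt_canonicalForm_geoFlow h p w s).sub ((hasDerivAt_id s).mul_const a)
    exact this.congr_deriv (by rw [one_mul]; exact sub_self a)
  have hc := is_const_of_deriv_eq_zero (fun s => (hd s).differentiableAt)
    (fun s => (hd s).deriv) t 0
  have h0 : A 0 = canonicalForm p w := by
    have h1 : ∀ f : Cot I Z → Cot I Z, f = id →
        canonicalForm (f p) (mfderiv (cotModel I) (cotModel I) f p w) = canonicalForm p w := by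
      rintro f rfl
      rw [mfderiv_id]
      rfl
    exact h1 _ (funext fun q => geoFlow_zero_time h q)
  simp only [zero_mul, sub_zero, h0] at hc
  change A t = _
  linarith

/-- For constant time this is `canonicalForm_mfderiv_geoFlow`. A variable time adds the differential
of `T` times the value of the canonical form on the generator, which is the squared length. -/
lemma pullForm_geoFlow {f : K → Cot I Z} {T : K → ℝ} {k : K}
    (hf : MDifferentiableAt IK (cotModel I) f k) (hT : MDifferentiableAt IK 𝓘(ℝ, ℝ) T k)
    (v : TangentSpace IK k) :
    pullForm IK (fun k => geoFlow h (T k) (f k)) k v = pullForm IK f k v +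
      T k * (show ℝ from mfderiv IK 𝓘(ℝ, ℝ) (fun k => normSq h (f k) / 2) k v) +
      normSq h (f k) * (show ℝ from mfderiv IK 𝓘(ℝ, ℝ) T k v) := by
  set Φ : ℝ × Cot I Z → Cot I Z := fun z => geoFlow h z.1 z.2 with hΦ
  have hΦd : MDifferentiableAt (𝓘(ℝ, ℝ).prod (cotModel I)) (cotModel I) Φ (T k, f k) :=
    (contMDiff_geoFlow h).mdifferentiableAt (by simp)
  have h1 := mfderiv_comp k (g := Φ) (f := fun k => (T k, f k)) hΦd (hT.prodMk hf)
  have h2 : mfderiv IK (cotModel I) (fun k => geoFlow h (T k) (f k)) k v =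
      mfderiv (𝓘(ℝ, ℝ).prod (cotModel I)) (cotModel I) Φ (T k, f k)
        (mfderiv IK 𝓘(ℝ, ℝ) T k v, mfderiv IK (cotModel I) f k v) := by
    refine (congrArg (fun A => A v) h1).trans ?_
    exact congrArg (mfderiv (𝓘(ℝ, ℝ).prod (cotModel I)) (cotModel I) Φ (T k, f k))
      (congrArg (fun A => A v) (mfderiv_prodMk hT hf))
  have h3 := mfderiv_prod_eq_add_apply (f := Φ) (p := (T k, f k))
    (v := (show TangentSpace (𝓘(ℝ, ℝ).prod (cotModel I)) (T k, f k) from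
      (mfderiv IK 𝓘(ℝ, ℝ) T k v, mfderiv IK (cotModel I) f k v))) hΦd
  have h4 := (isMIntegralCurve_geoFlow h (f k) (T k)).mfderiv
  set a : ℝ := mfderiv IK 𝓘(ℝ, ℝ) T k v with ha
  have h5 : mfderiv 𝓘(ℝ, ℝ) (cotModel I) (fun t => geoFlow h t (f k)) (T k) a =
      a • geoField h (geoFlow h (T k) (f k)) := congrArg (fun A => A a) h4
  have h6 : pullForm IK (fun k => geoFlow h (T k) (f k)) k v =
      canonicalForm (geoFlow h (T k) (f k)) (a • geoField h (geoFlow h (T k) (f k)) +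
        mfderiv (cotModel I) (cotModel I) (geoFlow h (T k)) (f k)
          (mfderiv IK (cotModel I) f k v)) := by
    refine congrArg (canonicalForm (geoFlow h (T k) (f k))) (h2.trans (h3.trans ?_))
    exact congrArg (fun b => b + mfderiv (cotModel I) (cotModel I) (geoFlow h (T k)) (f k)
          (mfderiv IK (cotModel I) f k v)) h5
  have hlin : ∀ (p : Cot I Z) (b : ℝ) (x y : TangentSpace (cotModel I) p),
      canonicalForm p (b • x + y) = b * canonicalForm p x + canonicalForm p y := by
    intro p b x y
    simp only [canonicalForm, map_add, map_smul, smul_eq_mul]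
  rw [h6, hlin, canonicalForm_geoField, normSq_geoFlow, canonicalForm_mfderiv_geoFlow]
  have h7 := congrArg (fun A => A v) (mfderiv_comp k (mdifferentiableAt_energy h (f k)) hf)
  have h8 : (show ℝ from mfderiv IK 𝓘(ℝ, ℝ) (fun k => normSq h (f k) / 2) k v) =
    (show ℝ from mfderiv (cotModel I) 𝓘(ℝ, ℝ) (fun p => normSq h p / 2) (f k)
      (mfderiv IK (cotModel I) f k v)) := h7
  rw [h8]
  change a * normSq h (f k) + (pullForm IK f k v + _) = _
  ring

end Pullback
end ScatGeom

namespace ScatGeom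

section Calculus

variable {EK : Type*} [NormedAddCommGroup EK] [NormedSpace ℝ EK]
  {HK : Type*} [TopologicalSpace HK] {IK : ModelWithCorners ℝ EK HK}
  {K : Type*} [TopologicalSpace K] [ChartedSpace HK K]
  {EN : Type*} [NormedAddCommGroup EN] [NormedSpace ℝ EN]
  {HN : Type*} [TopologicalSpace HN] {IN : ModelWithCorners ℝ EN HN}
  {N : Type*} [TopologicalSpace N] [ChartedSpace HN N]
  {W : Type*} [NormedAddCommGroup W] [NormedSpace ℝ W]
  {W' : Type*} [NormedAddCommGroup W'] [NormedSpace ℝ W']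

/-! ### Differentials of vector-valued maps -/

variable (IK) in
/-- The differential of a map to a vector space. -/
def dd (f : K → W) (k : K) : TangentSpace IK k →L[ℝ] W := mfderiv IK 𝓘(ℝ, W) f k

lemma dd_comp_mfderiv {f : N → W} {φ : K → N} {k : K}
    (hf : MDifferentiableAt IN 𝓘(ℝ, W) f (φ k)) (hφ : MDifferentiableAt IK IN φ k)
    (v : TangentSpace IK k) :
    dd IK (fun k => f (φ k)) k v = dd IN f (φ k) (mfderiv IK IN φ k v) :=
  congrArg (fun A => A v) (mfderiv_comp k hf hφ)

lemma dd_clm_comp (L : W →L[ℝ] W') {f : K → W} {k : K} (hf : MDifferentiableAt IK 𝓘(ℝ, W) f k)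
    (v : TangentSpace IK k) : dd IK (fun k => L (f k)) k v = L (dd IK f k v) := by
  have h1 : MDifferentiableAt 𝓘(ℝ, W) 𝓘(ℝ, W') L (f k) :=
    L.differentiableAt.mdifferentiableAt
  refine (dd_comp_mfderiv (f := L) h1 hf v).trans ?_
  have h2 : dd 𝓘(ℝ, W) (L : W → W') (f k) = L := by
    rw [dd, mfderiv_eq_fderiv]
    exact L.fderiv
  exact congrArg (fun A => A (mfderiv IK 𝓘(ℝ, W) f k v)) h2

lemma dd_prodMk {f : K → W} {g : K → W'} {k : K} (hf : MDifferentiableAt IK 𝓘(ℝ, W) f k)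
    (hg : MDifferentiableAt IK 𝓘(ℝ, W') g k) (v : TangentSpace IK k) :
    dd IK (fun k => (f k, g k)) k v = (dd IK f k v, dd IK g k v) := by
  have h1 : MDifferentiableAt IK 𝓘(ℝ, W × W') (fun k => (f k, g k)) k := hf.prodMk_space hg
  refine Prod.ext ?_ ?_
  · exact (dd_clm_comp (ContinuousLinearMap.fst ℝ W W') h1 v).symm
  · exact (dd_clm_comp (ContinuousLinearMap.snd ℝ W W') h1 v).symm

/-- The velocity at time zero of a curve through `k`. -/
def velAt {c : ℝ → K} {k : K} (hk : c 0 = k) : TangentSpace IK k :=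
  hk ▸ (mfderiv 𝓘(ℝ, ℝ) IK c 0 (1 : ℝ) : TangentSpace IK (c 0))

lemma hasDerivAt_velAt {c : ℝ → K} {k : K} (hk : c 0 = k)
    (hc : MDifferentiableAt 𝓘(ℝ, ℝ) IK c 0) {f : K → W} (hf : MDifferentiableAt IK 𝓘(ℝ, W) f k) :
    HasDerivAt (fun t => f (c t)) (dd IK f k (velAt hk)) 0 := by
  subst hk
  have h1 : HasFDerivAt (fun t => f (c t)) (dd 𝓘(ℝ, ℝ) (fun t => f (c t)) (0 : ℝ)) (0 : ℝ) :=
    (hf.comp (0 : ℝ) hc).hasMFDerivAt.hasFDerivAt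
  have h2 := h1.hasDerivAt
  refine h2.congr_deriv ?_
  exact dd_comp_mfderiv hf hc (1 : ℝ)

/-- Together with `exists_curve` this turns the differential of a function on a manifold into the
ordinary derivative along a curve, so that explicit formulas can be differentiated with the
one-variable calculus. -/
lemma dd_velAt {c : ℝ → K} {k : K} (hk : c 0 = k)
    (hc : MDifferentiableAt 𝓘(ℝ, ℝ) IK c 0) {f : K → W} (hf : MDifferentiableAt IK 𝓘(ℝ, W) f k)
    {w : W} (hw : HasDerivAt (fun t => f (c t)) w 0) : dd IK f k (velAt hk) = w :=
  (hasDerivAt_velAt hk hc hf).unique hw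

/-- Each tangent vector is the velocity of a curve. -/
lemma exists_curve [IK.Boundaryless] [IsManifold IK ∞ K] (k : K) (v : TangentSpace IK k) :
    ∃ c : ℝ → K, c 0 = k ∧ MDifferentiableAt 𝓘(ℝ, ℝ) IK c 0 ∧
      ∃ hk : c 0 = k, velAt (IK := IK) hk = v := by
  set κ := extChartAt IK k
  set v' : EK := v
  set c : ℝ → K := fun t => κ.symm (κ k + t • v') with hc
  have h0 : c 0 = k := by simp [hc, κ]
  have h1 : HasMFDerivAt 𝓘(ℝ, EK) IK κ.symm (κ k + (0 : ℝ) • v')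
      (mfderiv 𝓘(ℝ, EK) IK κ.symm (κ k + (0 : ℝ) • v')) := by
    refine MDifferentiableAt.hasMFDerivAt ?_
    have : κ k + (0 : ℝ) • v' = κ k := by simp
    rw [this]
    exact ((contMDiffOn_extChartAt_symm (n := ∞) k).contMDiffAt
      (extChartAt_target_mem_nhds k)).mdifferentiableAt (by simp)
  have h2 : HasFDerivAt (fun t : ℝ => κ k + t • v') ((1 : ℝ →L[ℝ] ℝ).smulRight v') 0 :=
    (((1 : ℝ →L[ℝ] ℝ).smulRight v').hasFDerivAt).const_add (κ k)
  have h3 : HasMFDerivAt 𝓘(ℝ, ℝ) IK c 0 _ := HasMFDerivAt.comp (0 : ℝ) h1 h2.hasMFDerivAt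
  refine ⟨c, h0, h3.mdifferentiableAt, h0, ?_⟩
  have h4 : HasDerivAt (fun t => κ (c t)) v' 0 := by
    have h5 : HasDerivAt (fun t : ℝ => κ k + t • v') v' 0 := by
      simpa using ((hasDerivAt_id (0 : ℝ)).smul_const v').const_add (κ k)
    refine h5.congr_of_eventuallyEq ?_
    have h6 : ContinuousAt (fun t : ℝ => κ k + t • v') 0 := h5.continuousAt
    filter_upwards [h6.preimage_mem_nhds
      (by rw [zero_smul, add_zero]; exact extChartAt_target_mem_nhds k :
        κ.target ∈ 𝓝 (κ k + (0 : ℝ) • v'))] with t ht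
    exact κ.right_inv ht
  have h7 := dd_velAt h0 h3.mdifferentiableAt
    (mdifferentiableAt_extChartAt (I := IK) (mem_chart_source HK k)) h4
  have h8 := mfderivWithin_extChartAt_symm_comp_mfderiv_extChartAt' (I := IK) (x := k)
    (mem_extChartAt_source k)
  have hinj : Function.Injective (mfderiv IK 𝓘(ℝ, EK) κ k) := by
    intro a b hab
    have ha := congrArg (fun A => A a) h8
    have hb := congrArg (fun A => A b) h8
    exact ha.symm.trans ((congrArg _ hab).trans hb)
  refine hinj (h7.trans ?_)
  have h9 := mfderiv_eq_fderiv_chart (IK := IK)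
    (mdifferentiableAt_extChartAt (I := IK) (mem_chart_source HK k))
  have h10 : fderiv ℝ (κ ∘ κ.symm) (κ k) = ContinuousLinearMap.id ℝ EK := by
    refine (HasFDerivAt.congr_of_eventuallyEq (hasFDerivAt_id _) ?_).fderiv
    filter_upwards [extChartAt_target_mem_nhds (I := IK) k] with x hx using κ.right_inv hx
  exact ((congrArg (fun A => A v) h9).trans (congrArg (fun A => A v') h10)).symm

end Calculus

section Retraction

variable {E₁ E₂ : Type*} [NormedAddCommGroup E₁] [NormedSpace ℝ E₁] [NormedAddCommGroup E₂]
  [NormedSpace ℝ E₂]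

/-! ### Submanifolds given by parametrizations -/

lemma comp_eq_id_of_retraction {ψ : E₁ → E₂} {ι : E₂ → E₁} {x₀ : E₁} {n₀ : E₂} {A : E₂ →L[ℝ] E₁}
    {B : E₁ →L[ℝ] E₂} (hψ : HasStrictFDerivAt ψ B x₀) (hι : HasStrictFDerivAt ι A n₀)
    (hx : ι n₀ = x₀) (hid : ∀ᶠ n in 𝓝 n₀, ψ (ι n) = n) :
    B.comp A = ContinuousLinearMap.id ℝ E₂ := by
  subst hx
  exact (hψ.hasFDerivAt.comp n₀ hι.hasFDerivAt).unique
    ((hasFDerivAt_id n₀).congr_of_eventuallyEq hid)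

/-- The image of `ι` is locally the set where `ι (ψ x) = x`, but these are too many equations. It is
enough to impose their component under the projection `P = 1 - A B` along the image of `A`: the map
`x ↦ P (x - ι (ψ x)) + A (ψ x)` has derivative `P (1 - A B) + A B = 1` at `x₀`, so it is locally
injective, and it takes the same value at `x` and at `ι (ψ x)` once the projected equations hold. -/
lemma eventually_eq_zero_iff_of_retraction [CompleteSpace E₁] {ψ : E₁ → E₂} {ι : E₂ → E₁} {x₀ : E₁}
    {n₀ : E₂} {A : E₂ →L[ℝ] E₁} {B : E₁ →L[ℝ] E₂} (hψ : HasStrictFDerivAt ψ B x₀)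
    (hι : HasStrictFDerivAt ι A n₀) (hn : ψ x₀ = n₀) (hx : ι n₀ = x₀)
    (hid : ∀ᶠ n in 𝓝 n₀, ψ (ι n) = n) :
    ∀ᶠ x in 𝓝 x₀, (ContinuousLinearMap.id ℝ E₁ - A.comp B) (x - ι (ψ x)) = 0 ↔ ι (ψ x) = x := by
  subst hn
  have hBA := comp_eq_id_of_retraction hψ hι hx hid
  set P := ContinuousLinearMap.id ℝ E₁ - A.comp B with hP
  set Θ : E₁ → E₁ := fun x => P (x - ι (ψ x)) + A (ψ x) with hΘ
  have hιψ : HasStrictFDerivAt (fun x => ι (ψ x)) (A.comp B) x₀ := hι.comp x₀ hψ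
  have hd : HasStrictFDerivAt Θ ((ContinuousLinearEquiv.refl ℝ E₁ : E₁ ≃L[ℝ] E₁) : E₁ →L[ℝ] E₁)
      x₀ := by
    have h1 := (P.hasStrictFDerivAt.comp x₀ ((hasStrictFDerivAt_id x₀).sub hιψ)).add
      (A.hasStrictFDerivAt.comp x₀ hψ)
    have h2 : P.comp (ContinuousLinearMap.id ℝ E₁ - A.comp B) + A.comp B =
        ((ContinuousLinearEquiv.refl ℝ E₁ : E₁ ≃L[ℝ] E₁) : E₁ →L[ℝ] E₁) := by
      ext v
      have : B (A (B v)) = B v := congrArg (fun L => L (B v)) hBA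
      simp [hP, this]
    rw [h2] at h1
    exact h1
  have hinv := hd.eventually_left_inverse
  have hc : Filter.Tendsto (fun x => ι (ψ x)) (𝓝 x₀) (𝓝 x₀) := by
    have := hιψ.hasFDerivAt.continuousAt.tendsto
    simpa only [hx] using this
  have hc' : Filter.Tendsto ψ (𝓝 x₀) (𝓝 (ψ x₀)) := hψ.hasFDerivAt.continuousAt.tendsto
  filter_upwards [hinv, hc.eventually hinv, hc'.eventually hid] with x h1 h2 h3
  constructor
  · intro h0
    have h4 : Θ x = Θ (ι (ψ x)) := by
      simp only [hΘ, h0, h3, sub_self, map_zero]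
    rw [← h2, ← h4, h1]
  · intro h0
    rw [h0, sub_self, map_zero]

variable {EK : Type*} [NormedAddCommGroup EK] [NormedSpace ℝ EK] [FiniteDimensional ℝ EK]
  {HK : Type*} [TopologicalSpace HK] {IK : ModelWithCorners ℝ EK HK} [IK.Boundaryless]
  {K : Type*} [TopologicalSpace K] [ChartedSpace HK K] [IsManifold IK ∞ K]
  {EN : Type*} [NormedAddCommGroup EN] [NormedSpace ℝ EN] [FiniteDimensional ℝ EN]
  {HN : Type*} [TopologicalSpace HN] {IN : ModelWithCorners ℝ EN HN} [IN.Boundaryless]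
  {N : Type*} [TopologicalSpace N] [ChartedSpace HN N] [IsManifold IN ∞ N]
  {W : Type*} [NormedAddCommGroup W] [NormedSpace ℝ W] [FiniteDimensional ℝ W]

/-- A map between manifolds in the charts at a point and at its image has the differential of the
map as its strict derivative. -/
lemma hasStrictFDerivAt_written {f : K → N} {k : K} (hf : ContMDiffAt IK IN ∞ f k) {n : N}
    (hn : f k = n) :
    HasStrictFDerivAt (fun x => extChartAt IN n (f ((extChartAt IK k).symm x)))
      (show EK →L[ℝ] EN from mfderiv IK IN f k) (extChartAt IK k k) := by
  subst hn
  have h1 : ContDiffAt ℝ ∞ (fun x => extChartAt IN (f k) (f ((extChartAt IK k).symm x)))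
      (extChartAt IK k k) := by
    have := (contMDiffAt_iff.1 hf).2
    rw [IK.range_eq_univ, contDiffWithinAt_univ] at this
    exact this
  have h2 := (hf.mdifferentiableAt (by simp)).mfderiv
  rw [IK.range_eq_univ, fderivWithin_univ] at h2
  have h3 := h1.hasStrictFDerivAt (by simp)
  have h4 : (show EK →L[ℝ] EN from mfderiv IK IN f k) =
    fderiv ℝ (fun x => extChartAt IN (f k) (f ((extChartAt IK k).symm x))) (extChartAt IK k k) := h2
  rw [h4]
  exact h3

/-- Cutting out by equations with values in a vector space. -/
lemma exists_cutsOut_of_vector {ρ : K → ℝ} {S : Set K} {p : K} {F : K → W} {c : ℕ}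
    (hc : Module.finrank ℝ W = c) {U : Set K} (hU : IsOpen U) (hp : p ∈ U)
    (hF : ContMDiffOn IK 𝓘(ℝ, W) ∞ F U) (hS : ∀ q ∈ U, q ∈ S ↔ 0 ≤ ρ q ∧ F q = 0)
    (hsurj : ∀ w : W, ∃ v : TangentSpace IK p, (ρ p = 0 → dd IK ρ p v = 0) ∧ dd IK F p v = w) :
    ∃ F' : K → Fin c → ℝ, CutsOut IK ρ S p F' ∧
      ∀ v : TangentSpace IK p, mfderiv IK 𝓘(ℝ, Fin c → ℝ) F' p v = (0 : Fin c → ℝ) →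
        dd IK F p v = 0 := by
  have e : W ≃L[ℝ] (Fin c → ℝ) := ContinuousLinearEquiv.ofFinrankEq (by simp [hc])
  have hFd : MDifferentiableAt IK 𝓘(ℝ, W) F p :=
    ((hF p hp).contMDiffAt (hU.mem_nhds hp)).mdifferentiableAt (by simp)
  have hd : ∀ v : TangentSpace IK p, dd IK (fun k => e (F k)) p v = e (dd IK F p v) :=
    fun v => dd_clm_comp (e : W →L[ℝ] (Fin c → ℝ)) hFd v
  refine ⟨fun k => e (F k), ⟨⟨U, hU, hp, ?_, fun q hq => ?_⟩, ?_, ?_⟩, fun v hv => ?_⟩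
  · exact fun q hq => e.contDiff.contMDiff.contMDiffAt.comp_contMDiffWithinAt q (hF q hq)
  · rw [hS q hq, e.map_eq_zero_iff]
  · intro w
    obtain ⟨v, -, hv⟩ := hsurj (e.symm w)
    exact ⟨v, (hd v).trans ((congrArg e hv).trans (e.apply_symm_apply w))⟩
  · intro h0 w
    obtain ⟨v, hv0, hv⟩ := hsurj (e.symm w)
    exact ⟨v, hv0 h0, (hd v).trans ((congrArg e hv).trans (e.apply_symm_apply w))⟩
  · have h1 : e (dd IK F p v) = 0 := (hd v).symm.trans hv
    exact e.map_eq_zero_iff.1 h1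

/-- Let `ι : N → K` be a parametrization with smooth left inverse `ψ`. The image under `ι` of the
submanifold `{g = 0}` of `N` is a submanifold of `K`, and its tangent spaces are the images of the
kernels of `dg`. -/
theorem exists_cutsOut_of_retraction {ψ : K → N} {ι : N → K} {g : N → W} {ρ : K → ℝ} {S : Set K}
    {p : K} {U : Set K} {V : Set N} {c : ℕ} (hU : IsOpen U) (hp : p ∈ U)
    (hψ : ContMDiffOn IK IN ∞ ψ U) (hV : IsOpen V) (hψU : MapsTo ψ U V)
    (hι : ContMDiffOn IN IK ∞ ι V) (hg : ContMDiffOn IN 𝓘(ℝ, W) ∞ g V)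
    (hid : ∀ n ∈ V, ι n ∈ U → ψ (ι n) = n)
    (hS : ∀ x ∈ U, x ∈ S ↔ 0 ≤ ρ x ∧ ι (ψ x) = x ∧ g (ψ x) = 0) (hpS : p ∈ S)
    (hgs : ∀ w : W, ∃ v : TangentSpace IN (ψ p), dd IN g (ψ p) v = w)
    (hρ : ρ p = 0 → MDifferentiableAt IK 𝓘(ℝ, ℝ) ρ p ∧
      ∃ v : TangentSpace IN (ψ p), dd IN g (ψ p) v = 0 ∧ dd IN (fun n => ρ (ι n)) (ψ p) v ≠ 0)
    (hc : c + Module.finrank ℝ EN = Module.finrank ℝ EK + Module.finrank ℝ W) :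
    ∃ F : K → Fin c → ℝ, CutsOut IK ρ S p F ∧
      ∀ χ : ∀ x : K, TangentSpace IK x → ℝ,
        (∀ v : TangentSpace IN (ψ p), dd IN g (ψ p) v = 0 →
          χ (ι (ψ p)) (mfderiv IN IK ι (ψ p) v) = 0) →
        ∀ v : TangentSpace IK p, mfderiv IK 𝓘(ℝ, Fin c → ℝ) F p v = (0 : Fin c → ℝ) → χ p v = 0 := by
  have hcompl : CompleteSpace EK := FiniteDimensional.complete ℝ EK
  obtain ⟨hρ0, hιp, hgp⟩ := (hS p hp).1 hpS
  set n := ψ p with hn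
  have hnV : n ∈ V := hψU hp
  set κ := extChartAt IK p with hκ
  set κN := extChartAt IN n with hκN
  have hψp : ContMDiffAt IK IN ∞ ψ p := (hψ p hp).contMDiffAt (hU.mem_nhds hp)
  have hιn : ContMDiffAt IN IK ∞ ι n := (hι n hnV).contMDiffAt (hV.mem_nhds hnV)
  set B : EK →L[ℝ] EN := mfderiv IK IN ψ p with hB
  set A : EN →L[ℝ] EK := mfderiv IN IK ι n with hA
  have hψs := hasStrictFDerivAt_written hψp hn.symm
  have hιs := hasStrictFDerivAt_written hιn hιp
  -- the retraction in coordinates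
  have hsymm0 : κ.symm (κ p) = p := extChartAt_to_inv p
  have hNsymm0 : κN.symm (κN n) = n := extChartAt_to_inv n
  have hιc : ContinuousAt (fun y => ι (κN.symm y)) (κN n) := by
    refine ContinuousAt.comp (g := ι) ?_ (continuousAt_extChartAt_symm n)
    rw [hNsymm0]
    exact hιn.continuousAt
  have hidc : ∀ᶠ y in 𝓝 (κN n), κN (ψ (κ.symm (κ (ι (κN.symm y))))) = y := by
    have h1 : ∀ᶠ y in 𝓝 (κN n), κN.symm y ∈ V :=
      (continuousAt_extChartAt_symm n).preimage_mem_nhds (hV.mem_nhds (by rw [hNsymm0]; exact hnV))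
    have h2 : ∀ᶠ y in 𝓝 (κN n), ι (κN.symm y) ∈ U ∩ κ.source := by
      refine hιc.preimage_mem_nhds ((hU.inter (isOpen_extChartAt_source p)).mem_nhds ?_)
      rw [hNsymm0, hιp]
      exact ⟨hp, mem_extChartAt_source p⟩
    filter_upwards [h1, h2, extChartAt_target_mem_nhds n] with y hy1 hy2 hy3
    rw [κ.left_inv hy2.2, hid _ hy1 hy2.1, κN.right_inv hy3]
  have hBA : B.comp A = ContinuousLinearMap.id ℝ EN :=
    comp_eq_id_of_retraction hψs hιs (by simp only [← hκN, hNsymm0, hιp]) hidc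
  have hev := eventually_eq_zero_iff_of_retraction hψs hιs
    (by simp only [← hκ, hsymm0, hn]) (by simp only [← hκN, hNsymm0, hιp]) hidc
  set Q := ContinuousLinearMap.id ℝ EK - A.comp B with hQ
  have hBQ : ∀ v, Q v ∈ LinearMap.ker (B : EK →ₗ[ℝ] EN) := fun v => by
    have : B (A (B v)) = B v := congrArg (fun L => L (B v)) hBA
    simp [hQ, this]
  set P : EK →L[ℝ] LinearMap.ker (B : EK →ₗ[ℝ] EN) := Q.codRestrict _ hBQ with hP
  have hPker : ∀ w : LinearMap.ker (B : EK →ₗ[ℝ] EN), P w = w := fun w => by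
    have : B w = 0 := w.2
    exact Subtype.ext (by simp [hP, hQ, this])
  have hPA : ∀ v, P (A v) = 0 := fun v => by
    have : B (A v) = v := congrArg (fun L => L v) hBA
    exact Subtype.ext (by simp [hP, hQ, this])
  have hP0 : ∀ v, P v = 0 → v = A (B v) := fun v hv => by
    have : Q v = 0 := congrArg Subtype.val hv
    simpa [hQ, sub_eq_zero] using this
  -- the equations
  set f₀ : K → LinearMap.ker (B : EK →ₗ[ℝ] EN) := fun x => P (κ x - κ (ι (ψ x))) with hf₀
  -- The first component, with values in `ker B`, cuts out the image of `ι` with exactly as many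
  -- equations as its codimension; the second restricts to `{g = 0}` inside it.
  set f : K → LinearMap.ker (B : EK →ₗ[ℝ] EN) × W := fun x => (f₀ x, g (ψ x)) with hf
  have hgn : ContMDiffAt IN 𝓘(ℝ, W) ∞ g n := (hg n hnV).contMDiffAt (hV.mem_nhds hnV)
  have hιψc : ContinuousOn (fun x => ι (ψ x)) U := hι.continuousOn.comp hψ.continuousOn hψU
  set U₀ := U ∩ (fun x => ι (ψ x)) ⁻¹' κ.source with hU₀
  have hU₀o : IsOpen U₀ := hιψc.isOpen_inter_preimage hU (isOpen_extChartAt_source p)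
  have hsm : ∀ x ∈ U₀ ∩ κ.source, ContMDiffAt IK 𝓘(ℝ, LinearMap.ker (B : EK →ₗ[ℝ] EN)) ∞ f₀ x ∧
      ContMDiffAt IK 𝓘(ℝ, W) ∞ (fun x => g (ψ x)) x := by
    rintro x ⟨⟨hxU, hx1⟩, hx2⟩
    have hψx : ContMDiffAt IK IN ∞ ψ x := (hψ x hxU).contMDiffAt (hU.mem_nhds hxU)
    have hιx : ContMDiffAt IN IK ∞ ι (ψ x) :=
      (hι _ (hψU hxU)).contMDiffAt (hV.mem_nhds (hψU hxU))
    have hκ1 : ContMDiffAt IK 𝓘(ℝ, EK) ∞ κ x :=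
      contMDiffAt_extChartAt' (by rw [← extChartAt_source IK]; exact hx2)
    have hκ2 : ContMDiffAt IK 𝓘(ℝ, EK) ∞ κ (ι (ψ x)) :=
      contMDiffAt_extChartAt' (by rw [← extChartAt_source IK]; exact hx1)
    have h3 : ContMDiffAt IK 𝓘(ℝ, EK) ∞ (fun x => κ (ι (ψ x))) x :=
      hκ2.comp x (hιx.comp x hψx)
    refine ⟨?_, ((hg _ (hψU hxU)).contMDiffAt (hV.mem_nhds (hψU hxU))).comp x hψx⟩
    exact P.contDiff.contMDiff.contMDiffAt.comp x (hκ1.sub h3)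
  have hpU₀ : p ∈ U₀ ∩ κ.source :=
    ⟨⟨hp, by change ι (ψ p) ∈ κ.source; rw [← hn, hιp]; exact mem_extChartAt_source p⟩,
      mem_extChartAt_source p⟩
  have hsrcN : ∀ᶠ x in 𝓝 p, ψ x ∈ κN.source :=
    hψp.continuousAt.preimage_mem_nhds (extChartAt_source_mem_nhds n)
  have hnear : ∀ᶠ x in 𝓝 p, x ∈ U₀ ∩ κ.source :=
    (hU₀o.inter (isOpen_extChartAt_source p)).mem_nhds hpU₀
  have hev' : ∀ᶠ x in 𝓝 p, f₀ x = 0 ↔ ι (ψ x) = x := by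
    have h1 := (continuousAt_extChartAt (I := IK) p).eventually hev
    filter_upwards [h1, hnear, hsrcN] with x hx1 hx2 hx4
    have hx3 : κ.symm (κ x) = x := κ.left_inv hx2.2
    simp only [← hκ, ← hκN, hx3, κN.left_inv hx4] at hx1
    rw [← κ.injOn.eq_iff (show ι (ψ x) ∈ κ.source from hx2.1.2) hx2.2, ← hx1]
    exact Subtype.ext_iff
  -- their differentials
  have hf₀d : ∀ v : TangentSpace IK p, dd IK f₀ p v = P (show EK from v) := by
    intro v
    have h1 := mfderiv_eq_fderiv_chart ((hsm p hpU₀).1.mdifferentiableAt (by simp))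
    have hx0 : (fun x => κN (ψ (κ.symm x))) (κ p) = κN n := by simp only [hsymm0, hn]
    have hι' := hιs.hasFDerivAt
    rw [← hκ, ← hκN, ← hx0] at hι'
    have h2 := P.hasFDerivAt.comp (κ p) ((hasFDerivAt_id (κ p)).sub
      (HasFDerivAt.comp (κ p) hι' hψs.hasFDerivAt))
    have h3 : (f₀ ∘ κ.symm) =ᶠ[𝓝 (κ p)] (P ∘ (id -
        (fun y => κ (ι (κN.symm y))) ∘ fun x => κN (ψ (κ.symm x)))) := by
      have h4 : ContinuousAt κ.symm (κ p) := continuousAt_extChartAt_symm p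
      have h5 : ∀ᶠ y in 𝓝 (κ p), ψ (κ.symm y) ∈ κN.source :=
        h4.eventually (by rw [hsymm0]; exact hsrcN)
      filter_upwards [h5, extChartAt_target_mem_nhds p] with y hy1 hy2
      simp only [hf₀, Function.comp_apply, Pi.sub_apply, id_eq, κN.left_inv hy1, κ.right_inv hy2]
    have h6 := (h2.congr_of_eventuallyEq h3).fderiv
    refine (congrArg (fun L => L v) (h1.trans h6)).trans ?_
    have hw : ∀ w : EK, P (w - A (B w)) = P w := fun w => by rw [map_sub, hPA, sub_zero]
    exact hw v
  have hgd : ∀ v : TangentSpace IK p,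
      dd IK (fun x => g (ψ x)) p v = dd IN g n (show EN from B v) := fun v =>
    dd_comp_mfderiv (hgn.mdifferentiableAt (by simp)) (hψp.mdifferentiableAt (by simp)) v
  have hfd : ∀ v : TangentSpace IK p,
      dd IK f p v = (P (show EK from v), dd IN g n (show EN from B v)) := fun v => by
    rw [← hf₀d, ← hgd]
    exact dd_prodMk ((hsm p hpU₀).1.mdifferentiableAt (by simp))
      ((hsm p hpU₀).2.mdifferentiableAt (by simp)) v
  have hBA' : ∀ v, B (A v) = v := fun v => congrArg (fun L => L v) hBA
  have hfr : Module.finrank ℝ (LinearMap.ker (B : EK →ₗ[ℝ] EN) × W) = c := by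
    have h1 := LinearMap.finrank_range_add_finrank_ker (B : EK →ₗ[ℝ] EN)
    have h2 : LinearMap.range (B : EK →ₗ[ℝ] EN) = ⊤ :=
      LinearMap.range_eq_top.2 fun v => ⟨A v, hBA' v⟩
    rw [h2, finrank_top] at h1
    rw [Module.finrank_prod]
    omega
  obtain ⟨U₁, hU₁, hU₁o, hpU₁⟩ := mem_nhds_iff.1 (hev'.and hnear)
  obtain ⟨F, hF, hF0⟩ := exists_cutsOut_of_vector (ρ := ρ) (S := S) hfr hU₁o hpU₁ (F := f)
    (fun x hx => ((hsm x (hU₁ hx).2).1.prodMk_space (hsm x (hU₁ hx).2).2).contMDiffWithinAt)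
    (fun x hx => by
      rw [hS x (hU₁ hx).2.1.1, ← (hU₁ hx).1, hf, Prod.mk_eq_zero])
    (by
      rintro ⟨w₁, w₂⟩
      obtain ⟨(v₂ : EN), hv₂⟩ := hgs w₂
      set v' : EK := A v₂ + w₁ with hv'
      have h1 : dd IK f p v' = (w₁, w₂) := by
        refine (hfd v').trans (Prod.ext ?_ ?_)
        · change P (A v₂ + w₁) = w₁
          rw [map_add, hPA, hPker, zero_add]
        · have h2 : B v' = v₂ := by
            have h3 : B w₁ = 0 := w₁.2
            rw [hv', map_add, hBA', h3, add_zero]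
          exact (congrArg (dd IN g n) h2).trans hv₂
      -- At a boundary point the preimage `v'` is corrected by a multiple of `A v₀`. This vector is
      -- tangent to `S`, so the value of the differential of the equations does not change, and it
      -- leaves the boundary at first order, so the multiple can be chosen to annihilate `dρ`.
      by_cases h0 : ρ p = 0
      · obtain ⟨hρd, (v₀ : EN), hv₀, hne⟩ := hρ h0
        have hdρ : ∀ x, ι n = x → MDifferentiableAt IK 𝓘(ℝ, ℝ) ρ x →
            dd IN (fun n => ρ (ι n)) n v₀ = (show EK →L[ℝ] ℝ from dd IK ρ x) (A v₀) := by
          rintro _ rfl hx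
          exact dd_comp_mfderiv hx (hιn.mdifferentiableAt (by simp)) v₀
        rw [hdρ p hιp hρd] at hne
        set R : EK →L[ℝ] ℝ := dd IK ρ p with hR
        have h4 : dd IK f p (show EK from A v₀) = 0 := by
          refine (hfd (A v₀)).trans (Prod.ext (hPA v₀) ?_)
          exact (congrArg (dd IN g n) (hBA' v₀)).trans hv₀
        refine ⟨(show EK from v' - (R v' / R (A v₀)) • A v₀), fun _ => ?_, ?_⟩
        · change R (v' - (R v' / R (A v₀)) • A v₀) = 0
          rw [map_sub, map_smul, smul_eq_mul, div_mul_cancel₀ _ hne, sub_self]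
        · set D : EK →L[ℝ] (LinearMap.ker (B : EK →ₗ[ℝ] EN) × W) := dd IK f p with hD
          change D (v' - (R v' / R (A v₀)) • A v₀) = (w₁, w₂)
          have h5 : D (A v₀) = 0 := h4
          rw [map_sub, map_smul, h5, smul_zero, sub_zero]
          exact h1
      · exact ⟨v', fun h => absurd h h0, h1⟩)
  refine ⟨F, hF, fun χ hχ v hv => ?_⟩
  have h1 := (hfd v).symm.trans (hF0 v hv)
  rw [Prod.mk_eq_zero] at h1
  have h2 := hP0 v h1.1
  have h3 : ∀ x, ι n = x → ∀ b : EN, χ (ι n) (mfderiv IN IK ι n b) = χ x (show EK from A b) := by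
    rintro _ rfl b
    rfl
  have h4 := (h3 p hιp (B v)).symm.trans (hχ (B v) h1.2)
  exact (congrArg (χ p) h2).trans h4

end Retraction
end ScatGeom

namespace ScatGeom

section Arctan

/-! ### The function `arctan √z / √z` -/

/-- The smooth function with `x * arctanQuot (x ^ 2) = arctan x`. -/
def arctanQuot (z : ℝ) : ℝ :=
  if |z| < 1 then ∑' n : ℕ, z ^ n * ((-1) ^ n / (2 * n + 1)) else Real.arctan √z / √z

lemma summable_arctanQuot {z : ℝ} (hz : |z| < 1) :
    Summable (fun n : ℕ => z ^ n * ((-1 : ℝ) ^ n / (2 * n + 1))) := by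
  refine Summable.of_norm_bounded (g := fun n : ℕ => |z| ^ n)
    (summable_geometric_of_lt_one (abs_nonneg z) hz) fun n => ?_
  rw [norm_mul, norm_div, norm_pow, norm_pow, norm_neg, norm_one, one_pow, Real.norm_eq_abs,
    Real.norm_eq_abs, abs_of_pos (by positivity : (0 : ℝ) < 2 * n + 1)]
  refine mul_le_of_le_one_right (by positivity) ?_
  rw [div_le_one (by positivity)]
  have : (0 : ℝ) ≤ n := Nat.cast_nonneg n
  linarith

lemma mul_arctanQuot (x : ℝ) : x * arctanQuot (x ^ 2) = Real.arctan x := by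
  unfold arctanQuot
  split_ifs with h
  · have hx : ‖x‖ < 1 := by
      rw [abs_of_nonneg (sq_nonneg x), sq_lt_one_iff_abs_lt_one] at h
      exact h
    refine ((summable_arctanQuot h).hasSum.mul_left x).unique ?_
    convert! Real.hasSum_arctan hx using 2 with n
    push_cast
    ring
  · have hx : x ≠ 0 := by
      rintro rfl
      simp at h
    rw [Real.sqrt_sq_eq_abs]
    rcases abs_cases x with ⟨h1, _⟩ | ⟨h1, _⟩ <;> rw [h1]
    · field_simp
    · rw [Real.arctan_neg]; field_simp

/-- At 0 the defining power series is used, since it continues to negative arguments; for positive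
arguments both cases of the definition agree with the quotient. -/
lemma contDiffAt_arctanQuot {z : ℝ} (hz : 0 ≤ z) : ContDiffAt ℝ ∞ arctanQuot z := by
  rcases hz.eq_or_lt with rfl | hz
  · have h1 : HasFPowerSeriesAt arctanQuot
        (FormalMultilinearSeries.ofScalars ℝ (fun n : ℕ => ((-1 : ℝ) ^ n / (2 * n + 1)))) 0 := by
      rw [hasFPowerSeriesAt_iff]
      have h2 : ∀ᶠ z : ℝ in 𝓝 0, |z| < 1 :=
        (continuous_abs.tendsto' (0 : ℝ) 0 abs_zero).eventually_lt_const one_pos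
      filter_upwards [h2] with z hz
      rw [zero_add, arctanQuot, if_pos hz]
      convert! (summable_arctanQuot hz).hasSum using 2 with n
      simp [FormalMultilinearSeries.coeff_ofScalars]
    exact h1.analyticAt.contDiffAt
  · have h1 : ContDiffAt ℝ ∞ (fun z => Real.arctan √z / √z) z := by
      have h2 : ContDiffAt ℝ ∞ (fun z : ℝ => √z) z := contDiffAt_id.sqrt hz.ne'
      exact ((Real.contDiff_arctan.contDiffAt).comp z h2).div h2 (Real.sqrt_pos.2 hz).ne'
    refine h1.congr_of_eventuallyEq ?_
    filter_upwards [lt_mem_nhds hz] with w hw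
    rw [eq_div_iff (Real.sqrt_pos.2 hw).ne', mul_comm, ← mul_arctanQuot, Real.sq_sqrt hw.le]

/-- Differentiate `x * arctanQuot (x ^ 2) = arctan x` at `x = √z`. This differential equation is
what removes `arctanQuot` from the contact form computations. -/
lemma arctanQuot_add_deriv {z : ℝ} (hz : 0 ≤ z) :
    arctanQuot z + 2 * z * deriv arctanQuot z = (1 + z)⁻¹ := by
  obtain ⟨x, rfl⟩ : ∃ x : ℝ, x ^ 2 = z := ⟨√z, Real.sq_sqrt hz⟩
  have h1 : HasDerivAt arctanQuot (deriv arctanQuot (x ^ 2)) (x ^ 2) :=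
    ((contDiffAt_arctanQuot hz).differentiableAt (by simp)).hasDerivAt
  have h2 : HasDerivAt (fun x : ℝ => x ^ 2) (2 * x) x := by simpa using hasDerivAt_pow 2 x
  have h3 := (hasDerivAt_id x).mul (HasDerivAt.comp (h := fun x : ℝ => x ^ 2) x h1 h2)
  have h4 : (id * (arctanQuot ∘ fun x => x ^ 2)) = Real.arctan := by
    funext x; exact mul_arctanQuot x
  rw [h4] at h3
  have h5 := h3.unique (Real.hasDerivAt_arctan x)
  simp only [one_mul, Function.comp_apply, id] at h5
  rw [← one_div, ← h5]
  ring

/-- The differential of `n ↦ 2 w A(n w²)` that appears in the pull-back of the canonical form. -/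
lemma hasDerivAt_arctanQuot_combination {w n : ℝ → ℝ} {w' n' t : ℝ} (hw : HasDerivAt w w' t)
    (hn : HasDerivAt n n' t) (hpos : 0 ≤ n t) :
    ∃ T' : ℝ, HasDerivAt (fun s => 2 * w s * arctanQuot (n s * w s ^ 2)) T' t ∧
      2 * w t * arctanQuot (n t * w t ^ 2) * (n' / 2) + n t * T' =
        (w t * n' + 2 * n t * w') / (1 + n t * w t ^ 2) := by
  have hz : 0 ≤ n t * w t ^ 2 := by positivity
  have h1 : HasDerivAt arctanQuot (deriv arctanQuot (n t * w t ^ 2)) (n t * w t ^ 2) :=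
    ((contDiffAt_arctanQuot hz).differentiableAt (by simp)).hasDerivAt
  have h2 : HasDerivAt (fun s => n s * w s ^ 2) (n' * w t ^ 2 + n t * (2 * w t * w')) t := by
    exact (hn.mul (hw.pow 2)).congr_deriv (by simp)
  have h3 := (hw.const_mul 2).mul (HasDerivAt.comp t h1 h2)
  refine ⟨_, h3, ?_⟩
  have h4 := arctanQuot_add_deriv hz
  rw [div_eq_mul_inv (w t * n' + _), ← h4]
  simp only [Function.comp_apply]
  ring

end Arctan
end ScatGeom

namespace ScatGeom

section Transit

/-! ### The transit time -/

/-- The time along a covector of length `√n` whose angle is `2 arctan (√n w)`. -/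
def flowTime (w n : ℝ) : ℝ := 2 * w * arctanQuot (n * w ^ 2)

lemma flowTime_eq {r : ℝ} (hr : r ≠ 0) (w : ℝ) :
    flowTime w (r ^ 2) = 2 * Real.arctan (r * w) / r := by
  rw [flowTime, ← mul_pow, ← mul_arctanQuot]
  field_simp

lemma contDiffAt_flowTime {x : ℝ × ℝ} (hx : 0 ≤ x.2) :
    ContDiffAt ℝ ∞ (fun x : ℝ × ℝ => flowTime x.1 x.2) x := by
  have h1 : ContDiffAt ℝ ∞ (fun x : ℝ × ℝ => x.2 * x.1 ^ 2) x :=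
    contDiffAt_snd.mul (contDiffAt_fst.pow 2)
  have h2 : ContDiffAt ℝ ∞ arctanQuot (x.2 * x.1 ^ 2) := contDiffAt_arctanQuot (by positivity)
  exact (contDiffAt_const.mul contDiffAt_fst).mul
    (ContDiffAt.comp (f := fun x : ℝ × ℝ => x.2 * x.1 ^ 2) x h2 h1)

/-- The positive quantity `2λ² cos²((s - s')/2)`. -/
def transitDen (lam t a b n : ℝ) : ℝ := lam ^ 2 - a * b + t * n

/-- The time of transit between the two end points, in terms of `t = tan θ`, `a = τ'`, `b = τ''`
and `n = |μ''|²`. -/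
def transit (lam t a b n : ℝ) : ℝ := flowTime ((a + t * b) / transitDen lam t a b n) n

/-- Put `δ = (s - s') / 2`. The addition formula for the cosine gives `transitDen = 2 λ² cos² δ`;
the one for the sine gives `sin s (a + t b) = λ sin 2δ`. So the argument of the arctangent is `tan
δ`, and `0 < s < π` puts `δ` strictly between `-π/2` and `π/2`, where the arctangent recovers it. -/
lemma transit_eq {lam s s' t : ℝ} (hlam : 0 < lam) (hs : s ∈ Icc 0 Real.pi)
    (hs' : s' ∈ Icc 0 Real.pi) (hpos : 0 < Real.sin s) (ht : t * Real.sin s = Real.sin s') :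
    0 < transitDen lam t (lam * Real.cos s') (-lam * Real.cos s) ((lam * Real.sin s) ^ 2) ∧
    transit lam t (lam * Real.cos s') (-lam * Real.cos s) ((lam * Real.sin s) ^ 2) =
      (s - s') / (lam * Real.sin s) := by
  have hs0 : 0 < s := hs.1.lt_of_ne (by rintro rfl; simp at hpos)
  have hs1 : s < Real.pi := hs.2.lt_of_ne (by rintro rfl; simp at hpos)
  set δ := (s - s') / 2 with hδ
  have hδ1 : -(Real.pi / 2) < δ := by have := hs'.2; rw [hδ]; linarith
  have hδ2 : δ < Real.pi / 2 := by have := hs'.1; rw [hδ]; linarith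
  have hc : 0 < Real.cos δ := Real.cos_pos_of_mem_Ioo ⟨hδ1, hδ2⟩
  have hss : s - s' = 2 * δ := by rw [hδ]; ring
  have hD : transitDen lam t (lam * Real.cos s') (-lam * Real.cos s) ((lam * Real.sin s) ^ 2) =
      2 * lam ^ 2 * Real.cos δ ^ 2 := by
    have h1 := Real.cos_sub s s'
    rw [hss, Real.cos_two_mul, ← ht] at h1
    rw [transitDen]
    linear_combination (-lam ^ 2) * h1
  have hDpos : 0 < 2 * lam ^ 2 * Real.cos δ ^ 2 := by positivity
  refine ⟨by rw [hD]; exact hDpos, ?_⟩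
  rw [transit, flowTime_eq (by positivity), hD]
  have h2 : lam * Real.sin s * ((lam * Real.cos s' + t * (-lam * Real.cos s)) /
      (2 * lam ^ 2 * Real.cos δ ^ 2)) = Real.tan δ := by
    have h1 := Real.sin_sub s s'
    rw [hss, Real.sin_two_mul, ← ht] at h1
    rw [Real.tan_eq_sin_div_cos]
    field_simp
    linear_combination (-1) * h1
  rw [h2, Real.arctan_tan hδ1 hδ2, hss]

end Transit

section LegL

universe u

variable {E : Type u} [NormedAddCommGroup E] [NormedSpace ℝ E] [FiniteDimensional ℝ E]
  {H : Type*} [TopologicalSpace H] {I : ModelWithCorners ℝ E H} [I.Boundaryless]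
  {Z : Type*} [TopologicalSpace Z] [ChartedSpace H Z] [IsManifold I ∞ Z]
  [CompactSpace Z] [T2Space Z]
  (h : ContMDiffRiemannianMetric I ∞ E (fun z : Z => TangentSpace I z)) (lam : ℝ)

/-! ### Equations for `L` -/

variable (I Z) in
/-- The space of the parameters `(θ, τ', τ'', (y'', μ''))`. -/
abbrev LegPar : Type _ := ℝ × ℝ × ℝ × Cot I Z

variable (I) in
/-- The model with corners of `LegPar I Z`. -/
abbrev legParModel := 𝓘(ℝ, ℝ).prod (𝓘(ℝ, ℝ).prod (𝓘(ℝ, ℝ).prod (cotModel I)))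

/-- The parameters of a point. -/
def legCoord (q : FibCot I Z) : LegPar I Z := (q.1, q.2.1.1, q.2.2.1, q.2.2.2)

/-- The transit time in terms of the parameters. -/
def legTime (x : LegPar I Z) : ℝ :=
  transit lam (Real.tan x.1) x.2.1 x.2.2.1 (normSq h x.2.2.2)

/-- The point of `L` with given parameters. -/
def legParam (x : LegPar I Z) : FibCot I Z :=
  (x.1, (x.2.1, (geoFlow h (legTime h lam x) x.2.2.2).scale (-Real.tan x.1)), x.2.2)

/-- The domain of the parameters. -/
def legDom : Set (LegPar I Z) :=
  {x | x.1 ∈ Ioo (-(Real.pi / 2)) (Real.pi / 2) ∧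
    0 < transitDen lam (Real.tan x.1) x.2.1 x.2.2.1 (normSq h x.2.2.2)}

/-- The equations for the parameters of the points of `L`. -/
def legEq (x : LegPar I Z) : ℝ × ℝ :=
  (x.2.2.1 ^ 2 + normSq h x.2.2.2 - lam ^ 2,
    x.2.1 ^ 2 + Real.tan x.1 ^ 2 * normSq h x.2.2.2 - lam ^ 2)

variable {lam}

lemma zero_eq_of_normSq {p : Cot I Z} (hp : normSq h p = 0) : p = Cot.zero p.proj :=
  (normSq_eq_zero h).1 hp

/-- For `θ < π/2` the condition `tan θ sin s = sin s'` forces `sin s > 0`, since otherwise both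
sines would vanish. So `s`, `s'` and the geodesic can be recovered from `τ'`, `τ''` and `(y'',
μ'')`, and `(y', μ')` is reached by the flow for the transit time. The points with `μ'' = 0` are
exactly those of the two families added to `L`. -/
lemma mem_legL_of_lt (hlam : 0 < lam) {q : FibCot I Z} (hq : q.1 ∈ Ico 0 (Real.pi / 2)) :
    q ∈ legL h lam ↔ legCoord q ∈ legDom h lam ∧ legParam h lam (legCoord q) = q ∧
      legEq h lam (legCoord q) = 0 := by
  obtain ⟨θ, ⟨τ', p'⟩, τ'', p''⟩ := q
  have hθ : θ ∈ Ioo (-(Real.pi / 2)) (Real.pi / 2) :=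
    ⟨lt_of_lt_of_le (by linarith [Real.pi_pos]) hq.1, hq.2⟩
  have hcos : 0 < Real.cos θ := Real.cos_pos_of_mem_Ioo hθ
  constructor
  · rintro ((⟨γ, hγ, hγ1, s, hs, s', hs', θ₁, hθ₁, hpos, hsin, heq⟩ | ⟨θ₁, hθ₁, y, heq⟩) |
      ⟨θ₁, hθ₁, y, heq⟩)
    · simp only [Prod.mk.injEq] at heq
      obtain ⟨rfl, ⟨rfl, rfl⟩, rfl, rfl⟩ := heq
      have htan : Real.tan θ * Real.sin s = Real.sin s' := by
        rw [Real.tan_eq_sin_div_cos]; field_simp; exact hsin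
      have hs0 : 0 < Real.sin s := by
        refine (Real.sin_nonneg_of_mem_Icc hs).lt_of_ne fun h0 => ?_
        rw [← h0] at htan hpos
        rw [← htan] at hpos
        simp at hpos
      have hN : normSq h ((γ s).scale (-lam * Real.sin s)) = (lam * Real.sin s) ^ 2 := by
        rw [normSq_scale, hγ.eq_geoFlow h s, normSq_geoFlow, hγ1]; ring
      obtain ⟨hD, hT⟩ := transit_eq hlam hs hs' hs0 htan
      refine ⟨⟨hθ, ?_⟩, ?_, ?_⟩
      · simp only [legCoord, hN]; exact hD
      · have hT' : legTime h lam (legCoord (θ, (lam * Real.cos s', (γ s').scale (lam * Real.sin s')),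
            (-lam * Real.cos s, (γ s).scale (-lam * Real.sin s)))) = (s - s') / (lam * Real.sin s) := by
          simp only [legTime, legCoord, hN]; exact hT
        simp only [legParam, hT']
        simp only [legCoord, Prod.mk.injEq, true_and, and_true]
        rw [geoFlow_scale, scale_scale]
        have e1 : (s - s') / (lam * Real.sin s) * (-lam * Real.sin s) = s' - s := by
          field_simp; ring
        have e2 : -Real.tan θ * (-lam * Real.sin s) = lam * Real.sin s' := by
          rw [← htan]; ring
        rw [e1, e2, hγ.eq_geoFlow h s, ← geoFlow_add, sub_add_cancel, ← hγ.eq_geoFlow h s']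
      · simp only [legEq, legCoord, hN, Prod.mk_eq_zero]
        have e3 := Real.sin_sq_add_cos_sq s
        have e4 := Real.sin_sq_add_cos_sq s'
        rw [← htan] at e4
        constructor
        · linear_combination lam ^ 2 * e3
        · linear_combination lam ^ 2 * e4
    · simp only [Prod.mk.injEq] at heq
      obtain ⟨rfl, ⟨rfl, rfl⟩, rfl, rfl⟩ := heq
      refine ⟨⟨hθ, ?_⟩, ?_, ?_⟩
      · simp only [legCoord, normSq_zero, transitDen]; nlinarith
      · simp [legParam, legCoord]
      · simp [legEq, legCoord]
    · simp only [Prod.mk.injEq] at heq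
      obtain ⟨rfl, ⟨rfl, rfl⟩, rfl, rfl⟩ := heq
      refine ⟨⟨hθ, ?_⟩, ?_, ?_⟩
      · simp only [legCoord, normSq_zero, transitDen]; nlinarith
      · simp [legParam, legCoord]
      · simp [legEq, legCoord]
  · rintro ⟨⟨-, hD⟩, hpar, heq⟩
    simp only [legEq, legCoord, Prod.mk_eq_zero] at heq
    obtain ⟨h1, h2⟩ := heq
    simp only [legCoord] at hD
    have hp' : p' = (geoFlow h (legTime h lam (legCoord (θ, (τ', p'), τ'', p''))) p'').scale
        (-Real.tan θ) := by
      have := congrArg (fun q : FibCot I Z => q.2.1.2) hpar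
      exact this.symm
    have hθ' : θ ∈ Icc 0 (Real.pi / 2) := ⟨hq.1, hq.2.le⟩
    have htan0 : 0 ≤ Real.tan θ := Real.tan_nonneg_of_nonneg_of_le_pi_div_two hq.1 hq.2.le
    rcases (normSq_nonneg h p'').eq_or_lt with h0 | h0
    · have hz : p'' = Cot.zero p''.proj := zero_eq_of_normSq h h0.symm
      rw [hz, geoFlow_zero, scale_zero_section] at hp'
      rw [← h0] at h1 h2 hD
      have hab : τ' ^ 2 = lam ^ 2 := by linarith
      have hbb : τ'' ^ 2 = lam ^ 2 := by linarith
      simp only [transitDen, mul_zero, add_zero] at hD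
      -- With `μ'' = 0` both `τ'` and `τ''` are `±λ`. Equal signs would make `transitDen = λ² -
      -- τ'τ''` vanish; opposite signs give the two added families.
      rcases sq_eq_sq_iff_eq_or_eq_neg.1 hab with ha | ha <;>
        rcases sq_eq_sq_iff_eq_or_eq_neg.1 hbb with hb | hb
      · rw [ha, hb] at hD; nlinarith
      · exact Or.inl (Or.inr ⟨θ, hθ', p''.proj, by rw [ha, hb, hp', ← hz]⟩)
      · exact Or.inr ⟨θ, hθ', p''.proj, by rw [ha, hb, hp', ← hz]⟩
      · rw [ha, hb] at hD; nlinarith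
    · set r := √(normSq h p'') with hr
      have hr0 : 0 < r := Real.sqrt_pos.2 h0
      have hr2 : r ^ 2 = normSq h p'' := Real.sq_sqrt h0.le
      rw [← hr2] at h1 h2
      set s := Real.arccos (-τ'' / lam) with hs
      set s' := Real.arccos (τ' / lam) with hs'
      have hb1 : τ'' ^ 2 ≤ lam ^ 2 := by nlinarith
      have ha1 : τ' ^ 2 ≤ lam ^ 2 := by nlinarith [sq_nonneg (Real.tan θ * r)]
      obtain ⟨hb2, hb3⟩ := abs_le.1 (abs_le_of_sq_le_sq hb1 hlam.le)
      obtain ⟨ha2, ha3⟩ := abs_le.1 (abs_le_of_sq_le_sq ha1 hlam.le)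
      have hcs : lam * Real.cos s = -τ'' := by
        rw [hs, Real.cos_arccos (by rw [le_div_iff₀ hlam]; linarith)
          (by rw [div_le_iff₀ hlam]; linarith)]
        field_simp
      have hcs' : lam * Real.cos s' = τ' := by
        rw [hs', Real.cos_arccos (by rw [le_div_iff₀ hlam]; linarith)
          (by rw [div_le_iff₀ hlam]; linarith)]
        field_simp
      have hsI : s ∈ Icc 0 Real.pi := ⟨Real.arccos_nonneg _, Real.arccos_le_pi _⟩
      have hsI' : s' ∈ Icc 0 Real.pi := ⟨Real.arccos_nonneg _, Real.arccos_le_pi _⟩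
      have hsn : lam * Real.sin s = r := by
        have e1 := Real.sin_sq_add_cos_sq s
        have e2 := Real.sin_nonneg_of_mem_Icc hsI
        have e3 : (lam * Real.sin s) ^ 2 = r ^ 2 := by
          have : (lam * Real.cos s) ^ 2 = τ'' ^ 2 := by rw [hcs]; ring
          linear_combination lam ^ 2 * e1 - this - h1
        exact (sq_eq_sq₀ (by positivity) hr0.le).1 e3
      have hsn' : lam * Real.sin s' = Real.tan θ * r := by
        have e1 := Real.sin_sq_add_cos_sq s'
        have e2 := Real.sin_nonneg_of_mem_Icc hsI'
        have e3 : (lam * Real.sin s') ^ 2 = (Real.tan θ * r) ^ 2 := by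
          have : (lam * Real.cos s') ^ 2 = τ' ^ 2 := by rw [hcs']
          linear_combination lam ^ 2 * e1 - this - h2
        exact (sq_eq_sq₀ (by positivity) (by positivity)).1 e3
      have hs0 : 0 < Real.sin s := by
        by_contra hc
        nlinarith
      have htan : Real.tan θ * Real.sin s = Real.sin s' := by
        have : lam * (Real.tan θ * Real.sin s) = lam * Real.sin s' := by
          rw [hsn', ← hsn]; ring
        exact mul_left_cancel₀ hlam.ne' this
      obtain ⟨-, hT⟩ := transit_eq hlam hsI hsI' hs0 htan
      have hT' : legTime h lam (legCoord (θ, (τ', p'), τ'', p'')) = (s - s') / r := by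
        rw [← hsn, ← hT, hsn, hr2, hcs', neg_mul, hcs, neg_neg]
        rfl
      rw [hT'] at hp'
      -- On `L` the covector `μ''` is `-λ sin s` times the unit covector at time `s`, and `r = λ sin
      -- s`. So `-μ''/r` is that unit covector, and flowing back for the time `s` gives the initial
      -- one.
      set p₀ := geoFlow h (-s) (p''.scale (-r⁻¹)) with hp₀
      have hγ : ∀ t, geoFlow h t p₀ = (geoFlow h ((s - t) / r) p'').scale (-r⁻¹) := by
        intro t
        rw [hp₀, ← geoFlow_add, geoFlow_scale]
        congr 2
        field_simp
        ring
      refine Or.inl (Or.inl ⟨fun t => geoFlow h t p₀, isGeodesicOrbit_geoFlow h p₀, ?_, s, hsI, s',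
        hsI', θ, hθ', ?_, ?_, ?_⟩)
      · rw [normSq_geoFlow, hp₀, normSq_geoFlow, normSq_scale, ← hr2]; field_simp
      · positivity
      · rw [← htan, Real.tan_eq_sin_div_cos]; field_simp
      · rw [hcs', neg_mul, hcs, neg_neg, neg_mul, hsn, hsn']
        simp only [hγ, scale_scale, sub_self, zero_div, geoFlow_zero_time]
        rw [hp']
        have e1 : -r * -r⁻¹ = 1 := by field_simp
        have e2 : Real.tan θ * r * -r⁻¹ = -Real.tan θ := by field_simp
        rw [e1, e2, scale_one]

end LegL
end ScatGeom

namespace ScatGeom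

section Transport

variable {EK : Type*} [NormedAddCommGroup EK] [NormedSpace ℝ EK]
  {HK : Type*} [TopologicalSpace HK] {IK : ModelWithCorners ℝ EK HK}
  {K : Type*} [TopologicalSpace K] [ChartedSpace HK K]
  {EN : Type*} [NormedAddCommGroup EN] [NormedSpace ℝ EN]
  {HN : Type*} [TopologicalSpace HN] {IN : ModelWithCorners ℝ EN HN}
  {N : Type*} [TopologicalSpace N] [ChartedSpace HN N]

/-! ### Transport of submanifolds -/

/-- Defining equations pull back under a submersion. It serves for the exchange of the two factors
and for the identification of the bundle over the interior of bf with a scattering cotangent bundle.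
In the second case the boundary is absent, hence the weak compatibility asked of `ρ` and `ρ'`. -/
lemma CutsOut.comp {σ : N → K} {ρ : K → ℝ} {ρ' : N → ℝ} {S : Set K} {S' : Set N} {p : N} {c : ℕ}
    {F : K → Fin c → ℝ} (hF : CutsOut IK ρ S (σ p) F) {U : Set N} (hU : IsOpen U) (hp : p ∈ U)
    (hσ : ContMDiffOn IN IK ∞ σ U) (hd : Function.Surjective (mfderiv IN IK σ p))
    (hS : ∀ q ∈ U, q ∈ S' ↔ σ q ∈ S) (hρ : ∀ q ∈ U, 0 ≤ ρ' q ↔ 0 ≤ ρ (σ q))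
    (hρ0 : ρ' p = 0 → MDifferentiableAt IK 𝓘(ℝ, ℝ) ρ (σ p) ∧ ρ' = fun q => ρ (σ q)) :
    CutsOut IN ρ' S' p (fun q => F (σ q)) ∧ ∀ v : TangentSpace IN p,
      dd IN (fun q => F (σ q)) p v = dd IK F (σ p) (mfderiv IN IK σ p v) := by
  obtain ⟨V, hV, hpV, hFV, hSV⟩ := hF.exists_nhds
  have hσp : MDifferentiableAt IN IK σ p :=
    ((hσ p hp).contMDiffAt (hU.mem_nhds hp)).mdifferentiableAt (by simp)
  have hFp : MDifferentiableAt IK 𝓘(ℝ, Fin c → ℝ) F (σ p) :=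
    ((hFV _ hpV).contMDiffAt (hV.mem_nhds hpV)).mdifferentiableAt (by simp)
  have hcomp : ∀ v : TangentSpace IN p,
      dd IN (fun q => F (σ q)) p v = dd IK F (σ p) (mfderiv IN IK σ p v) :=
    fun v => dd_comp_mfderiv hFp hσp v
  refine ⟨⟨⟨U ∩ σ ⁻¹' V, hσ.continuousOn.isOpen_inter_preimage hU hV, ⟨hp, hpV⟩, ?_, ?_⟩, ?_, ?_⟩,
    hcomp⟩
  · exact hFV.comp (hσ.mono inter_subset_left) fun q hq => hq.2
  · intro q hq
    rw [hS q hq.1, hSV _ hq.2, hρ q hq.1]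
  · intro w
    obtain ⟨u, hu⟩ := hF.independent w
    obtain ⟨v, hv⟩ := hd u
    exact ⟨v, (hcomp v).trans ((congrArg (dd IK F (σ p)) hv).trans hu)⟩
  · intro h0 w
    obtain ⟨hρd, rfl⟩ := hρ0 h0
    obtain ⟨u, hu0, hu⟩ := hF.transversal h0 w
    obtain ⟨v, hv⟩ := hd u
    exact ⟨v, (dd_comp_mfderiv hρd hσp v).trans ((congrArg (dd IK ρ (σ p)) hv).trans hu0),
      (hcomp v).trans ((congrArg (dd IK F (σ p)) hv).trans hu)⟩

lemma surjective_mfderiv_of_inverse {σ : N → K} {τ : K → N} {p : N}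
    (hσ : MDifferentiableAt IN IK σ p) (hτ : MDifferentiableAt IK IN τ (σ p))
    (hp : τ (σ p) = p) (hid : ∀ᶠ q in 𝓝 (σ p), σ (τ q) = q) :
    Function.Surjective (mfderiv IN IK σ p) := by
  have h1 : ∀ p', τ (σ p) = p' → MDifferentiableAt IN IK σ p' → ∀ w : EK,
      (show EN →L[ℝ] EK from mfderiv IN IK σ p')
        ((show EK →L[ℝ] EN from mfderiv IK IN τ (σ p)) w) = w := by
    rintro _ rfl hs w
    have h2 := mfderiv_comp (σ p) hs hτ
    have h3 : mfderiv IK IK (σ ∘ τ) (σ p) = ContinuousLinearMap.id ℝ (TangentSpace IK (σ p)) := by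
      have h4 : σ ∘ τ =ᶠ[𝓝 (σ p)] id := hid
      refine HasMFDerivAt.mfderiv ?_
      exact (hasMFDerivAt_id (σ p)).congr_of_eventuallyEq h4
    exact (congrArg (fun A => (show EK →L[ℝ] EK from A) w) h2).symm.trans
      (congrArg (fun A => (show EK →L[ℝ] EK from A) w) h3)
  exact fun w => ⟨_, h1 p hp hσ w⟩

end Transport

/-! ### Pull-backs of the contact forms -/

section LegL

universe u

variable {E : Type u} [NormedAddCommGroup E] [NormedSpace ℝ E] [FiniteDimensional ℝ E]
  {H : Type*} [TopologicalSpace H] {I : ModelWithCorners ℝ E H} [I.Boundaryless]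
  {Z : Type*} [TopologicalSpace Z] [ChartedSpace H Z] [IsManifold I ∞ Z]
  {EK : Type*} [NormedAddCommGroup EK] [NormedSpace ℝ EK]
  {HK : Type*} [TopologicalSpace HK] {IK : ModelWithCorners ℝ EK HK}
  {K : Type*} [TopologicalSpace K] [ChartedSpace HK K]

lemma contactForm_mfderiv {f : K → ScCot I Z} {k : K} (hf : MDifferentiableAt IK (scModel I) f k)
    (v : TangentSpace IK k) :
    contactForm (f k) (mfderiv IK (scModel I) f k v) =
      dd IK (fun k => (f k).1) k v + pullForm IK (fun k => (f k).2) k v := by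
  have h1 := dd_comp_mfderiv (f := fun w : ScCot I Z => w.1) (φ := f) mdifferentiableAt_fst hf v
  have h2 := mfderiv_comp (g := fun w : ScCot I Z => w.2) k mdifferentiableAt_snd hf
  exact congrArg₂ (· + ·) h1.symm (congrArg (fun A => canonicalForm (f k).2 (A v)) h2).symm

lemma pullForm_comp {EN : Type*} [NormedAddCommGroup EN] [NormedSpace ℝ EN]
    {HN : Type*} [TopologicalSpace HN] {IN : ModelWithCorners ℝ EN HN}
    {N : Type*} [TopologicalSpace N] [ChartedSpace HN N] {φ : N → Cot I Z} {f : K → N} {k : K}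
    (hφ : MDifferentiableAt IN (cotModel I) φ (f k)) (hf : MDifferentiableAt IK IN f k)
    (v : TangentSpace IK k) :
    pullForm IK (fun k => φ (f k)) k v =
      canonicalForm (φ (f k)) (mfderiv IN (cotModel I) φ (f k) (mfderiv IK IN f k v)) :=
  congrArg (fun A : TangentSpace IK k →L[ℝ] TangentSpace (cotModel I) (φ (f k)) =>
    canonicalForm (φ (f k)) (A v)) (mfderiv_comp k hφ hf)

lemma contMDiff_totalTau : ContMDiff (fibModel I) 𝓘(ℝ, ℝ) ∞ (totalTau : FibCot I Z → ℝ) := by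
  have h1 : ContMDiff (fibModel I) 𝓘(ℝ, ℝ) ∞ (fun q : FibCot I Z => q.1) := contMDiff_fst
  have h2 : ContMDiff (fibModel I) 𝓘(ℝ, ℝ) ∞ (fun q : FibCot I Z => q.2.1.1) :=
    contMDiff_fst.comp (contMDiff_fst.comp contMDiff_snd)
  have h3 : ContMDiff (fibModel I) 𝓘(ℝ, ℝ) ∞ (fun q : FibCot I Z => q.2.2.1) :=
    contMDiff_fst.comp (contMDiff_snd.comp contMDiff_snd)
  exact (h2.mul (Real.contDiff_cos.contMDiff.comp h1)).add
    (h3.mul (Real.contDiff_sin.contMDiff.comp h1))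

lemma fibContactForm_mfderiv {f : K → FibCot I Z} {k : K}
    (hf : MDifferentiableAt IK (fibModel I) f k) (v : TangentSpace IK k) :
    fibContactForm (f k) (mfderiv IK (fibModel I) f k v) =
      dd IK (fun k => totalTau (f k)) k v + totalEta (f k) * dd IK (fun k => (f k).1) k v +
        Real.cos (f k).1 * pullForm IK (fun k => (f k).2.1.2) k v +
        Real.sin (f k).1 * pullForm IK (fun k => (f k).2.2.2) k v := by
  have h0 := dd_comp_mfderiv (f := (totalTau : FibCot I Z → ℝ)) (φ := f)
    (contMDiff_totalTau.mdifferentiableAt (by simp)) hf v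
  have h1 := dd_comp_mfderiv (f := fun w : FibCot I Z => w.1) (φ := f) mdifferentiableAt_fst hf v
  have h2 := pullForm_comp (φ := fun w : FibCot I Z => w.2.1.2)
    ((contMDiff_snd.comp (contMDiff_fst.comp contMDiff_snd) : ContMDiff (fibModel I) (cotModel I) ∞
      (fun w : FibCot I Z => w.2.1.2)).mdifferentiableAt (by simp)) hf v
  have h3 := pullForm_comp (φ := fun w : FibCot I Z => w.2.2.2)
    ((contMDiff_snd.comp (contMDiff_snd.comp contMDiff_snd) : ContMDiff (fibModel I) (cotModel I) ∞
      (fun w : FibCot I Z => w.2.2.2)).mdifferentiableAt (by simp)) hf v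
  rw [h0, h1, h2, h3]
  rfl

variable [CompactSpace Z] [T2Space Z]
  (h : ContMDiffRiemannianMetric I ∞ E (fun z : Z => TangentSpace I z))

/-- The correction from `pullForm_geoFlow` involves `arctanQuot` and its derivative, but only in the
combination governed by `arctanQuot_add_deriv`. What remains is rational in `w` and the squared
length, so the Legendre conditions become algebra. -/
lemma pullForm_geoFlow_flowTime [IK.Boundaryless] [IsManifold IK ∞ K] {f : K → Cot I Z} {w : K → ℝ}
    {k : K} (hf : MDifferentiableAt IK (cotModel I) f k) (hw : MDifferentiableAt IK 𝓘(ℝ, ℝ) w k)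
    (v : TangentSpace IK k) :
    pullForm IK (fun k => geoFlow h (flowTime (w k) (normSq h (f k))) (f k)) k v =
      pullForm IK f k v + (w k * dd IK (fun k => normSq h (f k)) k v +
        2 * normSq h (f k) * dd IK w k v) / (1 + normSq h (f k) * w k ^ 2) := by
  have hn : MDifferentiableAt IK 𝓘(ℝ, ℝ) (fun k => normSq h (f k)) k :=
    MDifferentiableAt.comp (g := fun p => normSq h p) k
      ((contMDiff_normSq h).mdifferentiableAt (by simp)) hf
  have hT : MDifferentiableAt IK 𝓘(ℝ, ℝ) (fun k => flowTime (w k) (normSq h (f k))) k := by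
    have h1 : MDifferentiableAt 𝓘(ℝ, ℝ × ℝ) 𝓘(ℝ, ℝ) (fun x : ℝ × ℝ => flowTime x.1 x.2)
        (w k, normSq h (f k)) :=
      ((contDiffAt_flowTime (normSq_nonneg h (f k))).differentiableAt
        (by simp)).mdifferentiableAt
    exact MDifferentiableAt.comp (f := fun k => (w k, normSq h (f k))) k h1 (hw.prodMk_space hn)
  rw [pullForm_geoFlow h hf hT v]
  obtain ⟨c, -, hc, hk, rfl⟩ := exists_curve k v
  have d1 := hasDerivAt_velAt hk hc hw
  have d2 := hasDerivAt_velAt hk hc hn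
  obtain ⟨T', hT', he⟩ := hasDerivAt_arctanQuot_combination d1 d2 (by
    simp only [hk]; exact normSq_nonneg h (f k))
  have e1 : dd IK (fun k => flowTime (w k) (normSq h (f k))) k (velAt hk) = T' :=
    dd_velAt hk hc hT hT'
  have hn2 : MDifferentiableAt IK 𝓘(ℝ, ℝ) (fun k => normSq h (f k) / 2) k :=
    MDifferentiableAt.comp (g := fun p => normSq h p / 2) k
      ((contMDiff_energy h).mdifferentiableAt (by simp)) hf
  have e2 : dd IK (fun k => normSq h (f k) / 2) k (velAt hk) =
      dd IK (fun k => normSq h (f k)) k (velAt hk) / 2 :=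
    dd_velAt hk hc hn2 (d2.div_const 2)
  simp only [hk] at he
  rw [← he, ← e1, ← e2, ← add_assoc]
  rfl

end LegL
end ScatGeom

namespace ScatGeom

/-! ### Algebraic identities for the transit time -/

section Algebra

/-- This is `cos² δ + sin² δ = 1` in the variables of `transit_eq`. Divided by the square of
`transitDen`, it evaluates the denominator `1 + n w²` as `2 λ² / transitDen`. -/
lemma transit_sq {lam T a b n : ℝ} (e1 : b ^ 2 + n - lam ^ 2 = 0)
    (e2 : a ^ 2 + T ^ 2 * n - lam ^ 2 = 0) :
    transitDen lam T a b n ^ 2 + n * (a + T * b) ^ 2 = 2 * lam ^ 2 * transitDen lam T a b n := by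
  rw [transitDen]
  linear_combination (n + b ^ 2) * e2 + lam ^ 2 * e1

/-- The vanishing of the contact form on `L` divided by `cos θ`. The terms `dτ + η dθ` reduce to
`cos θ dτ' + sin θ dτ''`, which is the left side. The canonical forms of the two factors cancel
because `μ'` carries the factor `-tan θ`, and the correction from the variable flow time is the
right side. Primes denote derivatives along a curve, constrained by `d1` and `d2`. -/
lemma transit_contact {lam T a b n T' a' b' n' D : ℝ} (hlam : lam ≠ 0) (hD : D ≠ 0)
    (hDe : D = transitDen lam T a b n)
    (e1 : b ^ 2 + n - lam ^ 2 = 0) (e2 : a ^ 2 + T ^ 2 * n - lam ^ 2 = 0)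
    (d1 : 2 * b * b' + n' = 0) (d2 : 2 * a * a' + (2 * T * T' * n + T ^ 2 * n') = 0) :
    a' + T * b' = T * (((a + T * b) / D * n' + 2 * n * (((a' + (T' * b + T * b')) * D -
      (a + T * b) * (-(a' * b + a * b') + (T' * n + T * n'))) / D ^ 2)) /
        (1 + n * ((a + T * b) / D) ^ 2)) := by
  have h1 := transit_sq e1 e2
  rw [← hDe] at h1
  have h2 : 1 + n * ((a + T * b) / D) ^ 2 = 2 * lam ^ 2 / D := by
    field_simp
    linear_combination h1
  rw [h2]
  field_simp
  have hn : n = lam ^ 2 - b ^ 2 := by linarith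
  have hn' : n' = -2 * b * b' := by linarith
  rw [transitDen] at hDe
  subst hDe hn hn'
  linear_combination (lam ^ 2 * (a - b)) * d2 - 2 * lam ^ 2 * (a' + T * b') * e2

end Algebra

section LegL

universe u

variable {E : Type u} [NormedAddCommGroup E] [NormedSpace ℝ E] [FiniteDimensional ℝ E]
  {H : Type*} [TopologicalSpace H] {I : ModelWithCorners ℝ E H} [I.Boundaryless]
  {Z : Type*} [TopologicalSpace Z] [ChartedSpace H Z] [IsManifold I ∞ Z]
  [CompactSpace Z] [T2Space Z]
  (h : ContMDiffRiemannianMetric I ∞ E (fun z : Z => TangentSpace I z)) {lam : ℝ}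

/-! ### `L` as a submanifold -/

lemma contMDiff_legCoord : ContMDiff (fibModel I) (legParModel I) ∞ (legCoord (I := I) (Z := Z)) :=
  contMDiff_fst.prodMk ((contMDiff_fst.comp (contMDiff_fst.comp contMDiff_snd)).prodMk
    (contMDiff_snd.comp contMDiff_snd))

lemma contMDiff_legPar :
    ContMDiff (legParModel I) 𝓘(ℝ, ℝ) ∞ (fun x : LegPar I Z => x.1) ∧
    ContMDiff (legParModel I) 𝓘(ℝ, ℝ) ∞ (fun x : LegPar I Z => x.2.1) ∧
    ContMDiff (legParModel I) 𝓘(ℝ, ℝ) ∞ (fun x : LegPar I Z => x.2.2.1) ∧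
    ContMDiff (legParModel I) (cotModel I) ∞ (fun x : LegPar I Z => x.2.2.2) :=
  ⟨contMDiff_fst, contMDiff_fst.comp contMDiff_snd,
    contMDiff_fst.comp (contMDiff_snd.comp contMDiff_snd),
    contMDiff_snd.comp (contMDiff_snd.comp contMDiff_snd)⟩

lemma contMDiff_legPar_normSq :
    ContMDiff (legParModel I) 𝓘(ℝ, ℝ) ∞ (fun x : LegPar I Z => normSq h x.2.2.2) :=
  (contMDiff_normSq h).comp contMDiff_legPar.2.2.2

lemma contMDiffAt_legPar_tan {x : LegPar I Z} (hx : x.1 ∈ Ioo (-(Real.pi / 2)) (Real.pi / 2)) :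
    ContMDiffAt (legParModel I) 𝓘(ℝ, ℝ) ∞ (fun x : LegPar I Z => Real.tan x.1) x :=
  ContMDiffAt.comp (g := Real.tan) x
    (Real.contDiffAt_tan.2 (Real.cos_pos_of_mem_Ioo hx).ne').contMDiffAt contMDiff_legPar.1.contMDiffAt

lemma contMDiffAt_legDen {x : LegPar I Z} (hx : x.1 ∈ Ioo (-(Real.pi / 2)) (Real.pi / 2)) :
    ContMDiffAt (legParModel I) 𝓘(ℝ, ℝ) ∞ (fun x : LegPar I Z =>
      transitDen lam (Real.tan x.1) x.2.1 x.2.2.1 (normSq h x.2.2.2)) x :=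
  (contMDiffAt_const.sub (contMDiff_legPar.2.1.contMDiffAt.mul
    contMDiff_legPar.2.2.1.contMDiffAt)).add
      ((contMDiffAt_legPar_tan hx).mul (contMDiff_legPar_normSq h).contMDiffAt)

lemma isOpen_legDom : IsOpen (legDom h lam) := by
  rw [isOpen_iff_mem_nhds]
  rintro x ⟨hx1, hx2⟩
  filter_upwards [(isOpen_Ioo.preimage continuous_fst).mem_nhds hx1,
    (contMDiffAt_legDen h hx1).continuousAt.preimage_mem_nhds (isOpen_Ioi.mem_nhds hx2)]
    with y hy1 hy2
  exact ⟨hy1, hy2⟩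

/-- The tangent of half the angle of transit, divided by the length. -/
def legW (lam : ℝ) (x : LegPar I Z) : ℝ :=
  (x.2.1 + Real.tan x.1 * x.2.2.1) /
    transitDen lam (Real.tan x.1) x.2.1 x.2.2.1 (normSq h x.2.2.2)

lemma contMDiffAt_legW {x : LegPar I Z} (hx : x ∈ legDom h lam) :
    ContMDiffAt (legParModel I) 𝓘(ℝ, ℝ) ∞ (legW h lam) x :=
  (contMDiff_legPar.2.1.contMDiffAt.add ((contMDiffAt_legPar_tan hx.1).mul
    contMDiff_legPar.2.2.1.contMDiffAt)).div₀ (contMDiffAt_legDen h hx.1) hx.2.ne'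

lemma contMDiffAt_flowTime {EK : Type*} [NormedAddCommGroup EK] [NormedSpace ℝ EK]
    {HK : Type*} [TopologicalSpace HK] {IK : ModelWithCorners ℝ EK HK}
    {K : Type*} [TopologicalSpace K] [ChartedSpace HK K] {w n : K → ℝ} {k : K}
    (hw : ContMDiffAt IK 𝓘(ℝ, ℝ) ∞ w k) (hn : ContMDiffAt IK 𝓘(ℝ, ℝ) ∞ n k) (h0 : 0 ≤ n k) :
    ContMDiffAt IK 𝓘(ℝ, ℝ) ∞ (fun k => flowTime (w k) (n k)) k :=
  ContMDiffAt.comp (g := fun x : ℝ × ℝ => flowTime x.1 x.2) (f := fun k => (w k, n k)) k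
    (contDiffAt_flowTime h0).contMDiffAt (hw.prodMk_space hn)

lemma contMDiffAt_legFlow {x : LegPar I Z} (hx : x ∈ legDom h lam) :
    ContMDiffAt (legParModel I) (cotModel I) ∞
      (fun x : LegPar I Z => geoFlow h (legTime h lam x) x.2.2.2) x :=
  ContMDiffAt.comp (g := fun z : ℝ × Cot I Z => geoFlow h z.1 z.2)
    (f := fun x : LegPar I Z => (legTime h lam x, x.2.2.2)) x (contMDiff_geoFlow h).contMDiffAt
    ((contMDiffAt_flowTime (contMDiffAt_legW h hx) (contMDiff_legPar_normSq h).contMDiffAt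
      (normSq_nonneg h _)).prodMk contMDiff_legPar.2.2.2.contMDiffAt)

lemma contMDiffAt_legParam {x : LegPar I Z} (hx : x ∈ legDom h lam) :
    ContMDiffAt (legParModel I) (fibModel I) ∞ (legParam h lam) x :=
  contMDiff_legPar.1.contMDiffAt.prodMk ((contMDiff_legPar.2.1.contMDiffAt.prodMk
    (ContMDiffAt.cotScale (contMDiffAt_legPar_tan hx.1).neg (contMDiffAt_legFlow h hx))).prodMk
      (contMDiff_snd.comp contMDiff_snd).contMDiffAt)

lemma contMDiffAt_legEq {x : LegPar I Z} (hx : x.1 ∈ Ioo (-(Real.pi / 2)) (Real.pi / 2)) :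
    ContMDiffAt (legParModel I) 𝓘(ℝ, ℝ × ℝ) ∞ (legEq h lam) x :=
  (((contMDiff_legPar.2.2.1.contMDiffAt.pow 2).add
    (contMDiff_legPar_normSq h).contMDiffAt).sub contMDiffAt_const).prodMk_space
      (((contMDiff_legPar.2.1.contMDiffAt.pow 2).add (((contMDiffAt_legPar_tan hx).pow 2).mul
        (contMDiff_legPar_normSq h).contMDiffAt)).sub contMDiffAt_const)

/-- Scaling `(τ'', μ'')` changes the first equation at the rate `2 λ²`. The second equation is
changed alone by moving `τ'` if `τ' ≠ 0`. If `τ' = 0`, the equation says `tan² θ |μ''|² = λ²`, so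
moving `θ` works. -/
lemma legEq_surjective (hlam : 0 < lam) {x : LegPar I Z} (hx : x ∈ legDom h lam)
    (hx0 : legEq h lam x = 0) (w : ℝ × ℝ) :
    ∃ v : TangentSpace (legParModel I) x, dd (legParModel I) (legEq h lam) x v = w := by
  obtain ⟨θ, a, b, p⟩ := x
  have hg := (contMDiffAt_legEq h (lam := lam) hx.1).mdifferentiableAt (by simp)
  simp only [legEq, Prod.mk_eq_zero] at hx0
  obtain ⟨e1, e2⟩ := hx0
  have hcos : Real.cos θ ≠ 0 := (Real.cos_pos_of_mem_Ioo hx.1).ne'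
  obtain ⟨v₁, α, hα, hv₁⟩ : ∃ (v : TangentSpace (legParModel I) (θ, a, b, p)) (α : ℝ), α ≠ 0 ∧
      dd (legParModel I) (legEq h lam) (θ, a, b, p) v = (0, α) := by
    by_cases ha : a = 0
    · set c : ℝ → LegPar I Z := fun t => (θ + t, a, b, p) with hc
      have hc0 : c 0 = (θ, a, b, p) := by simp [hc]
      have hcd : MDifferentiableAt 𝓘(ℝ, ℝ) (legParModel I) c 0 :=
        MDifferentiableAt.prodMk (differentiableAt_id.const_add θ).mdifferentiableAt
          mdifferentiableAt_const
      refine ⟨velAt hc0, 2 * Real.tan θ * (1 / Real.cos θ ^ 2) * normSq h p, ?_,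
        dd_velAt hc0 hcd hg ?_⟩
      · have h0 : Real.tan θ ^ 2 * normSq h p ≠ 0 := by
          rw [ha] at e2
          have : Real.tan θ ^ 2 * normSq h p = lam ^ 2 := by linarith
          rw [this]; positivity
        have h1 : Real.tan θ ≠ 0 := fun h => h0 (by rw [h]; ring)
        have h2 : normSq h p ≠ 0 := fun h => h0 (by rw [h]; ring)
        positivity
      · have h1 : HasDerivAt (fun t => Real.tan (θ + t)) (1 / Real.cos θ ^ 2) 0 := by
          have := HasDerivAt.comp (h := fun t => θ + t) (0 : ℝ)
            (Real.hasDerivAt_tan (x := θ + 0) (by simpa using hcos)) ((hasDerivAt_id (0 : ℝ)).const_add θ)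
          exact this.congr_deriv (by simp)
        have h2 := (((h1.pow 2).mul_const (normSq h p)).const_add (a ^ 2)).sub_const (lam ^ 2)
        refine (hasDerivAt_const (0 : ℝ) (b ^ 2 + normSq h p - lam ^ 2)).prodMk (h2.congr_deriv ?_)
        simp
    · set c : ℝ → LegPar I Z := fun t => (θ, a + t, b, p) with hc
      have hc0 : c 0 = (θ, a, b, p) := by simp [hc]
      have hcd : MDifferentiableAt 𝓘(ℝ, ℝ) (legParModel I) c 0 :=
        MDifferentiableAt.prodMk mdifferentiableAt_const
          (MDifferentiableAt.prodMk (differentiableAt_id.const_add a).mdifferentiableAt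
            mdifferentiableAt_const)
      refine ⟨velAt hc0, 2 * a, by positivity, dd_velAt hc0 hcd hg ?_⟩
      have h1 : HasDerivAt (fun t => a + t) 1 0 := (hasDerivAt_id (0 : ℝ)).const_add a
      have h2 := ((h1.pow 2).add_const (Real.tan θ ^ 2 * normSq h p)).sub_const (lam ^ 2)
      refine (hasDerivAt_const (0 : ℝ) (b ^ 2 + normSq h p - lam ^ 2)).prodMk (h2.congr_deriv ?_)
      simp
  obtain ⟨v₂, γ, hv₂⟩ : ∃ (v : TangentSpace (legParModel I) (θ, a, b, p)) (γ : ℝ),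
      dd (legParModel I) (legEq h lam) (θ, a, b, p) v = (2 * lam ^ 2, γ) := by
    set c : ℝ → LegPar I Z := fun t => (θ, a, (1 + t) * b, p.scale (1 + t)) with hc
    have hc0 : c 0 = (θ, a, b, p) := by simp [hc, scale_one]
    have h1 : ContDiff ℝ ∞ fun t : ℝ => 1 + t := by fun_prop
    have hcd : MDifferentiableAt 𝓘(ℝ, ℝ) (legParModel I) c 0 := by
      have h2 : ContMDiffAt 𝓘(ℝ, ℝ) (cotModel I) ∞ (fun t : ℝ => p.scale (1 + t)) 0 :=
        ContMDiffAt.cotScale (f := fun _ => p) h1.contMDiff.contMDiffAt contMDiffAt_const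
      have h3 : ContMDiffAt 𝓘(ℝ, ℝ) 𝓘(ℝ, ℝ) ∞ (fun t : ℝ => (1 + t) * b) 0 :=
        (h1.mul contDiff_const).contMDiff.contMDiffAt
      exact (contMDiffAt_const.prodMk (contMDiffAt_const.prodMk
        (h3.prodMk h2))).mdifferentiableAt (by simp)
    refine ⟨velAt hc0, Real.tan θ ^ 2 * (2 * normSq h p), dd_velAt hc0 hcd hg ?_⟩
    have h4 : HasDerivAt (fun t : ℝ => 1 + t) 1 0 := (hasDerivAt_id (0 : ℝ)).const_add 1
    have h5 := (((h4.mul_const b).pow 2).add ((h4.pow 2).mul_const (normSq h p))).sub_const (lam ^ 2)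
    have h6 := ((((h4.pow 2).mul_const (normSq h p)).const_mul (Real.tan θ ^ 2)).const_add
      (a ^ 2)).sub_const (lam ^ 2)
    have h7 := (h5.congr_deriv (g' := 2 * lam ^ 2) (by simp; linear_combination 2 * e1)).prodMk
      (h6.congr_deriv (g' := Real.tan θ ^ 2 * (2 * normSq h p)) (by simp))
    refine h7.congr_of_eventuallyEq (Filter.Eventually.of_forall fun t => ?_)
    simp [hc, legEq, normSq_scale]
  have h2 : (2 * lam ^ 2) ≠ 0 := by positivity
  refine ⟨(w.1 / (2 * lam ^ 2)) • v₂ + ((w.2 - w.1 / (2 * lam ^ 2) * γ) / α) • v₁, ?_⟩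
  rw [map_add, map_smul, map_smul, hv₁, hv₂]
  refine Prod.ext ?_ ?_
  · simp; field_simp
  · simp; field_simp; ring

/-- At `θ = 0` the equations depend on `θ` only through `tan² θ`, which is stationary there, so
moving `θ` alone is tangent to the parameter set and leaves the boundary. -/
lemma exists_boundary_vector {x : LegPar I Z} (hx : x ∈ legDom h lam) (hx0 : x.1 = 0) :
    ∃ v : TangentSpace (legParModel I) x, dd (legParModel I) (legEq h lam) x v = 0 ∧
      dd (legParModel I) (fun x => bfDef (legParam h lam x)) x v ≠ 0 := by
  obtain ⟨θ, a, b, p⟩ := x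
  have hx1 : θ = 0 := hx0
  subst hx1
  have hg := (contMDiffAt_legEq h (lam := lam) hx.1).mdifferentiableAt (by simp)
  set c : ℝ → LegPar I Z := fun t => (t, a, b, p) with hc
  have hc0 : c 0 = (0, a, b, p) := by simp [hc]
  have hcd : MDifferentiableAt 𝓘(ℝ, ℝ) (legParModel I) c 0 :=
    MDifferentiableAt.prodMk differentiableAt_id.mdifferentiableAt mdifferentiableAt_const
  have hb : MDifferentiableAt (legParModel I) 𝓘(ℝ, ℝ)
      (fun x : LegPar I Z => bfDef (legParam h lam x)) (0, a, b, p) :=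
    (contMDiff_legPar.1.mul (contMDiff_const.sub contMDiff_legPar.1)).mdifferentiableAt (by simp)
  refine ⟨velAt hc0, dd_velAt hc0 hcd hg ?_, ?_⟩
  · have h1 : HasDerivAt Real.tan (1 / Real.cos 0 ^ 2) 0 := Real.hasDerivAt_tan (by simp)
    have h2 := (((h1.pow 2).mul_const (normSq h p)).const_add (a ^ 2)).sub_const (lam ^ 2)
    refine (hasDerivAt_const (0 : ℝ) (b ^ 2 + normSq h p - lam ^ 2)).prodMk (h2.congr_deriv ?_)
    simp
  · have h1 : HasDerivAt (fun t : ℝ => bfDef (legParam h lam (c t))) (Real.pi / 2) 0 := by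
      have := (hasDerivAt_id (0 : ℝ)).mul ((hasDerivAt_id (0 : ℝ)).const_sub (Real.pi / 2))
      refine this.congr_deriv ?_
      simp
    rw [dd_velAt hc0 hcd hb h1]
    positivity

/-- Along a curve with the given velocity all terms become ordinary derivatives;
`pullForm_geoFlow_flowTime` evaluates the canonical form on the flowed covector, and the result is
`cos θ` times `transit_contact`. -/
lemma fibContactForm_legParam (hlam : 0 < lam) {x : LegPar I Z} (hx : x ∈ legDom h lam)
    (hx0 : legEq h lam x = 0) (v : TangentSpace (legParModel I) x)
    (hv : dd (legParModel I) (legEq h lam) x v = 0) :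
    fibContactForm (legParam h lam x)
      (mfderiv (legParModel I) (fibModel I) (legParam h lam) x v) = 0 := by
  have hι := (contMDiffAt_legParam h hx).mdifferentiableAt (by simp)
  rw [fibContactForm_mfderiv hι]
  have hp : MDifferentiableAt (legParModel I) (cotModel I) (fun x : LegPar I Z => x.2.2.2) x :=
    contMDiff_legPar.2.2.2.mdifferentiableAt (by simp)
  have hw := (contMDiffAt_legW h hx).mdifferentiableAt (by simp)
  have hfl := (contMDiffAt_legFlow h hx).mdifferentiableAt (by simp)
  have hsc : MDifferentiableAt (legParModel I) (cotModel I) (fun x : LegPar I Z =>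
      (geoFlow h (legTime h lam x) x.2.2.2).scale (-Real.tan x.1)) x :=
    (ContMDiffAt.cotScale (contMDiffAt_legPar_tan hx.1).neg
      (contMDiffAt_legFlow h hx)).mdifferentiableAt (by simp)
  have q1 : pullForm (legParModel I) (fun x => (legParam h lam x).2.1.2) x v = _ :=
    pullForm_scale hfl hsc v
  have q2 : pullForm (legParModel I) (fun x => geoFlow h (legTime h lam x) x.2.2.2) x v = _ :=
    pullForm_geoFlow_flowTime h hp hw v
  have q3 : pullForm (legParModel I) (fun x => (legParam h lam x).2.2.2) x v =
    pullForm (legParModel I) (fun x => x.2.2.2) x v := rfl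
  rw [q1, q2, q3]
  have hτ : MDifferentiableAt (legParModel I) 𝓘(ℝ, ℝ) (fun x => totalTau (legParam h lam x)) x :=
    MDifferentiableAt.comp x (contMDiff_totalTau.mdifferentiableAt (by simp)) hι
  obtain ⟨c, -, hc, hk, rfl⟩ := exists_curve x v
  have dg := hasDerivAt_velAt hk hc ((contMDiffAt_legEq h (lam := lam) hx.1).mdifferentiableAt
    (by simp))
  have dθ := hasDerivAt_velAt hk hc (contMDiff_legPar.1.mdifferentiableAt (by simp))
  have da := hasDerivAt_velAt hk hc (contMDiff_legPar.2.1.mdifferentiableAt (by simp))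
  have db := hasDerivAt_velAt hk hc (contMDiff_legPar.2.2.1.mdifferentiableAt (by simp))
  have dn := hasDerivAt_velAt hk hc ((contMDiff_legPar_normSq h).mdifferentiableAt (by simp))
  rw [hv] at dg
  have eθ : dd (legParModel I) (fun x => (legParam h lam x).1) x (velAt hk) =
    dd (legParModel I) (fun x : LegPar I Z => x.1) x (velAt hk) := rfl
  rw [eθ]
  generalize dd (legParModel I) (fun x : LegPar I Z => x.1) x (velAt hk) = θ' at *
  generalize dd (legParModel I) (fun x : LegPar I Z => x.2.1) x (velAt hk) = a' at *
  generalize dd (legParModel I) (fun x : LegPar I Z => x.2.2.1) x (velAt hk) = b' at *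
  generalize dd (legParModel I) (fun x : LegPar I Z => normSq h x.2.2.2) x (velAt hk) = n' at *
  have hcos : Real.cos x.1 ≠ 0 := (Real.cos_pos_of_mem_Ioo hx.1).ne'
  have dT : HasDerivAt (fun t => Real.tan (c t).1) (1 / Real.cos x.1 ^ 2 * θ') 0 := by
    have := HasDerivAt.comp (h := fun t => (c t).1) (0 : ℝ)
      (Real.hasDerivAt_tan (x := (c 0).1) (by rw [hk]; exact hcos)) dθ
    rw [hk] at this
    exact this
  have dw := dd_velAt hk hc hw ((da.add (dT.mul db)).div
    (((da.mul db).const_sub (lam ^ 2)).add (dT.mul dn)) (by simp only [hk]; exact hx.2.ne'))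
  have dτ := dd_velAt hk hc hτ ((da.mul dθ.cos).add (db.mul dθ.sin))
  have r1 := ((hasFDerivAt_fst.comp_hasDerivAt (0 : ℝ) dg).unique
    (((db.pow 2).add dn).sub_const (lam ^ 2)))
  have r2 := ((hasFDerivAt_snd.comp_hasDerivAt (0 : ℝ) dg).unique
    (((da.pow 2).add ((dT.pow 2).mul dn)).sub_const (lam ^ 2)))
  simp only [legEq, Prod.mk_eq_zero] at hx0
  simp only [hk] at dw dτ r1 r2
  simp only [dw, dτ]
  simp only [legParam, totalEta, legW]
  have key := transit_contact hlam.ne' hx.2.ne' rfl hx0.1 hx0.2 (b' := b') (a' := a') (n' := n')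
    (T' := 1 / Real.cos x.1 ^ 2 * θ') (by simpa using r1.symm)
    (by simpa [hk] using r2.symm)
  have hk' : ((fun t => (c t).2.1) + (fun t => Real.tan (c t).1) * fun t => (c t).2.2.1) 0 =
      x.2.1 + Real.tan x.1 * x.2.2.1 := by simp [hk]
  rw [hk']
  have hs : Real.sin x.1 = Real.tan x.1 * Real.cos x.1 := by
    rw [Real.tan_mul_cos hcos]
  rw [hs]
  linear_combination Real.cos x.1 * key

lemma finrank_clm_real : Module.finrank ℝ (E →L[ℝ] ℝ) = Module.finrank ℝ E :=
  (LinearMap.toContinuousLinearMap (𝕜 := ℝ) (E := E) (F' := ℝ)).finrank_eq.symm.trans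
    Subspace.dual_finrank_eq

lemma bfDef_nonneg_iff {q : FibCot I Z} : 0 ≤ bfDef q ↔ q.1 ∈ Icc 0 (Real.pi / 2) := by
  have := Real.pi_pos
  rw [bfDef, mul_nonneg_iff, mem_Icc]
  constructor
  · rintro (⟨h1, h2⟩ | ⟨h1, h2⟩)
    · exact ⟨h1, by linarith⟩
    · exact absurd h2 (by linarith)
  · rintro ⟨h1, h2⟩
    exact Or.inl ⟨h1, by linarith⟩

lemma contMDiff_bfDef : ContMDiff (fibModel I) 𝓘(ℝ, ℝ) ∞ (bfDef : FibCot I Z → ℝ) :=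
  contMDiff_fst.mul (contMDiff_const.sub contMDiff_fst)

lemma mem_Icc_of_mem_legL {q : FibCot I Z} (hq : q ∈ legL h lam) : q.1 ∈ Icc 0 (Real.pi / 2) := by
  rcases hq with (⟨γ, -, -, s, -, s', -, θ, hθ, -, -, rfl⟩ | ⟨θ, hθ, y, rfl⟩) | ⟨θ, hθ, y, rfl⟩ <;>
  exact hθ

lemma exists_cutsOut_legL_of_lt (hlam : 0 < lam) {p : FibCot I Z} (hp : p ∈ legL h lam)
    (hlt : p.1 < Real.pi / 2) :
    ∃ F : FibCot I Z → Fin (2 * Module.finrank ℝ E + 2) → ℝ,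
      CutsOut (fibModel I) bfDef (legL h lam) p F ∧ ∀ v : TangentSpace (fibModel I) p,
        dd (fibModel I) F p v = 0 → fibContactForm p v = 0 := by
  have hp1 := mem_Icc_of_mem_legL h hp
  obtain ⟨hd, -, he⟩ := (mem_legL_of_lt h hlam ⟨hp1.1, hlt⟩).1 hp
  have hV := isOpen_legDom h (lam := lam)
  -- `legDom` extends to negative `θ`, so the equations are smooth across the corner; the condition
  -- on `bfDef` selects the points over bf.
  have hS : ∀ x ∈ legCoord ⁻¹' legDom h lam, x ∈ legL h lam ↔
      0 ≤ bfDef x ∧ legParam h lam (legCoord x) = x ∧ legEq h lam (legCoord x) = 0 := by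
    intro x hx
    rw [bfDef_nonneg_iff]
    constructor
    · intro hxL
      have hx1 := mem_Icc_of_mem_legL h hxL
      exact ⟨hx1, ((mem_legL_of_lt h hlam ⟨hx1.1, hx.1.2⟩).1 hxL).2⟩
    · rintro ⟨hx1, hx2⟩
      exact (mem_legL_of_lt h hlam ⟨hx1.1, hx.1.2⟩).2 ⟨hx, hx2⟩
  have hρ (h0 : bfDef p = 0) : MDifferentiableAt (fibModel I) 𝓘(ℝ, ℝ) bfDef p ∧
      ∃ v : TangentSpace (legParModel I) (legCoord p),
        dd (legParModel I) (legEq h lam) (legCoord p) v = 0 ∧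
        dd (legParModel I) (fun x => bfDef (legParam h lam x)) (legCoord p) v ≠ 0 := by
    refine ⟨contMDiff_bfDef.mdifferentiableAt (by simp), exists_boundary_vector h hd ?_⟩
    rcases mul_eq_zero.1 h0 with h1 | h1
    · exact h1
    · exact absurd h1 (by linarith)
  obtain ⟨F, hF, hF0⟩ := exists_cutsOut_of_retraction (c := 2 * Module.finrank ℝ E + 2)
    (hV.preimage contMDiff_legCoord.continuous) hd contMDiff_legCoord.contMDiffOn hV
    (fun x hx => hx) (fun x hx => (contMDiffAt_legParam h hx).contMDiffWithinAt)
    (fun x hx => (contMDiffAt_legEq h hx.1).contMDiffWithinAt) (fun n _ _ => rfl)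
    hS hp (legEq_surjective h hlam hd he) hρ (by
      simp only [Module.finrank_prod, Module.finrank_self, finrank_clm_real]
      ring)
  exact ⟨F, hF, hF0 fibContactForm (fibContactForm_legParam h hlam hd he)⟩

/-- The exchange of the two factors. -/
def swapFactors (q : FibCot I Z) : FibCot I Z := (Real.pi / 2 - q.1, q.2.2, q.2.1)

@[simp] lemma swapFactors_swapFactors (q : FibCot I Z) : swapFactors (swapFactors q) = q := by
  simp [swapFactors]

lemma contMDiff_swapFactors :
    ContMDiff (fibModel I) (fibModel I) ∞ (swapFactors (I := I) (Z := Z)) :=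
  (contMDiff_const.sub contMDiff_fst).prodMk
    ((contMDiff_snd.comp contMDiff_snd).prodMk (contMDiff_fst.comp contMDiff_snd))

/-- Reverse the geodesic: start from `-γ(π)`, and replace `(s, s')` by `(π - s', π - s)`. The two
added families are interchanged. -/
lemma swapFactors_mem_legL {q : FibCot I Z} (hq : q ∈ legL h lam) : swapFactors q ∈ legL h lam := by
  have hI : ∀ θ ∈ Icc 0 (Real.pi / 2), Real.pi / 2 - θ ∈ Icc 0 (Real.pi / 2) := fun θ hθ =>
    ⟨by linarith [hθ.2], by linarith [hθ.1]⟩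
  have hI' : ∀ s ∈ Icc 0 Real.pi, Real.pi - s ∈ Icc 0 Real.pi := fun θ hθ =>
    ⟨by linarith [hθ.2], by linarith [hθ.1]⟩
  rcases hq with (⟨γ, hγ, hγ1, s, hs, s', hs', θ, hθ, h0, hsin, rfl⟩ | ⟨θ, hθ, y, rfl⟩) |
    ⟨θ, hθ, y, rfl⟩
  · set p₀ := (γ Real.pi).scale (-1) with hp₀
    have hγ' : ∀ t, geoFlow h t p₀ = (γ (Real.pi - t)).scale (-1) := fun t => by
      rw [hp₀, geoFlow_scale, hγ.eq_geoFlow h Real.pi, ← geoFlow_add, mul_neg_one, neg_add_eq_sub,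
        ← hγ.eq_geoFlow h]
    refine Or.inl (Or.inl ⟨fun t => geoFlow h t p₀, isGeodesicOrbit_geoFlow h p₀, ?_,
      Real.pi - s', hI' _ hs', Real.pi - s, hI' _ hs, _, hI θ hθ, ?_, ?_, ?_⟩)
    · rw [normSq_geoFlow, hp₀, normSq_scale, hγ.eq_geoFlow h Real.pi, normSq_geoFlow, hγ1]; norm_num
    · rw [Real.sin_pi_sub, Real.sin_pi_sub, add_comm]; exact h0
    · rw [Real.sin_pi_sub, Real.sin_pi_sub, Real.sin_pi_div_two_sub, Real.cos_pi_div_two_sub]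
      exact hsin.symm
    · simp only [swapFactors, hγ', sub_sub_cancel, scale_scale, Real.sin_pi_sub, Real.cos_pi_sub]
      simp
  · exact Or.inr ⟨_, hI θ hθ, y, rfl⟩
  · exact Or.inl (Or.inr ⟨_, hI θ hθ, y, rfl⟩)

lemma swapFactors_mem_legL_iff {q : FibCot I Z} : swapFactors q ∈ legL h lam ↔ q ∈ legL h lam :=
  ⟨fun hq => by simpa using swapFactors_mem_legL h hq, swapFactors_mem_legL h⟩

/-- Both `η` and `dθ` change sign, `τ` is invariant, and the cosine and sine terms trade places
together with the factors. -/
lemma fibContactForm_swapFactors (q : FibCot I Z) (v : TangentSpace (fibModel I) q) :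
    fibContactForm (swapFactors q) (mfderiv (fibModel I) (fibModel I) swapFactors q v) =
      fibContactForm q v := by
  rw [fibContactForm_mfderiv (contMDiff_swapFactors.mdifferentiableAt (by simp))]
  have h1 : (fun q : FibCot I Z => totalTau (swapFactors q)) = totalTau := by
    funext q
    simp only [totalTau, swapFactors, Real.sin_pi_div_two_sub, Real.cos_pi_div_two_sub]
    ring
  have h2 : totalEta (swapFactors q) = -totalEta q := by
    simp only [totalEta, swapFactors, Real.sin_pi_div_two_sub, Real.cos_pi_div_two_sub]
    ring
  have hfst : MDifferentiableAt (fibModel I) 𝓘(ℝ, ℝ) (fun q : FibCot I Z => q.1) q :=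
    mdifferentiableAt_fst
  have h3 : dd (fibModel I) (fun q : FibCot I Z => (swapFactors q).1) q v =
      -dd (fibModel I) (fun q : FibCot I Z => q.1) q v := by
    obtain ⟨c, -, hc, hk, rfl⟩ := exists_curve q v
    refine dd_velAt hk hc ?_ ((hasDerivAt_velAt hk hc hfst).const_sub (Real.pi / 2))
    exact (contMDiff_const.sub contMDiff_fst : ContMDiff (fibModel I) 𝓘(ℝ, ℝ) ∞
      (fun q : FibCot I Z => Real.pi / 2 - q.1)).mdifferentiableAt (by simp)
  have h4 : Real.cos (swapFactors q).1 = Real.sin q.1 := Real.cos_pi_div_two_sub _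
  have h5 : Real.sin (swapFactors q).1 = Real.cos q.1 := Real.sin_pi_div_two_sub _
  rw [h1, h2, h3, h4, h5, neg_mul_neg, add_right_comm]
  rfl

/-- The description by parameters covers `θ < π/2`; points over the corner `θ = π/2` are moved to `θ
= 0` by the exchange of factors. -/
theorem isNeatIntegralSubmanifold_legL (hlam : 0 < lam) :
    IsNeatIntegralSubmanifold (fibModel I) fibContactForm bfDef (2 * Module.finrank ℝ E + 2)
      (legL h lam) := by
  intro p hp
  rcases lt_or_ge p.1 (Real.pi / 2) with hlt | hge
  · exact exists_cutsOut_legL_of_lt h hlam hp hlt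
  · obtain ⟨F, hF, hF0⟩ := exists_cutsOut_legL_of_lt h hlam (swapFactors_mem_legL h hp)
      (show Real.pi / 2 - p.1 < Real.pi / 2 by linarith [Real.pi_pos])
    have hsd := contMDiff_swapFactors (I := I) (Z := Z)
    obtain ⟨hG, hd⟩ := hF.comp (ρ' := bfDef) (S' := legL h lam) isOpen_univ (mem_univ p)
      hsd.contMDiffOn
      (surjective_mfderiv_of_inverse (hsd.mdifferentiableAt (by simp))
        (hsd.mdifferentiableAt (by simp)) (swapFactors_swapFactors p)
        (Filter.Eventually.of_forall swapFactors_swapFactors))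
      (fun q _ => (swapFactors_mem_legL_iff h).symm)
      (fun q _ => by simp only [bfDef, swapFactors, sub_sub_cancel, mul_comm])
      (fun _ => ⟨contMDiff_bfDef.mdifferentiableAt (by simp), by
        funext q; simp only [bfDef, swapFactors, sub_sub_cancel, mul_comm]⟩)
    refine ⟨_, hG, fun v hv => ?_⟩
    exact (fibContactForm_swapFactors p v).symm.trans (hF0 _ ((hd v).symm.trans hv))

end LegL
end ScatGeom

namespace ScatGeom

section FibreCoordinates

variable {E : Type*} [NormedAddCommGroup E] [NormedSpace ℝ E] [FiniteDimensional ℝ E]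
  {H : Type*} [TopologicalSpace H] {I : ModelWithCorners ℝ E H} [I.Boundaryless]
  {Z : Type*} [TopologicalSpace Z] [ChartedSpace H Z] [IsManifold I ∞ Z]
  {EK : Type*} [NormedAddCommGroup EK] [NormedSpace ℝ EK]
  {HK : Type*} [TopologicalSpace HK] {IK : ModelWithCorners ℝ EK HK}
  {K : Type*} [TopologicalSpace K] [ChartedSpace HK K]

/-! ### Covectors with given coordinates -/

/-- The covector at `z` with the coordinates `ζ` in the chart at `y`. -/
def ofFib (y z : Z) (ζ : E →L[ℝ] ℝ) : Cot I Z :=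
  (extChartAt (cotModel I) (Cot.zero (I := I) y)).symm (extChartAt I y z, ζ)

lemma extChartAt_ofFib {y z : Z} (hz : z ∈ (chartAt H y).source) (ζ : E →L[ℝ] ℝ) :
    (ofFib (I := I) y z ζ).proj = z ∧ fibCoord y (ofFib (I := I) y z ζ) = ζ := by
  have hz' : z ∈ (extChartAt I y).source := by rwa [extChartAt_source]
  have ht : (extChartAt I y z, ζ) ∈ (extChartAt (cotModel I) (Cot.zero (I := I) y)).target := by
    rw [extChartAt_cot_target]
    exact ⟨(extChartAt I y).map_source hz', mem_univ _⟩
  have h1 := (extChartAt (cotModel I) (Cot.zero (I := I) y)).right_inv ht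
  have h2 := (extChartAt (cotModel I) (Cot.zero (I := I) y)).map_target ht
  rw [extChartAt_cot_source] at h2
  rw [extChartAt_cot, Prod.mk.injEq] at h1
  refine ⟨(extChartAt I y).injOn ?_ hz' h1.1, h1.2⟩
  rw [extChartAt_source]
  exact h2

lemma proj_ofFib {y z : Z} (hz : z ∈ (chartAt H y).source) (ζ : E →L[ℝ] ℝ) :
    (ofFib (I := I) y z ζ).proj = z := (extChartAt_ofFib hz ζ).1

lemma fibCoord_ofFib {y z : Z} (hz : z ∈ (chartAt H y).source) (ζ : E →L[ℝ] ℝ) :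
    fibCoord y (ofFib (I := I) y z ζ) = ζ := (extChartAt_ofFib hz ζ).2

lemma ofFib_fibCoord {y : Z} {p : Cot I Z} (hp : p.proj ∈ (chartAt H y).source) :
    ofFib y p.proj (fibCoord y p) = p := by
  refine (eq_of_fibCoord hp (proj_ofFib hp (fibCoord y p)).symm ?_).symm
  rw [fibCoord_ofFib hp]

lemma contMDiffAt_ofFib {y : Z} {z : K → Z} {ζ : K → E →L[ℝ] ℝ} {k : K}
    (hzk : z k ∈ (chartAt H y).source) (hz : ContMDiffAt IK I ∞ z k)
    (hζ : ContMDiffAt IK 𝓘(ℝ, E →L[ℝ] ℝ) ∞ ζ k) :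
    ContMDiffAt IK (cotModel I) ∞ (fun k => ofFib (I := I) y (z k) (ζ k)) k := by
  have hz' : z k ∈ (extChartAt I y).source := by rwa [extChartAt_source]
  have h1 : ContMDiffAt IK 𝓘(ℝ, E × (E →L[ℝ] ℝ)) ∞ (fun k => (extChartAt I y (z k), ζ k)) k :=
    ((contMDiffAt_extChartAt' hzk).comp k hz).prodMk_space hζ
  have ht : (extChartAt I y (z k), ζ k) ∈ (extChartAt (cotModel I) (Cot.zero (I := I) y)).target := by
    rw [extChartAt_cot_target]
    exact ⟨(extChartAt I y).map_source hz', mem_univ _⟩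
  exact ((contMDiffOn_extChartAt_symm (n := ∞) (Cot.zero (I := I) y)).contMDiffAt
    ((isOpen_extChartAt_target _).mem_nhds ht)).comp k h1

lemma contMDiffAt_chart_proj {y : Z} {f : K → Cot I Z} {k : K}
    (hk : (f k).proj ∈ (chartAt H y).source) (hf : ContMDiffAt IK (cotModel I) ∞ f k) :
    ContMDiffAt IK 𝓘(ℝ, E) ∞ (fun k => extChartAt I y (f k).proj) k :=
  (contMDiffAt_extChartAt' hk).comp k (contMDiff_proj.contMDiffAt.comp k hf)

lemma pullForm_eq_fibCoord {y : Z} {f : K → Cot I Z} {k : K}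
    (hk : (f k).proj ∈ (chartAt H y).source) (hf : MDifferentiableAt IK (cotModel I) f k)
    (v : TangentSpace IK k) :
    pullForm IK f k v = fibCoord y (f k) (dd IK (fun k => extChartAt I y (f k).proj) k v) := by
  have h1 : MDifferentiableAt I 𝓘(ℝ, E) (extChartAt I y) (f k).proj :=
    mdifferentiableAt_extChartAt hk
  have h2 : MDifferentiableAt IK I (fun k => (f k).proj) k :=
    MDifferentiableAt.comp (g := fun p : Cot I Z => p.proj) k
      (contMDiff_proj.mdifferentiableAt (by simp)) hf
  rw [pullForm_eq hf, dd_comp_mfderiv (f := extChartAt I y) (φ := fun k => (f k).proj) h1 h2]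
  exact (fibCoord_apply_mfderiv hk _).symm

lemma exists_dd_chart_proj {y : Z} {p : Cot I Z} (hp : p.proj ∈ (chartAt H y).source) (e : E) :
    ∃ v : TangentSpace (cotModel I) p,
      dd (cotModel I) (fun p : Cot I Z => extChartAt I y p.proj) p v = e := by
  set κ := extChartAt I y with hκ
  have hp' : p.proj ∈ κ.source := by rwa [hκ, extChartAt_source]
  set c : ℝ → Cot I Z := fun t => ofFib y (κ.symm (κ p.proj + t • e)) (fibCoord y p) with hc
  have h0 : κ p.proj + (0 : ℝ) • e = κ p.proj := by simp
  have hc0 : c 0 = p := by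
    simp only [hc, h0, κ.left_inv hp', ofFib_fibCoord hp]
  have hz0 : κ.symm (κ p.proj + (0 : ℝ) • e) = p.proj := by rw [h0, κ.left_inv hp']
  have hcd : MDifferentiableAt 𝓘(ℝ, ℝ) (cotModel I) c 0 := by
    refine (contMDiffAt_ofFib ?_ ?_ contMDiffAt_const).mdifferentiableAt (by simp)
    · rw [hz0]; exact hp
    · have h1 : ContMDiffAt 𝓘(ℝ, ℝ) 𝓘(ℝ, E) ∞ (fun t : ℝ => κ p.proj + t • e) 0 :=
        (show ContDiff ℝ ∞ (fun t : ℝ => κ p.proj + t • e) by fun_prop).contMDiff.contMDiffAt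
      refine ContMDiffAt.comp (g := κ.symm) (0 : ℝ) ?_ h1
      refine (contMDiffOn_extChartAt_symm (n := ∞) y).contMDiffAt ?_
      rw [h0]
      exact (isOpen_extChartAt_target _).mem_nhds (κ.map_source hp')
  refine ⟨velAt hc0, dd_velAt hc0 hcd ((contMDiffAt_chart_proj (f := id) hp
    contMDiffAt_id).mdifferentiableAt (by simp)) ?_⟩
  have h5 : HasDerivAt (fun t : ℝ => κ p.proj + t • e) e 0 := by
    simpa using ((hasDerivAt_id (0 : ℝ)).smul_const e).const_add (κ p.proj)
  refine h5.congr_of_eventuallyEq ?_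
  have h6 : ContinuousAt (fun t : ℝ => κ p.proj + t • e) 0 := h5.continuousAt
  filter_upwards [h6.preimage_mem_nhds (by
    rw [h0]; exact (isOpen_extChartAt_target _).mem_nhds (κ.map_source hp') :
      κ.target ∈ 𝓝 (κ p.proj + (0 : ℝ) • e))] with t ht
  have h7 : κ.symm (κ p.proj + t • e) ∈ (chartAt H y).source := by
    rw [← extChartAt_source I]; exact κ.map_target ht
  change κ (ofFib y (κ.symm (κ p.proj + t • e)) (fibCoord y p)).proj = _
  rw [proj_ofFib h7, κ.right_inv ht]

end FibreCoordinates

section Sharp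

variable {E : Type*} [NormedAddCommGroup E] [NormedSpace ℝ E] [FiniteDimensional ℝ E]
  {H : Type*} [TopologicalSpace H] {I : ModelWithCorners ℝ E H} [I.Boundaryless]
  {Z : Type*} [TopologicalSpace Z] [ChartedSpace H Z] [IsManifold I ∞ Z] [CompactSpace Z] [T2Space Z]
  {EK : Type*} [NormedAddCommGroup EK] [NormedSpace ℝ EK]
  {HK : Type*} [TopologicalSpace HK] {IK : ModelWithCorners ℝ EK HK}
  {K : Type*} [TopologicalSpace K] [ChartedSpace HK K]

/-! ### Graphs of constants -/

lemma pullForm_zeroSection {z : K → Z} {k : K} (hz : ContMDiffAt IK I ∞ z k)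
    (v : TangentSpace IK k) : pullForm IK (fun k => Cot.zero (I := I) (z k)) k v = 0 := by
  have h1 : MDifferentiableAt IK (cotModel I) (fun k => Cot.zero (I := I) (z k)) k :=
    (contMDiff_zeroSection.contMDiffAt.comp k hz).mdifferentiableAt (by simp)
  rw [pullForm_eq h1]
  rfl

/-- On each sheet `τ` is constant and the covector vanishes, so both terms of the contact form
vanish. Working where `τ` avoids the other constants isolates one sheet. -/
lemma isLegendre_constGraph (Λ : Finset ℝ) :
    IsLegendre {q : ScCot I Z | ∃ c ∈ Λ, ∃ z, q = (c, Cot.zero z)} := by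
  rintro _ ⟨c, hc, z, rfl⟩
  have hsm : ContMDiff I (scModel I) ∞ (fun z : Z => ((c, Cot.zero z) : ScCot I Z)) :=
    contMDiff_const.prodMk contMDiff_zeroSection
  have hU : IsOpen {q : ScCot I Z | q.1 ∉ (Λ.erase c : Set ℝ)} :=
    (Finset.finite_toSet _).isClosed.isOpen_compl.preimage continuous_fst
  obtain ⟨F, hF, hF0⟩ := exists_cutsOut_of_retraction (IK := scModel I) (IN := I)
    (ψ := fun q : ScCot I Z => q.2.proj) (ι := fun z : Z => ((c, Cot.zero z) : ScCot I Z))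
    (g := fun _ => (0 : Fin 0 → ℝ)) (ρ := fun _ => 1)
    (S := {q : ScCot I Z | ∃ c ∈ Λ, ∃ z, q = (c, Cot.zero z)})
    (p := (c, Cot.zero z)) (V := univ) (c := Module.finrank ℝ E + 1) hU (by simp)
    (contMDiff_proj.comp contMDiff_snd).contMDiffOn isOpen_univ (fun _ _ => mem_univ _)
    hsm.contMDiffOn contMDiffOn_const (fun _ _ _ => rfl)
    (fun x hx => by
      constructor
      · rintro ⟨c', hc', z', rfl⟩
        have : c' = c := by
          by_contra hne
          exact hx (by simp [hne, hc'])
        subst this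
        exact ⟨zero_le_one, rfl, rfl⟩
      · rintro ⟨-, hx1, -⟩
        exact ⟨c, hc, x.2.proj, hx1.symm⟩)
    ⟨c, hc, z, rfl⟩ (fun w => ⟨0, Subsingleton.elim _ _⟩)
    (fun h0 => absurd h0 one_ne_zero) (by
      simp only [Module.finrank_prod, Module.finrank_self, finrank_clm_real,
        Module.finrank_fin_fun]
      ring)
  refine ⟨F, hF, hF0 contactForm fun v _ => ?_⟩
  rw [contactForm_mfderiv (hsm.mdifferentiableAt (by simp)),
    pullForm_zeroSection (z := fun z => z) contMDiffAt_id, add_zero]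
  obtain ⟨γ, -, hγ, hk, rfl⟩ := exists_curve z v
  exact dd_velAt hk hγ mdifferentiableAt_const (hasDerivAt_const _ _)

variable (I Z) in
lemma mem_legSharp_union {lam : ℝ} {q : FibCot I Z} :
    q ∈ legSharp I Z lam ∪ legSharp I Z (-lam) ↔ q.1 ∈ Icc 0 (Real.pi / 2) ∧
      ∃ e ∈ ({lam, -lam} : Finset ℝ), ∃ y' y'' : Z, q.2 = ((e, Cot.zero y'), (e, Cot.zero y'')) := by
  obtain ⟨θ, q⟩ := q
  constructor
  · rintro (⟨θ, hθ, y', y'', heq⟩ | ⟨θ, hθ, y', y'', heq⟩) <;> cases heq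
    · exact ⟨hθ, -lam, by simp, y', y'', rfl⟩
    · exact ⟨hθ, - -lam, by simp, y', y'', rfl⟩
  · rintro ⟨hθ, e, he, y', y'', rfl⟩
    simp only [Finset.mem_insert, Finset.mem_singleton] at he
    rcases he with rfl | rfl
    · exact Or.inr ⟨θ, hθ, y', y'', by simp⟩
    · exact Or.inl ⟨θ, hθ, y', y'', rfl⟩

/-- With `τ' = τ'' = c` one has `τ = c (cos θ + sin θ)` and `η = c (sin θ - cos θ)`, so `dτ + η dθ =
0`; the remaining terms vanish with the covectors. -/
lemma isNeatIntegralSubmanifold_legSharp (lam : ℝ) :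
    IsNeatIntegralSubmanifold (fibModel I) fibContactForm bfDef (2 * Module.finrank ℝ E + 2)
      (legSharp I Z lam ∪ legSharp I Z (-lam)) := by
  intro p hp
  obtain ⟨hθ, c, hc, y', y'', hp2⟩ := (mem_legSharp_union I Z).1 hp
  set ι : ℝ × Z × Z → FibCot I Z :=
    fun n => (n.1, ((c, Cot.zero n.2.1), (c, Cot.zero n.2.2))) with hι
  set ψ : FibCot I Z → ℝ × Z × Z := fun q => (q.1, q.2.1.2.proj, q.2.2.2.proj) with hψ
  have hsm : ContMDiff (𝓘(ℝ, ℝ).prod (I.prod I)) (fibModel I) ∞ ι :=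
    contMDiff_fst.prodMk ((contMDiff_const.prodMk (contMDiff_zeroSection.comp
      (contMDiff_fst.comp contMDiff_snd))).prodMk (contMDiff_const.prodMk
        (contMDiff_zeroSection.comp (contMDiff_snd.comp contMDiff_snd))))
  have hψs : ContMDiff (fibModel I) (𝓘(ℝ, ℝ).prod (I.prod I)) ∞ ψ :=
    contMDiff_fst.prodMk ((contMDiff_proj.comp (contMDiff_snd.comp (contMDiff_fst.comp
      contMDiff_snd))).prodMk (contMDiff_proj.comp (contMDiff_snd.comp (contMDiff_snd.comp
        contMDiff_snd))))
  have hU : IsOpen {q : FibCot I Z | q.2.1.1 ∉ ((({lam, -lam} : Finset ℝ).erase c : Finset ℝ) :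
      Set ℝ)} :=
    (Finset.finite_toSet _).isClosed.isOpen_compl.preimage
      (continuous_fst.comp (continuous_fst.comp continuous_snd))
  have hpψ : ψ p = (p.1, y', y'') := by simp only [hψ, hp2]; rfl
  have hb : MDifferentiableAt (fibModel I) 𝓘(ℝ, ℝ) bfDef p :=
    contMDiff_bfDef.mdifferentiableAt (by simp)
  have hθd (n : ℝ × Z × Z) : MDifferentiableAt (𝓘(ℝ, ℝ).prod (I.prod I)) 𝓘(ℝ, ℝ)
      (fun n : ℝ × Z × Z => n.1) n := mdifferentiableAt_fst
  obtain ⟨F, hF, hF0⟩ := exists_cutsOut_of_retraction (IK := fibModel I)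
    (IN := 𝓘(ℝ, ℝ).prod (I.prod I)) (ψ := ψ) (ι := ι)
    (g := fun _ => (0 : Fin 0 → ℝ)) (ρ := bfDef)
    (S := legSharp I Z lam ∪ legSharp I Z (-lam))
    (p := p) (V := univ) (c := 2 * Module.finrank ℝ E + 2) hU (by
      change p.2.1.1 ∉ _
      rw [hp2]
      simp)
    hψs.contMDiffOn isOpen_univ (fun _ _ => mem_univ _)
    hsm.contMDiffOn contMDiffOn_const (fun _ _ _ => rfl)
    (fun x hx => by
      rw [mem_legSharp_union, bfDef_nonneg_iff]
      refine and_congr_right fun _ => ?_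
      constructor
      · rintro ⟨c', hc', z', z'', hx2⟩
        have : c' = c := by
          by_contra hne
          refine hx ?_
          rw [hx2]
          exact Finset.mem_coe.2 (Finset.mem_erase.2 ⟨hne, hc'⟩)
        subst this
        refine ⟨?_, rfl⟩
        simp only [hψ, hι, hx2]
        exact Prod.ext rfl hx2.symm
      · rintro ⟨hx1, -⟩
        exact ⟨c, hc, x.2.1.2.proj, x.2.2.2.proj, (congrArg Prod.snd hx1).symm⟩)
    hp (fun w => ⟨0, Subsingleton.elim _ _⟩)
    (fun h0 => by
      refine ⟨hb, ?_⟩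
      set c : ℝ → ℝ × Z × Z := fun t => (p.1 + t, y', y'') with hc
      have hc0 : c 0 = ψ p := by simp [hc, hpψ]
      have hcd : MDifferentiableAt 𝓘(ℝ, ℝ) (𝓘(ℝ, ℝ).prod (I.prod I)) c 0 :=
        MDifferentiableAt.prodMk (differentiableAt_id.const_add p.1).mdifferentiableAt
          mdifferentiableAt_const
      refine ⟨velAt hc0, Subsingleton.elim _ _, ?_⟩
      have h1 : HasDerivAt (fun t : ℝ => p.1 + t) 1 0 := (hasDerivAt_id (0 : ℝ)).const_add p.1
      have h2 : HasDerivAt (fun t : ℝ => bfDef (ι (c t))) (Real.pi / 2 - 2 * p.1) 0 := by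
        refine (h1.mul (h1.const_sub (Real.pi / 2))).congr_deriv ?_
        ring
      have h3 : MDifferentiableAt (𝓘(ℝ, ℝ).prod (I.prod I)) 𝓘(ℝ, ℝ) (fun n => bfDef (ι n)) (ψ p) :=
        (contMDiff_bfDef.comp hsm).mdifferentiableAt (by simp)
      rw [dd_velAt hc0 hcd h3 h2]
      rcases mul_eq_zero.1 h0 with h4 | h4
      · rw [h4]; have := Real.pi_pos; intro h5; linarith
      · have := Real.pi_pos; intro h5; linarith) (by
      simp only [Module.finrank_prod, Module.finrank_self, finrank_clm_real,
        Module.finrank_fin_fun]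
      ring)
  refine ⟨F, hF, hF0 fibContactForm fun v _ => ?_⟩
  rw [fibContactForm_mfderiv (hsm.mdifferentiableAt (by simp))]
  have e1 : pullForm (𝓘(ℝ, ℝ).prod (I.prod I)) (fun n => (ι n).2.1.2) (ψ p) v = 0 :=
    pullForm_zeroSection (z := fun n => n.2.1) (contMDiff_fst.comp contMDiff_snd).contMDiffAt v
  have e2 : pullForm (𝓘(ℝ, ℝ).prod (I.prod I)) (fun n => (ι n).2.2.2) (ψ p) v = 0 :=
    pullForm_zeroSection (z := fun n => n.2.2) (contMDiff_snd.comp contMDiff_snd).contMDiffAt v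
  have hτ : MDifferentiableAt (𝓘(ℝ, ℝ).prod (I.prod I)) 𝓘(ℝ, ℝ) (fun n => totalTau (ι n)) (ψ p) :=
    (contMDiff_totalTau.comp hsm).mdifferentiableAt (by simp)
  rw [e1, e2]
  obtain ⟨γ, -, hγ, hk, rfl⟩ := exists_curve (ψ p) v
  have dθ := hasDerivAt_velAt hk hγ (hθd (ψ p))
  have e3 := dd_velAt hk hγ hτ ((dθ.cos.const_mul c).add (dθ.sin.const_mul c))
  simp only [hk] at e3
  rw [e3]
  change _ + totalEta (ι (ψ p)) * dd (𝓘(ℝ, ℝ).prod (I.prod I)) (fun n : ℝ × Z × Z => n.1) (ψ p)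
    (velAt hk) + _ + _ = 0
  simp only [totalEta, hι]
  ring

lemma corner_rb_legSharp (lam : ℝ) :
    corner .rb (legSharp I Z lam ∪ legSharp I Z (-lam)) =
      corner .lb (legSharp I Z lam ∪ legSharp I Z (-lam)) := by
  have := Real.pi_pos
  ext w
  change ((Real.pi / 2, w.2, w.1) ∈ legSharp I Z lam ∪ legSharp I Z (-lam)) ↔
    ((0, w.1, w.2) ∈ legSharp I Z lam ∪ legSharp I Z (-lam))
  rw [mem_legSharp_union, mem_legSharp_union]
  refine and_congr ?_ ?_
  · simp only [mem_Icc]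
    constructor <;> intro <;> constructor <;> linarith
  · constructor
    · rintro ⟨e, he, y', y'', h1⟩
      exact ⟨e, he, y'', y', Prod.ext (congrArg Prod.snd h1) (congrArg Prod.fst h1)⟩
    · rintro ⟨e, he, y', y'', h1⟩
      exact ⟨e, he, y'', y', Prod.ext (congrArg Prod.snd h1) (congrArg Prod.fst h1)⟩

lemma mem_corner_lb_legSharp {lam : ℝ} {w : ScCot I Z × ScCot I Z} :
    w ∈ corner .lb (legSharp I Z lam ∪ legSharp I Z (-lam)) ↔
      ∃ e ∈ ({lam, -lam} : Finset ℝ), ∃ y' y'' : Z, w = ((e, Cot.zero y'), (e, Cot.zero y'')) := by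
  have := Real.pi_pos
  change ((0, w.1, w.2) ∈ legSharp I Z lam ∪ legSharp I Z (-lam)) ↔ _
  rw [mem_legSharp_union]
  exact and_iff_right ⟨le_rfl, by linarith⟩

/-- Over each of the two sheets of the base the corner is a product, trivialized by the second
component. Since `lam > 0`, the sign of `τ` separates the sheets. -/
lemma isFibration_corner_legSharp {lam : ℝ} (hlam : 0 < lam) (S : SideFace) :
    IsFibration (corner S (legSharp I Z lam ∪ legSharp I Z (-lam)))
      {q : ScCot I Z | ∃ c ∈ ({lam, -lam} : Finset ℝ), ∃ z, q = (c, Cot.zero z)} := by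
  have hS : corner S (legSharp I Z lam ∪ legSharp I Z (-lam)) =
      corner .lb (legSharp I Z lam ∪ legSharp I Z (-lam)) := by
    cases S
    · rfl
    · exact corner_rb_legSharp lam
  rw [hS]
  have hsign : ∀ e ∈ ({lam, -lam} : Finset ℝ), ∀ e' ∈ ({lam, -lam} : Finset ℝ), 0 < e * e' →
      e' = e := by
    intro e he e' he' h0
    simp only [Finset.mem_insert, Finset.mem_singleton] at he he'
    rcases he with rfl | rfl <;> rcases he' with rfl | rfl <;> first | rfl | nlinarith
  refine ⟨?_, ?_⟩
  · ext q
    constructor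
    · rintro ⟨w, hw, rfl⟩
      obtain ⟨e, he, y', y'', rfl⟩ := mem_corner_lb_legSharp.1 hw
      exact ⟨e, he, y', rfl⟩
    · rintro ⟨e, he, y', rfl⟩
      exact ⟨_, mem_corner_lb_legSharp.2 ⟨e, he, y', y', rfl⟩, rfl⟩
  · rintro _ ⟨e, he, z, rfl⟩
    have he0 : 0 < e * e := by
      simp only [Finset.mem_insert, Finset.mem_singleton] at he
      rcases he with rfl | rfl <;> nlinarith
    refine ⟨{j | 0 < e * j.1}, Prod.snd, Prod.snd,
      isOpen_lt continuous_const (continuous_const.mul continuous_fst), he0, contMDiffOn_snd,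
      contMDiffOn_snd, ?_, ?_⟩
    · intro j hj f hjf
      obtain ⟨e', he', y', y'', heq⟩ := mem_corner_lb_legSharp.1 hjf
      cases heq
      obtain rfl := hsign e he e' he' hj
      exact ⟨mem_corner_lb_legSharp.2 ⟨e', he', z, y'', rfl⟩, rfl⟩
    · rintro j ⟨⟨e', he', y', rfl⟩, hj⟩ k hk
      obtain ⟨e'', he'', z', z'', heq⟩ := mem_corner_lb_legSharp.1 hk
      cases heq
      obtain rfl := hsign e he e' he' hj
      exact ⟨mem_corner_lb_legSharp.2 ⟨e', he', y', z'', rfl⟩, rfl⟩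

lemma cornerFibre_legSharp {lam : ℝ} (S : SideFace) {e : ℝ} (he : e ∈ ({lam, -lam} : Finset ℝ))
    (z : Z) :
    cornerFibre S (legSharp I Z lam ∪ legSharp I Z (-lam)) (e, Cot.zero z) =
      {q : ScCot I Z | ∃ c ∈ ({e} : Finset ℝ), ∃ z, q = (c, Cot.zero z)} := by
  have hS : corner S (legSharp I Z lam ∪ legSharp I Z (-lam)) =
      corner .lb (legSharp I Z lam ∪ legSharp I Z (-lam)) := by
    cases S
    · rfl
    · exact corner_rb_legSharp lam
  ext f
  change _ ∈ corner S _ ↔ _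
  rw [hS, mem_corner_lb_legSharp]
  constructor
  · rintro ⟨e', he', y', y'', heq⟩
    cases heq
    exact ⟨e, by simp, y'', rfl⟩
  · rintro ⟨c, hc, y, rfl⟩
    rw [Finset.mem_singleton] at hc
    subst hc
    exact ⟨c, he, z, y, rfl⟩

theorem isFibLegendre_legSharp {lam : ℝ} (hlam : 0 < lam) :
    IsFibLegendre (legSharp I Z lam ∪ legSharp I Z (-lam)) := by
  refine ⟨isNeatIntegralSubmanifold_legSharp lam, fun S => ⟨_, isLegendre_constGraph {lam, -lam},
    isFibration_corner_legSharp hlam S, ?_⟩⟩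
  rintro _ ⟨e, he, z, rfl⟩
  rw [cornerFibre_legSharp S he z]
  exact isLegendre_constGraph _

end Sharp
end ScatGeom

namespace ScatGeom

section Corner

universe u

variable {E : Type u} [NormedAddCommGroup E] [NormedSpace ℝ E] [FiniteDimensional ℝ E]
  {H : Type*} [TopologicalSpace H] {I : ModelWithCorners ℝ E H} [I.Boundaryless]
  {Z : Type*} [TopologicalSpace Z] [ChartedSpace H Z] [IsManifold I ∞ Z]
  [CompactSpace Z] [T2Space Z]
  (h : ContMDiffRiemannianMetric I ∞ E (fun z : Z => TangentSpace I z)) {lam : ℝ}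

/-! ### The corners of `L` -/

lemma flowTime_neg (w n : ℝ) : flowTime (-w) n = -flowTime w n := by
  simp only [flowTime, neg_sq]; ring

/-- The time is homogeneous: scaling the covector by `c` divides the time by `c` at the same angle.
This matches `geoFlow_scale`. -/
lemma flowTime_mul (c w n : ℝ) : flowTime (c * w) n = c * flowTime w (c ^ 2 * n) := by
  simp only [flowTime]
  rw [show n * (c * w) ^ 2 = c ^ 2 * n * w ^ 2 by ring]
  ring

/-- Stereographic projection of the fibres of `{τ² + |μ|² = e²}` from `τ = e`, followed by the
geodesic flow. -/
def stereo (e : ℝ) (f : ScCot I Z) : Cot I Z :=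
  (geoFlow h (flowTime (1 / (e - f.1)) (normSq h f.2)) f.2).scale (1 / (e - f.1))

/-- The inverse of `stereo`. -/
def stereoInv (e : ℝ) (c : Cot I Z) : ScCot I Z :=
  (-e * (1 - normSq h c) / (1 + normSq h c),
    (geoFlow h (flowTime (-1) (normSq h c)) c).scale (2 * e / (1 + normSq h c)))

/-- The image of `stereoInv`. -/
def sphereBundle (e : ℝ) : Set (ScCot I Z) := {f | 0 < e * (e - f.1) ∧ f.1 ^ 2 + normSq h f.2 = e ^ 2}

variable {e : ℝ}

lemma stereoInv_mem (he : e ≠ 0) (c : Cot I Z) : stereoInv h e c ∈ sphereBundle h e := by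
  have hq : 0 < 1 + normSq h c := by linarith [normSq_nonneg h c]
  refine ⟨?_, ?_⟩
  · have : e * (e - (stereoInv h e c).1) = 2 * e ^ 2 / (1 + normSq h c) := by
      simp only [stereoInv]; field_simp; ring
    rw [this]
    positivity
  · simp only [stereoInv, normSq_scale, normSq_geoFlow]
    field_simp
    ring

/-- The two scaling factors are inverse to each other, and once the flow is commuted past the
scaling the two flow times are opposite, by `flowTime_mul` and oddness. -/
lemma stereo_stereoInv (he : e ≠ 0) (c : Cot I Z) : stereo h e (stereoInv h e c) = c := by
  have hq : 0 < 1 + normSq h c := by linarith [normSq_nonneg h c]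
  have hw : 1 / (e - (stereoInv h e c).1) = (1 + normSq h c) / (2 * e) := by
    have : e - (stereoInv h e c).1 = 2 * e / (1 + normSq h c) := by
      simp only [stereoInv]; field_simp; ring
    rw [this, one_div_div]
  rw [stereo, hw]
  simp only [stereoInv, normSq_scale, normSq_geoFlow]
  rw [geoFlow_scale, ← geoFlow_add, scale_scale]
  have h1 : (1 + normSq h c) / (2 * e) * (2 * e / (1 + normSq h c)) = 1 := by field_simp
  have h2 : flowTime ((1 + normSq h c) / (2 * e)) ((2 * e / (1 + normSq h c)) ^ 2 * normSq h c) *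
      (2 * e / (1 + normSq h c)) + flowTime (-1) (normSq h c) = 0 := by
    have h3 := flowTime_mul (2 * e / (1 + normSq h c)) ((1 + normSq h c) / (2 * e)) (normSq h c)
    rw [mul_comm, ← h3, mul_comm, h1, flowTime_neg, add_neg_cancel]
  rw [h1, h2, geoFlow_zero_time, scale_one]

lemma sub_ne_zero_of_mem {f : ScCot I Z} (hf : f ∈ sphereBundle h e) : e - f.1 ≠ 0 := fun h0 => by
  have := hf.1
  rw [h0, mul_zero] at this
  exact this.false

lemma normSq_stereo {f : ScCot I Z} (hf : f ∈ sphereBundle h e) :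
    normSq h (stereo h e f) = (e + f.1) / (e - f.1) := by
  have h0 := sub_ne_zero_of_mem h hf
  have h1 : normSq h f.2 = (e + f.1) * (e - f.1) := by linear_combination hf.2
  rw [stereo, normSq_scale, normSq_geoFlow, h1]
  field_simp

lemma stereoInv_stereo {f : ScCot I Z} (hf : f ∈ sphereBundle h e) :
    stereoInv h e (stereo h e f) = f := by
  have h0 := sub_ne_zero_of_mem h hf
  have he : e ≠ 0 := fun h1 => by have := hf.1; rw [h1, zero_mul] at this; exact this.false
  have h1 : 1 + (e + f.1) / (e - f.1) = 2 * e / (e - f.1) := by field_simp; ring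
  have h2 : 1 - (e + f.1) / (e - f.1) = -2 * f.1 / (e - f.1) := by field_simp; ring
  have hN := normSq_stereo h hf
  simp only [stereoInv, hN, h1, h2]
  refine Prod.ext ?_ ?_
  · change -e * (-2 * f.1 / (e - f.1)) / (2 * e / (e - f.1)) = f.1
    field_simp
  · change ((geoFlow h (flowTime (-1) ((e + f.1) / (e - f.1))) (stereo h e f)).scale
      (2 * e / (2 * e / (e - f.1)))) = f.2
    have h3 : 2 * e / (2 * e / (e - f.1)) = e - f.1 := by field_simp
    rw [h3, stereo, geoFlow_scale, scale_scale, ← geoFlow_add]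
    have h4 : (e - f.1) * (1 / (e - f.1)) = 1 := by field_simp
    have h5 : flowTime (1 / (e - f.1)) (normSq h f.2) =
        1 / (e - f.1) * flowTime 1 ((e + f.1) / (e - f.1)) := by
      have h6 := flowTime_mul (1 / (e - f.1)) 1 (normSq h f.2)
      rw [mul_one] at h6
      rw [h6]
      congr 2
      have h1 : normSq h f.2 = (e + f.1) * (e - f.1) := by linear_combination hf.2
      rw [h1]
      field_simp
    rw [h4, h5, flowTime_neg]
    rw [show -flowTime 1 ((e + f.1) / (e - f.1)) * (1 / (e - f.1)) +
      1 / (e - f.1) * flowTime 1 ((e + f.1) / (e - f.1)) = 0 by ring, geoFlow_zero_time, scale_one]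

lemma contMDiff_stereoInv : ContMDiff (cotModel I) (scModel I) ∞ (stereoInv h e) := by
  intro c
  have hq : 1 + normSq h c ≠ 0 := by linarith [normSq_nonneg h c]
  have hn : ContMDiffAt (cotModel I) 𝓘(ℝ, ℝ) ∞ (normSq h) c := (contMDiff_normSq h).contMDiffAt
  refine ContMDiffAt.prodMk ?_ (ContMDiffAt.cotScale ?_ ?_)
  · exact (contMDiffAt_const.mul (contMDiffAt_const.sub hn)).div₀ (contMDiffAt_const.add hn) hq
  · exact contMDiffAt_const.div₀ (contMDiffAt_const.add hn) hq
  · exact ContMDiffAt.comp (g := fun z : ℝ × Cot I Z => geoFlow h z.1 z.2)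
      (f := fun c : Cot I Z => (flowTime (-1) (normSq h c), c)) c (contMDiff_geoFlow h).contMDiffAt
      ((contMDiffAt_flowTime contMDiffAt_const hn (normSq_nonneg h c)).prodMk contMDiffAt_id)

lemma contMDiffAt_stereo {f : ScCot I Z} (hf : e - f.1 ≠ 0) :
    ContMDiffAt (scModel I) (cotModel I) ∞ (stereo h e) f := by
  have hn : ContMDiffAt (scModel I) 𝓘(ℝ, ℝ) ∞ (fun f : ScCot I Z => normSq h f.2) f :=
    ((contMDiff_normSq h).comp contMDiff_snd).contMDiffAt
  have hw : ContMDiffAt (scModel I) 𝓘(ℝ, ℝ) ∞ (fun f : ScCot I Z => 1 / (e - f.1)) f :=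
    contMDiffAt_const.div₀ (contMDiffAt_const.sub contMDiffAt_fst) hf
  refine ContMDiffAt.cotScale hw ?_
  exact ContMDiffAt.comp (g := fun z : ℝ × Cot I Z => geoFlow h z.1 z.2)
    (f := fun f : ScCot I Z => (flowTime (1 / (e - f.1)) (normSq h f.2), f.2)) f
    (contMDiff_geoFlow h).contMDiffAt
    ((contMDiffAt_flowTime hw hn (normSq_nonneg h _)).prodMk contMDiffAt_snd)

lemma isOpen_stereoDom : IsOpen {f : ScCot I Z | 0 < e * (e - f.1)} :=
  isOpen_lt continuous_const (continuous_const.mul (continuous_const.sub continuous_fst))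

/-- With `n = |c|²` the differential of the height is `2e dn/(1 + n)²`. The flow for the time
`flowTime (-1) n` changes the canonical form by `-dn/(1 + n)`, which after the scaling cancels it
exactly. This is why the projection is combined with the flow. -/
lemma contactForm_stereoInv (he : e ≠ 0) (c : Cot I Z) (v : TangentSpace (cotModel I) c) :
    contactForm (stereoInv h e c) (mfderiv (cotModel I) (scModel I) (stereoInv h e) c v) =
      2 * e / (1 + normSq h c) * canonicalForm c v := by
  have hq : 1 + normSq h c ≠ 0 := by linarith [normSq_nonneg h c]
  have hsm := (contMDiff_stereoInv h (e := e)).mdifferentiableAt (x := c) (by simp)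
  rw [contactForm_mfderiv hsm]
  have hid : MDifferentiableAt (cotModel I) (cotModel I) (fun c : Cot I Z => c) c :=
    mdifferentiableAt_id
  have hn : MDifferentiableAt (cotModel I) 𝓘(ℝ, ℝ) (normSq h) c :=
    (contMDiff_normSq h).mdifferentiableAt (by simp)
  have hfl : MDifferentiableAt (cotModel I) (cotModel I)
      (fun c : Cot I Z => geoFlow h (flowTime (-1) (normSq h c)) c) c := by
    refine ContMDiffAt.mdifferentiableAt (n := ∞) ?_ (by simp)
    exact ContMDiffAt.comp (g := fun z : ℝ × Cot I Z => geoFlow h z.1 z.2)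
      (f := fun c : Cot I Z => (flowTime (-1) (normSq h c), c)) c (contMDiff_geoFlow h).contMDiffAt
      ((contMDiffAt_flowTime contMDiffAt_const (contMDiff_normSq h).contMDiffAt
        (normSq_nonneg h c)).prodMk contMDiffAt_id)
  have e1 : pullForm (cotModel I) (fun c => (stereoInv h e c).2) c v = _ :=
    pullForm_scale hfl (mdifferentiableAt_snd.comp c hsm) v
  have e2 := pullForm_geoFlow_flowTime h hid (w := fun _ => -1) mdifferentiableAt_const v
  have e3 : pullForm (cotModel I) (fun c : Cot I Z => c) c v = canonicalForm c v :=
    congrArg (fun A : TangentSpace (cotModel I) c →L[ℝ] TangentSpace (cotModel I) c =>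
      canonicalForm c (A v)) mfderiv_id
  have hτ : MDifferentiableAt (cotModel I) 𝓘(ℝ, ℝ) (fun c => (stereoInv h e c).1) c :=
    mdifferentiableAt_fst.comp c hsm
  rw [e1, e2, e3]
  obtain ⟨γ, -, hγ, hk, rfl⟩ := exists_curve c v
  have dn := hasDerivAt_velAt hk hγ hn
  have e4 := dd_velAt hk hγ (f := fun _ : Cot I Z => (-1 : ℝ)) mdifferentiableAt_const
    (hasDerivAt_const (0 : ℝ) (-1))
  have e5 := dd_velAt hk hγ hτ (((dn.const_sub 1).const_mul (-e)).div (dn.const_add 1)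
    (by rw [hk]; exact hq))
  rw [e4, e5]
  simp only [hk]
  field_simp
  ring

lemma corner_rb_legL : corner .rb (legL h lam) = corner .lb (legL h lam) := by
  ext w
  have h1 := swapFactors_mem_legL_iff h (lam := lam) (q := (0, w.1, w.2))
  rw [swapFactors, sub_zero] at h1
  exact h1

/-- At `θ = 0` the relations give `μ' = 0` and `τ' = e` with `e = ±λ`; then `transitDen = e (e -
τ'')`, and its positivity is the first condition of `sphereBundle`. The transit time becomes
`flowTime (1 / (e - τ''))`, the one in `stereo`, so the base point `y'` is the base point of the
stereographic image. -/
lemma mem_corner_legL (hlam : 0 < lam) (S : SideFace) {b f : ScCot I Z} :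
    (b, f) ∈ corner S (legL h lam) ↔ ∃ e ∈ ({lam, -lam} : Finset ℝ),
      f ∈ sphereBundle h e ∧ b = (e, Cot.zero (stereo h e f).proj) := by
  have hS : corner S (legL h lam) = corner .lb (legL h lam) := by
    cases S
    · rfl
    · exact corner_rb_legL h
  have hpi := Real.pi_pos
  rw [hS]
  change ((0 : ℝ), b, f) ∈ legL h lam ↔ _
  rw [mem_legL_of_lt h hlam ⟨le_rfl, by linarith⟩]
  obtain ⟨a, p'⟩ := b
  obtain ⟨τ, p⟩ := f
  have hT : a ^ 2 = lam ^ 2 → a ≠ 0 →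
      legTime h lam (legCoord ((0 : ℝ), (a, p'), (τ, p))) = flowTime (1 / (a - τ)) (normSq h p) := by
    intro ha ha0
    simp only [legTime, legCoord, transit, transitDen, Real.tan_zero, zero_mul, add_zero]
    rw [← ha, show a ^ 2 - a * τ = a * (a - τ) by ring, div_mul_eq_div_div, div_self ha0]
  constructor
  · rintro ⟨⟨-, hD⟩, hpar, heq⟩
    simp only [legCoord, transitDen, Real.tan_zero, zero_mul, add_zero] at hD
    simp only [legEq, legCoord, Real.tan_zero, Prod.mk_eq_zero] at heq
    obtain ⟨h1, h2⟩ := heq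
    have h3 : a ^ 2 = lam ^ 2 := by linarith
    have ha : a = lam ∨ a = -lam := sq_eq_sq_iff_eq_or_eq_neg.1 h3
    have ha0 : a ≠ 0 := by rintro rfl; nlinarith
    refine ⟨a, by simpa using ha, ⟨?_, ?_⟩, ?_⟩
    · change 0 < a * (a - τ)
      nlinarith
    · change τ ^ 2 + normSq h p = a ^ 2
      linarith
    · have h4 : (geoFlow h (legTime h lam (legCoord ((0 : ℝ), (a, p'), (τ, p)))) p).scale
          (-Real.tan 0) = p' := congrArg (fun q : FibCot I Z => q.2.1.2) hpar
      rw [hT h3 ha0, Real.tan_zero, neg_zero, scale_zero] at h4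
      exact Prod.ext rfl h4.symm
  · rintro ⟨e, he, hf, heq⟩
    rw [Prod.mk.injEq] at heq
    obtain ⟨rfl, rfl⟩ := heq
    have h3 : a ^ 2 = lam ^ 2 := by
      simp only [Finset.mem_insert, Finset.mem_singleton] at he
      rcases he with rfl | rfl <;> ring
    have ha0 : a ≠ 0 := by rintro rfl; nlinarith
    have hf1 : 0 < a * (a - τ) := hf.1
    have hf2 : τ ^ 2 + normSq h p = a ^ 2 := hf.2
    refine ⟨⟨⟨?_, ?_⟩, ?_⟩, ?_, ?_⟩
    · change -(Real.pi / 2) < 0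
      linarith
    · change 0 < Real.pi / 2
      linarith
    · simp only [legCoord, transitDen, Real.tan_zero, zero_mul, add_zero]
      nlinarith
    · simp only [legParam, hT h3 ha0]
      simp only [legCoord, Real.tan_zero, neg_zero, scale_zero]
      rfl
    · simp only [legEq, legCoord, Real.tan_zero, Prod.mk_eq_zero]
      constructor <;> linarith

lemma cornerFibre_legL (hlam : 0 < lam) (S : SideFace) (he : e ∈ ({lam, -lam} : Finset ℝ)) (z : Z) :
    cornerFibre S (legL h lam) (e, Cot.zero z) =
      {f | f ∈ sphereBundle h e ∧ (stereo h e f).proj = z} := by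
  ext f
  change (_, _) ∈ corner S _ ↔ _
  rw [mem_corner_legL h hlam]
  constructor
  · rintro ⟨e', -, hf, heq⟩
    obtain ⟨rfl, h2⟩ := Prod.ext_iff.1 heq
    exact ⟨hf, (congrArg (fun p : Cot I Z => p.proj) h2).symm⟩
  · rintro ⟨hf, rfl⟩
    exact ⟨e, he, hf, rfl⟩

/-- Under `stereo` this set corresponds to the cotangent space at `z`, on which the canonical form
vanishes; by `contactForm_stereoInv` the contact form corresponds to a multiple of it. -/
lemma isLegendre_cornerFibre (he : e ≠ 0) (z : Z) :
    IsLegendre {f | f ∈ sphereBundle h e ∧ (stereo h e f).proj = z} := by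
  rintro p ⟨hp, hpz⟩
  set V : Set (Cot I Z) := (fun c : Cot I Z => c.proj) ⁻¹' (chartAt H z).source with hV
  have hVo : IsOpen V := (chartAt H z).open_source.preimage contMDiff_proj.continuous
  have hst : ContMDiffOn (scModel I) (cotModel I) ∞ (stereo h e) {f | 0 < e * (e - f.1)} :=
    fun f hf => (contMDiffAt_stereo h (fun h0 => by
      have : 0 < e * (e - f.1) := hf
      rw [h0, mul_zero] at this; exact this.false)).contMDiffWithinAt
  have hz : z ∈ (chartAt H z).source := mem_chart_source H z
  have hpV : stereo h e p ∈ V := by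
    change (stereo h e p).proj ∈ (chartAt H z).source
    rw [hpz]
    exact hz
  have hg : ∀ c ∈ V, ContMDiffAt (cotModel I) 𝓘(ℝ, E) ∞
      (fun c : Cot I Z => extChartAt I z c.proj - extChartAt I z z) c := fun c hc =>
    (contMDiffAt_chart_proj (f := fun c => c) hc contMDiffAt_id).sub contMDiffAt_const
  have hdd : ∀ v : TangentSpace (cotModel I) (stereo h e p),
      dd (cotModel I) (fun c : Cot I Z => extChartAt I z c.proj - extChartAt I z z) (stereo h e p) v =
      dd (cotModel I) (fun c : Cot I Z => extChartAt I z c.proj) (stereo h e p) v := by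
    intro v
    obtain ⟨γ, -, hγ, hk, rfl⟩ := exists_curve (stereo h e p) v
    exact dd_velAt hk hγ ((hg _ hpV).mdifferentiableAt (by simp)) ((hasDerivAt_velAt hk hγ
      ((contMDiffAt_chart_proj (f := fun c => c) hpV contMDiffAt_id).mdifferentiableAt
        (by simp))).sub_const _)
  obtain ⟨F, hF, hF0⟩ := exists_cutsOut_of_retraction (IK := scModel I) (IN := cotModel I)
    (ψ := stereo h e) (ι := stereoInv h e)
    (g := fun c : Cot I Z => extChartAt I z c.proj - extChartAt I z z) (ρ := fun _ => 1)
    (S := {f | f ∈ sphereBundle h e ∧ (stereo h e f).proj = z})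
    (p := p) (V := V) (c := Module.finrank ℝ E + 1)
    (hst.continuousOn.isOpen_inter_preimage isOpen_stereoDom hVo) ⟨hp.1, hpV⟩
    (hst.mono inter_subset_left) hVo (fun f hf => hf.2)
    (contMDiff_stereoInv h).contMDiffOn (fun c hc => (hg c hc).contMDiffWithinAt)
    (fun c _ _ => stereo_stereoInv h he c)
    (fun x hx => by
      have hinj : extChartAt I z (stereo h e x).proj - extChartAt I z z = 0 ↔
          (stereo h e x).proj = z := by
        rw [sub_eq_zero]
        refine (extChartAt I z).injOn.eq_iff ?_ (mem_extChartAt_source z)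
        rw [extChartAt_source]; exact hx.2
      rw [hinj]
      constructor
      · rintro ⟨h1, h2⟩
        exact ⟨zero_le_one, stereoInv_stereo h h1, h2⟩
      · rintro ⟨-, h1, h2⟩
        refine ⟨?_, h2⟩
        rw [← h1]
        exact stereoInv_mem h he _)
    ⟨hp, hpz⟩ (fun w => by
      obtain ⟨v, hv⟩ := exists_dd_chart_proj (p := stereo h e p) hpV w
      exact ⟨v, (hdd v).trans hv⟩)
    (fun h0 => absurd h0 one_ne_zero) (by
      simp only [Module.finrank_prod, Module.finrank_self, finrank_clm_real]
      ring)
  refine ⟨F, hF, hF0 contactForm fun v hv => ?_⟩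
  have e3 : pullForm (cotModel I) (fun c : Cot I Z => c) (stereo h e p) v =
      canonicalForm (stereo h e p) v :=
    congrArg (fun A : TangentSpace (cotModel I) (stereo h e p) →L[ℝ]
      TangentSpace (cotModel I) (stereo h e p) => canonicalForm (stereo h e p) (A v)) mfderiv_id
  have e4 := pullForm_eq_fibCoord (f := fun c : Cot I Z => c) (k := stereo h e p) hpV
    mdifferentiableAt_id v
  rw [contactForm_stereoInv h he, ← e3, e4, ← hdd, hv, map_zero, mul_zero]

/-- Through `stereo` the corner over one sheet is the cotangent bundle with its projection to `Z`.
So a local trivialization keeps the chart coordinates of the stereographic image and changes only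
its base point. -/
lemma isFibration_corner_legL (hlam : 0 < lam) (S : SideFace) :
    IsFibration (corner S (legL h lam))
      {q : ScCot I Z | ∃ c ∈ ({lam, -lam} : Finset ℝ), ∃ z, q = (c, Cot.zero z)} := by
  have hsign : ∀ e ∈ ({lam, -lam} : Finset ℝ), ∀ e' ∈ ({lam, -lam} : Finset ℝ), 0 < e * e' →
      e' = e := by
    intro e he e' he' h0
    simp only [Finset.mem_insert, Finset.mem_singleton] at he he'
    rcases he with rfl | rfl <;> rcases he' with rfl | rfl <;> first | rfl | nlinarith
  have hne : ∀ e ∈ ({lam, -lam} : Finset ℝ), e ≠ 0 := by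
    intro e he
    simp only [Finset.mem_insert, Finset.mem_singleton] at he
    rcases he with rfl | rfl
    · exact hlam.ne'
    · exact (neg_neg_of_pos hlam).ne
  have hmem : ∀ e ∈ ({lam, -lam} : Finset ℝ), ∀ c : Cot I Z,
      ((e, Cot.zero c.proj), stereoInv h e c) ∈ corner S (legL h lam) := fun e he c =>
    (mem_corner_legL h hlam S).2 ⟨e, he, stereoInv_mem h (hne e he) c, by
      rw [stereo_stereoInv h (hne e he)]⟩
  refine ⟨?_, ?_⟩
  · ext q
    constructor
    · rintro ⟨⟨b, f⟩, hw, rfl⟩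
      obtain ⟨e, he, -, rfl⟩ := (mem_corner_legL h hlam S).1 hw
      exact ⟨e, he, _, rfl⟩
    · rintro ⟨e, he, z, rfl⟩
      exact ⟨_, hmem e he (Cot.zero z), rfl⟩
  · rintro _ ⟨e, he, z, rfl⟩
    have he0 : e ≠ 0 := hne e he
    have hz : z ∈ (chartAt H z).source := mem_chart_source H z
    set V : Set (ScCot I Z) := {j | 0 < e * j.1 ∧ j.2.proj ∈ (chartAt H z).source} with hV
    have hVo : IsOpen V := (isOpen_lt continuous_const (continuous_const.mul continuous_fst)).inter
      ((chartAt H z).open_source.preimage (contMDiff_proj.continuous.comp continuous_snd))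
    have key : ∀ j ∈ V, ∀ f, (j, f) ∈ corner S (legL h lam) → f ∈ sphereBundle h e ∧
        j = (e, Cot.zero (stereo h e f).proj) ∧ (stereo h e f).proj ∈ (chartAt H z).source := by
      intro j hj f hjf
      obtain ⟨e', he', hf, rfl⟩ := (mem_corner_legL h hlam S).1 hjf
      obtain rfl := hsign e he e' he' hj.1
      exact ⟨hf, rfl, hj.2⟩
    refine ⟨V, fun w => stereoInv h e (ofFib z z (fibCoord z (stereo h e w.2))),
      fun w => stereoInv h e (ofFib z w.1.2.proj (fibCoord z (stereo h e w.2))), hVo,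
      ⟨mul_self_pos.2 he0, hz⟩, ?_, ?_, ?_, ?_⟩
    · rintro ⟨j, f⟩ ⟨hjf, hj⟩
      obtain ⟨hf, -, hs⟩ := key j hj f hjf
      have h1 : ContMDiffAt ((scModel I).prod (scModel I)) (cotModel I) ∞
          (fun w : ScCot I Z × ScCot I Z => stereo h e w.2) (j, f) :=
        ContMDiffAt.comp (g := stereo h e) (j, f)
          (contMDiffAt_stereo h (sub_ne_zero_of_mem h hf)) contMDiffAt_snd
      have h2 : ContMDiffAt ((scModel I).prod (scModel I)) 𝓘(ℝ, E →L[ℝ] ℝ) ∞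
          (fun w : ScCot I Z × ScCot I Z => fibCoord z (stereo h e w.2)) (j, f) :=
        ContMDiffAt.comp (g := fibCoord z) (j, f) (contMDiffAt_fibCoord hs) h1
      exact (ContMDiffAt.comp (g := stereoInv h e) (j, f) (contMDiff_stereoInv h).contMDiffAt
        (contMDiffAt_ofFib hz contMDiffAt_const h2)).contMDiffWithinAt
    · rintro ⟨j, f⟩ ⟨⟨-, hj⟩, hbf⟩
      obtain ⟨hf, -, hs⟩ := key (e, Cot.zero z) ⟨mul_self_pos.2 he0, hz⟩ f hbf
      have h1 : ContMDiffAt ((scModel I).prod (scModel I)) (cotModel I) ∞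
          (fun w : ScCot I Z × ScCot I Z => stereo h e w.2) (j, f) :=
        ContMDiffAt.comp (g := stereo h e) (j, f)
          (contMDiffAt_stereo h (sub_ne_zero_of_mem h hf)) contMDiffAt_snd
      have h2 : ContMDiffAt ((scModel I).prod (scModel I)) 𝓘(ℝ, E →L[ℝ] ℝ) ∞
          (fun w : ScCot I Z × ScCot I Z => fibCoord z (stereo h e w.2)) (j, f) :=
        ContMDiffAt.comp (g := fibCoord z) (j, f) (contMDiffAt_fibCoord hs) h1
      have h3 : ContMDiffAt ((scModel I).prod (scModel I)) I ∞
          (fun w : ScCot I Z × ScCot I Z => w.1.2.proj) (j, f) :=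
        (contMDiff_proj.comp (contMDiff_snd.comp contMDiff_fst)).contMDiffAt
      exact (ContMDiffAt.comp (g := stereoInv h e) (j, f) (contMDiff_stereoInv h).contMDiffAt
        (contMDiffAt_ofFib hj.2 h3 h2)).contMDiffWithinAt
    · intro j hj f hjf
      obtain ⟨hf, rfl, hs⟩ := key j hj f hjf
      refine ⟨?_, ?_⟩
      · have := hmem e he (ofFib z z (fibCoord z (stereo h e f)))
        rwa [proj_ofFib hz] at this
      · simp only [stereo_stereoInv h he0, fibCoord_ofFib hz, proj_zero, ofFib_fibCoord hs]
        exact stereoInv_stereo h hf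
    · rintro j ⟨⟨e', he', y, rfl⟩, hj⟩ k hbk
      obtain rfl := hsign e he e' he' hj.1
      obtain ⟨hk, hb, hs⟩ := key (e', Cot.zero z) ⟨mul_self_pos.2 he0, hz⟩ k hbk
      have hsz : z = (stereo h e' k).proj :=
        congrArg (fun b : ScCot I Z => b.2.proj) hb
      have hy : y ∈ (chartAt H z).source := hj.2
      refine ⟨?_, ?_⟩
      · have := hmem e' he (ofFib z y (fibCoord z (stereo h e' k)))
        rwa [proj_ofFib hy] at this
      · simp only [stereo_stereoInv h he0, proj_zero, fibCoord_ofFib hy]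
        have h1 : ofFib z z (fibCoord z (stereo h e' k)) = stereo h e' k := by
          have := ofFib_fibCoord hs
          rwa [← hsz] at this
        rw [h1]
        exact stereoInv_stereo h hk

theorem isFibLegendre_legL (hlam : 0 < lam) : IsFibLegendre (legL h lam) := by
  refine ⟨isNeatIntegralSubmanifold_legL h hlam, fun S => ⟨_, isLegendre_constGraph {lam, -lam},
    isFibration_corner_legL h hlam S, ?_⟩⟩
  rintro _ ⟨e, he, z, rfl⟩
  rw [cornerFibre_legL h hlam S he z]
  refine isLegendre_cornerFibre h ?_ z
  simp only [Finset.mem_insert, Finset.mem_singleton] at he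
  rcases he with rfl | rfl
  · exact hlam.ne'
  · exact (neg_neg_of_pos hlam).ne

end Corner
end ScatGeom

namespace ScatGeom

section PolarLift

lemma eq_of_mem_closure {X Y : Type*} [TopologicalSpace X] [TopologicalSpace Y] [T1Space Y]
    {A : Set X} {x : X} {f : X → Y} {c : Y} (hx : x ∈ closure A) (hf : ContinuousAt f x)
    (hA : ∀ a ∈ A, f a = c) : f x = c := by
  by_contra hne
  have h1 : ∀ᶠ a in 𝓝 x, f a ≠ c := hf.eventually_ne hne
  exact (mem_closure_iff_frequently.1 hx) (h1.mono fun a ha haA => ha (hA a haA))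

variable {EK : Type*} [NormedAddCommGroup EK] [NormedSpace ℝ EK] [FiniteDimensional ℝ EK]
  {HK : Type*} [TopologicalSpace HK] {IK : ModelWithCorners ℝ EK HK} [IK.Boundaryless]
  {K : Type*} [TopologicalSpace K] [ChartedSpace HK K] [IsManifold IK ∞ K] [T2Space K]
  {EN : Type*} [NormedAddCommGroup EN] [NormedSpace ℝ EN] [FiniteDimensional ℝ EN]
  {HN : Type*} [TopologicalSpace HN] {IN : ModelWithCorners ℝ EN HN} [IN.Boundaryless]
  {N : Type*} [TopologicalSpace N] [ChartedSpace HN N] [IsManifold IN ∞ N]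
  {W : Type*} [NormedAddCommGroup W] [NormedSpace ℝ W] [FiniteDimensional ℝ W]
  {k : ℕ}

/-! ### Lifts to the blow-up -/

/-- Along an ultrafilter of points off `{u = 0}` that converges to `q`, the directions `u/‖u‖`
converge because the unit sphere is compact. The limit is a point of the closed lift above `q`. -/
lemma closure_subset_image_polarLift {u : K → EuclideanSpace ℝ (Fin k)} {G U : Set K}
    (hU : IsOpen U) (hu : ContinuousOn u U) (hG : G ∩ U ⊆ closure {q ∈ G ∩ U | u q ≠ 0}) :
    closure G ∩ U ⊆ Prod.fst '' closure (polarLift u (G ∩ U)) := by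
  rintro q ⟨hq, hqU⟩
  have h1 : q ∈ closure {q ∈ G ∩ U | u q ≠ 0} := by
    have : q ∈ closure (G ∩ U) := by
      rw [inter_comm]
      exact hU.inter_closure ⟨hqU, hq⟩
    exact (closure_minimal hG isClosed_closure) this
  rw [mem_closure_iff_ultrafilter] at h1
  obtain ⟨F, hF, hFq⟩ := h1
  have hcu : ContinuousAt u q := hu.continuousAt (hU.mem_nhds hqU)
  obtain ⟨ν, -, hν⟩ := (isCompact_sphere (0 : EuclideanSpace ℝ (Fin k)) 1).ultrafilter_le_nhds
    (F.map fun q => ‖u q‖⁻¹ • u q) (by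
      rw [Ultrafilter.coe_map, Filter.le_principal_iff, Filter.mem_map]
      filter_upwards [hF] with x hx
      have hx0 : ‖u x‖ ≠ 0 := norm_ne_zero_iff.2 hx.2
      simp [norm_smul, hx0])
  refine ⟨(q, ‖u q‖, ν), ?_, rfl⟩
  have hlim : Filter.Tendsto (fun q => (q, ‖u q‖, ‖u q‖⁻¹ • u q)) F (𝓝 (q, ‖u q‖, ν)) :=
    Filter.Tendsto.prodMk_nhds hFq (Filter.Tendsto.prodMk_nhds (hcu.norm.tendsto.mono_left hFq) hν)
  refine mem_closure_of_tendsto hlim ?_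
  filter_upwards [hF] with x hx
  exact ⟨hx.1, hx.2, rfl, rfl⟩

/-- A criterion for the closure of a lift to be a submanifold: it is parametrized by
`(φ, r, w)` on `{‖w‖ = 1, g = 0}`, with a left inverse `ψ` of the parametrization; the scalings `σ`
make `‖w‖ = 1` an independent equation and, with the translations `ε` of `r`, give the
transversality to the front face. -/
theorem isNeatSubmanifold_polarLift {u : K → EuclideanSpace ℝ (Fin k)} {G U : Set K}
    {O : Set (K × ℝ × EuclideanSpace ℝ (Fin k))} {V : Set N}
    {ψ : K × ℝ × EuclideanSpace ℝ (Fin k) → N} {φ : N → K} {r : N → ℝ}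
    {w : N → EuclideanSpace ℝ (Fin k)} {g : N → W} {σ ε : ℝ → N → N} {c : ℕ}
    (hO : IsOpen O) (hV : IsOpen V)
    (hψ : ContMDiffOn (IK.prod (𝓘(ℝ, ℝ).prod 𝓘(ℝ, EuclideanSpace ℝ (Fin k)))) IN ∞ ψ O)
    (hψO : MapsTo ψ O V) (hφ : ContMDiffOn IN IK ∞ φ V) (hr : ContMDiffOn IN 𝓘(ℝ, ℝ) ∞ r V)
    (hw : ContMDiffOn IN 𝓘(ℝ, EuclideanSpace ℝ (Fin k)) ∞ w V)
    (hg : ContMDiffOn IN 𝓘(ℝ, W) ∞ g V)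
    (hid : ∀ n ∈ V, (φ n, r n, w n) ∈ O → ψ (φ n, r n, w n) = n)
    (hOU : ∀ x ∈ O, x.1 ∈ U)
    (hcl : ∀ x ∈ closure (polarLift u (G ∩ U)), x.1 ∈ U → x ∈ O)
    (hS : ∀ x ∈ O, 0 < x.2.1 → (x ∈ polarLift u (G ∩ U) ↔
      (φ (ψ x), r (ψ x), w (ψ x)) = x ∧ ‖w (ψ x)‖ = 1 ∧ g (ψ x) = 0))
    (hσr : ∀ n ∈ V, ∀ s > 0, r (σ s n) = r n / s) (hσw : ∀ n ∈ V, ∀ s > 0, w (σ s n) = s • w n)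
    (hσg : ∀ n ∈ V, ∀ s > 0, g (σ s n) = g n) (hσ1 : ∀ n, σ 1 n = n)
    (hσc : ∀ n ∈ V, ContinuousAt (fun x : ℝ × N => σ x.1 x.2) (1, n))
    (hσd : ∀ n ∈ V, MDifferentiableAt 𝓘(ℝ, ℝ) IN (fun s => σ s n) 1)
    (hεr : ∀ n ∈ V, r n = 0 → ∀ t, r (ε t n) = t) (hεg : ∀ n ∈ V, ∀ t, g (ε t n) = g n)
    (hε0 : ∀ n, ε 0 n = n) (hεd : ∀ n ∈ V, MDifferentiableAt 𝓘(ℝ, ℝ) IN (fun t => ε t n) 0)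
    (hgs : ∀ n ∈ V, g n = 0 → ∀ y : W, ∃ v : TangentSpace IN n, dd IN g n v = y)
    (hc : c + Module.finrank ℝ EN =
      Module.finrank ℝ EK + (1 + k) + (1 + Module.finrank ℝ W)) :
    IsNeatSubmanifold (IK.prod (𝓘(ℝ, ℝ).prod 𝓘(ℝ, EuclideanSpace ℝ (Fin k))))
      (fun x : K × ℝ × EuclideanSpace ℝ (Fin k) => x.2.1) c
      (closure (polarLift u (G ∩ U)) ∩ Prod.fst ⁻¹' U) := by
  set ι : N → K × ℝ × EuclideanSpace ℝ (Fin k) := fun n => (φ n, r n, w n) with hι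
  set gg : N → ℝ × W := fun n => (‖w n‖ ^ 2 - 1, g n) with hgg
  have hgg0 : ∀ n, gg n = 0 ↔ ‖w n‖ = 1 ∧ g n = 0 := fun n => by
    rw [hgg, Prod.mk_eq_zero]
    refine and_congr_left fun _ => ?_
    rw [sub_eq_zero, pow_eq_one_iff_of_nonneg (norm_nonneg _) two_ne_zero]
  have hιs : ContMDiffOn IN (IK.prod (𝓘(ℝ, ℝ).prod 𝓘(ℝ, EuclideanSpace ℝ (Fin k)))) ∞ ι V :=
    hφ.prodMk (hr.prodMk hw)
  have hg1 : ContMDiffOn IN 𝓘(ℝ, ℝ) ∞ (fun n => ‖w n‖ ^ 2 - 1) V := by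
    have h1 : ContDiff ℝ ∞ (fun x : EuclideanSpace ℝ (Fin k) => ‖x‖ ^ 2 - 1) :=
      (contDiff_norm_sq ℝ).sub contDiff_const
    exact h1.contMDiff.comp_contMDiffOn hw
  have hggs : ContMDiffOn IN 𝓘(ℝ, ℝ × W) ∞ gg V := hg1.prodMk_space hg
  have hat : ∀ n ∈ V, ContMDiffAt IN 𝓘(ℝ, ℝ × W) ∞ gg n := fun n hn =>
    (hggs n hn).contMDiffAt (hV.mem_nhds hn)
  have hcσ : ∀ n ∈ V, MDifferentiableAt 𝓘(ℝ, ℝ) IN (fun t => σ (1 + t) n) 0 := fun n hn => by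
    have h1 : MDifferentiableAt 𝓘(ℝ, ℝ) 𝓘(ℝ, ℝ) (fun t : ℝ => 1 + t) 0 :=
      (differentiableAt_id.const_add 1).mdifferentiableAt
    refine MDifferentiableAt.comp (g := fun s => σ s n) (0 : ℝ) ?_ h1
    rw [add_zero]
    exact hσd n hn
  have hc0 : ∀ n, (fun t => σ (1 + t) n) 0 = n := fun n => by simp [hσ1]
  have hpos : ∀ᶠ t : ℝ in 𝓝 0, 0 < 1 + t := by
    filter_upwards [eventually_gt_nhds (show (-1 : ℝ) < 0 by norm_num)] with t ht
    linarith
  have hrad : ∀ n ∈ V, ‖w n‖ = 1 →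
      dd IN gg n (velAt (c := fun t => σ (1 + t) n) (hc0 n)) = (2, 0) := fun n hn hwn => by
    refine dd_velAt (hc0 n) (hcσ n hn) ((hat n hn).mdifferentiableAt (by simp)) ?_
    have h1 : HasDerivAt (fun t : ℝ => ((1 + t) ^ 2 - 1, g n)) ((2 : ℝ), (0 : W)) 0 := by
      refine HasDerivAt.prodMk ?_ (hasDerivAt_const _ _)
      refine ((((hasDerivAt_id (0 : ℝ)).const_add 1).pow 2).sub_const 1).congr_deriv ?_
      simp
    refine h1.congr_of_eventuallyEq ?_
    filter_upwards [hpos] with t ht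
    simp only [hgg, hσw n hn _ ht, hσg n hn _ ht, norm_smul, hwn, mul_one, Real.norm_eq_abs, sq_abs]
  have hggd : ∀ n ∈ V, ∀ v : TangentSpace IN n, dd IN gg n v =
      (dd IN (fun n => ‖w n‖ ^ 2 - 1) n v, dd IN g n v) := fun n hn v =>
    dd_prodMk (((hg1 n hn).contMDiffAt (hV.mem_nhds hn)).mdifferentiableAt (by simp))
      (((hg n hn).contMDiffAt (hV.mem_nhds hn)).mdifferentiableAt (by simp)) v
  -- Closure points satisfy the equations by continuity. Conversely, a solution with positive radius
  -- is already in the lift, and a solution on the front face is a limit of such ones.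
  have hSO : ∀ x ∈ O, x ∈ closure (polarLift u (G ∩ U)) ∩ Prod.fst ⁻¹' U ↔
      0 ≤ x.2.1 ∧ ι (ψ x) = x ∧ gg (ψ x) = 0 := by
    intro x hx
    have hψx : ContinuousAt ψ x := hψ.continuousOn.continuousAt (hO.mem_nhds hx)
    have hVx : V ∈ 𝓝 (ψ x) := hV.mem_nhds (hψO hx)
    have hιx : ContinuousAt ι (ψ x) := hιs.continuousOn.continuousAt hVx
    constructor
    · rintro ⟨hxc, -⟩
      have h1 : x ∈ closure (polarLift u (G ∩ U) ∩ O) := by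
        rw [inter_comm]
        exact hO.inter_closure ⟨hx, hxc⟩
      have hlift : ∀ y ∈ polarLift u (G ∩ U) ∩ O, 0 ≤ y.2.1 ∧ ι (ψ y) = y ∧ gg (ψ y) = 0 := by
        rintro y ⟨hy, hyO⟩
        have h0 : 0 < y.2.1 := by
          rw [hy.2.2.1]
          exact norm_pos_iff.2 hy.2.1
        obtain ⟨h2, h3⟩ := (hS y hyO h0).1 hy
        exact ⟨h0.le, h2, (hgg0 _).2 h3⟩
      refine ⟨?_, ?_, ?_⟩
      · have : IsClosed {y : K × ℝ × EuclideanSpace ℝ (Fin k) | 0 ≤ y.2.1} :=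
          isClosed_le continuous_const (continuous_fst.comp continuous_snd)
        exact closure_minimal (fun y hy => (hlift y hy).1) this h1
      · have h2 : ContinuousAt (fun y => ι (ψ y)) x := ContinuousAt.comp hιx hψx
        exact tendsto_nhds_unique_of_frequently_eq h2.tendsto Filter.tendsto_id
          ((mem_closure_iff_frequently.1 h1).mono fun y hy => (hlift y hy).2.1)
      · exact eq_of_mem_closure (f := fun y => gg (ψ y)) h1 (ContinuousAt.comp (g := gg)
          (hggs.continuousOn.continuousAt hVx) hψx) fun y hy => (hlift y hy).2.2
    · rintro ⟨hx0, hx1, hx2⟩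
      refine ⟨?_, hOU x hx⟩
      rcases hx0.eq_or_lt with h0 | h0
      · set n := ψ x with hn
        have hnV : n ∈ V := hψO hx
        obtain ⟨hw1, hg0⟩ := (hgg0 n).1 hx2
        have hrn : r n = 0 := by
          have : (ι n).2.1 = x.2.1 := by rw [hx1]
          exact this.trans h0.symm
        have hε : Filter.Tendsto (fun t => ε t n) (𝓝 0) (𝓝 n) := by
          have := (hεd n hnV).continuousAt.tendsto
          simpa only [hε0] using this
        have hwc : ContinuousAt w n := hw.continuousOn.continuousAt (hV.mem_nhds hnV)
        have hN : Filter.Tendsto (fun t => ‖w (ε t n)‖⁻¹) (𝓝 0) (𝓝 1) := by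
          have h1 := ((hwc.tendsto.comp hε).norm).inv₀ (by rw [hw1]; exact one_ne_zero)
          rw [hw1, inv_one] at h1
          exact h1
        -- Approach the front face point by making the radius equal to `t > 0`. The translation may
        -- spoil `‖w‖ = 1`; the scaling restores it and changes the radius only by a positive
        -- factor.
        set γ : ℝ → N := fun t => σ (‖w (ε t n)‖⁻¹) (ε t n) with hγ
        have hγt : Filter.Tendsto γ (𝓝 0) (𝓝 n) := by
          have h1 := (hσc n hnV).tendsto.comp (hN.prodMk_nhds hε)
          simp only [hσ1] at h1
          exact h1
        have hιγ : Filter.Tendsto (fun t => ι (γ t)) (𝓝[>] 0) (𝓝 x) := by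
          have h1 := hιx.tendsto.comp hγt
          rw [hx1] at h1
          exact h1.mono_left nhdsWithin_le_nhds
        refine mem_closure_of_tendsto hιγ ?_
        have hNpos : ∀ᶠ t in 𝓝 (0 : ℝ), 0 < ‖w (ε t n)‖⁻¹ := hN.eventually_const_lt one_pos
        have hγV := hγt.eventually_mem (hV.mem_nhds hnV)
        filter_upwards [self_mem_nhdsWithin, nhdsWithin_le_nhds hNpos, nhdsWithin_le_nhds hγV,
          nhdsWithin_le_nhds (hε.eventually_mem (hV.mem_nhds hnV)),
          hιγ.eventually_mem (hO.mem_nhds hx)] with t ht hNt hVt hεt hOt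
        have e1 : r (γ t) = t / ‖w (ε t n)‖⁻¹ := by
          simp only [hγ]
          rw [hσr _ hεt _ hNt, hεr n hnV hrn]
        have e2 : ‖w (γ t)‖ = 1 := by
          simp only [hγ]
          rw [hσw _ hεt _ hNt, norm_smul, norm_inv, norm_norm]
          exact inv_mul_cancel₀ (fun h => by rw [h, inv_zero] at hNt; exact hNt.false)
        have e3 : g (γ t) = 0 := by
          simp only [hγ]
          rw [hσg _ hεt _ hNt, hεg n hnV, hg0]
        have e4 : ψ (ι (γ t)) = γ t := hid _ hVt hOt
        have e5 : 0 < (ι (γ t)).2.1 := by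
          change 0 < r (γ t)
          rw [e1]
          exact div_pos ht hNt
        refine (hS _ hOt e5).2 ?_
        rw [e4]
        exact ⟨rfl, e2, e3⟩
      · exact subset_closure ((hS x hx h0).2 ⟨hx1, (hgg0 _).1 hx2⟩)
  intro p hp
  have hpO : p ∈ O := hcl p hp.1 hp.2
  obtain ⟨hp0, hp1, hp2⟩ := (hSO p hpO).1 hp
  obtain ⟨hwp, hgp⟩ := (hgg0 _).1 hp2
  have hVp := hψO hpO
  have hrad' := hrad (ψ p) hVp hwp
  obtain ⟨F, hF, -⟩ := exists_cutsOut_of_retraction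
    (IK := IK.prod (𝓘(ℝ, ℝ).prod 𝓘(ℝ, EuclideanSpace ℝ (Fin k)))) (IN := IN)
    (ψ := ψ) (ι := ι) (g := gg) (ρ := fun x => x.2.1) (p := p) (c := c) hO hpO hψ hV hψO hιs hggs
    hid hSO hp (fun y => by
      obtain ⟨v, hv⟩ := hgs (ψ p) hVp hgp y.2
      refine ⟨v + ((y.1 - dd IN (fun n => ‖w n‖ ^ 2 - 1) (ψ p) v) / 2) •
        velAt (c := fun t => σ (1 + t) (ψ p)) (hc0 (ψ p)), ?_⟩
      rw [map_add, map_smul, hrad', hggd _ hVp, hv]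
      refine Prod.ext ?_ ?_
      · simp
      · simp)
    (fun h0 => by
      refine ⟨(contMDiff_fst.comp contMDiff_snd : ContMDiff
        (IK.prod (𝓘(ℝ, ℝ).prod 𝓘(ℝ, EuclideanSpace ℝ (Fin k)))) 𝓘(ℝ, ℝ) ∞
        (fun x : K × ℝ × EuclideanSpace ℝ (Fin k) => x.2.1)).mdifferentiableAt (by simp), ?_⟩
      have hrp : r (ψ p) = 0 := by
        have : (ι (ψ p)).2.1 = p.2.1 := by rw [hp1]
        exact this.trans h0
      have hrd : MDifferentiableAt IN 𝓘(ℝ, ℝ) r (ψ p) :=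
        ((hr _ hVp).contMDiffAt (hV.mem_nhds hVp)).mdifferentiableAt (by simp)
      have d1 : dd IN r (ψ p) (velAt (c := fun t => ε t (ψ p)) (hε0 (ψ p))) = 1 := by
        refine dd_velAt (hε0 (ψ p)) (hεd _ hVp) hrd ?_
        simp only [hεr _ hVp hrp]
        exact hasDerivAt_id 0
      have d2 : dd IN r (ψ p) (velAt (c := fun t => σ (1 + t) (ψ p)) (hc0 (ψ p))) = 0 := by
        refine dd_velAt (hc0 (ψ p)) (hcσ _ hVp) hrd ?_
        refine (hasDerivAt_const (0 : ℝ) (0 : ℝ)).congr_of_eventuallyEq ?_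
        filter_upwards [hpos] with t ht
        rw [hσr _ hVp _ ht, hrp, zero_div]
      have d3 : dd IN g (ψ p) (velAt (c := fun t => ε t (ψ p)) (hε0 (ψ p))) = 0 := by
        refine dd_velAt (hε0 (ψ p)) (hεd _ hVp)
          (((hg _ hVp).contMDiffAt (hV.mem_nhds hVp)).mdifferentiableAt (by simp)) ?_
        simp only [hεg _ hVp]
        exact hasDerivAt_const _ _
      set v₁ := velAt (IK := IN) (c := fun t => ε t (ψ p)) (hε0 (ψ p))
      set v₂ := velAt (IK := IN) (c := fun t => σ (1 + t) (ψ p)) (hc0 (ψ p))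
      -- The translation of the radius, corrected by the scaling so as to be tangent to `‖w‖ = 1`.
      -- On the front face the scaling leaves `r = 0` unchanged, so the derivative of `r` stays 1.
      refine ⟨v₁ - (dd IN (fun n => ‖w n‖ ^ 2 - 1) (ψ p) v₁ / 2) • v₂, ?_, ?_⟩
      · rw [map_sub, map_smul, hrad', hggd _ hVp, d3]
        refine Prod.ext ?_ ?_
        · simp
        · simp
      · change dd IN r (ψ p) _ ≠ 0
        rw [map_sub, map_smul, d1, d2]
        simp)
    (by
      simp only [Module.finrank_prod, Module.finrank_self, finrank_euclideanSpace_fin]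
      linarith)
  exact ⟨F, hF⟩

end PolarLift
end ScatGeom

namespace ScatGeom

section ConicTime

/-! ### The time of transit near the conic points -/

/-- This is `arctan x + arctan (1/x) = ±π/2` with `x = √n w`. It trades an argument that tends to
infinity for one that tends to zero, which is what makes the time smooth at the conic points. -/
lemma flowTime_add_inv {w w' n : ℝ} (hn : 0 < n) (hw : w ≠ 0) (hww : n * (w * w') = 1) :
    flowTime w n = SignType.sign w * (Real.pi / √n) - flowTime w' n := by
  have hr : 0 < √n := Real.sqrt_pos.2 hn
  have hr2 : √n ^ 2 = n := Real.sq_sqrt hn.le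
  have h1 : √n * w' = (√n * w)⁻¹ := by
    refine eq_inv_of_mul_eq_one_left ?_
    linear_combination hww + w * w' * hr2
  have h2 := flowTime_eq hr.ne' w
  have h3 := flowTime_eq hr.ne' w'
  rw [hr2] at h2 h3
  rw [h2, h3, h1]
  rcases hw.lt_or_gt with h0 | h0
  · rw [Real.arctan_inv_of_neg (mul_neg_of_pos_of_neg hr h0), sign_neg h0]
    simp only [SignType.coe_neg_one]
    field_simp
    ring
  · rw [Real.arctan_inv_of_pos (mul_pos hr h0), sign_pos h0]
    simp only [SignType.coe_one]
    field_simp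
    ring

/-- The value of `τ` close to `c` for which `τ² + ρ² n = c²`. -/
def conicTau (c ρ n : ℝ) : ℝ := c * √(1 - ρ ^ 2 * n / c ^ 2)

lemma conicTau_sq {c ρ n : ℝ} (hc : c ≠ 0) (hn : ρ ^ 2 * n ≤ c ^ 2) :
    conicTau c ρ n ^ 2 + ρ ^ 2 * n = c ^ 2 := by
  have h1 : 0 ≤ 1 - ρ ^ 2 * n / c ^ 2 := by
    rw [sub_nonneg, div_le_one (by positivity)]; exact hn
  rw [conicTau, mul_pow, Real.sq_sqrt h1]
  field_simp
  ring

lemma mul_conicTau_pos {c ρ n : ℝ} (hc : c ≠ 0) (hn : ρ ^ 2 * n < c ^ 2) :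
    0 < c * conicTau c ρ n := by
  have h1 : 0 < 1 - ρ ^ 2 * n / c ^ 2 := by
    rw [sub_pos, div_lt_one (by positivity)]; exact hn
  rw [conicTau, ← mul_assoc]
  have := Real.sqrt_pos.2 h1
  have := mul_self_pos.2 hc
  positivity

lemma eq_conicTau {c ρ n τ : ℝ} (hc : c ≠ 0) (hτ : τ ^ 2 + ρ ^ 2 * n = c ^ 2) (h0 : 0 < c * τ) :
    τ = conicTau c ρ n := by
  have hτ0 : 0 < τ ^ 2 := by
    have : τ ≠ 0 := fun h => by rw [h, mul_zero] at h0; exact h0.false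
    positivity
  have h1 : ρ ^ 2 * n < c ^ 2 := by linarith
  have h2 := conicTau_sq hc h1.le
  have h3 := mul_conicTau_pos hc h1
  rcases sq_eq_sq_iff_eq_or_eq_neg.1 (show τ ^ 2 = conicTau c ρ n ^ 2 by linarith) with h4 | h4
  · exact h4
  · rw [h4] at h0
    nlinarith

lemma contDiffAt_conicTau {c : ℝ} {x : ℝ × ℝ} (hc : c ≠ 0) (hx : x.1 ^ 2 * x.2 < c ^ 2) :
    ContDiffAt ℝ ∞ (fun x : ℝ × ℝ => conicTau c x.1 x.2) x := by
  have h1 : 1 - x.1 ^ 2 * x.2 / c ^ 2 ≠ 0 := by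
    have : x.1 ^ 2 * x.2 / c ^ 2 < 1 := by rw [div_lt_one (by positivity)]; exact hx
    linarith
  refine contDiffAt_const.mul (ContDiffAt.sqrt ?_ h1)
  fun_prop

lemma conicTau_scale {c ρ n s : ℝ} (hs : s ≠ 0) :
    conicTau c (ρ / s) (s ^ 2 * n) = conicTau c ρ n := by
  rw [conicTau, conicTau]
  congr 4
  field_simp

/-- The function `T` is the flow time of `stereo` for the direction covector `d`, where `μ = ρ d`
and `n = |d|²`. The closure of a corner fibre meets the span of `d(1/x)` at the two poles `τ = c`.
At `c = e`, the conic point, `e - τ` tends to zero and `flowTime_add_inv` replaces it by `e + τ`. At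
`c = -e`, where the fibre itself is smooth, the formula is regular already. -/
lemma exists_conicTime {e c : ℝ} (he : e ≠ 0) (hc : c = e ∨ c = -e) :
    ∃ T : ℝ → ℝ → ℝ,
      (∀ x : ℝ × ℝ, 0 < x.2 → x.1 ^ 2 * x.2 < e ^ 2 →
        ContDiffAt ℝ ∞ (fun x : ℝ × ℝ => T x.1 x.2) x) ∧
      (∀ ρ n, 0 < ρ → 0 < n → ρ ^ 2 * n < e ^ 2 →
        T ρ n = flowTime (ρ / (e - conicTau c ρ n)) n) ∧
      ∀ ρ n s, 0 < s → T (ρ / s) (s ^ 2 * n) = T ρ n / s := by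
  have hscale : ∀ w n s : ℝ, 0 < s → flowTime (w / s) (s ^ 2 * n) = flowTime w n / s := by
    intro w n s hs
    rw [div_eq_inv_mul, flowTime_mul, div_eq_inv_mul]
    congr 2
    field_simp
  have hsq : ∀ x : ℝ × ℝ, 0 ≤ √(1 - x.1 ^ 2 * x.2 / e ^ 2) := fun x => Real.sqrt_nonneg _
  rcases hc with rfl | rfl
  · have hne : ∀ x : ℝ × ℝ, c + conicTau c x.1 x.2 ≠ 0 := fun x => by
      rw [conicTau, show c + c * √(1 - x.1 ^ 2 * x.2 / c ^ 2) =
        c * (1 + √(1 - x.1 ^ 2 * x.2 / c ^ 2)) by ring]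
      exact mul_ne_zero he (by linarith [hsq x])
    refine ⟨fun ρ n => SignType.sign c * (Real.pi / √n) - flowTime (ρ / (c + conicTau c ρ n)) n,
      ?_, ?_, ?_⟩
    · intro x hx0 hx
      have h1 : ContDiffAt ℝ ∞ (fun x : ℝ × ℝ => x.1 / (c + conicTau c x.1 x.2)) x :=
        contDiffAt_fst.div (contDiffAt_const.add (contDiffAt_conicTau he hx)) (hne x)
      have h2 : ContDiffAt ℝ ∞ (fun x : ℝ × ℝ => √x.2) x := contDiffAt_snd.sqrt hx0.ne'
      refine (contDiffAt_const.mul (contDiffAt_const.div h2 (Real.sqrt_pos.2 hx0).ne')).sub ?_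
      exact ContDiffAt.comp (g := fun y : ℝ × ℝ => flowTime y.1 y.2)
        (f := fun x : ℝ × ℝ => (x.1 / (c + conicTau c x.1 x.2), x.2)) x
        (contDiffAt_flowTime hx0.le) (h1.prodMk contDiffAt_snd)
    · intro ρ n hρ hn hlt
      have h1 := conicTau_sq he hlt.le
      have h2 : (c - conicTau c ρ n) * (c + conicTau c ρ n) = ρ ^ 2 * n := by linear_combination -h1
      have h3 : c + conicTau c ρ n ≠ 0 := hne (ρ, n)
      have h4 : c - conicTau c ρ n ≠ 0 := fun h0 => by
        rw [h0, zero_mul] at h2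
        have : 0 < ρ ^ 2 * n := by positivity
        linarith
      have h5 : SignType.sign (ρ / (c - conicTau c ρ n)) = SignType.sign c := by
        have h6 : 0 < c * (c + conicTau c ρ n) := by
          have := mul_conicTau_pos he hlt
          nlinarith
        have h7 : 0 < (c - conicTau c ρ n) * (c + conicTau c ρ n) := by rw [h2]; positivity
        rcases he.lt_or_gt with h8 | h8
        · have h9 : c + conicTau c ρ n < 0 := by
            by_contra hcon
            nlinarith
          have h10 : c - conicTau c ρ n < 0 := by
            by_contra hcon
            nlinarith
          rw [sign_neg (div_neg_of_pos_of_neg hρ h10), sign_neg h8]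
        · have h9 : 0 < c + conicTau c ρ n := by
            by_contra hcon
            nlinarith
          have h10 : 0 < c - conicTau c ρ n := by
            by_contra hcon
            nlinarith
          rw [sign_pos (div_pos hρ h10), sign_pos h8]
      rw [flowTime_add_inv (w' := ρ / (c + conicTau c ρ n)) hn (div_ne_zero hρ.ne' h4), h5]
      rw [div_mul_div_comm, h2]
      field_simp
    · intro ρ n s hs
      dsimp only
      rw [conicTau_scale hs.ne', div_right_comm, hscale _ _ _ hs, Real.sqrt_mul (sq_nonneg s),
        Real.sqrt_sq hs.le, sub_div]
      congr 1
      rw [mul_comm s, ← div_div, mul_div_assoc]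
  · have hne : ∀ x : ℝ × ℝ, e - conicTau (-e) x.1 x.2 ≠ 0 := fun x => by
      rw [conicTau, neg_sq, show e - -e * √(1 - x.1 ^ 2 * x.2 / e ^ 2) =
        e * (1 + √(1 - x.1 ^ 2 * x.2 / e ^ 2)) by ring]
      exact mul_ne_zero he (by linarith [hsq x])
    refine ⟨fun ρ n => flowTime (ρ / (e - conicTau (-e) ρ n)) n, ?_, fun _ _ _ _ _ => rfl, ?_⟩
    · intro x hx0 hx
      have h1 : ContDiffAt ℝ ∞ (fun x : ℝ × ℝ => x.1 / (e - conicTau (-e) x.1 x.2)) x :=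
        contDiffAt_fst.div (contDiffAt_const.sub (contDiffAt_conicTau (neg_ne_zero.2 he)
          (by rwa [neg_sq]))) (hne x)
      exact ContDiffAt.comp (g := fun y : ℝ × ℝ => flowTime y.1 y.2)
        (f := fun x : ℝ × ℝ => (x.1 / (e - conicTau (-e) x.1 x.2), x.2)) x
        (contDiffAt_flowTime hx0.le) (h1.prodMk contDiffAt_snd)
    · intro ρ n s hs
      dsimp only
      rw [conicTau_scale hs.ne', div_right_comm, hscale _ _ _ hs]

end ConicTime

end ScatGeom

namespace ScatGeom

section CornerConic

universe u

variable {E : Type u} [NormedAddCommGroup E] [NormedSpace ℝ E] [FiniteDimensional ℝ E]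
  {H : Type*} [TopologicalSpace H] {I : ModelWithCorners ℝ E H} [I.Boundaryless]
  {Z : Type*} [TopologicalSpace Z] [ChartedSpace H Z] [IsManifold I ∞ Z]
  [CompactSpace Z] [T2Space Z]
  (h : ContMDiffRiemannianMetric I ∞ E (fun z : Z => TangentSpace I z)) {e : ℝ}

/-! ### The conic points over the corners -/

lemma scDiff_const (c : ℝ) (z : Z) :
    scDiff I (fun _ : Z => c) z = ((-c, Cot.zero z) : ScCot I Z) := by
  rw [scDiff, mfderiv_const]
  rfl

variable (E) in
/-- Euclidean coordinates on the dual space. -/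
def dualCoord : (E →L[ℝ] ℝ) ≃L[ℝ] EuclideanSpace ℝ (Fin (Module.finrank ℝ E)) :=
  ContinuousLinearEquiv.ofFinrankEq (by rw [finrank_clm_real, finrank_euclideanSpace_fin])

/-- The covector with direction `ν` in the chart at `z₀`. -/
def dirCov (z₀ z : Z) (ν : EuclideanSpace ℝ (Fin (Module.finrank ℝ E))) : Cot I Z :=
  ofFib z₀ z ((dualCoord E).symm ν)

variable {EK : Type*} [NormedAddCommGroup EK] [NormedSpace ℝ EK]
  {HK : Type*} [TopologicalSpace HK] {IK : ModelWithCorners ℝ EK HK}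
  {K : Type*} [TopologicalSpace K] [ChartedSpace HK K]

lemma contMDiffAt_dirCov {z₀ : Z} {z : K → Z}
    {ν : K → EuclideanSpace ℝ (Fin (Module.finrank ℝ E))} {k : K}
    (hzk : z k ∈ (chartAt H z₀).source) (hz : ContMDiffAt IK I ∞ z k)
    (hν : ContMDiffAt IK 𝓘(ℝ, EuclideanSpace ℝ (Fin (Module.finrank ℝ E))) ∞ ν k) :
    ContMDiffAt IK (cotModel I) ∞ (fun k => dirCov (I := I) z₀ (z k) (ν k)) k :=
  contMDiffAt_ofFib hzk hz ((dualCoord E).symm.contDiff.contMDiff.contMDiffAt.comp k hν)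

lemma contMDiffAt_dualCoord_fibCoord {z₀ : Z} {f : K → Cot I Z} {k : K}
    (hk : (f k).proj ∈ (chartAt H z₀).source) (hf : ContMDiffAt IK (cotModel I) ∞ f k) :
    ContMDiffAt IK 𝓘(ℝ, EuclideanSpace ℝ (Fin (Module.finrank ℝ E))) ∞
      (fun k => dualCoord E (fibCoord z₀ (f k))) k :=
  (dualCoord E).contDiff.contMDiff.contMDiffAt.comp k
    (ContMDiffAt.comp (g := fibCoord z₀) k (contMDiffAt_fibCoord hk) hf)

lemma contMDiffAt_geoFlow_comp {T : K → ℝ} {f : K → Cot I Z} {k : K}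
    (hT : ContMDiffAt IK 𝓘(ℝ, ℝ) ∞ T k) (hf : ContMDiffAt IK (cotModel I) ∞ f k) :
    ContMDiffAt IK (cotModel I) ∞ (fun k => geoFlow h (T k) (f k)) k :=
  ContMDiffAt.comp (g := fun z : ℝ × Cot I Z => geoFlow h z.1 z.2) (f := fun k => (T k, f k)) k
    (contMDiff_geoFlow h).contMDiffAt (hT.prodMk hf)

lemma contMDiffAt_comp_real_prod {F : ℝ × ℝ → ℝ} {a b : K → ℝ} {k : K}
    (hF : ContDiffAt ℝ ∞ F (a k, b k)) (ha : ContMDiffAt IK 𝓘(ℝ, ℝ) ∞ a k)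
    (hb : ContMDiffAt IK 𝓘(ℝ, ℝ) ∞ b k) :
    ContMDiffAt IK 𝓘(ℝ, ℝ) ∞ (fun k => F (a k, b k)) k :=
  ContMDiffAt.comp (g := F) (f := fun k => (a k, b k)) k hF.contMDiffAt (ha.prodMk_space hb)

lemma dirCov_eq {z₀ : Z} {p : Cot I Z} (hp : p.proj ∈ (chartAt H z₀).source) :
    dirCov z₀ p.proj (dualCoord E (fibCoord z₀ p)) = p := by
  rw [dirCov, ContinuousLinearEquiv.symm_apply_apply, ofFib_fibCoord hp]

lemma dualCoord_fibCoord_dirCov {z₀ z : Z} (hz : z ∈ (chartAt H z₀).source)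
    (ν : EuclideanSpace ℝ (Fin (Module.finrank ℝ E))) :
    dualCoord E (fibCoord z₀ (dirCov (I := I) z₀ z ν)) = ν := by
  rw [dirCov, fibCoord_ofFib hz, ContinuousLinearEquiv.apply_symm_apply]

lemma normSq_dirCov_pos {z₀ z : Z} (hz : z ∈ (chartAt H z₀).source)
    {ν : EuclideanSpace ℝ (Fin (Module.finrank ℝ E))} (hν : ν ≠ 0) :
    0 < normSq h (dirCov (I := I) z₀ z ν) := by
  refine (normSq_nonneg h _).lt_of_ne fun h0 => hν ?_
  have h1 := (normSq_eq_zero h).1 h0.symm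
  have h2 := dualCoord_fibCoord_dirCov (I := I) hz ν
  rw [h1, fibCoord_zero, map_zero] at h2
  exact h2.symm

/-- Coordinates of the lift of a covector to the blow-up of the zero section. -/
lemma eq_scale_dirCov {z₀ : Z} {p : Cot I Z} (hp : p.proj ∈ (chartAt H z₀).source) {ρ : ℝ}
    {ν : EuclideanSpace ℝ (Fin (Module.finrank ℝ E))} :
    dualCoord E (fibCoord z₀ p) = ρ • ν ↔ p = (dirCov z₀ p.proj ν).scale ρ := by
  constructor
  · intro h1
    refine eq_of_fibCoord hp (proj_ofFib hp _).symm ((dualCoord E).injective ?_)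
    rw [fibCoord_scale, map_smul, dualCoord_fibCoord_dirCov hp, h1]
  · intro h1
    have h2 := congrArg (fun q => dualCoord E (fibCoord z₀ q)) h1
    simp only [fibCoord_scale, map_smul, dualCoord_fibCoord_dirCov hp] at h2
    exact h2

lemma exists_dd_dualCoord {z₀ : Z} {p : Cot I Z} (hp : p.proj ∈ (chartAt H z₀).source)
    (ν : EuclideanSpace ℝ (Fin (Module.finrank ℝ E))) :
    ∃ v : TangentSpace (cotModel I) p,
      dd (cotModel I) (fun p : Cot I Z => dualCoord E (fibCoord z₀ p)) p v = ν := by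
  set c : ℝ → Cot I Z := fun t => dirCov z₀ p.proj (dualCoord E (fibCoord z₀ p) + t • ν) with hc
  have hc0 : c 0 = p := by simp only [hc, zero_smul, add_zero, dirCov_eq hp]
  have h1 : ContDiff ℝ ∞ (fun t : ℝ => dualCoord E (fibCoord z₀ p) + t • ν) := by fun_prop
  have hcd : MDifferentiableAt 𝓘(ℝ, ℝ) (cotModel I) c 0 :=
    (contMDiffAt_dirCov (z := fun _ => p.proj) hp contMDiffAt_const
      h1.contMDiff.contMDiffAt).mdifferentiableAt (by simp)
  refine ⟨velAt hc0, dd_velAt hc0 hcd ((contMDiffAt_dualCoord_fibCoord (f := fun p => p) hp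
    contMDiffAt_id).mdifferentiableAt (by simp)) ?_⟩
  simp only [hc, dualCoord_fibCoord_dirCov hp]
  simpa using ((hasDerivAt_id (0 : ℝ)).smul_const ν).const_add (dualCoord E (fibCoord z₀ p))

/-- A corner fibre contains a point of the span of `d(1/x)`, the pole corresponding to the zero
covector under `stereo`, and the lift omits it. It is approached along a ray `t ζ` in the cotangent
space at `z`, which needs a nonzero covector `ζ` and hence positive dimension. -/
lemma mem_closure_cornerFibre (hm : 0 < Module.finrank ℝ E) (he : e ≠ 0) {z : Z} {q : ScCot I Z}
    (hq : q ∈ sphereBundle h e) (hqz : (stereo h e q).proj = z) :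
    q ∈ closure {f | (f ∈ sphereBundle h e ∧ (stereo h e f).proj = z) ∧ 0 < normSq h f.2} := by
  rcases (normSq_nonneg h q.2).lt_or_eq with h0 | h0
  · exact subset_closure ⟨⟨hq, hqz⟩, h0⟩
  have : Nontrivial (E →L[ℝ] ℝ) := Module.nontrivial_of_finrank_pos (R := ℝ) (by
    rwa [finrank_clm_real])
  obtain ⟨ζ, hζ⟩ := exists_ne (0 : E →L[ℝ] ℝ)
  have hz : z ∈ (chartAt H z).source := mem_chart_source H z
  set c : ℝ → Cot I Z := fun t => (ofFib z z ζ).scale t with hc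
  have hcpos : 0 < normSq h (ofFib (I := I) z z ζ) := by
    refine (normSq_nonneg h _).lt_of_ne fun h1 => hζ ?_
    rw [← fibCoord_ofFib (I := I) hz ζ, (normSq_eq_zero h).1 h1.symm, fibCoord_zero]
  have hc0 : stereoInv h e (c 0) = q := by
    have h1 : stereo h e q = Cot.zero z := by
      have h2 : normSq h (stereo h e q) = 0 := by
        rw [stereo, normSq_scale, normSq_geoFlow, ← h0, mul_zero]
      rw [(normSq_eq_zero h).1 h2, hqz]
    simp only [hc, scale_zero, proj_ofFib hz]
    rw [← h1, stereoInv_stereo h hq]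
  have hcc : Filter.Tendsto (fun t => stereoInv h e (c t)) (𝓝[≠] 0) (𝓝 q) := by
    have h1 : ContMDiffAt 𝓘(ℝ, ℝ) (scModel I) ∞ (fun t => stereoInv h e (c t)) 0 :=
      ContMDiffAt.comp (g := stereoInv h e) (0 : ℝ) (contMDiff_stereoInv h).contMDiffAt
        (ContMDiffAt.cotScale (f := fun _ => ofFib z z ζ) contMDiffAt_id contMDiffAt_const)
    have h2 := h1.continuousAt.tendsto
    rw [hc0] at h2
    exact h2.mono_left nhdsWithin_le_nhds
  refine mem_closure_of_tendsto hcc ?_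
  filter_upwards [self_mem_nhdsWithin] with t ht
  have ht0 : t ≠ 0 := ht
  refine ⟨⟨stereoInv_mem h he _, ?_⟩, ?_⟩
  · rw [stereo_stereoInv h he]
    exact proj_ofFib hz ζ
  · simp only [stereoInv, hc, normSq_scale, normSq_geoFlow]
    have : 0 < 1 + t ^ 2 * normSq h (ofFib (I := I) z z ζ) := by positivity
    positivity

end CornerConic
end ScatGeom

namespace ScatGeom

/-! ### The lift of a corner fibre to the blow-up -/

section CornerConic

universe u

variable {E : Type u} [NormedAddCommGroup E] [NormedSpace ℝ E] [FiniteDimensional ℝ E]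
  {H : Type*} [TopologicalSpace H] {I : ModelWithCorners ℝ E H} [I.Boundaryless]
  {Z : Type*} [TopologicalSpace Z] [ChartedSpace H Z] [IsManifold I ∞ Z]
  [CompactSpace Z] [T2Space Z]
  (h : ContMDiffRiemannianMetric I ∞ E (fun z : Z => TangentSpace I z)) {e : ℝ}

lemma flowTime_div (x y n : ℝ) : flowTime (x / y) n = flowTime (1 / y) (x ^ 2 * n) * x := by
  rw [← mul_one_div, flowTime_mul, mul_comm]

/-- Near the pole `τ = c` write `μ = ρ D`. Membership in the corner fibre means that `τ` is the root
`conicTau` and that `D`, flowed for the time of `exists_conicTime`, lies over `z`. Both conditions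
are smooth up to `ρ = 0` as long as `D ≠ 0`, and the unit length of the direction guarantees this.
-/
lemma isNeatSubmanifold_cornerLift (he : e ≠ 0) (z z₀ : Z) {c : ℝ} (hc : c = e ∨ c = -e) :
    IsNeatSubmanifold ((scModel I).prod (𝓘(ℝ, ℝ).prod
        𝓘(ℝ, EuclideanSpace ℝ (Fin (Module.finrank ℝ E)))))
      (fun x : ScCot I Z × ℝ × EuclideanSpace ℝ (Fin (Module.finrank ℝ E)) => x.2.1)
      (2 * Module.finrank ℝ E + 2)
      (closure (polarLift (fun f : ScCot I Z => dualCoord E (fibCoord z₀ f.2))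
        ({f | f ∈ sphereBundle h e ∧ (stereo h e f).proj = z} ∩
          {f | 0 < c * f.1 ∧ f.2.proj ∈ (chartAt H z₀).source})) ∩
        Prod.fst ⁻¹' {f | 0 < c * f.1 ∧ f.2.proj ∈ (chartAt H z₀).source}) := by
  have hce : c ^ 2 = e ^ 2 := by rcases hc with rfl | rfl <;> ring
  have hc0 : c ≠ 0 := fun h0 => he (by rw [h0] at hce; exact pow_eq_zero_iff two_ne_zero |>.1 (by linarith))
  obtain ⟨T, hTs, hTf, hTr⟩ := exists_conicTime he hc
  set X := ScCot I Z × ℝ × EuclideanSpace ℝ (Fin (Module.finrank ℝ E)) with hX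
  set MX := (scModel I).prod (𝓘(ℝ, ℝ).prod
    𝓘(ℝ, EuclideanSpace ℝ (Fin (Module.finrank ℝ E)))) with hMX
  set MN := 𝓘(ℝ, ℝ).prod (cotModel I) with hMN
  set U : Set (ScCot I Z) := {f | 0 < c * f.1 ∧ f.2.proj ∈ (chartAt H z₀).source} with hUdef
  have hU : IsOpen U := (isOpen_lt continuous_const (continuous_const.mul continuous_fst)).inter
    ((chartAt H z₀).open_source.preimage (contMDiff_proj.continuous.comp continuous_snd))
  set u : ScCot I Z → EuclideanSpace ℝ (Fin (Module.finrank ℝ E)) :=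
    fun f => dualCoord E (fibCoord z₀ f.2) with hu
  -- the retraction
  set D : X → Cot I Z := fun x => dirCov z₀ x.1.2.proj x.2.2 with hD
  have hDs : ∀ x : X, x.1 ∈ U → ContMDiffAt MX (cotModel I) ∞ D x := fun x hx =>
    contMDiffAt_dirCov (z := fun x : X => x.1.2.proj) hx.2
      (contMDiff_proj.comp (contMDiff_snd.comp contMDiff_fst)).contMDiffAt
      (contMDiff_snd.comp contMDiff_snd).contMDiffAt
  have hr1 : ContMDiff MX 𝓘(ℝ, ℝ) ∞ (fun x : X => x.2.1) := contMDiff_fst.comp contMDiff_snd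
  have hDn : ∀ x : X, x.1 ∈ U → ContMDiffAt MX 𝓘(ℝ, ℝ) ∞ (fun x => normSq h (D x)) x := fun x hx =>
    ContMDiffAt.comp (g := normSq h) x (contMDiff_normSq h).contMDiffAt (hDs x hx)
  -- The parameter is the covector after the flow, not `D` itself. In this form the remaining
  -- condition is just that its base point is `z`, which is visibly independent.
  set ψ : X → ℝ × Cot I Z := fun x => (x.2.1, geoFlow h (T x.2.1 (normSq h (D x))) (D x)) with hψ
  set O₁ : Set X := {x | x.1 ∈ U ∧ x.2.2 ≠ 0 ∧ x.2.1 ^ 2 * normSq h (D x) < e ^ 2} with hO₁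
  have hO₁o : IsOpen O₁ := by
    rw [isOpen_iff_mem_nhds]
    rintro x ⟨h1, h2, h3⟩
    have h4 : ContinuousAt (fun x : X => x.2.1 ^ 2 * normSq h (D x)) x :=
      (hr1.continuous.continuousAt.pow 2).mul (hDn x h1).continuousAt
    filter_upwards [(hU.preimage continuous_fst).mem_nhds h1,
      (continuous_snd.comp continuous_snd).continuousAt.eventually_ne h2,
      h4.preimage_mem_nhds (isOpen_Iio.mem_nhds h3)] with y h5 h6 h7 using ⟨h5, h6, h7⟩
  have hDpos : ∀ x : X, x.1 ∈ U → x.2.2 ≠ 0 → 0 < normSq h (D x) := fun x hx hx2 =>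
    normSq_dirCov_pos h hx.2 hx2
  have hψs : ContMDiffOn MX MN ∞ ψ O₁ := fun x hx => by
    refine (hr1.contMDiffAt.prodMk (contMDiffAt_geoFlow_comp h ?_ (hDs x hx.1))).contMDiffWithinAt
    exact contMDiffAt_comp_real_prod (F := fun x : ℝ × ℝ => T x.1 x.2)
      (hTs _ (hDpos x hx.1 hx.2.1) hx.2.2) hr1.contMDiffAt (hDn x hx.1)
  set O : Set X := O₁ ∩ ψ ⁻¹' {n | n.2.proj ∈ (chartAt H z).source} with hO
  have hOo : IsOpen O := hψs.continuousOn.isOpen_inter_preimage hO₁o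
    ((chartAt H z).open_source.preimage (contMDiff_proj.continuous.comp continuous_snd))
  -- the parametrization
  set d : ℝ × Cot I Z → Cot I Z := fun n => geoFlow h (-(T n.1 (normSq h n.2))) n.2 with hd
  have hn1 : ContMDiff MN 𝓘(ℝ, ℝ) ∞ (fun n : ℝ × Cot I Z => n.1) := contMDiff_fst
  have hn2 : ContMDiff MN (cotModel I) ∞ (fun n : ℝ × Cot I Z => n.2) := contMDiff_snd
  have hnn : ContMDiff MN 𝓘(ℝ, ℝ) ∞ (fun n : ℝ × Cot I Z => normSq h n.2) :=
    (contMDiff_normSq h).comp hn2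
  set V₁ : Set (ℝ × Cot I Z) := {n | 0 < normSq h n.2 ∧ n.1 ^ 2 * normSq h n.2 < e ^ 2 ∧
    n.2.proj ∈ (chartAt H z).source} with hV₁
  have hV₁o : IsOpen V₁ := (isOpen_lt continuous_const hnn.continuous).inter
    ((isOpen_lt ((continuous_fst.pow 2).mul hnn.continuous) continuous_const).inter
      ((chartAt H z).open_source.preimage (contMDiff_proj.continuous.comp continuous_snd)))
  have hds : ∀ n ∈ V₁, ContMDiffAt MN (cotModel I) ∞ d n := fun n hn =>
    contMDiffAt_geoFlow_comp h (contMDiffAt_comp_real_prod (F := fun x : ℝ × ℝ => T x.1 x.2)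
      (a := fun n : ℝ × Cot I Z => n.1) (b := fun n : ℝ × Cot I Z => normSq h n.2)
      (hTs (n.1, normSq h n.2) hn.1 hn.2.1) hn1.contMDiffAt hnn.contMDiffAt).neg hn2.contMDiffAt
  set V : Set (ℝ × Cot I Z) := V₁ ∩ d ⁻¹' {p | p.proj ∈ (chartAt H z₀).source} with hV
  have hVo : IsOpen V := ContinuousOn.isOpen_inter_preimage
    (fun n hn => (hds n hn).continuousAt.continuousWithinAt) hV₁o
    ((chartAt H z₀).open_source.preimage contMDiff_proj.continuous)
  set φ : ℝ × Cot I Z → ScCot I Z :=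
    fun n => (conicTau c n.1 (normSq h n.2), (d n).scale n.1) with hφ
  set w : ℝ × Cot I Z → EuclideanSpace ℝ (Fin (Module.finrank ℝ E)) :=
    fun n => dualCoord E (fibCoord z₀ (d n)) with hw
  set g : ℝ × Cot I Z → E := fun n => extChartAt I z n.2.proj - extChartAt I z z with hg
  have hgV : ∀ n ∈ V, ContMDiffAt MN 𝓘(ℝ, E) ∞ g n := fun n hn =>
    (contMDiffAt_chart_proj (f := fun n : ℝ × Cot I Z => n.2) hn.1.2.2 hn2.contMDiffAt).sub
      contMDiffAt_const
  have hg0 : ∀ n : ℝ × Cot I Z, n.2.proj ∈ (chartAt H z).source → (g n = 0 ↔ n.2.proj = z) := by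
    intro n hn
    rw [hg, sub_eq_zero]
    refine (extChartAt I z).injOn.eq_iff ?_ (mem_extChartAt_source z)
    rwa [extChartAt_source]
  have hdψ : ∀ x, d (ψ x) = D x := fun x => by
    simp only [hd, hψ, normSq_geoFlow, geoFlow_neg_geoFlow]
  have hscale : ∀ (n : ℝ × Cot I Z) (s : ℝ), 0 < s → d (n.1 / s, n.2.scale s) = (d n).scale s := by
    intro n s hs
    simp only [hd, normSq_scale, hTr _ _ _ hs, geoFlow_scale]
    congr 2
    field_simp
  -- points of the lift
  have hlift : ∀ x ∈ polarLift u ({f | f ∈ sphereBundle h e ∧ (stereo h e f).proj = z} ∩ U),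
      x.1 ∈ U ∧ 0 < x.2.1 ∧ ‖x.2.2‖ = 1 ∧ x.1.2 = (D x).scale x.2.1 ∧
      x.1.1 ^ 2 + x.2.1 ^ 2 * normSq h (D x) = e ^ 2 ∧ (ψ x).2.proj = z := by
    rintro x ⟨⟨⟨hx1, hx2⟩, hxU⟩, hx3, hx4, hx5⟩
    have h0 : 0 < x.2.1 := by rw [hx4]; exact norm_pos_iff.2 hx3
    have h1 : x.1.2 = (D x).scale x.2.1 := by
      refine (eq_scale_dirCov hxU.2).1 ?_
      rw [hx5, hx4, smul_inv_smul₀ (norm_ne_zero_iff.2 hx3)]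
    have h2 : x.1.1 ^ 2 + x.2.1 ^ 2 * normSq h (D x) = e ^ 2 := by
      have := hx1.2
      rwa [h1, normSq_scale] at this
    have h3 : ‖x.2.2‖ = 1 := by
      rw [hx5, norm_smul, norm_inv, norm_norm, inv_mul_cancel₀ (norm_ne_zero_iff.2 hx3)]
    have h4 : x.2.2 ≠ 0 := fun h => by rw [h, norm_zero] at h3; exact zero_ne_one h3
    refine ⟨hxU, h0, h3, h1, h2, ?_⟩
    have hD0 := hDpos x hxU h4
    have hτ : 0 < x.1.1 ^ 2 := by
      have h6 : 0 < c * x.1.1 := hxU.1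
      have : x.1.1 ≠ 0 := fun h => by rw [h, mul_zero] at h6; exact h6.false
      positivity
    have h5 : x.1.1 = conicTau c x.2.1 (normSq h (D x)) :=
      eq_conicTau hc0 (by rw [hce]; exact h2) hxU.1
    rw [← hx2, stereo, h1, normSq_scale, geoFlow_scale]
    simp only [hψ, proj_scale]
    rw [hTf _ _ h0 hD0 (by linarith), ← h5, flowTime_div x.2.1]
  have hS : ∀ x ∈ O, 0 < x.2.1 →
      (x ∈ polarLift u ({f | f ∈ sphereBundle h e ∧ (stereo h e f).proj = z} ∩ U) ↔
        (φ (ψ x), (ψ x).1, w (ψ x)) = x ∧ ‖w (ψ x)‖ = 1 ∧ g (ψ x) = 0) := by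
    rintro x ⟨⟨hxU, hx2, hx3⟩, hxz⟩ h0
    have hwx : w (ψ x) = x.2.2 := by
      simp only [hw, hdψ]
      exact dualCoord_fibCoord_dirCov hxU.2 _
    have hφx : φ (ψ x) = (conicTau c x.2.1 (normSq h (D x)), (D x).scale x.2.1) := by
      simp only [hφ, hdψ]
      simp only [hψ, normSq_geoFlow]
    have hD0 := hDpos x hxU hx2
    rw [hwx, hφx, hg0 _ hxz]
    constructor
    · intro hx
      obtain ⟨-, -, h3, h4, h5, h6⟩ := hlift x hx
      refine ⟨Prod.ext (Prod.ext ?_ h4.symm) rfl, h3, h6⟩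
      exact (eq_conicTau hc0 (by rw [hce]; exact h5) hxU.1).symm
    · rintro ⟨hx4, hx5, hx6⟩
      have h1 : x.1.1 = conicTau c x.2.1 (normSq h (D x)) :=
        (congrArg (fun y : X => y.1.1) hx4).symm
      have h2 : x.1.2 = (D x).scale x.2.1 := (congrArg (fun y : X => y.1.2) hx4).symm
      have h3 : u x.1 = x.2.1 • x.2.2 := (eq_scale_dirCov hxU.2).2 h2
      have h4 : ‖u x.1‖ = x.2.1 := by
        rw [h3, norm_smul, hx5, mul_one, Real.norm_of_nonneg h0.le]
      have h5 : x.1.1 ^ 2 + x.2.1 ^ 2 * normSq h (D x) = e ^ 2 := by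
        rw [h1, ← hce]
        exact conicTau_sq hc0 (by rw [hce]; exact hx3.le)
      have h6 : 0 < e * (e - x.1.1) := by
        have h7 : 0 < x.2.1 ^ 2 * normSq h (D x) := by positivity
        have h8 : x.1.1 ^ 2 < e ^ 2 := by linarith
        have h9 : e * x.1.1 ≤ |e| * |x.1.1| := by rw [← abs_mul]; exact le_abs_self _
        have h10 : |x.1.1| < |e| := sq_lt_sq.1 h8
        have h11 : 0 < |e| := abs_pos.2 he
        nlinarith [sq_abs e]
      refine ⟨⟨⟨⟨h6, ?_⟩, ?_⟩, hxU⟩, ?_, h4.symm, ?_⟩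
      · rw [h2, normSq_scale]; exact h5
      · rw [← hx6, stereo, h2, normSq_scale, geoFlow_scale]
        simp only [hψ, proj_scale]
        rw [hTf _ _ h0 hD0 hx3, ← h1, flowTime_div x.2.1]
      · rw [h3]
        exact smul_ne_zero h0.ne' hx2
      · rw [h4, h3, inv_smul_smul₀ h0.ne']
  -- The unit length, the sphere equation and the base point pass to the limit. As `c τ > 0` on `U`,
  -- the sphere equation gives `ρ² |D|² < e²`, so the limit stays in the domain where the time is
  -- smooth.
  have hcl : ∀ x ∈ closure (polarLift u
      ({f | f ∈ sphereBundle h e ∧ (stereo h e f).proj = z} ∩ U)), x.1 ∈ U → x ∈ O := by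
    intro x hx hxU
    have h1 : ‖x.2.2‖ = 1 := eq_of_mem_closure (f := fun x : X => ‖x.2.2‖) hx
      (continuous_snd.comp continuous_snd).norm.continuousAt fun y hy => (hlift y hy).2.2.1
    have h2 : x.1.1 ^ 2 + x.2.1 ^ 2 * normSq h (D x) = e ^ 2 :=
      eq_of_mem_closure (f := fun x : X => x.1.1 ^ 2 + x.2.1 ^ 2 * normSq h (D x)) hx
        (((continuous_fst.comp continuous_fst).continuousAt.pow 2).add
          ((hr1.continuous.continuousAt.pow 2).mul (hDn x hxU).continuousAt))
        fun y hy => (hlift y hy).2.2.2.2.1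
    have hx1 : x ∈ O₁ := by
      refine ⟨hxU, fun h => ?_, ?_⟩
      · rw [h, norm_zero] at h1; exact zero_ne_one h1
      · have h6 : 0 < c * x.1.1 := hxU.1
        have : x.1.1 ≠ 0 := fun h => by rw [h, mul_zero] at h6; exact h6.false
        have : 0 < x.1.1 ^ 2 := by positivity
        linarith
    refine ⟨hx1, ?_⟩
    have h3 : (ψ x).2.proj = z := by
      refine eq_of_mem_closure (f := fun x : X => (ψ x).2.proj) hx ?_ fun y hy =>
        (hlift y hy).2.2.2.2.2
      exact (contMDiff_proj.continuous.comp continuous_snd).continuousAt.comp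
        (hψs.continuousOn.continuousAt (hO₁o.mem_nhds hx1))
    change (ψ x).2.proj ∈ (chartAt H z).source
    rw [h3]
    exact mem_chart_source H z
  refine isNeatSubmanifold_polarLift (IN := MN) (IK := scModel I) (O := O) (V := V) (ψ := ψ)
    (φ := φ) (r := fun n => n.1) (w := w) (g := g) (σ := fun s n => (n.1 / s, n.2.scale s))
    (ε := fun t n => (n.1 + t, n.2)) hOo hVo (hψs.mono inter_subset_left) ?_ ?_ hn1.contMDiffOn ?_
    (fun n hn => (hgV n hn).contMDiffWithinAt) ?_ (fun x hx => hx.1.1) hcl hS ?_ ?_ ?_ ?_ ?_ ?_ ?_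
    ?_ ?_ ?_ ?_ ?_
  · rintro x ⟨⟨hx1, hx2, hx3⟩, hxz⟩
    refine ⟨⟨?_, ?_, hxz⟩, ?_⟩
    · simp only [hψ, normSq_geoFlow]; exact hDpos x hx1 hx2
    · simp only [hψ, normSq_geoFlow]; exact hx3
    · change (d (ψ x)).proj ∈ (chartAt H z₀).source
      rw [hdψ]
      simp only [hD, dirCov, proj_ofFib hx1.2]
      exact hx1.2
  · intro n hn
    refine (ContMDiffAt.prodMk ?_ (ContMDiffAt.cotScale hn1.contMDiffAt
      (hds n hn.1))).contMDiffWithinAt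
    exact contMDiffAt_comp_real_prod (F := fun x : ℝ × ℝ => conicTau c x.1 x.2)
      (contDiffAt_conicTau hc0 (by rw [hce]; exact hn.1.2.1)) hn1.contMDiffAt hnn.contMDiffAt
  · exact fun n hn => (contMDiffAt_dualCoord_fibCoord hn.2 (hds n hn.1)).contMDiffWithinAt
  · intro n hn _
    have h0 : (d n).proj ∈ (chartAt H z₀).source := hn.2
    have h1 : D (φ n, n.1, w n) = d n := dirCov_eq (p := d n) h0
    simp only [hψ, h1]
    refine Prod.ext rfl ?_
    simp only [hd, normSq_geoFlow, ← geoFlow_add, add_neg_cancel, geoFlow_zero_time]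
  · exact fun n _ s _ => rfl
  · intro n _ s hs
    simp only [hw, hscale n s hs, fibCoord_scale, map_smul]
  · exact fun n _ s _ => rfl
  · intro n
    simp [scale_one]
  · intro n _
    have h1 : ContMDiffAt (𝓘(ℝ, ℝ).prod MN) MN ∞
        (fun x : ℝ × ℝ × Cot I Z => ((x.2.1 / x.1, x.2.2.scale x.1) : ℝ × Cot I Z)) (1, n) :=
      ((contMDiff_fst.comp contMDiff_snd).contMDiffAt.div₀ contMDiffAt_fst one_ne_zero).prodMk
        (ContMDiffAt.cotScale contMDiffAt_fst (contMDiff_snd.comp contMDiff_snd).contMDiffAt)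
    exact h1.continuousAt
  · intro n _
    have h1 : ContMDiffAt 𝓘(ℝ, ℝ) MN ∞
        (fun s : ℝ => ((n.1 / s, n.2.scale s) : ℝ × Cot I Z)) 1 :=
      (contMDiffAt_const.div₀ contMDiffAt_id one_ne_zero).prodMk
        (ContMDiffAt.cotScale (f := fun _ => n.2) contMDiffAt_id contMDiffAt_const)
    exact h1.mdifferentiableAt (by simp)
  · intro n _ hn t
    simp only [hn, zero_add]
  · exact fun n _ t => rfl
  · intro n
    simp
  · intro n _
    exact MDifferentiableAt.prodMk (differentiableAt_id.const_add n.1).mdifferentiableAt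
      mdifferentiableAt_const
  · intro n hn _ y
    obtain ⟨v, hv⟩ := exists_dd_chart_proj hn.1.2.2 y
    have h1 : MDifferentiableAt (cotModel I) MN (fun p : Cot I Z => (n.1, p)) n.2 :=
      MDifferentiableAt.prodMk mdifferentiableAt_const mdifferentiableAt_id
    refine ⟨mfderiv (cotModel I) MN (fun p : Cot I Z => (n.1, p)) n.2 v, ?_⟩
    have h2 := dd_comp_mfderiv (f := g) (φ := fun p : Cot I Z => (n.1, p)) (k := n.2)
      ((hgV n hn).mdifferentiableAt (by simp)) h1 v
    refine h2.symm.trans (Eq.trans ?_ hv)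
    obtain ⟨γ, -, hγ, hk, rfl⟩ := exists_curve n.2 v
    have h3 := contMDiffAt_chart_proj (I := I) (f := fun p : Cot I Z => p) hn.1.2.2 contMDiffAt_id
    exact dd_velAt hk hγ ((h3.sub contMDiffAt_const).mdifferentiableAt (by simp))
      ((hasDerivAt_velAt hk hγ (h3.mdifferentiableAt (by simp))).sub_const _)
  · simp only [Module.finrank_prod, Module.finrank_self, finrank_clm_real]
    ring

end CornerConic
end ScatGeom

namespace ScatGeom

/-! ### The conic pairs over the corners -/

section CornerConic

universe u

variable {E : Type u} [NormedAddCommGroup E] [NormedSpace ℝ E] [FiniteDimensional ℝ E]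
  {H : Type*} [TopologicalSpace H] {I : ModelWithCorners ℝ E H} [I.Boundaryless]
  {Z : Type*} [TopologicalSpace Z] [ChartedSpace H Z] [IsManifold I ∞ Z]
  [CompactSpace Z] [T2Space Z]
  (h : ContMDiffRiemannianMetric I ∞ E (fun z : Z => TangentSpace I z)) {e : ℝ}

/-- On the closure `τ² + |μ|² = e²`, so a closure point with `μ = 0` is one of the poles `τ = ±e`.
There `isNeatSubmanifold_cornerLift` applies, with the fibre coordinates of `μ` as equations of the
span. -/
lemma isConicAlong_cornerFibre (hm : 0 < Module.finrank ℝ E) (he : e ≠ 0) (z : Z) :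
    IsConicAlong (scModel I) (Module.finrank ℝ E) (2 * Module.finrank ℝ E + 2)
      {q : ScCot I Z | ∃ c : ℝ, ∃ z, q = (c, Cot.zero z)}
      {f | f ∈ sphereBundle h e ∧ (stereo h e f).proj = z} := by
  rintro _ ⟨⟨c, z₀, rfl⟩, hcl⟩
  have hce : c ^ 2 = e ^ 2 := by
    have h1 := eq_of_mem_closure (f := fun f : ScCot I Z => f.1 ^ 2 + normSq h f.2) hcl
      ((continuous_fst.pow 2).add ((contMDiff_normSq h).continuous.comp continuous_snd)).continuousAt
      fun f hf => hf.1.2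
    simpa using h1
  have hc : c = e ∨ c = -e := sq_eq_sq_iff_eq_or_eq_neg.1 hce
  have hc0 : c ≠ 0 := fun h0 => he (by rw [h0] at hce; exact (pow_eq_zero_iff two_ne_zero).1 (by linarith))
  set U : Set (ScCot I Z) := {f | 0 < c * f.1 ∧ f.2.proj ∈ (chartAt H z₀).source} with hUdef
  have hU : IsOpen U := (isOpen_lt continuous_const (continuous_const.mul continuous_fst)).inter
    ((chartAt H z₀).open_source.preimage (contMDiff_proj.continuous.comp continuous_snd))
  set u : ScCot I Z → EuclideanSpace ℝ (Fin (Module.finrank ℝ E)) :=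
    fun f => dualCoord E (fibCoord z₀ f.2) with hu
  have hus : ∀ q ∈ U, ContMDiffAt (scModel I) 𝓘(ℝ, EuclideanSpace ℝ (Fin (Module.finrank ℝ E))) ∞
      u q := fun q hq => contMDiffAt_dualCoord_fibCoord (f := fun f : ScCot I Z => f.2) hq.2
        contMDiffAt_snd
  have huc : ContinuousOn u U := fun q hq => (hus q hq).continuousAt.continuousWithinAt
  have hu0 : ∀ q ∈ U, u q = 0 ↔ q.2 = Cot.zero q.2.proj := fun q hq => by
    constructor
    · intro h0
      exact eq_zero_of_fibCoord hq.2 ((dualCoord E).map_eq_zero_iff.1 h0)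
    · intro h0
      simp only [hu]
      rw [h0, fibCoord_zero, map_zero]
  refine ⟨U, u, hU, ⟨mul_self_pos.2 hc0, mem_chart_source H z₀⟩,
    fun q hq => (hus q hq).contMDiffWithinAt, fun q hq ν => ?_, fun q hq => ?_,
    isNeatSubmanifold_cornerLift h he z z₀ hc, closure_subset_image_polarLift hU huc ?_⟩
  · obtain ⟨v, hv⟩ := exists_dd_dualCoord hq.2 ν
    have h1 : MDifferentiableAt (cotModel I) (scModel I) (fun p : Cot I Z => (q.1, p)) q.2 :=
      MDifferentiableAt.prodMk mdifferentiableAt_const mdifferentiableAt_id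
    refine ⟨mfderiv (cotModel I) (scModel I) (fun p : Cot I Z => (q.1, p)) q.2 v, ?_⟩
    exact (dd_comp_mfderiv (f := u) (φ := fun p : Cot I Z => (q.1, p)) (k := q.2)
      ((hus q hq).mdifferentiableAt (by simp)) h1 v).symm.trans hv
  · rw [hu0 q hq]
    constructor
    · rintro ⟨c, z, rfl⟩
      rfl
    · intro h0
      exact ⟨q.1, q.2.proj, Prod.ext rfl h0⟩
  · rintro q ⟨hq, hqU⟩
    have h1 := mem_closure_cornerFibre h hm he hq.1 hq.2
    have h2 := hU.inter_closure ⟨hqU, h1⟩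
    refine closure_mono ?_ h2
    rintro f ⟨hfU, hf, hf0⟩
    refine ⟨⟨hf, hfU⟩, fun h0 => ?_⟩
    rw [(hu0 f hfU).1 h0, normSq_zero] at hf0
    exact hf0.false

/-- The given boundary defining function of the factor already works, hence `a = 1`. The constant is
`-e` because the differential of `c/x` has `τ = -c`. -/
theorem isConicPair_cornerFibre (hm : 0 < Module.finrank ℝ E) (he : e ≠ 0) (z : Z) :
    IsConicPair univ {f | f ∈ sphereBundle h e ∧ (stereo h e f).proj = z}
      {q : ScCot I Z | ∃ c ∈ ({e} : Finset ℝ), ∃ z, q = (c, Cot.zero z)} := by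
  refine ⟨fun _ _ => mem_univ _, isLegendre_cornerFibre h he z, isLegendre_constGraph _,
    fun _ => 1, {-e}, contMDiffOn_const, fun _ _ => one_pos, ?_, ?_, ?_⟩
  · ext q
    simp [scDiff_const]
  · rintro q ⟨⟨hq, -⟩, hqG⟩
    have h1 : q.1 ^ 2 + normSq h q.2 = e ^ 2 :=
      eq_of_mem_closure (f := fun f : ScCot I Z => f.1 ^ 2 + normSq h f.2) hq
        ((continuous_fst.pow 2).add
          ((contMDiff_normSq h).continuous.comp continuous_snd)).continuousAt fun f hf => hf.1.2
    -- Away from `τ = e` the map `stereo` is continuous and the fibre is relatively closed. On the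
    -- sphere the failure of this inequality leaves only the pole `τ = e`, a point of the second
    -- set.
    by_cases h2 : 0 < e * (e - q.1)
    · refine absurd ⟨⟨h2, h1⟩, ?_⟩ hqG
      exact eq_of_mem_closure (f := fun f => (stereo h e f).proj) hq
        (contMDiff_proj.continuous.continuousAt.comp (contMDiffAt_stereo h
          (fun h0 => by rw [h0, mul_zero] at h2; exact h2.false)).continuousAt) fun f hf => hf.2
    · have h3 := normSq_nonneg h q.2
      have h4 : e ^ 2 ≤ e * q.1 := by nlinarith
      have h5 : (e - q.1) ^ 2 ≤ 0 := by nlinarith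
      have h6 : e - q.1 = 0 := pow_eq_zero_iff two_ne_zero |>.1 (le_antisymm h5 (sq_nonneg _))
      have h7 : q.1 = e := by linarith
      have h8 : normSq h q.2 = 0 := by rw [h7] at h1; linarith
      exact ⟨e, by simp, q.2.proj, Prod.ext h7 ((normSq_eq_zero h).1 h8)⟩
  · convert isConicAlong_cornerFibre h hm he z using 1
    ext q
    simp only [mem_univ, true_and, mul_one, scDiff_const]
    constructor
    · rintro ⟨c, z, rfl⟩
      exact ⟨-c, z, rfl⟩
    · rintro ⟨c, z, rfl⟩
      exact ⟨-c, z, by rw [neg_neg]⟩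

end CornerConic
end ScatGeom

namespace ScatGeom

/-! ### Coordinates of covectors from their values -/

section FibCoordOf

variable {E : Type*} [NormedAddCommGroup E] [NormedSpace ℝ E] [FiniteDimensional ℝ E]
  {H : Type*} [TopologicalSpace H] {I : ModelWithCorners ℝ E H} [I.Boundaryless]
  {Z : Type*} [TopologicalSpace Z] [ChartedSpace H Z] [IsManifold I ∞ Z]

/-- The coordinates of a linear form that is given in terms of the chart. -/
lemma fibCoord_of {z₀ z : Z} (hz : z ∈ (chartAt H z₀).source) {ξ : TangentSpace I z →L[ℝ] ℝ}
    {m : E →L[ℝ] ℝ} (hξ : ∀ v, ξ v = m (dd I (extChartAt I z₀) z v)) :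
    fibCoord z₀ (Cot.of z ξ) = m := by
  ext v
  have h1 := hξ ((trivializationAt E (TangentSpace I) z₀).symmL ℝ z v)
  refine h1.trans (congrArg m ?_)
  have h2 : dd I (extChartAt I z₀) z =
      (trivializationAt E (TangentSpace I) z₀).continuousLinearMapAt ℝ z :=
    (TangentBundle.continuousLinearMapAt_trivializationAt hz).symm
  rw [h2]
  exact (trivializationAt E (TangentSpace I) z₀).continuousLinearMapAt_symmL
    (by simpa using hz) v

end FibCoordOf

section Interior

universe u

variable {E : Type u} [NormedAddCommGroup E] [NormedSpace ℝ E] [FiniteDimensional ℝ E]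
  {H : Type*} [TopologicalSpace H] {I : ModelWithCorners ℝ E H} [I.Boundaryless]
  {Z : Type*} [TopologicalSpace Z] [ChartedSpace H Z] [IsManifold I ∞ Z]
  [CompactSpace Z] [T2Space Z]

/-! ### The bundle over the interior of bf -/

variable (I) in
/-- The model with corners of bf. -/
abbrev bfModel : ModelWithCorners ℝ (ℝ × E × E) (ModelProd ℝ (ModelProd H H)) :=
  𝓘(ℝ, ℝ).prod (I.prod I)

variable (E) in
/-- The linear form `(η, m', m'')`. -/
def tripleForm (η : ℝ) (m' m'' : E →L[ℝ] ℝ) : (ℝ × E × E) →L[ℝ] ℝ :=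
  η • ContinuousLinearMap.fst ℝ ℝ (E × E) +
    m'.comp ((ContinuousLinearMap.fst ℝ E E).comp (ContinuousLinearMap.snd ℝ ℝ (E × E))) +
    m''.comp ((ContinuousLinearMap.snd ℝ E E).comp (ContinuousLinearMap.snd ℝ ℝ (E × E)))

lemma tripleForm_apply (η : ℝ) (m' m'' : E →L[ℝ] ℝ) (v : ℝ × E × E) :
    tripleForm E η m' m'' v = η * v.1 + m' v.2.1 + m'' v.2.2 := rfl

variable (E) in
/-- The inclusion of the second factor. -/
def incl' : E →L[ℝ] ℝ × E × E :=
  (ContinuousLinearMap.inr ℝ ℝ (E × E)).comp (ContinuousLinearMap.inl ℝ E E)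

variable (E) in
/-- The inclusion of the third factor. -/
def incl'' : E →L[ℝ] ℝ × E × E :=
  (ContinuousLinearMap.inr ℝ ℝ (E × E)).comp (ContinuousLinearMap.inr ℝ E E)

lemma tripleForm_eq (ξ : (ℝ × E × E) →L[ℝ] ℝ) :
    tripleForm E (ξ (1, 0, 0)) (ξ.comp (incl' E)) (ξ.comp (incl'' E)) = ξ := by
  refine ContinuousLinearMap.ext fun v => ?_
  have h1 : v = v.1 • ((1, 0, 0) : ℝ × E × E) + incl' E v.2.1 + incl'' E v.2.2 := by
    simp [incl', incl'']
  conv_rhs => rw [h1, map_add, map_add, map_smul, smul_eq_mul, mul_comm]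
  rfl

lemma tripleForm_comp_incl' (η : ℝ) (m' m'' : E →L[ℝ] ℝ) :
    (tripleForm E η m' m'').comp (incl' E) = m' := by
  ext v; simp [tripleForm_apply, incl']

lemma tripleForm_comp_incl'' (η : ℝ) (m' m'' : E →L[ℝ] ℝ) :
    (tripleForm E η m' m'').comp (incl'' E) = m'' := by
  ext v; simp [tripleForm_apply, incl'']

lemma proj_toInterior (q : FibCot I Z) :
    (toInterior q).2.proj = (q.1, q.2.1.2.proj, q.2.2.2.proj) := rfl

lemma mem_chart_bf {z₀ z : ℝ × Z × Z} (h' : z.2.1 ∈ (chartAt H z₀.2.1).source)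
    (h'' : z.2.2 ∈ (chartAt H z₀.2.2).source) :
    z ∈ (chartAt (ModelProd ℝ (ModelProd H H)) z₀).source := by
  simp [prodChartedSpace_chartAt, h', h'', chartAt_self_eq]

/-- The product chart of bf splits a tangent vector into its three components, on which `η dθ`, `cos
θ μ'` and `sin θ μ''` act separately. -/
lemma fibCoord_toInterior {z₀ : ℝ × Z × Z} {q : FibCot I Z}
    (h' : q.2.1.2.proj ∈ (chartAt H z₀.2.1).source)
    (h'' : q.2.2.2.proj ∈ (chartAt H z₀.2.2).source) :
    fibCoord z₀ (toInterior q).2 = tripleForm E (totalEta q)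
      (Real.cos q.1 • fibCoord z₀.2.1 q.2.1.2) (Real.sin q.1 • fibCoord z₀.2.2 q.2.2.2) := by
  have hz := mem_chart_bf (z₀ := z₀) (z := (q.1, q.2.1.2.proj, q.2.2.2.proj)) h' h''
  have hκ : MDifferentiableAt (bfModel I) 𝓘(ℝ, ℝ × E × E) (extChartAt (bfModel I) z₀)
      (q.1, q.2.1.2.proj, q.2.2.2.proj) := mdifferentiableAt_extChartAt hz
  refine fibCoord_of hz fun v => ?_
  rw [tripleForm_apply]
  have e1 : (dd (bfModel I) (extChartAt (bfModel I) z₀) (q.1, q.2.1.2.proj, q.2.2.2.proj) v).1 =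
      dd (bfModel I) (fun w : ℝ × Z × Z => w.1) (q.1, q.2.1.2.proj, q.2.2.2.proj) v :=
    (dd_clm_comp (ContinuousLinearMap.fst ℝ ℝ (E × E)) hκ v).symm
  have e2 : (dd (bfModel I) (extChartAt (bfModel I) z₀) (q.1, q.2.1.2.proj, q.2.2.2.proj) v).2.1 =
      dd (bfModel I) (fun w : ℝ × Z × Z => extChartAt I z₀.2.1 w.2.1)
        (q.1, q.2.1.2.proj, q.2.2.2.proj) v :=
    (dd_clm_comp ((ContinuousLinearMap.fst ℝ E E).comp (ContinuousLinearMap.snd ℝ ℝ (E × E)))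
      hκ v).symm
  have e3 : (dd (bfModel I) (extChartAt (bfModel I) z₀) (q.1, q.2.1.2.proj, q.2.2.2.proj) v).2.2 =
      dd (bfModel I) (fun w : ℝ × Z × Z => extChartAt I z₀.2.2 w.2.2)
        (q.1, q.2.1.2.proj, q.2.2.2.proj) v :=
    (dd_clm_comp ((ContinuousLinearMap.snd ℝ E E).comp (ContinuousLinearMap.snd ℝ ℝ (E × E)))
      hκ v).symm
  rw [e1, e2, e3]
  have p1 : MDifferentiableAt (bfModel I) I (fun w : ℝ × Z × Z => w.2.1)
      (q.1, q.2.1.2.proj, q.2.2.2.proj) :=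
    (contMDiff_fst.comp contMDiff_snd : ContMDiff (bfModel I) I ∞ _).mdifferentiableAt (by simp)
  have p2 : MDifferentiableAt (bfModel I) I (fun w : ℝ × Z × Z => w.2.2)
      (q.1, q.2.1.2.proj, q.2.2.2.proj) :=
    (contMDiff_snd.comp contMDiff_snd : ContMDiff (bfModel I) I ∞ _).mdifferentiableAt (by simp)
  have e4 := dd_comp_mfderiv (f := extChartAt I z₀.2.1) (φ := fun w : ℝ × Z × Z => w.2.1)
    (k := (q.1, q.2.1.2.proj, q.2.2.2.proj)) (mdifferentiableAt_extChartAt (I := I) h') p1 v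
  have e5 := dd_comp_mfderiv (f := extChartAt I z₀.2.2) (φ := fun w : ℝ × Z × Z => w.2.2)
    (k := (q.1, q.2.1.2.proj, q.2.2.2.proj)) (mdifferentiableAt_extChartAt (I := I) h'') p2 v
  rw [e4, e5]
  have e6 := fibCoord_apply_mfderiv (p := q.2.1.2) h'
    (mfderiv (bfModel I) I (fun w : ℝ × Z × Z => w.2.1) (q.1, q.2.1.2.proj, q.2.2.2.proj) v)
  have e7 := fibCoord_apply_mfderiv (p := q.2.2.2) h''
    (mfderiv (bfModel I) I (fun w : ℝ × Z × Z => w.2.2) (q.1, q.2.1.2.proj, q.2.2.2.proj) v)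
  exact congrArg₂ (· + ·) (congrArg₂ (· + ·) rfl (congrArg (Real.cos q.1 * ·) e6.symm))
    (congrArg (Real.sin q.1 * ·) e7.symm)

/-- The inverse of `toInterior` in a chart. -/
def fromInterior (z₀ : ℝ × Z × Z) (q : ScCot (bfModel I) (ℝ × Z × Z)) : FibCot I Z :=
  (q.2.proj.1,
    (q.1 * Real.cos q.2.proj.1 + fibCoord z₀ q.2 (1, 0, 0) * Real.sin q.2.proj.1,
      ofFib z₀.2.1 q.2.proj.2.1 ((Real.cos q.2.proj.1)⁻¹ • (fibCoord z₀ q.2).comp (incl' E))),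
    (q.1 * Real.sin q.2.proj.1 - fibCoord z₀ q.2 (1, 0, 0) * Real.cos q.2.proj.1,
      ofFib z₀.2.2 q.2.proj.2.2 ((Real.sin q.2.proj.1)⁻¹ • (fibCoord z₀ q.2).comp (incl'' E))))

variable (I) in
/-- The part of the bundle over the interior of bf on which `fromInterior z₀` is defined. -/
def intDom (z₀ : ℝ × Z × Z) : Set (ScCot (bfModel I) (ℝ × Z × Z)) :=
  {q | q.2.proj.1 ∈ Ioo 0 (Real.pi / 2) ∧ q.2.proj.2.1 ∈ (chartAt H z₀.2.1).source ∧
    q.2.proj.2.2 ∈ (chartAt H z₀.2.2).source}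

variable (I) in
/-- The image of `intDom` under `fromInterior`. -/
def fibDom (z₀ : ℝ × Z × Z) : Set (FibCot I Z) :=
  {q | q.1 ∈ Ioo 0 (Real.pi / 2) ∧ q.2.1.2.proj ∈ (chartAt H z₀.2.1).source ∧
    q.2.2.2.proj ∈ (chartAt H z₀.2.2).source}

lemma isOpen_intDom (z₀ : ℝ × Z × Z) : IsOpen (intDom I z₀) := by
  have h1 : Continuous (fun q : ScCot (bfModel I) (ℝ × Z × Z) => q.2.proj) :=
    contMDiff_proj.continuous.comp continuous_snd
  exact (isOpen_Ioo.preimage h1.fst).inter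
    (((chartAt H z₀.2.1).open_source.preimage h1.snd.fst).inter
      ((chartAt H z₀.2.2).open_source.preimage h1.snd.snd))

lemma isOpen_fibDom (z₀ : ℝ × Z × Z) : IsOpen (fibDom I z₀) := by
  have h1 : Continuous (fun q : FibCot I Z => q.2.1.2.proj) :=
    contMDiff_proj.continuous.comp continuous_snd.fst.snd
  have h2 : Continuous (fun q : FibCot I Z => q.2.2.2.proj) :=
    contMDiff_proj.continuous.comp continuous_snd.snd.snd
  exact (isOpen_Ioo.preimage continuous_fst).inter
    (((chartAt H z₀.2.1).open_source.preimage h1).inter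
      ((chartAt H z₀.2.2).open_source.preimage h2))

lemma toInterior_mem {z₀ : ℝ × Z × Z} {q : FibCot I Z} :
    toInterior q ∈ intDom I z₀ ↔ q ∈ fibDom I z₀ := Iff.rfl

lemma fromInterior_mem {z₀ : ℝ × Z × Z} {q : ScCot (bfModel I) (ℝ × Z × Z)}
    (hq : q ∈ intDom I z₀) : fromInterior z₀ q ∈ fibDom I z₀ := by
  refine ⟨hq.1, ?_, ?_⟩
  · simp only [fromInterior, proj_ofFib hq.2.1]; exact hq.2.1
  · simp only [fromInterior, proj_ofFib hq.2.2]; exact hq.2.2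

/-- The pair `(τ, η)` is an orthogonal transformation of `(τ', τ'')` depending on `θ`. The covectors
are recovered by dividing by `cos θ` and `sin θ`, which is possible only in the interior of bf. -/
lemma fromInterior_toInterior {z₀ : ℝ × Z × Z} {q : FibCot I Z} (hq : q ∈ fibDom I z₀) :
    fromInterior z₀ (toInterior q) = q := by
  have hs : Real.sin q.1 ≠ 0 :=
    (Real.sin_pos_of_pos_of_lt_pi hq.1.1 (by linarith [hq.1.2, Real.pi_pos])).ne'
  have hc : Real.cos q.1 ≠ 0 :=
    (Real.cos_pos_of_mem_Ioo ⟨by linarith [hq.1.1, Real.pi_pos], hq.1.2⟩).ne'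
  have h1 := Real.sin_sq_add_cos_sq q.1
  simp only [fromInterior, proj_toInterior, fibCoord_toInterior hq.2.1 hq.2.2,
    tripleForm_comp_incl', tripleForm_comp_incl'', inv_smul_smul₀ hs, inv_smul_smul₀ hc,
    ofFib_fibCoord hq.2.1, ofFib_fibCoord hq.2.2, tripleForm_apply]
  refine Prod.ext rfl (Prod.ext (Prod.ext ?_ rfl) (Prod.ext ?_ rfl))
  · simp only [toInterior, totalTau, totalEta, mul_one, map_zero, add_zero]
    linear_combination q.2.1.1 * h1
  · simp only [toInterior, totalTau, totalEta, mul_one, map_zero, add_zero]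
    linear_combination q.2.2.1 * h1

lemma toInterior_fromInterior {z₀ : ℝ × Z × Z} {q : ScCot (bfModel I) (ℝ × Z × Z)}
    (hq : q ∈ intDom I z₀) : toInterior (fromInterior z₀ q) = q := by
  have hs : Real.sin q.2.proj.1 ≠ 0 :=
    (Real.sin_pos_of_pos_of_lt_pi hq.1.1 (by linarith [hq.1.2, Real.pi_pos])).ne'
  have hc : Real.cos q.2.proj.1 ≠ 0 :=
    (Real.cos_pos_of_mem_Ioo ⟨by linarith [hq.1.1, Real.pi_pos], hq.1.2⟩).ne'
  have h1 := Real.sin_sq_add_cos_sq q.2.proj.1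
  have hm := fromInterior_mem hq
  refine Prod.ext ?_ ?_
  · simp only [toInterior, totalTau, fromInterior]
    linear_combination q.1 * h1
  · have hp : (toInterior (fromInterior z₀ q)).2.proj = q.2.proj := by
      rw [proj_toInterior]
      simp only [fromInterior, proj_ofFib hq.2.1, proj_ofFib hq.2.2]
    refine eq_of_fibCoord (y := z₀) ?_ hp ?_
    · rw [hp]
      exact mem_chart_bf hq.2.1 hq.2.2
    · rw [fibCoord_toInterior hm.2.1 hm.2.2]
      refine Eq.trans ?_ (tripleForm_eq (fibCoord z₀ q.2))
      simp only [fromInterior, fibCoord_ofFib hq.2.1, fibCoord_ofFib hq.2.2,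
        smul_inv_smul₀ hs, smul_inv_smul₀ hc, totalEta]
      congr 1
      linear_combination fibCoord z₀ q.2 (1, 0, 0) * h1

lemma contMDiff_totalEta : ContMDiff (fibModel I) 𝓘(ℝ, ℝ) ∞ (totalEta : FibCot I Z → ℝ) := by
  have h1 : ContMDiff (fibModel I) 𝓘(ℝ, ℝ) ∞ (fun q : FibCot I Z => q.1) := contMDiff_fst
  have h2 : ContMDiff (fibModel I) 𝓘(ℝ, ℝ) ∞ (fun q : FibCot I Z => q.2.1.1) :=
    contMDiff_fst.comp (contMDiff_fst.comp contMDiff_snd)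
  have h3 : ContMDiff (fibModel I) 𝓘(ℝ, ℝ) ∞ (fun q : FibCot I Z => q.2.2.1) :=
    contMDiff_fst.comp (contMDiff_snd.comp contMDiff_snd)
  exact (h2.mul (Real.contDiff_sin.contMDiff.comp h1)).sub
    (h3.mul (Real.contDiff_cos.contMDiff.comp h1))

lemma contMDiff_toInterior :
    ContMDiff (fibModel I) (scModel (bfModel I)) ∞ (toInterior (I := I) (Z := Z)) := by
  intro q₀
  have h0 : ContMDiff (fibModel I) 𝓘(ℝ, ℝ) ∞ (fun q : FibCot I Z => q.1) := contMDiff_fst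
  have hp' : ContMDiff (fibModel I) (cotModel I) ∞ (fun q : FibCot I Z => q.2.1.2) :=
    contMDiff_snd.comp (contMDiff_fst.comp contMDiff_snd)
  have hp'' : ContMDiff (fibModel I) (cotModel I) ∞ (fun q : FibCot I Z => q.2.2.2) :=
    contMDiff_snd.comp (contMDiff_snd.comp contMDiff_snd)
  have hcos : ContMDiff (fibModel I) 𝓘(ℝ, ℝ) ∞ (fun q : FibCot I Z => Real.cos q.1) :=
    Real.contDiff_cos.contMDiff.comp h0
  have hsin : ContMDiff (fibModel I) 𝓘(ℝ, ℝ) ∞ (fun q : FibCot I Z => Real.sin q.1) :=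
    Real.contDiff_sin.contMDiff.comp h0
  refine ContMDiffAt.prodMk contMDiff_totalTau.contMDiffAt ?_
  rw [contMDiffAt_cot_iff]
  refine ⟨(h0.prodMk ((contMDiff_proj.comp hp').prodMk
    (contMDiff_proj.comp hp''))).contMDiffAt, ?_⟩
  set z₀ : ℝ × Z × Z := (q₀.1, q₀.2.1.2.proj, q₀.2.2.2.proj) with hz₀
  have hs' : q₀.2.1.2.proj ∈ (chartAt H z₀.2.1).source := mem_chart_source H _
  have hs'' : q₀.2.2.2.proj ∈ (chartAt H z₀.2.2).source := mem_chart_source H _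
  have hT : ContDiff ℝ ∞ (fun x : ℝ × (E →L[ℝ] ℝ) × (E →L[ℝ] ℝ) =>
      tripleForm E x.1 x.2.1 x.2.2) := by
    unfold tripleForm
    fun_prop
  have hf' : ContMDiffAt (fibModel I) 𝓘(ℝ, E →L[ℝ] ℝ) ∞
      (fun q : FibCot I Z => Real.cos q.1 • fibCoord z₀.2.1 q.2.1.2) q₀ :=
    hcos.contMDiffAt.smul (ContMDiffAt.comp (g := fibCoord z₀.2.1) q₀ (contMDiffAt_fibCoord hs')
      hp'.contMDiffAt)
  have hf'' : ContMDiffAt (fibModel I) 𝓘(ℝ, E →L[ℝ] ℝ) ∞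
      (fun q : FibCot I Z => Real.sin q.1 • fibCoord z₀.2.2 q.2.2.2) q₀ :=
    hsin.contMDiffAt.smul (ContMDiffAt.comp (g := fibCoord z₀.2.2) q₀ (contMDiffAt_fibCoord hs'')
      hp''.contMDiffAt)
  have hcomp : ContMDiffAt (fibModel I) 𝓘(ℝ, (ℝ × E × E) →L[ℝ] ℝ) ∞
      (fun q : FibCot I Z => tripleForm E (totalEta q)
        (Real.cos q.1 • fibCoord z₀.2.1 q.2.1.2) (Real.sin q.1 • fibCoord z₀.2.2 q.2.2.2)) q₀ :=
    ContMDiffAt.comp (g := fun x : ℝ × (E →L[ℝ] ℝ) × (E →L[ℝ] ℝ) => tripleForm E x.1 x.2.1 x.2.2)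
      (f := fun q : FibCot I Z => (totalEta q, Real.cos q.1 • fibCoord z₀.2.1 q.2.1.2,
        Real.sin q.1 • fibCoord z₀.2.2 q.2.2.2)) q₀ hT.contMDiff.contMDiffAt
      (contMDiff_totalEta.contMDiffAt.prodMk_space (hf'.prodMk_space hf''))
  refine hcomp.congr_of_eventuallyEq ?_
  have ho' := ((chartAt H z₀.2.1).open_source.preimage
    (contMDiff_proj.continuous.comp hp'.continuous)).mem_nhds hs'
  have ho'' := ((chartAt H z₀.2.2).open_source.preimage
    (contMDiff_proj.continuous.comp hp''.continuous)).mem_nhds hs''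
  filter_upwards [ho', ho''] with q h' h''
  exact fibCoord_toInterior h' h''

lemma contMDiffAt_fromInterior {z₀ : ℝ × Z × Z} {q : ScCot (bfModel I) (ℝ × Z × Z)}
    (hq : q ∈ intDom I z₀) :
    ContMDiffAt (scModel (bfModel I)) (fibModel I) ∞ (fromInterior z₀) q := by
  have hs : Real.sin q.2.proj.1 ≠ 0 :=
    (Real.sin_pos_of_pos_of_lt_pi hq.1.1 (by linarith [hq.1.2, Real.pi_pos])).ne'
  have hc : Real.cos q.2.proj.1 ≠ 0 :=
    (Real.cos_pos_of_mem_Ioo ⟨by linarith [hq.1.1, Real.pi_pos], hq.1.2⟩).ne'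
  have hpr : ContMDiff (scModel (bfModel I)) (bfModel I) ∞
      (fun q : ScCot (bfModel I) (ℝ × Z × Z) => q.2.proj) := contMDiff_proj.comp contMDiff_snd
  have h0 : ContMDiff (scModel (bfModel I)) 𝓘(ℝ, ℝ) ∞
      (fun q : ScCot (bfModel I) (ℝ × Z × Z) => q.2.proj.1) := contMDiff_fst.comp hpr
  have hcos : ContMDiff (scModel (bfModel I)) 𝓘(ℝ, ℝ) ∞
      (fun q : ScCot (bfModel I) (ℝ × Z × Z) => Real.cos q.2.proj.1) :=
    Real.contDiff_cos.contMDiff.comp h0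
  have hsin : ContMDiff (scModel (bfModel I)) 𝓘(ℝ, ℝ) ∞
      (fun q : ScCot (bfModel I) (ℝ × Z × Z) => Real.sin q.2.proj.1) :=
    Real.contDiff_sin.contMDiff.comp h0
  have hτ : ContMDiff (scModel (bfModel I)) 𝓘(ℝ, ℝ) ∞
      (fun q : ScCot (bfModel I) (ℝ × Z × Z) => q.1) := contMDiff_fst
  have hξ : ContMDiffAt (scModel (bfModel I)) 𝓘(ℝ, (ℝ × E × E) →L[ℝ] ℝ) ∞
      (fun q : ScCot (bfModel I) (ℝ × Z × Z) => fibCoord z₀ q.2) q :=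
    ContMDiffAt.comp (g := fibCoord z₀) q (contMDiffAt_fibCoord (mem_chart_bf hq.2.1 hq.2.2))
      contMDiffAt_snd
  have hη : ContMDiffAt (scModel (bfModel I)) 𝓘(ℝ, ℝ) ∞
      (fun q : ScCot (bfModel I) (ℝ × Z × Z) => fibCoord z₀ q.2 (1, 0, 0)) q := by
    have h1 : ContDiff ℝ ∞ (fun ξ : (ℝ × E × E) →L[ℝ] ℝ => ξ (1, 0, 0)) := by fun_prop
    exact ContMDiffAt.comp (g := fun ξ : (ℝ × E × E) →L[ℝ] ℝ => ξ (1, 0, 0)) q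
      h1.contMDiff.contMDiffAt hξ
  have hcomp (A : E →L[ℝ] ℝ × E × E) : ContMDiffAt (scModel (bfModel I)) 𝓘(ℝ, E →L[ℝ] ℝ) ∞
      (fun q : ScCot (bfModel I) (ℝ × Z × Z) => (fibCoord z₀ q.2).comp A) q := by
    have h1 : ContDiff ℝ ∞ (fun ξ : (ℝ × E × E) →L[ℝ] ℝ => ξ.comp A) := by fun_prop
    exact ContMDiffAt.comp (g := fun ξ : (ℝ × E × E) →L[ℝ] ℝ => ξ.comp A) q
      h1.contMDiff.contMDiffAt hξ
  refine h0.contMDiffAt.prodMk (ContMDiffAt.prodMk (ContMDiffAt.prodMk ?_ ?_)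
    (ContMDiffAt.prodMk ?_ ?_))
  · exact (hτ.contMDiffAt.mul hcos.contMDiffAt).add (hη.mul hsin.contMDiffAt)
  · exact contMDiffAt_ofFib hq.2.1 (contMDiff_fst.comp (contMDiff_snd.comp hpr)).contMDiffAt
      ((hcos.contMDiffAt.inv₀ hc).smul (hcomp _))
  · exact (hτ.contMDiffAt.mul hsin.contMDiffAt).sub (hη.mul hcos.contMDiffAt)
  · exact contMDiffAt_ofFib hq.2.2 (contMDiff_snd.comp (contMDiff_snd.comp hpr)).contMDiffAt
      ((hsin.contMDiffAt.inv₀ hs).smul (hcomp _))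

end Interior
end ScatGeom

namespace ScatGeom

/-! ### Legendre submanifolds over the interior of bf -/

section Interior

universe u

variable {E : Type u} [NormedAddCommGroup E] [NormedSpace ℝ E] [FiniteDimensional ℝ E]
  {H : Type*} [TopologicalSpace H] {I : ModelWithCorners ℝ E H} [I.Boundaryless]
  {Z : Type*} [TopologicalSpace Z] [ChartedSpace H Z] [IsManifold I ∞ Z]
  [CompactSpace Z] [T2Space Z]

lemma dd_congr {EK : Type*} [NormedAddCommGroup EK] [NormedSpace ℝ EK]
    {HK : Type*} [TopologicalSpace HK] {IK : ModelWithCorners ℝ EK HK}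
    {K : Type*} [TopologicalSpace K] [ChartedSpace HK K]
    {W : Type*} [NormedAddCommGroup W] [NormedSpace ℝ W] {f g : K → W} {k : K}
    (hfg : f =ᶠ[𝓝 k] g) (v : TangentSpace IK k) : dd IK f k v = dd IK g k v := by
  have h1 : MDifferentiableAt IK 𝓘(ℝ, W) f k ↔ MDifferentiableAt IK 𝓘(ℝ, W) g k :=
    ⟨fun h => h.congr_of_eventuallyEq hfg.symm, fun h => h.congr_of_eventuallyEq hfg⟩
  by_cases hf : MDifferentiableAt IK 𝓘(ℝ, W) f k
  · obtain h2 := (hf.hasMFDerivAt.congr_of_eventuallyEq hfg.symm).mfderiv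
    exact congrArg (fun A : EK →L[ℝ] W => A v) h2.symm
  · have h2 := mfderiv_zero_of_not_mdifferentiableAt hf
    have h3 := mfderiv_zero_of_not_mdifferentiableAt (fun h => hf (h1.2 h))
    exact (congrArg (fun A : EK →L[ℝ] W => A v) h2).trans
      (congrArg (fun A : EK →L[ℝ] W => A v) h3).symm

/-- The contact forms agree over the interior of bf. -/
lemma contactForm_eq_fromInterior {z₀ : ℝ × Z × Z} {q : ScCot (bfModel I) (ℝ × Z × Z)}
    (hq : q ∈ intDom I z₀) (v : TangentSpace (scModel (bfModel I)) q) :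
    contactForm q v = fibContactForm (fromInterior z₀ q)
      (mfderiv (scModel (bfModel I)) (fibModel I) (fromInterior z₀) q v) := by
  have hF := contMDiffAt_fromInterior hq
  have hnear := (isOpen_intDom z₀).mem_nhds hq
  have hm := fromInterior_mem hq
  rw [fibContactForm_mfderiv (hF.mdifferentiableAt (by simp))]
  have hs' : ContMDiffAt (scModel (bfModel I)) (cotModel I) ∞
      (fun k => (fromInterior z₀ k).2.1.2) q :=
    ContMDiffAt.comp (g := fun w : FibCot I Z => w.2.1.2) (f := fromInterior z₀) q
      (contMDiff_snd.comp (contMDiff_fst.comp contMDiff_snd)).contMDiffAt hF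
  have hs'' : ContMDiffAt (scModel (bfModel I)) (cotModel I) ∞
      (fun k => (fromInterior z₀ k).2.2.2) q :=
    ContMDiffAt.comp (g := fun w : FibCot I Z => w.2.2.2) (f := fromInterior z₀) q
      (contMDiff_snd.comp (contMDiff_snd.comp contMDiff_snd)).contMDiffAt hF
  rw [pullForm_eq_fibCoord (f := fun k => (fromInterior z₀ k).2.1.2) hm.2.1 (hs'.mdifferentiableAt (by simp)),
    pullForm_eq_fibCoord (f := fun k => (fromInterior z₀ k).2.2.2) hm.2.2
      (hs''.mdifferentiableAt (by simp))]
  have hz : q.2.proj ∈ (chartAt (ModelProd ℝ (ModelProd H H)) z₀).source :=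
    mem_chart_bf hq.2.1 hq.2.2
  have h0 : contactForm q v = dd (scModel (bfModel I))
      (fun w : ScCot (bfModel I) (ℝ × Z × Z) => w.1) q v +
      pullForm (scModel (bfModel I)) (fun w : ScCot (bfModel I) (ℝ × Z × Z) => w.2) q v := rfl
  have hsnd : ContMDiffAt (scModel (bfModel I)) (cotModel (bfModel I)) ∞
      (fun w : ScCot (bfModel I) (ℝ × Z × Z) => w.2) q := contMDiffAt_snd
  have h1 := pullForm_eq_fibCoord (y := z₀) (f := fun w : ScCot (bfModel I) (ℝ × Z × Z) => w.2)
    hz (hsnd.mdifferentiableAt (by simp)) v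
  have hκ : MDifferentiableAt (scModel (bfModel I)) 𝓘(ℝ, ℝ × E × E)
      (fun w : ScCot (bfModel I) (ℝ × Z × Z) => extChartAt (bfModel I) z₀ w.2.proj) q :=
    (contMDiffAt_chart_proj (y := z₀) (f := fun w : ScCot (bfModel I) (ℝ × Z × Z) => w.2) hz
      hsnd).mdifferentiableAt (by simp)
  have h2 : fibCoord z₀ q.2 = tripleForm E (totalEta (fromInterior z₀ q))
      (Real.cos (fromInterior z₀ q).1 • fibCoord z₀.2.1 (fromInterior z₀ q).2.1.2)
      (Real.sin (fromInterior z₀ q).1 • fibCoord z₀.2.2 (fromInterior z₀ q).2.2.2) := by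
    rw [← fibCoord_toInterior hm.2.1 hm.2.2, toInterior_fromInterior hq]
  rw [h0, h1, h2, tripleForm_apply]
  have e0 : dd (scModel (bfModel I)) (fun w : ScCot (bfModel I) (ℝ × Z × Z) => w.1) q v =
      dd (scModel (bfModel I)) (fun w => totalTau (fromInterior z₀ w)) q v := by
    refine dd_congr ?_ v
    filter_upwards [hnear] with w hw
    exact (congrArg Prod.fst (toInterior_fromInterior hw)).symm
  have e1 : (dd (scModel (bfModel I)) (fun w : ScCot (bfModel I) (ℝ × Z × Z) =>
      extChartAt (bfModel I) z₀ w.2.proj) q v).1 =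
      dd (scModel (bfModel I)) (fun w => (fromInterior z₀ w).1) q v :=
    (dd_clm_comp (ContinuousLinearMap.fst ℝ ℝ (E × E)) hκ v).symm
  have e2 : (dd (scModel (bfModel I)) (fun w : ScCot (bfModel I) (ℝ × Z × Z) =>
      extChartAt (bfModel I) z₀ w.2.proj) q v).2.1 =
      dd (scModel (bfModel I)) (fun w => extChartAt I z₀.2.1 (fromInterior z₀ w).2.1.2.proj) q v := by
    refine (dd_clm_comp ((ContinuousLinearMap.fst ℝ E E).comp
      (ContinuousLinearMap.snd ℝ ℝ (E × E))) hκ v).symm.trans (dd_congr ?_ v)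
    filter_upwards [hnear] with w hw
    simp only [fromInterior, proj_ofFib hw.2.1]
    rfl
  have e3 : (dd (scModel (bfModel I)) (fun w : ScCot (bfModel I) (ℝ × Z × Z) =>
      extChartAt (bfModel I) z₀ w.2.proj) q v).2.2 =
      dd (scModel (bfModel I)) (fun w => extChartAt I z₀.2.2 (fromInterior z₀ w).2.2.2.proj) q v := by
    refine (dd_clm_comp ((ContinuousLinearMap.snd ℝ E E).comp
      (ContinuousLinearMap.snd ℝ ℝ (E × E))) hκ v).symm.trans (dd_congr ?_ v)
    filter_upwards [hnear] with w hw
    simp only [fromInterior, proj_ofFib hw.2.2]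
    rfl
  rw [e0, e1, e2, e3]
  simp only [smul_apply, smul_eq_mul]
  ring

lemma mem_interiorPart_iff {G : Set (FibCot I Z)} {z₀ : ℝ × Z × Z}
    {q : ScCot (bfModel I) (ℝ × Z × Z)} (hq : q ∈ intDom I z₀) :
    q ∈ interiorPart G ↔ fromInterior z₀ q ∈ G := by
  constructor
  · rintro ⟨p, ⟨hp, hp1⟩, rfl⟩
    rwa [fromInterior_toInterior (toInterior_mem.1 hq)]
  · exact fun hp => ⟨_, ⟨hp, hq.1⟩, toInterior_fromInterior hq⟩

lemma proj_of_mem_interiorPart {G : Set (FibCot I Z)} {q : ScCot (bfModel I) (ℝ × Z × Z)}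
    (hq : q ∈ interiorPart G) : q.2.proj ∈ (bfInterior : Set (ℝ × Z × Z)) := by
  obtain ⟨p, ⟨-, hp⟩, rfl⟩ := hq
  exact hp

lemma mem_intDom_self {q : ScCot (bfModel I) (ℝ × Z × Z)}
    (hq : q.2.proj ∈ (bfInterior : Set (ℝ × Z × Z))) : q ∈ intDom I q.2.proj :=
  ⟨hq, mem_chart_source H _, mem_chart_source H _⟩

lemma surjective_mfderiv_fromInterior {z₀ : ℝ × Z × Z} {q : ScCot (bfModel I) (ℝ × Z × Z)}
    (hq : q ∈ intDom I z₀) :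
    Function.Surjective (mfderiv (scModel (bfModel I)) (fibModel I) (fromInterior z₀) q) := by
  refine surjective_mfderiv_of_inverse (τ := toInterior)
    ((contMDiffAt_fromInterior hq).mdifferentiableAt (by simp))
    (contMDiff_toInterior.mdifferentiableAt (by simp)) (toInterior_fromInterior hq) ?_
  filter_upwards [(isOpen_fibDom z₀).mem_nhds (fromInterior_mem hq)] with w hw
  exact fromInterior_toInterior hw

/-- Over the interior of bf, Legendre submanifolds of the fibred-scattering cotangent bundle are
Legendre submanifolds of the scattering cotangent bundle. -/
lemma isLegendre_interiorPart {G : Set (FibCot I Z)}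
    (hG : IsNeatIntegralSubmanifold (fibModel I) fibContactForm bfDef
      (2 * Module.finrank ℝ E + 2) G) : IsLegendre (interiorPart G) := by
  have hfin : Module.finrank ℝ (ℝ × E × E) + 1 = 2 * Module.finrank ℝ E + 2 := by
    simp only [Module.finrank_prod, Module.finrank_self]
    ring
  unfold IsLegendre
  rw [hfin]
  intro q hqG
  have hq := mem_intDom_self (proj_of_mem_interiorPart hqG)
  have hqF := (mem_interiorPart_iff hq).1 hqG
  obtain ⟨F, hF, hF0⟩ := hG _ hqF
  have hpos : ∀ w ∈ intDom I q.2.proj, 0 < bfDef (fromInterior q.2.proj w) := fun w hw =>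
    mul_pos hw.1.1 (sub_pos.2 hw.1.2)
  obtain ⟨h1, h2⟩ := hF.comp (ρ' := fun _ => 1) (S' := interiorPart G) (isOpen_intDom q.2.proj) hq
    (fun w hw => (contMDiffAt_fromInterior hw).contMDiffWithinAt)
    (surjective_mfderiv_fromInterior hq) (fun w hw => mem_interiorPart_iff hw)
    (fun w hw => iff_of_true zero_le_one (hpos w hw).le)
    (fun h0 => absurd h0 one_ne_zero)
  refine ⟨_, h1, fun v hv => ?_⟩
  rw [contactForm_eq_fromInterior hq]
  exact hF0 _ ((h2 v).symm.trans hv)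

end Interior
end ScatGeom

namespace ScatGeom

section ConicTransit

/-! ### The time of transit near the conic points over the interior of bf -/

/-- The quotient of `transitDen` by `|μ''|²` near the conic points. -/
def conicDen (c t ρ n : ℝ) : ℝ :=
  (c ^ 2 * (1 + t ^ 2) - t ^ 2 * (ρ ^ 2 * n)) /
    (c ^ 2 + conicTau c (t * ρ) n * conicTau c ρ n) + t

/-- The time of transit near the conic points, for a rescaled covector. -/
def conicTransit (c t ρ n : ℝ) : ℝ :=
  SignType.sign c * (Real.pi / √n) -
    flowTime (ρ * conicDen c t ρ n / (conicTau c (t * ρ) n + t * conicTau c ρ n)) n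

variable {c t ρ n : ℝ}

lemma conicTau_mul_pos (hc : c ≠ 0) (h1 : ρ ^ 2 * n < c ^ 2) (h2 : (t * ρ) ^ 2 * n < c ^ 2) :
    0 < conicTau c (t * ρ) n * conicTau c ρ n := by
  have h3 := mul_pos (mul_conicTau_pos hc h2) (mul_conicTau_pos hc h1)
  have h4 := mul_self_pos.2 hc
  by_contra hcon
  nlinarith

lemma conicDen_pos (hc : c ≠ 0) (ht : 0 < t) (h1 : ρ ^ 2 * n < c ^ 2)
    (h2 : (t * ρ) ^ 2 * n < c ^ 2) : 0 < conicDen c t ρ n := by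
  have h3 := conicTau_mul_pos hc h1 h2
  have h4 : 0 < c ^ 2 := by positivity
  have h5 : 0 < c ^ 2 * (1 + t ^ 2) - t ^ 2 * (ρ ^ 2 * n) := by nlinarith [sq_nonneg t]
  unfold conicDen
  positivity

/-- Near a conic point `λ² - τ'τ''` is a difference of nearly equal quantities. Multiplying by `c² +
τ'τ''`, which is positive, turns it into `c⁴ - τ'²τ''²`, from which the sphere relations extract the
factor `ρ² n`. -/
lemma transitDen_conic {lam : ℝ} (hlam : c ^ 2 = lam ^ 2) (hc : c ≠ 0) (h1 : ρ ^ 2 * n < c ^ 2)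
    (h2 : (t * ρ) ^ 2 * n < c ^ 2) :
    transitDen lam t (conicTau c (t * ρ) n) (conicTau c ρ n) (ρ ^ 2 * n) =
      ρ ^ 2 * n * conicDen c t ρ n := by
  have h3 := conicTau_mul_pos hc h1 h2
  have h4 : 0 < c ^ 2 := by positivity
  have h5 := conicTau_sq hc h1.le
  have h6 := conicTau_sq hc h2.le
  rw [transitDen, conicDen, ← hlam]
  set a := conicTau c (t * ρ) n
  set b := conicTau c ρ n
  have h7 : c ^ 2 + a * b ≠ 0 := by positivity
  field_simp
  linear_combination (-b ^ 2) * h6 - (c ^ 2 - (t * ρ) ^ 2 * n) * h5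

lemma mul_add_conicTau_pos (hc : c ≠ 0) (ht : 0 ≤ t) (h1 : ρ ^ 2 * n < c ^ 2)
    (h2 : (t * ρ) ^ 2 * n < c ^ 2) : 0 < c * (conicTau c (t * ρ) n + t * conicTau c ρ n) := by
  have h3 := mul_conicTau_pos hc h1
  have h4 := mul_conicTau_pos hc h2
  nlinarith

/-- The covector `d` has length `1/ρ` times that of `μ'' = ρ d`, so its time is `ρ` times the
transit time. Then `flowTime_add_inv` applies; the sign is that of `τ' + t τ''`, which near the
conic point is the sign of `c`. -/
lemma conicTransit_eq {lam : ℝ} (hlam : c ^ 2 = lam ^ 2) (hc : c ≠ 0) (ht : 0 < t) (hρ : 0 < ρ)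
    (hn : 0 < n) (h1 : ρ ^ 2 * n < c ^ 2) (h2 : (t * ρ) ^ 2 * n < c ^ 2) :
    conicTransit c t ρ n =
      ρ * transit lam t (conicTau c (t * ρ) n) (conicTau c ρ n) (ρ ^ 2 * n) := by
  have h3 := conicDen_pos hc ht h1 h2
  have h4 := mul_add_conicTau_pos hc ht.le h1 h2
  rw [transit, transitDen_conic hlam hc h1 h2, ← flowTime_mul, conicTransit]
  set A := conicTau c (t * ρ) n + t * conicTau c ρ n with hA
  have hA0 : A ≠ 0 := fun h => by rw [h, mul_zero] at h4; exact h4.false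
  have h5 : SignType.sign (ρ * (A / (ρ ^ 2 * n * conicDen c t ρ n))) = SignType.sign c := by
    rcases hc.lt_or_gt with h8 | h8
    · have : A < 0 := by by_contra hcon; nlinarith
      rw [sign_neg h8, sign_neg]
      exact mul_neg_of_pos_of_neg hρ (div_neg_of_neg_of_pos this (by positivity))
    · have : 0 < A := by by_contra hcon; nlinarith
      rw [sign_pos h8, sign_pos]
      positivity
  rw [flowTime_add_inv (w := ρ * (A / (ρ ^ 2 * n * conicDen c t ρ n)))
    (w' := ρ * conicDen c t ρ n / A) hn (by positivity) (by field_simp), h5]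

lemma contDiffAt_conicTransit {x : ℝ × ℝ × ℝ} (hc : c ≠ 0) (ht : 0 ≤ x.1) (hn : 0 < x.2.2)
    (h1 : x.2.1 ^ 2 * x.2.2 < c ^ 2) (h2 : (x.1 * x.2.1) ^ 2 * x.2.2 < c ^ 2) :
    ContDiffAt ℝ ∞ (fun x : ℝ × ℝ × ℝ => conicTransit c x.1 x.2.1 x.2.2) x := by
  have ht' : ContDiffAt ℝ ∞ (fun x : ℝ × ℝ × ℝ => x.1) x := contDiffAt_fst
  have hρ' : ContDiffAt ℝ ∞ (fun x : ℝ × ℝ × ℝ => x.2.1) x := contDiffAt_fst.comp x contDiffAt_snd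
  have hn' : ContDiffAt ℝ ∞ (fun x : ℝ × ℝ × ℝ => x.2.2) x := contDiffAt_snd.comp x contDiffAt_snd
  have hb : ContDiffAt ℝ ∞ (fun x : ℝ × ℝ × ℝ => conicTau c x.2.1 x.2.2) x :=
    ContDiffAt.comp (g := fun y : ℝ × ℝ => conicTau c y.1 y.2)
      (f := fun x : ℝ × ℝ × ℝ => (x.2.1, x.2.2)) x (contDiffAt_conicTau hc h1) (hρ'.prodMk hn')
  have ha : ContDiffAt ℝ ∞ (fun x : ℝ × ℝ × ℝ => conicTau c (x.1 * x.2.1) x.2.2) x :=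
    ContDiffAt.comp (g := fun y : ℝ × ℝ => conicTau c y.1 y.2)
      (f := fun x : ℝ × ℝ × ℝ => (x.1 * x.2.1, x.2.2)) x (contDiffAt_conicTau hc h2)
      ((ht'.mul hρ').prodMk hn')
  have h3 := conicTau_mul_pos hc h1 h2
  have h4 := mul_add_conicTau_pos hc ht h1 h2
  have h5 : c ^ 2 + conicTau c (x.1 * x.2.1) x.2.2 * conicTau c x.2.1 x.2.2 ≠ 0 := by positivity
  have h6 : conicTau c (x.1 * x.2.1) x.2.2 + x.1 * conicTau c x.2.1 x.2.2 ≠ 0 :=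
    fun h => by rw [h, mul_zero] at h4; exact h4.false
  have hd : ContDiffAt ℝ ∞ (fun x : ℝ × ℝ × ℝ => conicDen c x.1 x.2.1 x.2.2) x :=
    (((contDiffAt_const.mul (contDiffAt_const.add (ht'.pow 2))).sub
      ((ht'.pow 2).mul ((hρ'.pow 2).mul hn'))).div (contDiffAt_const.add (ha.mul hb)) h5).add ht'
  refine (contDiffAt_const.mul (contDiffAt_const.div (hn'.sqrt hn.ne')
    (Real.sqrt_pos.2 hn).ne')).sub ?_
  exact ContDiffAt.comp (g := fun y : ℝ × ℝ => flowTime y.1 y.2)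
    (f := fun x : ℝ × ℝ × ℝ => (x.2.1 * conicDen c x.1 x.2.1 x.2.2 /
      (conicTau c (x.1 * x.2.1) x.2.2 + x.1 * conicTau c x.2.1 x.2.2), x.2.2)) x
    (contDiffAt_flowTime hn.le) (((hρ'.mul hd).div (ha.add (ht'.mul hb)) h6).prodMk hn')

/-- The pairs `(ρ, d)` and `(ρ/s, s d)` describe the same covector, and the time scales inversely to
the length of `d`. -/
lemma conicTransit_scale {s : ℝ} (hs : 0 < s) :
    conicTransit c t (ρ / s) (s ^ 2 * n) = conicTransit c t ρ n / s := by
  have h1 : (ρ / s) ^ 2 * (s ^ 2 * n) = ρ ^ 2 * n := by field_simp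
  have h2 : flowTime (ρ / s * conicDen c t ρ n / (conicTau c (t * ρ) n + t * conicTau c ρ n))
      (s ^ 2 * n) =
      flowTime (ρ * conicDen c t ρ n / (conicTau c (t * ρ) n + t * conicTau c ρ n)) n / s := by
    rw [show ρ / s * conicDen c t ρ n / (conicTau c (t * ρ) n + t * conicTau c ρ n) = s⁻¹ *
      (ρ * conicDen c t ρ n / (conicTau c (t * ρ) n + t * conicTau c ρ n)) by ring, flowTime_mul,
      show s⁻¹ ^ 2 * (s ^ 2 * n) = n by field_simp]
    ring
  rw [conicTransit, conicDen, ← mul_div_assoc t ρ s, conicTau_scale hs.ne', conicTau_scale hs.ne',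
    h1, ← conicDen, h2, Real.sqrt_mul (sq_nonneg s), Real.sqrt_sq hs.le, conicTransit, sub_div]
  congr 1
  rw [mul_comm s, ← div_div, mul_div_assoc]

end ConicTransit

/-! ### L near the conic points over the interior of bf -/

section LegLConic

universe u

variable {E : Type u} [NormedAddCommGroup E] [NormedSpace ℝ E] [FiniteDimensional ℝ E]
  {H : Type*} [TopologicalSpace H] {I : ModelWithCorners ℝ E H} [I.Boundaryless]
  {Z : Type*} [TopologicalSpace Z] [ChartedSpace H Z] [IsManifold I ∞ Z]
  [CompactSpace Z] [T2Space Z]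
  (h : ContMDiffRiemannianMetric I ∞ E (fun z : Z => TangentSpace I z)) {lam : ℝ}

lemma tan_pos_of_mem {θ : ℝ} (hθ : θ ∈ Ioo 0 (Real.pi / 2)) : 0 < Real.tan θ :=
  Real.tan_pos_of_pos_of_lt_pi_div_two hθ.1 hθ.2

lemma legL_relations (hlam : 0 < lam) {q : FibCot I Z} (hq : q ∈ legL h lam)
    (hθ : q.1 ∈ Ioo 0 (Real.pi / 2)) :
    0 < transitDen lam (Real.tan q.1) q.2.1.1 q.2.2.1 (normSq h q.2.2.2) ∧
      q.2.2.1 ^ 2 + normSq h q.2.2.2 = lam ^ 2 ∧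
      q.2.1.1 ^ 2 + Real.tan q.1 ^ 2 * normSq h q.2.2.2 = lam ^ 2 ∧
      normSq h q.2.1.2 = Real.tan q.1 ^ 2 * normSq h q.2.2.2 := by
  obtain ⟨h1, h2, h3⟩ := (mem_legL_of_lt h hlam ⟨hθ.1.le, hθ.2⟩).1 hq
  simp only [legEq, legCoord, Prod.mk_eq_zero] at h3
  refine ⟨h1.2, by linarith [h3.1], by linarith [h3.2], ?_⟩
  have h4 := congrArg (fun q : FibCot I Z => normSq h q.2.1.2) h2
  simp only [legParam, normSq_scale, normSq_geoFlow, neg_sq] at h4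
  exact h4.symm

/-- `L` near the conic points over the interior of bf. -/
lemma mem_legL_conic (hlam : 0 < lam) {c : ℝ} (hc : c ^ 2 = lam ^ 2) {θ a b ρ : ℝ}
    (hθ : θ ∈ Ioo 0 (Real.pi / 2)) (hρ : 0 < ρ) {p' d : Cot I Z} (hd : 0 < normSq h d)
    (ha : 0 < c * a) (hb : 0 < c * b) (h1 : ρ ^ 2 * normSq h d < c ^ 2)
    (h2 : (Real.tan θ * ρ) ^ 2 * normSq h d < c ^ 2) :
    (θ, (a, p'), (b, d.scale ρ)) ∈ legL h lam ↔
      a = conicTau c (Real.tan θ * ρ) (normSq h d) ∧ b = conicTau c ρ (normSq h d) ∧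
        p' = ((geoFlow h (conicTransit c (Real.tan θ) ρ (normSq h d)) d).scale
          (-Real.tan θ)).scale ρ := by
  have hc0 : c ≠ 0 := fun h0 => by rw [h0, zero_mul] at ha; exact ha.false
  have ht := tan_pos_of_mem hθ
  have key : ∀ a b, a = conicTau c (Real.tan θ * ρ) (normSq h d) → b = conicTau c ρ (normSq h d) →
      (geoFlow h (legTime h lam (θ, a, b, d.scale ρ)) (d.scale ρ)).scale (-Real.tan θ) =
        ((geoFlow h (conicTransit c (Real.tan θ) ρ (normSq h d)) d).scale
          (-Real.tan θ)).scale ρ := by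
    rintro _ _ rfl rfl
    rw [conicTransit_eq hc hc0 ht hρ hd h1 h2]
    simp only [legTime, normSq_scale, geoFlow_scale, scale_scale]
    rw [mul_comm ρ (transit _ _ _ _ _), mul_comm ρ]
  constructor
  · intro hq
    obtain ⟨-, h3, h4, -⟩ := legL_relations h hlam hq hθ
    obtain ⟨-, h5, -⟩ := (mem_legL_of_lt h hlam ⟨hθ.1.le, hθ.2⟩).1 hq
    simp only [normSq_scale] at h3 h4
    have e1 : a = conicTau c (Real.tan θ * ρ) (normSq h d) :=
      eq_conicTau hc0 (by rw [hc, ← h4]; ring) ha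
    have e2 : b = conicTau c ρ (normSq h d) := eq_conicTau hc0 (by rw [hc, ← h3]) hb
    refine ⟨e1, e2, ?_⟩
    rw [← key a b e1 e2]
    exact (congrArg (fun q : FibCot I Z => q.2.1.2) h5).symm
  · rintro ⟨e1, e2, e3⟩
    rw [mem_legL_of_lt h hlam ⟨hθ.1.le, hθ.2⟩]
    refine ⟨⟨⟨show -(Real.pi / 2) < θ by linarith [hθ.1, Real.pi_pos], hθ.2⟩, ?_⟩, ?_, ?_⟩
    · simp only [legCoord, normSq_scale]
      rw [e1, e2, transitDen_conic hc hc0 h1 h2]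
      have := conicDen_pos hc0 ht h1 h2
      positivity
    · rw [e3, ← key a b e1 e2]
      rfl
    · simp only [legEq, legCoord, normSq_scale, Prod.mk_eq_zero]
      have h3 := conicTau_sq hc0 h1.le
      have h4 := conicTau_sq hc0 h2.le
      rw [← e1] at h4
      rw [← e2] at h3
      constructor
      · linarith
      · rw [← hc]; linear_combination h4

end LegLConic
end ScatGeom

namespace ScatGeom

section InteriorClosure

universe u

variable {E : Type u} [NormedAddCommGroup E] [NormedSpace ℝ E] [FiniteDimensional ℝ E]
  {H : Type*} [TopologicalSpace H] {I : ModelWithCorners ℝ E H} [I.Boundaryless]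
  {Z : Type*} [TopologicalSpace Z] [ChartedSpace H Z] [IsManifold I ∞ Z]
  [CompactSpace Z] [T2Space Z]
  (h : ContMDiffRiemannianMetric I ∞ E (fun z : Z => TangentSpace I z)) {lam : ℝ}

/-! ### The closure of `L` over the interior of bf -/

lemma continuousAt_tan_fst {q : FibCot I Z} (hθ : q.1 ∈ Ioo 0 (Real.pi / 2)) :
    ContinuousAt (fun q : FibCot I Z => Real.tan q.1) q :=
  ContinuousAt.comp (g := Real.tan) (f := fun q : FibCot I Z => q.1)
    (Real.continuousAt_tan.2 (Real.cos_pos_of_mem_Ioo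
      ⟨by linarith [hθ.1, Real.pi_pos], hθ.2⟩).ne') continuousAt_fst

lemma continuous_normSq_snd :
    Continuous (fun q : FibCot I Z => normSq h q.2.1.2) ∧
      Continuous (fun q : FibCot I Z => normSq h q.2.2.2) :=
  ⟨(contMDiff_normSq h).continuous.comp continuous_snd.fst.snd,
    (contMDiff_normSq h).continuous.comp continuous_snd.snd.snd⟩

lemma closure_legL_relations (hlam : 0 < lam) {q : FibCot I Z} (hq : q ∈ closure (legL h lam))
    (hθ : q.1 ∈ Ioo 0 (Real.pi / 2)) :
    0 ≤ transitDen lam (Real.tan q.1) q.2.1.1 q.2.2.1 (normSq h q.2.2.2) ∧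
      q.2.2.1 ^ 2 + normSq h q.2.2.2 = lam ^ 2 ∧
      q.2.1.1 ^ 2 + Real.tan q.1 ^ 2 * normSq h q.2.2.2 = lam ^ 2 ∧
      normSq h q.2.1.2 = Real.tan q.1 ^ 2 * normSq h q.2.2.2 ∧
      ∃ᶠ x in 𝓝 q, x ∈ legL h lam ∧ x.1 ∈ Ioo 0 (Real.pi / 2) := by
  have hO : IsOpen {x : FibCot I Z | x.1 ∈ Ioo 0 (Real.pi / 2)} :=
    isOpen_Ioo.preimage continuous_fst
  have hcl := hO.inter_closure ⟨hθ, hq⟩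
  have ht := continuousAt_tan_fst hθ
  obtain ⟨hn', hn''⟩ := continuous_normSq_snd h
  have ha : Continuous (fun q : FibCot I Z => q.2.1.1) := continuous_snd.fst.fst
  have hb : Continuous (fun q : FibCot I Z => q.2.2.1) := continuous_snd.snd.fst
  refine ⟨?_, ?_, ?_, ?_, ?_⟩
  · have hD : ContinuousAt (fun q : FibCot I Z =>
        transitDen lam (Real.tan q.1) q.2.1.1 q.2.2.1 (normSq h q.2.2.2)) q :=
      (continuousAt_const.sub (ha.mul hb).continuousAt).add (ht.mul hn''.continuousAt)
    by_contra hcon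
    obtain ⟨x, hx1, hx2⟩ := mem_closure_iff_nhds.1 hcl _
      (hD.preimage_mem_nhds (isOpen_Iio.mem_nhds (not_le.1 hcon)))
    exact absurd hx1 (not_lt.2 (legL_relations h hlam hx2.2 hx2.1).1.le)
  · exact eq_of_mem_closure (f := fun q : FibCot I Z => q.2.2.1 ^ 2 + normSq h q.2.2.2) hcl
      ((hb.pow 2).add hn'').continuousAt fun x hx => (legL_relations h hlam hx.2 hx.1).2.1
  · exact eq_of_mem_closure
      (f := fun q : FibCot I Z => q.2.1.1 ^ 2 + Real.tan q.1 ^ 2 * normSq h q.2.2.2) hcl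
      ((ha.pow 2).continuousAt.add ((ht.pow 2).mul hn''.continuousAt))
      fun x hx => (legL_relations h hlam hx.2 hx.1).2.2.1
  · refine sub_eq_zero.1 (eq_of_mem_closure
      (f := fun q : FibCot I Z => normSq h q.2.1.2 - Real.tan q.1 ^ 2 * normSq h q.2.2.2) hcl
      (hn'.continuousAt.sub ((ht.pow 2).mul hn''.continuousAt))
      fun x hx => sub_eq_zero.2 (legL_relations h hlam hx.2 hx.1).2.2.2)
  · rw [mem_closure_iff_frequently] at hcl
    exact hcl.mono fun x hx => ⟨hx.2, hx.1⟩

/-- Limits of points of `L` satisfy the closed relations and `transitDen ≥ 0`. Where `transitDen >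
0` the parametrization is continuous, so the limit lies in `L`. Where it vanishes the relations
force a point of the second set. -/
lemma mem_of_mem_closure_legL (hlam : 0 < lam) {q : FibCot I Z} (hq : q ∈ closure (legL h lam))
    (hθ : q.1 ∈ Ioo 0 (Real.pi / 2)) :
    q ∈ legL h lam ∨ q ∈ legSharp I Z lam ∪ legSharp I Z (-lam) := by
  obtain ⟨hD, h1, h2, h3, hf⟩ := closure_legL_relations h hlam hq hθ
  have ht := tan_pos_of_mem hθ
  rcases hD.lt_or_eq with hD | hD
  · left
    have hdom : legCoord q ∈ legDom h lam :=
      ⟨⟨show -(Real.pi / 2) < q.1 by linarith [hθ.1, Real.pi_pos], hθ.2⟩, hD⟩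
    rw [mem_legL_of_lt h hlam ⟨hθ.1.le, hθ.2⟩]
    refine ⟨hdom, ?_, ?_⟩
    · have hc : ContinuousAt (fun x => legParam h lam (legCoord x)) q :=
        ContinuousAt.comp (g := legParam h lam) (contMDiffAt_legParam h hdom).continuousAt
          contMDiff_legCoord.continuous.continuousAt
      exact tendsto_nhds_unique_of_frequently_eq hc.tendsto continuousAt_id.tendsto
        (hf.mono fun x hx => ((mem_legL_of_lt h hlam ⟨hx.2.1.le, hx.2.2⟩).1 hx.1).2.1)
    · simp only [legEq, legCoord, Prod.mk_eq_zero]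
      constructor <;> linarith
  · right
    have hn := normSq_nonneg h q.2.2.2
    rw [transitDen] at hD
    obtain ⟨θ, ⟨a, p'⟩, b, p''⟩ := q
    simp only at *
    set t := Real.tan θ
    set n := normSq h p'' with hn''
    -- By the two sphere relations, `2 transitDen = (a - b)² + (1 + t)² n`. Since `t > 0`, its
    -- vanishing gives `n = 0` and then `a = b`.
    have hn0 : n = 0 := by
      by_contra hne
      have hpos : 0 < n := hn.lt_of_ne' hne
      have : 0 < t * n := mul_pos ht hpos
      nlinarith [sq_nonneg (a - b), mul_nonneg (sq_nonneg t) hn]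
    rw [hn0] at hD h1 h2 h3
    have hab : a = b := by
      have : (a - b) ^ 2 = 0 := by nlinarith
      have := pow_eq_zero_iff two_ne_zero |>.1 this
      linarith
    have hbl : b = lam ∨ b = -lam := sq_eq_sq_iff_eq_or_eq_neg.1 (by linarith)
    rw [mul_zero] at h3
    rw [mem_legSharp_union]
    refine ⟨⟨hθ.1.le, hθ.2.le⟩, b, by simpa using hbl, p'.proj, p''.proj, ?_⟩
    refine Prod.ext (Prod.ext hab ((normSq_eq_zero h).1 h3)) (Prod.ext rfl ?_)
    exact (normSq_eq_zero h).1 (hn''.symm.trans hn0)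

lemma fromInterior_mem_closure {G : Set (FibCot I Z)} {z₀ : ℝ × Z × Z}
    {q : ScCot (bfModel I) (ℝ × Z × Z)} (hq : q ∈ intDom I z₀)
    (hcl : q ∈ closure (interiorPart G)) : fromInterior z₀ q ∈ closure G := by
  have h1 := (isOpen_intDom z₀).inter_closure ⟨hq, hcl⟩
  have h2 := mem_closure_image (contMDiffAt_fromInterior hq).continuousAt h1
  refine closure_mono ?_ h2
  rintro _ ⟨x, hx, rfl⟩
  exact (mem_interiorPart_iff hx.1).1 hx.2

/-- The graphs over the interior of bf. -/
lemma scDiff_interior (c : ℝ) (z : ℝ × Z × Z) :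
    scDiff (bfModel I) (fun w : ℝ × Z × Z => c * (Real.cos w.1 + Real.sin w.1)) z =
      toInterior (I := I) (z.1, (-c, Cot.zero z.2.1), (-c, Cot.zero z.2.2)) := by
  have hd : HasDerivAt (fun s : ℝ => c * (Real.cos s + Real.sin s))
      (c * (-Real.sin z.1 + Real.cos z.1)) z.1 :=
    ((Real.hasDerivAt_cos z.1).add (Real.hasDerivAt_sin z.1)).const_mul c
  have h1 : MDifferentiableAt (bfModel I) 𝓘(ℝ, ℝ) (fun w : ℝ × Z × Z => w.1) z :=
    mdifferentiableAt_fst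
  have h2 : ∀ v : TangentSpace (bfModel I) z,
      dd (bfModel I) (fun w : ℝ × Z × Z => c * (Real.cos w.1 + Real.sin w.1)) z v =
      totalEta ((z.1, (-c, Cot.zero z.2.1), (-c, Cot.zero z.2.2)) : FibCot I Z) *
        dd (bfModel I) (fun w : ℝ × Z × Z => w.1) z v := by
    intro v
    refine (dd_comp_mfderiv (f := fun s : ℝ => c * (Real.cos s + Real.sin s))
      (φ := fun w : ℝ × Z × Z => w.1) hd.differentiableAt.mdifferentiableAt h1 v).trans ?_
    have h3 : dd 𝓘(ℝ, ℝ) (fun s : ℝ => c * (Real.cos s + Real.sin s)) z.1 =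
        ContinuousLinearMap.toSpanSingleton ℝ (c * (-Real.sin z.1 + Real.cos z.1)) := by
      rw [dd, mfderiv_eq_fderiv]
      exact hd.hasFDerivAt.fderiv
    refine (congrArg (fun A : ℝ →L[ℝ] ℝ => A (dd (bfModel I) (fun w : ℝ × Z × Z => w.1) z v))
      h3).trans ?_
    simp only [ContinuousLinearMap.toSpanSingleton_apply, smul_eq_mul, totalEta]
    ring
  refine Prod.ext ?_ (congrArg (Cot.of z) ?_)
  · simp only [scDiff, toInterior, totalTau]
    ring
  · refine ContinuousLinearMap.ext fun v => ?_
    refine (h2 v).trans ?_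
    have h4 : ∀ x : ℝ, x = x + Real.cos z.1 * 0 + Real.sin z.1 * 0 := fun x => by ring
    exact h4 _

lemma mem_interiorPart_legSharp (lam : ℝ) :
    interiorPart (legSharp I Z lam ∪ legSharp I Z (-lam)) =
      {q | ∃ c ∈ ({lam, -lam} : Finset ℝ), ∃ z ∈ (bfInterior : Set (ℝ × Z × Z)),
        q = scDiff (bfModel I) (fun w => c * (Real.cos w.1 + Real.sin w.1)) z} := by
  ext q
  simp only [scDiff_interior]
  constructor
  · rintro ⟨⟨θ, p⟩, ⟨hp, hθ⟩, rfl⟩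
    obtain ⟨-, e, he, y', y'', hp2⟩ := (mem_legSharp_union I Z).1 hp
    refine ⟨-e, ?_, (θ, y', y''), hθ, ?_⟩
    · simp only [Finset.mem_insert, Finset.mem_singleton] at he ⊢
      rcases he with rfl | rfl <;> simp
    · rw [neg_neg]
      exact congrArg (fun p => toInterior (θ, p)) hp2
  · rintro ⟨c, hc, z, hz, rfl⟩
    refine ⟨(z.1, (-c, Cot.zero z.2.1), (-c, Cot.zero z.2.2)), ⟨(mem_legSharp_union I Z).2
      ⟨⟨hz.1.le, hz.2.le⟩, -c, ?_, z.2.1, z.2.2, rfl⟩, hz⟩, rfl⟩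
    simp only [Finset.mem_insert, Finset.mem_singleton] at hc ⊢
    rcases hc with rfl | rfl <;> simp

lemma closure_interiorPart_legL (hlam : 0 < lam) :
    {q ∈ closure (interiorPart (legL h lam)) | q.2.proj ∈ (bfInterior : Set (ℝ × Z × Z))} \
      interiorPart (legL h lam) ⊆ interiorPart (legSharp I Z lam ∪ legSharp I Z (-lam)) := by
  rintro q ⟨⟨hq, hqi⟩, hqL⟩
  have hd := mem_intDom_self hqi
  rw [mem_interiorPart_iff hd] at hqL ⊢
  exact (mem_of_mem_closure_legL h hlam (fromInterior_mem_closure hd hq) hqi).resolve_left hqL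

end InteriorClosure
end ScatGeom

namespace ScatGeom

section InteriorConic

universe u

variable {E : Type u} [NormedAddCommGroup E] [NormedSpace ℝ E] [FiniteDimensional ℝ E]
  {H : Type*} [TopologicalSpace H] {I : ModelWithCorners ℝ E H} [I.Boundaryless]
  {Z : Type*} [TopologicalSpace Z] [ChartedSpace H Z] [IsManifold I ∞ Z]
  [CompactSpace Z] [T2Space Z]
  (h : ContMDiffRiemannianMetric I ∞ E (fun z : Z => TangentSpace I z)) (c : ℝ)

/-! ### Parameters near the conic points over the interior of bf -/

variable (I) in
/-- The model with corners of the parameters `(θ, ρ, d)`. -/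
abbrev conParModel := 𝓘(ℝ, ℝ).prod (𝓘(ℝ, ℝ).prod (cotModel I))

/-- The parameters for which the parametrization is smooth. -/
def conDom : Set (ℝ × ℝ × Cot I Z) :=
  {n | n.1 ∈ Ioo 0 (Real.pi / 2) ∧ 0 < normSq h n.2.2 ∧ n.2.1 ^ 2 * normSq h n.2.2 < c ^ 2 ∧
    (Real.tan n.1 * n.2.1) ^ 2 * normSq h n.2.2 < c ^ 2}

/-- The rescaled covector `μ'`. -/
def conOmega (n : ℝ × ℝ × Cot I Z) : Cot I Z :=
  (geoFlow h (conicTransit c (Real.tan n.1) n.2.1 (normSq h n.2.2)) n.2.2).scale (-Real.tan n.1)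

/-- The coordinate `τ'`. -/
def conTau' (n : ℝ × ℝ × Cot I Z) : ℝ := conicTau c (Real.tan n.1 * n.2.1) (normSq h n.2.2)

/-- The coordinate `τ''`. -/
def conTau'' (n : ℝ × ℝ × Cot I Z) : ℝ := conicTau c n.2.1 (normSq h n.2.2)

/-- The rescaled difference `τ' - τ''`. -/
def conDiff (n : ℝ × ℝ × Cot I Z) : ℝ :=
  n.2.1 * normSq h n.2.2 * (1 - Real.tan n.1 ^ 2) / (conTau' h c n + conTau'' h c n)

/-- The point with given parameters. -/
def conPoint (n : ℝ × ℝ × Cot I Z) : FibCot I Z :=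
  (n.1, (conTau' h c n, (conOmega h c n).scale n.2.1), (conTau'' h c n, n.2.2.scale n.2.1))

lemma contMDiff_conPar :
    ContMDiff (conParModel I) 𝓘(ℝ, ℝ) ∞ (fun n : ℝ × ℝ × Cot I Z => n.1) ∧
    ContMDiff (conParModel I) 𝓘(ℝ, ℝ) ∞ (fun n : ℝ × ℝ × Cot I Z => n.2.1) ∧
    ContMDiff (conParModel I) (cotModel I) ∞ (fun n : ℝ × ℝ × Cot I Z => n.2.2) :=
  ⟨contMDiff_fst, contMDiff_fst.comp contMDiff_snd, contMDiff_snd.comp contMDiff_snd⟩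

lemma contMDiff_conPar_normSq :
    ContMDiff (conParModel I) 𝓘(ℝ, ℝ) ∞ (fun n : ℝ × ℝ × Cot I Z => normSq h n.2.2) :=
  (contMDiff_normSq h).comp contMDiff_conPar.2.2

lemma contMDiffAt_conPar_tan {n : ℝ × ℝ × Cot I Z} (hn : n.1 ∈ Ioo 0 (Real.pi / 2)) :
    ContMDiffAt (conParModel I) 𝓘(ℝ, ℝ) ∞ (fun n : ℝ × ℝ × Cot I Z => Real.tan n.1) n :=
  ContMDiffAt.comp (g := Real.tan) (f := fun n : ℝ × ℝ × Cot I Z => n.1) n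
    (Real.contDiffAt_tan.2 (Real.cos_pos_of_mem_Ioo
      ⟨by linarith [hn.1, Real.pi_pos], hn.2⟩).ne').contMDiffAt contMDiff_conPar.1.contMDiffAt

lemma isOpen_conDom : IsOpen (conDom h c) := by
  rw [isOpen_iff_mem_nhds]
  rintro n ⟨h1, h2, h3, h4⟩
  have hN := (contMDiff_conPar_normSq h).continuous.continuousAt (x := n)
  have hρ := (contMDiff_conPar (I := I) (Z := Z)).2.1.continuous.continuousAt (x := n)
  have ht := (contMDiffAt_conPar_tan h1).continuousAt
  filter_upwards [(isOpen_Ioo.preimage continuous_fst).mem_nhds h1,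
    hN.preimage_mem_nhds (isOpen_Ioi.mem_nhds h2),
    ((hρ.pow 2).mul hN).preimage_mem_nhds (isOpen_Iio.mem_nhds h3),
    (((ht.mul hρ).pow 2).mul hN).preimage_mem_nhds (isOpen_Iio.mem_nhds h4)] with x e1 e2 e3 e4
  exact ⟨e1, e2, e3, e4⟩

variable {c} {n : ℝ × ℝ × Cot I Z}

lemma contMDiffAt_conTau' (hc : c ≠ 0) (hn : n ∈ conDom h c) :
    ContMDiffAt (conParModel I) 𝓘(ℝ, ℝ) ∞ (conTau' h c) n :=
  contMDiffAt_comp_real_prod (F := fun x : ℝ × ℝ => conicTau c x.1 x.2)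
    (a := fun n : ℝ × ℝ × Cot I Z => Real.tan n.1 * n.2.1)
    (b := fun n : ℝ × ℝ × Cot I Z => normSq h n.2.2) (contDiffAt_conicTau hc hn.2.2.2)
    ((contMDiffAt_conPar_tan hn.1).mul contMDiff_conPar.2.1.contMDiffAt)
    (contMDiff_conPar_normSq h).contMDiffAt

lemma contMDiffAt_conTau'' (hc : c ≠ 0) (hn : n ∈ conDom h c) :
    ContMDiffAt (conParModel I) 𝓘(ℝ, ℝ) ∞ (conTau'' h c) n :=
  contMDiffAt_comp_real_prod (F := fun x : ℝ × ℝ => conicTau c x.1 x.2)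
    (a := fun n : ℝ × ℝ × Cot I Z => n.2.1)
    (b := fun n : ℝ × ℝ × Cot I Z => normSq h n.2.2) (contDiffAt_conicTau hc hn.2.2.1)
    contMDiff_conPar.2.1.contMDiffAt (contMDiff_conPar_normSq h).contMDiffAt

lemma mul_conTau_pos (hc : c ≠ 0) (hn : n ∈ conDom h c) :
    0 < c * conTau' h c n ∧ 0 < c * conTau'' h c n :=
  ⟨mul_conicTau_pos hc hn.2.2.2, mul_conicTau_pos hc hn.2.2.1⟩

lemma conTau_add_ne (hc : c ≠ 0) (hn : n ∈ conDom h c) : conTau' h c n + conTau'' h c n ≠ 0 := by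
  obtain ⟨h1, h2⟩ := mul_conTau_pos h hc hn
  intro h0
  have : c * (conTau' h c n + conTau'' h c n) = 0 := by rw [h0, mul_zero]
  linarith

lemma contMDiffAt_conDiff (hc : c ≠ 0) (hn : n ∈ conDom h c) :
    ContMDiffAt (conParModel I) 𝓘(ℝ, ℝ) ∞ (conDiff h c) n :=
  ((contMDiff_conPar.2.1.contMDiffAt.mul (contMDiff_conPar_normSq h).contMDiffAt).mul
    (contMDiffAt_const.sub ((contMDiffAt_conPar_tan hn.1).pow 2))).div₀
      ((contMDiffAt_conTau' h hc hn).add (contMDiffAt_conTau'' h hc hn)) (conTau_add_ne h hc hn)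

lemma contMDiffAt_conOmega (hc : c ≠ 0) (hn : n ∈ conDom h c) :
    ContMDiffAt (conParModel I) (cotModel I) ∞ (conOmega h c) n := by
  have hT : ContMDiffAt (conParModel I) 𝓘(ℝ, ℝ) ∞
      (fun n : ℝ × ℝ × Cot I Z => conicTransit c (Real.tan n.1) n.2.1 (normSq h n.2.2)) n :=
    ContMDiffAt.comp (g := fun x : ℝ × ℝ × ℝ => conicTransit c x.1 x.2.1 x.2.2)
      (f := fun n : ℝ × ℝ × Cot I Z => (Real.tan n.1, n.2.1, normSq h n.2.2)) n
      (contDiffAt_conicTransit hc (tan_pos_of_mem hn.1).le hn.2.1 hn.2.2.1 hn.2.2.2).contMDiffAt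
      ((contMDiffAt_conPar_tan hn.1).prodMk_space (contMDiff_conPar.2.1.contMDiffAt.prodMk_space
        (contMDiff_conPar_normSq h).contMDiffAt))
  exact ContMDiffAt.cotScale (contMDiffAt_conPar_tan hn.1).neg
    (contMDiffAt_geoFlow_comp h hT contMDiff_conPar.2.2.contMDiffAt)

lemma contMDiffAt_conPoint (hc : c ≠ 0) (hn : n ∈ conDom h c) :
    ContMDiffAt (conParModel I) (fibModel I) ∞ (conPoint h c) n :=
  contMDiff_conPar.1.contMDiffAt.prodMk (((contMDiffAt_conTau' h hc hn).prodMk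
    (ContMDiffAt.cotScale contMDiff_conPar.2.1.contMDiffAt (contMDiffAt_conOmega h hc hn))).prodMk
      ((contMDiffAt_conTau'' h hc hn).prodMk (ContMDiffAt.cotScale
        contMDiff_conPar.2.1.contMDiffAt contMDiff_conPar.2.2.contMDiffAt)))

/-- `τ' - τ'' = (τ'² - τ''²)/(τ' + τ'')`, and the sphere relations make the numerator divisible by
`ρ²`. So the normal component `τ' - τ''`, too, can be divided smoothly by `ρ`. -/
lemma conTau_sub (hc : c ≠ 0) (hn : n ∈ conDom h c) :
    conTau' h c n - conTau'' h c n = n.2.1 * conDiff h c n := by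
  have h1 := conicTau_sq hc hn.2.2.1.le
  have h2 := conicTau_sq hc hn.2.2.2.le
  have h3 := conTau_add_ne h hc hn
  rw [conDiff, ← mul_div_assoc, eq_div_iff h3]
  simp only [conTau', conTau''] at *
  linear_combination h2 - h1

lemma conPoint_mem_legL {lam : ℝ} (hlam : 0 < lam) (hc : c ^ 2 = lam ^ 2) (hn : n ∈ conDom h c)
    (hρ : 0 < n.2.1) : conPoint h c n ∈ legL h lam := by
  have hc0 : c ≠ 0 := fun h0 => by rw [h0] at hc; nlinarith
  obtain ⟨h1, h2⟩ := mul_conTau_pos h hc0 hn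
  exact (mem_legL_conic h hlam hc hn.1 hρ hn.2.1 h1 h2 hn.2.2.1 hn.2.2.2).2 ⟨rfl, rfl, rfl⟩

lemma eq_conPoint {lam : ℝ} (hlam : 0 < lam) (hc : c ^ 2 = lam ^ 2) (hn : n ∈ conDom h c)
    (hρ : 0 < n.2.1) {q : FibCot I Z} (hq : q ∈ legL h lam) (h0 : q.1 = n.1)
    (ha : 0 < c * q.2.1.1) (hb : 0 < c * q.2.2.1) (hd : q.2.2.2 = n.2.2.scale n.2.1) :
    q = conPoint h c n := by
  obtain ⟨θ, ⟨a, p'⟩, b, p''⟩ := q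
  simp only at h0 hd ha hb
  subst h0 hd
  obtain ⟨e1, e2, e3⟩ :=
    (mem_legL_conic h hlam hc hn.1 hρ hn.2.1 ha hb hn.2.2.1 hn.2.2.2).1 hq
  exact Prod.ext rfl (Prod.ext (Prod.ext e1 e3) (Prod.ext e2 rfl))

/-- Replacing `(ρ, d)` by `(ρ/s, s d)` does not move the point of `L`. This redundancy is removed by
normalizing the normal vector, and the homogeneity of its components is what makes the normalization
an independent equation. -/
lemma conOmega_scale {s : ℝ} (hs : 0 < s) (n : ℝ × ℝ × Cot I Z) :
    conOmega h c (n.1, n.2.1 / s, n.2.2.scale s) = (conOmega h c n).scale s := by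
  simp only [conOmega, normSq_scale, conicTransit_scale hs, geoFlow_scale, scale_scale]
  rw [div_mul_cancel₀ _ hs.ne', mul_comm]

lemma conDiff_scale {s : ℝ} (hs : 0 < s) (n : ℝ × ℝ × Cot I Z) :
    conDiff h c (n.1, n.2.1 / s, n.2.2.scale s) = s * conDiff h c n := by
  simp only [conDiff, conTau', conTau'', normSq_scale, ← mul_div_assoc (Real.tan n.1),
    conicTau_scale hs.ne']
  rw [show n.2.1 / s * (s ^ 2 * normSq h n.2.2) = s * (n.2.1 * normSq h n.2.2) by field_simp]
  ring

end InteriorConic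
end ScatGeom

namespace ScatGeom

lemma eq_of_mem_closure_of_continuousAt {X Y : Type*} [TopologicalSpace X] [TopologicalSpace Y]
    [T2Space Y] {A : Set X} {x : X} {f g : X → Y} (hx : x ∈ closure A) (hf : ContinuousAt f x)
    (hg : ContinuousAt g x) (hA : ∀ a ∈ A, f a = g a) : f x = g x :=
  tendsto_nhds_unique_of_frequently_eq hf.tendsto hg.tendsto
    ((mem_closure_iff_frequently.1 hx).mono hA)

section InteriorConic

universe u

variable {E : Type u} [NormedAddCommGroup E] [NormedSpace ℝ E] [FiniteDimensional ℝ E]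
  {H : Type*} [TopologicalSpace H] {I : ModelWithCorners ℝ E H} [I.Boundaryless]
  {Z : Type*} [TopologicalSpace Z] [ChartedSpace H Z] [IsManifold I ∞ Z]
  [CompactSpace Z] [T2Space Z]
  (h : ContMDiffRiemannianMetric I ∞ E (fun z : Z => TangentSpace I z)) {lam c : ℝ}

/-! ### The lift of `L` over the interior of bf -/

variable (E) in
/-- Euclidean coordinates on the space of the normal vectors. -/
def normalCoord : (ℝ × (E →L[ℝ] ℝ) × (E →L[ℝ] ℝ)) ≃L[ℝ]
    EuclideanSpace ℝ (Fin (Module.finrank ℝ (ℝ × E × E))) :=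
  ContinuousLinearEquiv.ofFinrankEq (by
    rw [finrank_euclideanSpace_fin]
    simp only [Module.finrank_prod, finrank_clm_real])

/-- The functions `τ' - τ''`, `μ'`, `μ''`, which cut out the span of `d(1/x)`. -/
def normalFun (z₀ : ℝ × Z × Z) (q : FibCot I Z) : ℝ × (E →L[ℝ] ℝ) × (E →L[ℝ] ℝ) :=
  (q.2.1.1 - q.2.2.1, fibCoord z₀.2.1 q.2.1.2, fibCoord z₀.2.2 q.2.2.2)

/-- The functions `normalFun` on the scattering cotangent bundle. -/
def normalMap (z₀ : ℝ × Z × Z) (q : ScCot (bfModel I) (ℝ × Z × Z)) :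
    EuclideanSpace ℝ (Fin (Module.finrank ℝ (ℝ × E × E))) :=
  normalCoord E (normalFun z₀ (fromInterior z₀ q))

variable (I) in
/-- A neighbourhood of a conic point. -/
def conicNhd (z₀ : ℝ × Z × Z) (c : ℝ) : Set (ScCot (bfModel I) (ℝ × Z × Z)) :=
  {q | q ∈ intDom I z₀ ∧ 0 < c * (fromInterior z₀ q).2.1.1 ∧ 0 < c * (fromInterior z₀ q).2.2.1}

lemma continuousAt_fromInterior_tau {z₀ : ℝ × Z × Z} {q : ScCot (bfModel I) (ℝ × Z × Z)}
    (hq : q ∈ intDom I z₀) :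
    ContinuousAt (fun q => (fromInterior z₀ q).2.1.1) q ∧
      ContinuousAt (fun q => (fromInterior z₀ q).2.2.1) q := by
  have h1 := (contMDiffAt_fromInterior hq).continuousAt
  exact ⟨ContinuousAt.comp (g := fun p : FibCot I Z => p.2.1.1) continuous_snd.fst.fst.continuousAt
    h1, ContinuousAt.comp (g := fun p : FibCot I Z => p.2.2.1)
      continuous_snd.snd.fst.continuousAt h1⟩

lemma isOpen_conicNhd (z₀ : ℝ × Z × Z) (c : ℝ) : IsOpen (conicNhd I z₀ c) := by
  rw [isOpen_iff_mem_nhds]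
  rintro q ⟨h1, h2, h3⟩
  obtain ⟨e1, e2⟩ := continuousAt_fromInterior_tau h1
  filter_upwards [(isOpen_intDom z₀).mem_nhds h1,
    (continuousAt_const.mul e1).preimage_mem_nhds (isOpen_Ioi.mem_nhds h2),
    (continuousAt_const.mul e2).preimage_mem_nhds (isOpen_Ioi.mem_nhds h3)] with x a1 a2 a3
  exact ⟨a1, a2, a3⟩

/-- The covectors with given coordinates. -/
lemma normalMap_eq_iff {z₀ : ℝ × Z × Z} {q : ScCot (bfModel I) (ℝ × Z × Z)}
    (hq : q ∈ intDom I z₀) {ρ : ℝ} {ν : ℝ × (E →L[ℝ] ℝ) × (E →L[ℝ] ℝ)} :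
    normalMap z₀ q = ρ • normalCoord E ν ↔
      (fromInterior z₀ q).2.1.1 - (fromInterior z₀ q).2.2.1 = ρ * ν.1 ∧
      (fromInterior z₀ q).2.1.2 = (ofFib z₀.2.1 q.2.proj.2.1 ν.2.1).scale ρ ∧
      (fromInterior z₀ q).2.2.2 = (ofFib z₀.2.2 q.2.proj.2.2 ν.2.2).scale ρ := by
  have hm := fromInterior_mem hq
  have hp' : (fromInterior z₀ q).2.1.2.proj = q.2.proj.2.1 := proj_ofFib hq.2.1 _
  have hp'' : (fromInterior z₀ q).2.2.2.proj = q.2.proj.2.2 := proj_ofFib hq.2.2 _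
  have key : ∀ {y z : Z} {p : Cot I Z} {ζ : E →L[ℝ] ℝ}, z ∈ (chartAt H y).source → p.proj = z →
      (fibCoord y p = ρ • ζ ↔ p = (ofFib y z ζ).scale ρ) := by
    rintro y _ p ζ hz rfl
    constructor
    · intro h1
      refine eq_of_fibCoord hz (proj_ofFib hz ζ).symm ?_
      rw [fibCoord_scale, fibCoord_ofFib hz, h1]
    · intro h1
      have h2 := congrArg (fibCoord y) h1
      rwa [fibCoord_scale, fibCoord_ofFib hz] at h2
  rw [← key hq.2.1 hp', ← key hq.2.2 hp'', normalMap, ← map_smul,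
    (normalCoord E).injective.eq_iff, normalFun, Prod.ext_iff, Prod.ext_iff]
  rfl

/-- The span is cut out by `(τ' - τ'', μ', μ'')`, and along `L` all three are `ρ` times smooth
functions of the parameters `(θ, ρ, d)`. The retraction reads off `θ`, the radius and the `μ''` part
of the direction; no equation besides the normalization remains, hence `W` of dimension zero. -/
lemma isNeatSubmanifold_interiorLift (hlam : 0 < lam) (hc : c ^ 2 = lam ^ 2) (z₀ : ℝ × Z × Z) :
    IsNeatSubmanifold ((scModel (bfModel I)).prod (𝓘(ℝ, ℝ).prod
        𝓘(ℝ, EuclideanSpace ℝ (Fin (Module.finrank ℝ (ℝ × E × E))))))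
      (fun x : ScCot (bfModel I) (ℝ × Z × Z) × ℝ ×
        EuclideanSpace ℝ (Fin (Module.finrank ℝ (ℝ × E × E))) => x.2.1)
      (2 * Module.finrank ℝ (ℝ × E × E) + 2)
      (closure (polarLift (normalMap z₀) (interiorPart (legL h lam) ∩ conicNhd I z₀ c)) ∩
        Prod.fst ⁻¹' conicNhd I z₀ c) := by
  have hc0 : c ≠ 0 := fun h0 => by rw [h0] at hc; nlinarith
  set X := ScCot (bfModel I) (ℝ × Z × Z) × ℝ ×
    EuclideanSpace ℝ (Fin (Module.finrank ℝ (ℝ × E × E))) with hX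
  set MX := (scModel (bfModel I)).prod (𝓘(ℝ, ℝ).prod
    𝓘(ℝ, EuclideanSpace ℝ (Fin (Module.finrank ℝ (ℝ × E × E))))) with hMX
  set U := conicNhd I z₀ c with hUdef
  have hU : IsOpen U := isOpen_conicNhd z₀ c
  set S := polarLift (normalMap z₀) (interiorPart (legL h lam) ∩ U) with hSdef
  set ν : X → ℝ × (E →L[ℝ] ℝ) × (E →L[ℝ] ℝ) := fun x => (normalCoord E).symm x.2.2 with hν
  set D' : X → Cot I Z := fun x => ofFib z₀.2.1 x.1.2.proj.2.1 (ν x).2.1 with hD'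
  set D : X → Cot I Z := fun x => ofFib z₀.2.2 x.1.2.proj.2.2 (ν x).2.2 with hD
  have hνs : ContMDiff MX 𝓘(ℝ, ℝ × (E →L[ℝ] ℝ) × (E →L[ℝ] ℝ)) ∞ ν :=
    (normalCoord E).symm.contDiff.contMDiff.comp (contMDiff_snd.comp contMDiff_snd)
  have hν' : ContMDiff MX 𝓘(ℝ, E →L[ℝ] ℝ) ∞ (fun x => (ν x).2.1) :=
    (contDiff_fst.comp contDiff_snd).contMDiff.comp hνs
  have hν'' : ContMDiff MX 𝓘(ℝ, E →L[ℝ] ℝ) ∞ (fun x => (ν x).2.2) :=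
    (contDiff_snd.comp contDiff_snd).contMDiff.comp hνs
  have hpr : ContMDiff MX (bfModel I) ∞ (fun x : X => x.1.2.proj) :=
    contMDiff_proj.comp (contMDiff_snd.comp contMDiff_fst)
  have hθs : ContMDiff MX 𝓘(ℝ, ℝ) ∞ (fun x : X => x.1.2.proj.1) := contMDiff_fst.comp hpr
  have hr1 : ContMDiff MX 𝓘(ℝ, ℝ) ∞ (fun x : X => x.2.1) := contMDiff_fst.comp contMDiff_snd
  have hDs' : ∀ x : X, x.1 ∈ U → ContMDiffAt MX (cotModel I) ∞ D' x := fun x hx =>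
    contMDiffAt_ofFib (z := fun x : X => x.1.2.proj.2.1) hx.1.2.1
      (contMDiff_fst.comp (contMDiff_snd.comp hpr)).contMDiffAt hν'.contMDiffAt
  have hDs : ∀ x : X, x.1 ∈ U → ContMDiffAt MX (cotModel I) ∞ D x := fun x hx =>
    contMDiffAt_ofFib (z := fun x : X => x.1.2.proj.2.2) hx.1.2.2
      (contMDiff_snd.comp (contMDiff_snd.comp hpr)).contMDiffAt hν''.contMDiffAt
  set ψ : X → ℝ × ℝ × Cot I Z := fun x => (x.1.2.proj.1, x.2.1, D x) with hψ
  have hψs : ∀ x : X, x.1 ∈ U → ContMDiffAt MX (conParModel I) ∞ ψ x := fun x hx =>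
    hθs.contMDiffAt.prodMk (hr1.contMDiffAt.prodMk (hDs x hx))
  set V : Set (ℝ × ℝ × Cot I Z) := conDom h c ∩ {n | n.2.2.proj ∈ (chartAt H z₀.2.2).source} ∩
    conOmega h c ⁻¹' {p | p.proj ∈ (chartAt H z₀.2.1).source} with hV
  have hVo : IsOpen V := by
    refine ContinuousOn.isOpen_inter_preimage
      (fun n hn => (contMDiffAt_conOmega h hc0 hn.1).continuousAt.continuousWithinAt)
      ((isOpen_conDom h c).inter ?_)
      ((chartAt H z₀.2.1).open_source.preimage contMDiff_proj.continuous)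
    exact (chartAt H z₀.2.2).open_source.preimage
      (contMDiff_proj.continuous.comp continuous_snd.snd)
  set O : Set X := Prod.fst ⁻¹' U ∩ ψ ⁻¹' V with hO
  have hOo : IsOpen O := ContinuousOn.isOpen_inter_preimage
    (fun x hx => (hψs x hx).continuousAt.continuousWithinAt) (hU.preimage continuous_fst) hVo
  set w : ℝ × ℝ × Cot I Z → EuclideanSpace ℝ (Fin (Module.finrank ℝ (ℝ × E × E))) :=
    fun n => normalCoord E (conDiff h c n, fibCoord z₀.2.1 (conOmega h c n),
      fibCoord z₀.2.2 n.2.2) with hw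
  have hmem : ∀ n ∈ V, conPoint h c n ∈ fibDom I z₀ := fun n hn => ⟨hn.1.1.1, hn.2, hn.1.2⟩
  have hF : ∀ n ∈ V, fromInterior z₀ (toInterior (conPoint h c n)) = conPoint h c n := fun n hn =>
    fromInterior_toInterior (hmem n hn)
  have hu : ∀ n ∈ V, normalMap z₀ (toInterior (conPoint h c n)) = n.2.1 • w n := fun n hn => by
    rw [normalMap_eq_iff (toInterior_mem.2 (hmem n hn)), hF n hn]
    refine ⟨conTau_sub h hc0 hn.1.1, ?_, ?_⟩
    · exact congrArg (Cot.scale n.2.1) (ofFib_fibCoord (p := conOmega h c n) hn.2).symm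
    · exact congrArg (Cot.scale n.2.1) (ofFib_fibCoord (p := n.2.2) hn.1.2).symm
  -- points of the lift
  have hlift : ∀ x ∈ S, x.1 ∈ U ∧ fromInterior z₀ x.1 ∈ legL h lam ∧ 0 < x.2.1 ∧ ‖x.2.2‖ = 1 ∧
      (fromInterior z₀ x.1).2.1.1 - (fromInterior z₀ x.1).2.2.1 = x.2.1 * (ν x).1 ∧
      (fromInterior z₀ x.1).2.1.2 = (D' x).scale x.2.1 ∧
      (fromInterior z₀ x.1).2.2.2 = (D x).scale x.2.1 := by
    rintro x ⟨⟨hxG, hxU⟩, hx3, hx4, hx5⟩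
    have h0 : 0 < x.2.1 := by rw [hx4]; exact norm_pos_iff.2 hx3
    have h1 : normalMap z₀ x.1 = x.2.1 • normalCoord E (ν x) := by
      simp only [hν, ContinuousLinearEquiv.apply_symm_apply]
      rw [hx5, hx4, smul_inv_smul₀ (norm_ne_zero_iff.2 hx3)]
    refine ⟨hxU, (mem_interiorPart_iff hxU.1).1 hxG, h0, ?_, (normalMap_eq_iff hxU.1).1 h1⟩
    rw [hx5, norm_smul, norm_inv, norm_norm, inv_mul_cancel₀ (norm_ne_zero_iff.2 hx3)]
  set τ' : X → ℝ := fun x => (fromInterior z₀ x.1).2.1.1 with hτ'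
  set τ'' : X → ℝ := fun x => (fromInterior z₀ x.1).2.2.1 with hτ''
  set t : X → ℝ := fun x => Real.tan x.1.2.proj.1 with ht
  have hrel : ∀ x ∈ S, τ'' x ^ 2 + x.2.1 ^ 2 * normSq h (D x) = c ^ 2 ∧
      τ' x ^ 2 + (t x * x.2.1) ^ 2 * normSq h (D x) = c ^ 2 ∧
      normSq h (D' x) - t x ^ 2 * normSq h (D x) = 0 ∧
      (ν x).1 * (τ' x + τ'' x) - x.2.1 * normSq h (D x) * (1 - t x ^ 2) = 0 := by
    intro x hx
    obtain ⟨hxU, hxL, h0, -, e1, e2, e3⟩ := hlift x hx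
    obtain ⟨-, r1, r2, r3⟩ := legL_relations h hlam hxL hxU.1.1
    rw [e3, normSq_scale] at r1 r2 r3
    rw [e2, normSq_scale] at r3
    have r2' : τ' x ^ 2 + (t x * x.2.1) ^ 2 * normSq h (D x) = c ^ 2 := by
      rw [hc, ← r2]
      simp only [hτ', ht]
      rw [show (fromInterior z₀ x.1).1 = x.1.2.proj.1 from rfl]
      ring
    have r1' : τ'' x ^ 2 + x.2.1 ^ 2 * normSq h (D x) = c ^ 2 := by rw [hc, ← r1]
    refine ⟨r1', r2', ?_, ?_⟩
    · have h2 : x.2.1 ^ 2 * (normSq h (D' x) - t x ^ 2 * normSq h (D x)) = 0 := by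
        rw [show (fromInterior z₀ x.1).1 = x.1.2.proj.1 from rfl] at r3
        simp only [ht]
        linear_combination r3
      exact (mul_eq_zero.1 h2).resolve_left (by positivity)
    · have h2 : x.2.1 * ((ν x).1 * (τ' x + τ'' x) -
          x.2.1 * normSq h (D x) * (1 - t x ^ 2)) = 0 := by
        have e1' : τ' x - τ'' x = x.2.1 * (ν x).1 := e1
        linear_combination (-(τ' x + τ'' x)) * e1' + r2' - r1'
      exact (mul_eq_zero.1 h2).resolve_left h0.ne'
  -- The direction of `μ''` controls the others: its length determines that of the direction of
  -- `μ'`, and if both vanish, so does the direction of `τ' - τ''`, because `τ' + τ'' ≠ 0`. A unit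
  -- normal vector therefore has `d ≠ 0`, and `d` can serve as a parameter.
  have hDpos : ∀ x : X, x.1 ∈ U → ‖x.2.2‖ = 1 → normSq h (D' x) - t x ^ 2 * normSq h (D x) = 0 →
      (ν x).1 * (τ' x + τ'' x) - x.2.1 * normSq h (D x) * (1 - t x ^ 2) = 0 →
      0 < normSq h (D x) := by
    intro x hxU h1 h2 h3
    refine (normSq_nonneg h _).lt_of_ne fun h0 => ?_
    rw [← h0] at h2 h3
    have a2 : (ν x).2.2 = 0 := by
      rw [← fibCoord_ofFib (I := I) hxU.1.2.2 (ν x).2.2]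
      exact (congrArg (fibCoord z₀.2.2) ((normSq_eq_zero h).1 h0.symm)).trans (fibCoord_zero _ _)
    have a1 : (ν x).2.1 = 0 := by
      rw [← fibCoord_ofFib (I := I) hxU.1.2.1 (ν x).2.1]
      exact (congrArg (fibCoord z₀.2.1) ((normSq_eq_zero h).1 (by linarith :
        normSq h (D' x) = 0))).trans (fibCoord_zero _ _)
    have a0 : (ν x).1 = 0 := by
      have b1 : 0 < c * τ' x := hxU.2.1
      have b2 : 0 < c * τ'' x := hxU.2.2
      have b3 : (ν x).1 * (τ' x + τ'' x) = 0 := by linarith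
      refine (mul_eq_zero.1 b3).resolve_right fun b4 => ?_
      have : c * (τ' x + τ'' x) = 0 := by rw [b4, mul_zero]
      linarith
    have hν0 : ν x = 0 := Prod.ext a0 (Prod.ext a1 a2)
    have : x.2.2 = 0 := (normalCoord E).symm.map_eq_zero_iff.1 hν0
    rw [this, norm_zero] at h1
    exact zero_ne_one h1
  have hdom : ∀ x : X, x.1 ∈ U → 0 < normSq h (D x) →
      τ'' x ^ 2 + x.2.1 ^ 2 * normSq h (D x) = c ^ 2 →
      τ' x ^ 2 + (t x * x.2.1) ^ 2 * normSq h (D x) = c ^ 2 → ψ x ∈ conDom h c := by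
    intro x hxU h1 h2 h3
    have b1 : 0 < c * τ' x := hxU.2.1
    have b2 : 0 < c * τ'' x := hxU.2.2
    have b3 : 0 < τ' x ^ 2 := by
      have : τ' x ≠ 0 := fun h => by rw [h, mul_zero] at b1; exact b1.false
      positivity
    have b4 : 0 < τ'' x ^ 2 := by
      have : τ'' x ≠ 0 := fun h => by rw [h, mul_zero] at b2; exact b2.false
      positivity
    exact ⟨hxU.1.1, h1, show x.2.1 ^ 2 * normSq h (D x) < c ^ 2 by linarith,
      show (t x * x.2.1) ^ 2 * normSq h (D x) < c ^ 2 by linarith⟩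
  have hpt : ∀ x ∈ S, ψ x ∈ conDom h c ∧ fromInterior z₀ x.1 = conPoint h c (ψ x) := by
    intro x hx
    obtain ⟨hxU, hxL, h0, h1, e1, e2, e3⟩ := hlift x hx
    obtain ⟨r1, r2, r3, r4⟩ := hrel x hx
    have hd := hdom x hxU (hDpos x hxU h1 r3 r4) r1 r2
    exact ⟨hd, eq_conPoint h hlam hc hd h0 hxL rfl hxU.2.1 hxU.2.2 e3⟩
  -- The relations of `hrel` were divided by powers of the radius, so they retain their content in
  -- the limit on the front face and keep the limit inside the domain of the parametrization.
  have hcl : ∀ x ∈ closure S, x.1 ∈ U → x ∈ O := by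
    intro x hx hxU
    have cτ' : ContinuousAt τ' x := ContinuousAt.comp (g := fun q => (fromInterior z₀ q).2.1.1)
      (continuousAt_fromInterior_tau hxU.1).1 continuousAt_fst
    have cτ'' : ContinuousAt τ'' x := ContinuousAt.comp (g := fun q => (fromInterior z₀ q).2.2.1)
      (continuousAt_fromInterior_tau hxU.1).2 continuousAt_fst
    have ct : ContinuousAt t x := ContinuousAt.comp (g := Real.tan)
      (f := fun x : X => x.1.2.proj.1) (Real.continuousAt_tan.2 (Real.cos_pos_of_mem_Ioo
        ⟨by linarith [hxU.1.1.1, Real.pi_pos], hxU.1.1.2⟩).ne') hθs.continuous.continuousAt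
    have cN : ContinuousAt (fun x => normSq h (D x)) x :=
      (contMDiff_normSq h).continuous.continuousAt.comp (hDs x hxU).continuousAt
    have cN' : ContinuousAt (fun x => normSq h (D' x)) x :=
      (contMDiff_normSq h).continuous.continuousAt.comp (hDs' x hxU).continuousAt
    have cρ : ContinuousAt (fun x : X => x.2.1) x := hr1.continuous.continuousAt
    have cν : ContinuousAt (fun x : X => (ν x).1) x := hνs.continuous.fst.continuousAt
    have h1 : ‖x.2.2‖ = 1 := eq_of_mem_closure (f := fun x : X => ‖x.2.2‖) hx
      (continuous_snd.comp continuous_snd).norm.continuousAt fun y hy => (hlift y hy).2.2.2.1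
    have r1 := eq_of_mem_closure (f := fun x => τ'' x ^ 2 + x.2.1 ^ 2 * normSq h (D x)) hx
      ((cτ''.pow 2).add ((cρ.pow 2).mul cN)) fun y hy => (hrel y hy).1
    have r2 := eq_of_mem_closure (f := fun x => τ' x ^ 2 + (t x * x.2.1) ^ 2 * normSq h (D x)) hx
      ((cτ'.pow 2).add (((ct.mul cρ).pow 2).mul cN)) fun y hy => (hrel y hy).2.1
    have r3 := eq_of_mem_closure (f := fun x => normSq h (D' x) - t x ^ 2 * normSq h (D x)) hx
      (cN'.sub ((ct.pow 2).mul cN)) fun y hy => (hrel y hy).2.2.1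
    have r4 := eq_of_mem_closure
      (f := fun x => (ν x).1 * (τ' x + τ'' x) - x.2.1 * normSq h (D x) * (1 - t x ^ 2)) hx
      ((cν.mul (cτ'.add cτ'')).sub ((cρ.mul cN).mul (continuousAt_const.sub (ct.pow 2))))
      fun y hy => (hrel y hy).2.2.2
    have hd := hdom x hxU (hDpos x hxU h1 r3 r4) r1 r2
    refine ⟨hxU, ⟨hd, ?_⟩, ?_⟩
    · change (D x).proj ∈ (chartAt H z₀.2.2).source
      simp only [hD, proj_ofFib hxU.1.2.2]
      exact hxU.1.2.2
    · have h2 : (conOmega h c (ψ x)).proj = x.1.2.proj.2.1 := by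
        refine eq_of_mem_closure_of_continuousAt (f := fun x => (conOmega h c (ψ x)).proj)
          (g := fun x : X => x.1.2.proj.2.1) hx ?_ hpr.continuous.snd.fst.continuousAt ?_
        · exact contMDiff_proj.continuous.continuousAt.comp (ContinuousAt.comp (g := conOmega h c)
            (contMDiffAt_conOmega h hc0 hd).continuousAt (hψs x hxU).continuousAt)
        · intro y hy
          have h3 := congrArg (fun q : FibCot I Z => q.2.1.2.proj) (hpt y hy).2
          exact h3.symm.trans (proj_ofFib (hlift y hy).1.1.2.1 _)
      change (conOmega h c (ψ x)).proj ∈ (chartAt H z₀.2.1).source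
      rw [h2]
      exact hxU.1.2.1
  have hS : ∀ x ∈ O, 0 < x.2.1 → (x ∈ S ↔
      (toInterior (conPoint h c (ψ x)), (ψ x).2.1, w (ψ x)) = x ∧ ‖w (ψ x)‖ = 1 ∧
        (0 : Fin 0 → ℝ) = 0) := by
    rintro x ⟨hxU, hxV⟩ h0
    constructor
    · intro hx
      have h1 : toInterior (conPoint h c (ψ x)) = x.1 := by
        rw [← (hpt x hx).2, toInterior_fromInterior hxU.1]
      obtain ⟨-, hx3, hx4, hx5⟩ := hx
      have h2 : w (ψ x) = x.2.2 := by
        have h3 := hu _ hxV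
        rw [h1] at h3
        rw [hx5, h3, ← h3, ← hx4, h3]
        exact (inv_smul_smul₀ h0.ne' _).symm
      refine ⟨Prod.ext h1 (Prod.ext rfl h2), ?_, rfl⟩
      rw [h2, hx5, norm_smul, norm_inv, norm_norm, inv_mul_cancel₀ (norm_ne_zero_iff.2 hx3)]
    · rintro ⟨hx1, hx2, -⟩
      have h1 : toInterior (conPoint h c (ψ x)) = x.1 := congrArg Prod.fst hx1
      have h2 : w (ψ x) = x.2.2 := congrArg (fun y : X => y.2.2) hx1
      have h3 := hu _ hxV
      rw [h1, h2] at h3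
      rw [h2] at hx2
      have h3' : normalMap z₀ x.1 = x.2.1 • x.2.2 := h3
      have h4 : ‖normalMap z₀ x.1‖ = x.2.1 := by
        rw [h3', norm_smul, hx2, mul_one, Real.norm_of_nonneg h0.le]
      refine ⟨⟨?_, hxU⟩, ?_, h4.symm, ?_⟩
      · rw [mem_interiorPart_iff hxU.1, ← h1, hF _ hxV]
        exact conPoint_mem_legL h hlam hc hxV.1.1 h0
      · rw [← norm_ne_zero_iff, h4]
        exact h0.ne'
      · rw [h4, h3', inv_smul_smul₀ h0.ne']
  refine isNeatSubmanifold_polarLift (IN := conParModel I) (IK := scModel (bfModel I)) (O := O)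
    (V := V) (ψ := ψ) (φ := fun n => toInterior (conPoint h c n)) (r := fun n => n.2.1) (w := w)
    (W := Fin 0 → ℝ) (g := fun _ => 0) (σ := fun s n => (n.1, n.2.1 / s, n.2.2.scale s))
    (ε := fun t n => (n.1, n.2.1 + t, n.2.2)) hOo hVo
    (fun x hx => (hψs x hx.1).contMDiffWithinAt) (fun x hx => hx.2) ?_
    contMDiff_conPar.2.1.contMDiffOn ?_ contMDiffOn_const ?_ (fun x hx => hx.1) hcl hS
    (fun n _ s _ => rfl) ?_ (fun n _ s _ => rfl) ?_ ?_ ?_ ?_ (fun n _ t => rfl) ?_ ?_ ?_ ?_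
  · exact fun n hn => (contMDiff_toInterior.contMDiffAt.comp n
      (contMDiffAt_conPoint h hc0 hn.1.1)).contMDiffWithinAt
  · intro n hn
    have h1 : ContMDiffAt (conParModel I) 𝓘(ℝ, E →L[ℝ] ℝ) ∞
        (fun n => fibCoord z₀.2.1 (conOmega h c n)) n :=
      ContMDiffAt.comp (g := fibCoord z₀.2.1) n (contMDiffAt_fibCoord hn.2)
        (contMDiffAt_conOmega h hc0 hn.1.1)
    have h2 : ContMDiffAt (conParModel I) 𝓘(ℝ, E →L[ℝ] ℝ) ∞
        (fun n : ℝ × ℝ × Cot I Z => fibCoord z₀.2.2 n.2.2) n :=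
      ContMDiffAt.comp (g := fibCoord z₀.2.2) n (contMDiffAt_fibCoord hn.1.2)
        contMDiff_conPar.2.2.contMDiffAt
    exact ((normalCoord E).contDiff.contMDiff.contMDiffAt.comp n
      ((contMDiffAt_conDiff h hc0 hn.1.1).prodMk_space (h1.prodMk_space h2))).contMDiffWithinAt
  · intro n hn _
    have h1 : (ν (toInterior (conPoint h c n), n.2.1, w n)).2.2 = fibCoord z₀.2.2 n.2.2 := by
      simp only [hν, hw, ContinuousLinearEquiv.symm_apply_apply]
    refine Prod.ext rfl (Prod.ext rfl ?_)
    change ofFib z₀.2.2 n.2.2.proj (ν (toInterior (conPoint h c n), n.2.1, w n)).2.2 = n.2.2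
    rw [h1, ofFib_fibCoord hn.1.2]
  · intro n _ s hs
    simp only [hw, conOmega_scale h hs, conDiff_scale h hs, fibCoord_scale]
    rw [← map_smul]
    rfl
  · intro n
    simp [scale_one]
  · intro n _
    have h1 : ContMDiffAt (𝓘(ℝ, ℝ).prod (conParModel I)) (conParModel I) ∞
        (fun x : ℝ × ℝ × ℝ × Cot I Z =>
          ((x.2.1, x.2.2.1 / x.1, x.2.2.2.scale x.1) : ℝ × ℝ × Cot I Z)) (1, n) :=
      (contMDiff_fst.comp contMDiff_snd).contMDiffAt.prodMk
        (((contMDiff_fst.comp (contMDiff_snd.comp contMDiff_snd)).contMDiffAt.div₀ contMDiffAt_fst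
          one_ne_zero).prodMk (ContMDiffAt.cotScale contMDiffAt_fst
            (contMDiff_snd.comp (contMDiff_snd.comp contMDiff_snd)).contMDiffAt))
    exact h1.continuousAt
  · intro n _
    have h1 : ContMDiffAt 𝓘(ℝ, ℝ) (conParModel I) ∞
        (fun s : ℝ => ((n.1, n.2.1 / s, n.2.2.scale s) : ℝ × ℝ × Cot I Z)) 1 :=
      contMDiffAt_const.prodMk ((contMDiffAt_const.div₀ contMDiffAt_id one_ne_zero).prodMk
        (ContMDiffAt.cotScale (f := fun _ => n.2.2) contMDiffAt_id contMDiffAt_const))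
    exact h1.mdifferentiableAt (by simp)
  · intro n _ hn t
    simp only [hn, zero_add]
  · intro n
    simp
  · intro n _
    exact MDifferentiableAt.prodMk mdifferentiableAt_const (MDifferentiableAt.prodMk
      (differentiableAt_id.const_add n.2.1).mdifferentiableAt mdifferentiableAt_const)
  · intro n _ _ y
    exact ⟨0, Subsingleton.elim _ _⟩
  · simp only [Module.finrank_prod, Module.finrank_self, finrank_clm_real, Module.finrank_fin_fun]
    ring

end InteriorConic
end ScatGeom

namespace ScatGeom

section InteriorConic

universe u

variable {E : Type u} [NormedAddCommGroup E] [NormedSpace ℝ E] [FiniteDimensional ℝ E]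
  {H : Type*} [TopologicalSpace H] {I : ModelWithCorners ℝ E H} [I.Boundaryless]
  {Z : Type*} [TopologicalSpace Z] [ChartedSpace H Z] [IsManifold I ∞ Z]
  [CompactSpace Z] [T2Space Z]
  (h : ContMDiffRiemannianMetric I ∞ E (fun z : Z => TangentSpace I z)) {lam : ℝ}

/-! ### The conic points over the interior of bf -/

lemma contMDiffAt_normalFun {z₀ : ℝ × Z × Z} {q : FibCot I Z} (hq : q ∈ fibDom I z₀) :
    ContMDiffAt (fibModel I) 𝓘(ℝ, ℝ × (E →L[ℝ] ℝ) × (E →L[ℝ] ℝ)) ∞ (normalFun z₀) q := by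
  have h1 : ContMDiffAt (fibModel I) 𝓘(ℝ, ℝ) ∞ (fun q : FibCot I Z => q.2.1.1 - q.2.2.1) q :=
    (contMDiff_fst.comp (contMDiff_fst.comp contMDiff_snd)).contMDiffAt.sub
      (contMDiff_fst.comp (contMDiff_snd.comp contMDiff_snd)).contMDiffAt
  have h2 : ContMDiffAt (fibModel I) 𝓘(ℝ, E →L[ℝ] ℝ) ∞
      (fun q : FibCot I Z => fibCoord z₀.2.1 q.2.1.2) q :=
    ContMDiffAt.comp (g := fibCoord z₀.2.1) q (contMDiffAt_fibCoord hq.2.1)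
      (contMDiff_snd.comp (contMDiff_fst.comp contMDiff_snd)).contMDiffAt
  have h3 : ContMDiffAt (fibModel I) 𝓘(ℝ, E →L[ℝ] ℝ) ∞
      (fun q : FibCot I Z => fibCoord z₀.2.2 q.2.2.2) q :=
    ContMDiffAt.comp (g := fibCoord z₀.2.2) q (contMDiffAt_fibCoord hq.2.2)
      (contMDiff_snd.comp (contMDiff_snd.comp contMDiff_snd)).contMDiffAt
  exact h1.prodMk_space (h2.prodMk_space h3)

lemma exists_dd_normalFun {z₀ : ℝ × Z × Z} {q : FibCot I Z} (hq : q ∈ fibDom I z₀)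
    (ν : ℝ × (E →L[ℝ] ℝ) × (E →L[ℝ] ℝ)) :
    ∃ v : TangentSpace (fibModel I) q, dd (fibModel I) (normalFun z₀) q v = ν := by
  set γ : ℝ → FibCot I Z := fun t => (q.1,
    (q.2.1.1 + t * ν.1, ofFib z₀.2.1 q.2.1.2.proj (fibCoord z₀.2.1 q.2.1.2 + t • ν.2.1)),
    (q.2.2.1, ofFib z₀.2.2 q.2.2.2.proj (fibCoord z₀.2.2 q.2.2.2 + t • ν.2.2))) with hγ
  have hγ0 : γ 0 = q := by
    simp only [hγ, zero_smul, zero_mul, add_zero, ofFib_fibCoord hq.2.1, ofFib_fibCoord hq.2.2]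
  have hlin : ∀ ζ ζ' : E →L[ℝ] ℝ, ContMDiffAt 𝓘(ℝ, ℝ) 𝓘(ℝ, E →L[ℝ] ℝ) ∞
      (fun t : ℝ => ζ + t • ζ') 0 := fun ζ ζ' =>
    (show ContDiff ℝ ∞ (fun t : ℝ => ζ + t • ζ') by fun_prop).contMDiff.contMDiffAt
  have hγd : MDifferentiableAt 𝓘(ℝ, ℝ) (fibModel I) γ 0 := by
    have h1 : ContMDiffAt 𝓘(ℝ, ℝ) 𝓘(ℝ, ℝ) ∞ (fun t : ℝ => q.2.1.1 + t * ν.1) 0 :=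
      (show ContDiff ℝ ∞ (fun t : ℝ => q.2.1.1 + t * ν.1) by fun_prop).contMDiff.contMDiffAt
    have h2 : ContMDiffAt 𝓘(ℝ, ℝ) (fibModel I) ∞ γ 0 :=
      contMDiffAt_const.prodMk ((h1.prodMk (contMDiffAt_ofFib (z := fun _ => q.2.1.2.proj) hq.2.1
        contMDiffAt_const (hlin _ _))).prodMk (contMDiffAt_const.prodMk
          (contMDiffAt_ofFib (z := fun _ => q.2.2.2.proj) hq.2.2 contMDiffAt_const (hlin _ _))))
    exact h2.mdifferentiableAt (by simp)
  refine ⟨velAt hγ0, dd_velAt hγ0 hγd ((contMDiffAt_normalFun hq).mdifferentiableAt (by simp)) ?_⟩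
  have h3 : (fun t => normalFun z₀ (γ t)) = fun t : ℝ => normalFun z₀ q + t • ν := by
    funext t
    simp only [normalFun, hγ, fibCoord_ofFib hq.2.1, fibCoord_ofFib hq.2.2]
    refine Prod.ext ?_ rfl
    change q.2.1.1 + t * ν.1 - q.2.2.1 = q.2.1.1 - q.2.2.1 + t * ν.1
    ring
  rw [h3]
  simpa using ((hasDerivAt_id (0 : ℝ)).smul_const ν).const_add (normalFun z₀ q)

lemma contMDiffAt_normalMap {z₀ : ℝ × Z × Z} {q : ScCot (bfModel I) (ℝ × Z × Z)}
    (hq : q ∈ intDom I z₀) :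
    ContMDiffAt (scModel (bfModel I))
      𝓘(ℝ, EuclideanSpace ℝ (Fin (Module.finrank ℝ (ℝ × E × E)))) ∞ (normalMap z₀) q :=
  (normalCoord E).contDiff.contMDiff.contMDiffAt.comp q
    (ContMDiffAt.comp (g := normalFun z₀) q (contMDiffAt_normalFun (fromInterior_mem hq))
      (contMDiffAt_fromInterior hq))

lemma surjective_mfderiv_normalMap {z₀ : ℝ × Z × Z} {q : ScCot (bfModel I) (ℝ × Z × Z)}
    (hq : q ∈ intDom I z₀) :
    Function.Surjective (mfderiv (scModel (bfModel I))
      𝓘(ℝ, EuclideanSpace ℝ (Fin (Module.finrank ℝ (ℝ × E × E)))) (normalMap z₀) q) := by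
  intro ν
  have hm := fromInterior_mem hq
  have hs := contMDiffAt_normalFun hm
  have hF := contMDiffAt_fromInterior hq
  obtain ⟨w, hw⟩ := exists_dd_normalFun hm ((normalCoord E).symm ν)
  obtain ⟨v, hv⟩ := surjective_mfderiv_fromInterior hq w
  have h1 := dd_comp_mfderiv (f := normalFun z₀) (φ := fromInterior z₀)
    (hs.mdifferentiableAt (by simp)) (hF.mdifferentiableAt (by simp)) v
  have h2 := dd_clm_comp (normalCoord E : (ℝ × (E →L[ℝ] ℝ) × (E →L[ℝ] ℝ)) →L[ℝ]
    EuclideanSpace ℝ (Fin (Module.finrank ℝ (ℝ × E × E))))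
    (f := fun q => normalFun z₀ (fromInterior z₀ q))
    ((ContMDiffAt.comp (g := normalFun z₀) q hs hF).mdifferentiableAt (by simp)) v
  refine ⟨v, h2.trans ?_⟩
  have h3 := h1.trans ((congrArg (dd (fibModel I) (normalFun z₀) (fromInterior z₀ q)) hv).trans hw)
  exact (congrArg (normalCoord E) h3).trans ((normalCoord E).apply_symm_apply ν)

lemma normalMap_eq_zero_iff {z₀ : ℝ × Z × Z} {q : ScCot (bfModel I) (ℝ × Z × Z)}
    (hq : q ∈ intDom I z₀) :
    normalMap z₀ q = 0 ↔ ∃ c : ℝ, fromInterior z₀ q =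
      (q.2.proj.1, (c, Cot.zero q.2.proj.2.1), (c, Cot.zero q.2.proj.2.2)) := by
  have h1 := normalMap_eq_iff hq (ρ := 0) (ν := 0)
  simp only [zero_smul, zero_mul, scale_zero, proj_ofFib hq.2.1, proj_ofFib hq.2.2] at h1
  rw [h1]
  constructor
  · rintro ⟨e1, e2, e3⟩
    exact ⟨(fromInterior z₀ q).2.2.1, Prod.ext rfl (Prod.ext (Prod.ext (sub_eq_zero.1 e1) e2)
      (Prod.ext rfl e3))⟩
  · rintro ⟨c, hcq⟩
    rw [hcq]
    exact ⟨sub_self c, rfl, rfl⟩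

theorem isConicPair_interior (hlam : 0 < lam) :
    IsConicPair bfInterior (interiorPart (legL h lam))
      (interiorPart (legSharp I Z lam ∪ legSharp I Z (-lam))) := by
  -- The choice `a = cos θ + sin θ` means `a/x = 1/x' + 1/x''`, whose differential has `τ' = τ''`
  -- and vanishing covectors, as on the second set.
  refine ⟨fun q hq => proj_of_mem_interiorPart hq,
    isLegendre_interiorPart (isNeatIntegralSubmanifold_legL h hlam),
    isLegendre_interiorPart (isNeatIntegralSubmanifold_legSharp lam),
    fun w => Real.cos w.1 + Real.sin w.1, {lam, -lam}, ?_, ?_, mem_interiorPart_legSharp lam,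
    closure_interiorPart_legL h hlam, ?_⟩
  · exact ((Real.contDiff_cos.add Real.contDiff_sin).contMDiff.comp contMDiff_fst).contMDiffOn
  · intro z hz
    have h1 := Real.sin_pos_of_pos_of_lt_pi hz.1 (by linarith [hz.2, Real.pi_pos])
    have h2 := Real.cos_pos_of_mem_Ioo ⟨by linarith [hz.1, Real.pi_pos], hz.2⟩
    exact add_pos h2 h1
  simp only [scDiff_interior]
  rintro p ⟨⟨c₀, z₀, hz₀, rfl⟩, hcl⟩
  obtain ⟨c, rfl⟩ : ∃ c, c₀ = -c := ⟨-c₀, (neg_neg c₀).symm⟩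
  simp only [neg_neg] at hcl ⊢
  set p : FibCot I Z := (z₀.1, (c, Cot.zero z₀.2.1), (c, Cot.zero z₀.2.2)) with hp
  have hpd : p ∈ fibDom I z₀ := ⟨hz₀, mem_chart_source H _, mem_chart_source H _⟩
  have hFp : fromInterior z₀ (toInterior p) = p := fromInterior_toInterior hpd
  have hpcl := fromInterior_mem_closure (z₀ := z₀) (toInterior_mem.2 hpd) hcl
  rw [hFp] at hpcl
  have hc : c ^ 2 = lam ^ 2 := by
    have := (closure_legL_relations h hlam hpcl hz₀).2.1
    simpa [hp] using this
  have hc0 : c ≠ 0 := fun h0 => by rw [h0] at hc; nlinarith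
  have hU := isOpen_conicNhd (I := I) z₀ c
  refine ⟨conicNhd I z₀ c, normalMap z₀, hU, ⟨toInterior_mem.2 hpd, ?_, ?_⟩,
    fun q hq => (contMDiffAt_normalMap hq.1).contMDiffWithinAt,
    fun q hq => surjective_mfderiv_normalMap hq.1, fun q hq => ?_,
    isNeatSubmanifold_interiorLift h hlam hc z₀, closure_subset_image_polarLift hU
      (fun q hq => (contMDiffAt_normalMap hq.1).continuousAt.continuousWithinAt) ?_⟩
  · rw [hFp]; exact mul_self_pos.2 hc0
  · rw [hFp]; exact mul_self_pos.2 hc0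
  · rw [normalMap_eq_zero_iff hq.1]
    constructor
    · rintro ⟨e, z, hz, rfl⟩
      exact ⟨-e, fromInterior_toInterior (toInterior_mem.1 hq.1)⟩
    · rintro ⟨e, he⟩
      refine ⟨-e, q.2.proj, hq.1.1, ?_⟩
      rw [neg_neg, ← he, toInterior_fromInterior hq.1]
  -- Over the interior `L` does not meet the span: `τ' = τ''` and `μ'' = 0` would give `transitDen =
  -- 0`. So nothing of `L` is lost in the lift, and unlike over the corners no assumption on the
  -- dimension is needed.
  · rintro q ⟨hqG, hqU⟩
    refine subset_closure ⟨⟨hqG, hqU⟩, fun h0 => ?_⟩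
    obtain ⟨e, he⟩ := (normalMap_eq_zero_iff hqU.1).1 h0
    have hL := (mem_interiorPart_iff hqU.1).1 hqG
    rw [he] at hL
    obtain ⟨r1, r2, -, -⟩ := legL_relations h hlam hL hqU.1.1
    simp only [transitDen, normSq_zero, mul_zero, add_zero] at r1 r2
    nlinarith

/-- The pair `(L, L♯)` is an intersecting pair of Legendre submanifolds with conic points. -/
theorem isFibConicPair_legL (hm : 0 < Module.finrank ℝ E) (hlam : 0 < lam) :
    IsFibConicPair (legL h lam) (legSharp I Z lam ∪ legSharp I Z (-lam)) := by
  refine ⟨isFibLegendre_legL h hlam, isFibLegendre_legSharp hlam, isConicPair_interior h hlam,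
    fun S => ⟨{q | ∃ c ∈ ({lam, -lam} : Finset ℝ), ∃ z, q = (c, Cot.zero z)},
      isLegendre_constGraph _, isFibration_corner_legL h hlam S, isFibration_corner_legSharp hlam S,
      ?_⟩⟩
  rintro _ ⟨e, he, z, rfl⟩
  have he0 : e ≠ 0 := by
    simp only [Finset.mem_insert, Finset.mem_singleton] at he
    rcases he with rfl | rfl
    · exact hlam.ne'
    · exact neg_ne_zero.2 hlam.ne'
  rw [cornerFibre_legL h hlam S he z, cornerFibre_legSharp S he z]
  exact isConicPair_cornerFibre h hm he0 z

end InteriorConic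
end ScatGeom

end

theorem proposition7p1 (m : ℕ) (hm : 1 ≤ m)
    (Y : Type*) [TopologicalSpace Y] [ChartedSpace (EuclideanSpace ℝ (Fin m)) Y]
    [IsManifold (𝓡 m) ∞ Y] [T2Space Y] [CompactSpace Y]
    (h : ContMDiffRiemannianMetric (𝓡 m) ∞ (EuclideanSpace ℝ (Fin m))
      (fun y : Y => TangentSpace (𝓡 m) y))
    (lam : ℝ) (hlam : 0 < lam) :
    ScatGeom.IsFibConicPair (ScatGeom.legL h lam)
      (ScatGeom.legSharp (𝓡 m) Y lam ∪ ScatGeom.legSharp (𝓡 m) Y (-lam)) := by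
  exact ScatGeom.isFibConicPair_legL h (by rw [finrank_euclideanSpace_fin]; exact hm) hlam
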